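/- Let $k$ be a field of characteristic $0$ and let $m,n\ge 0$. Let ${\bf L}={\bf H}\triangleright{\bf V}$ be a Lie bialgebra over $k$ with basis $H_1,\dots,H_m$ of ${\bf H}$ and $X^1,\dots,X^n$ of ${\bf V}$ and structure (summation over repeated indices is understood) $$[H_i,H_j]=C^l_{ij}H_l,\quad [H_i,X^\mu]=A_{i\nu}^{\ \mu}X^\nu,\quad [X^\mu,X^\nu]=0,$$ $$\delta(X^\mu)=\gamma^\mu_{\rho\sigma}X^\rho\otimes X^\sigma,\quad \delta(H_i)=\alpha_{\rho i}^{\ l}(X^\rho\otimes H_l-H_l\otimes X^\rho).$$ The dual Lie bialgebra ${\bf L}^*={\bf V}^*\triangleright{\bf H}^*$ has the same form, in the dual bases $\zeta_\mu$ of ${\bf V}^*$ and $\eta^i$ of ${\bf H}^*$, with $(C,A,\gamma,\alpha)$ replaced by $(\gamma,\alpha,C,A)$. A *quantization* of ${\bf L}$ is a topological Hopf algebra $U$ with elements $H_i$ and with an algebra homomorphism $k[[X^1,\dots,X^n]]\to U$, such that: * each element of $U$ is in exactly one way a finite sum of products $f(X)\psi(H)$, where $f$ is a power series and $\psi(H)$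 runs through the symmetrized monomials in the $H_i$ (so that $U=k[[X]]\otimes U({\bf H})$ as a linear space), and the topology of $U$ is the adic topology of the two-sided ideal $I$ generated by the $X^\mu$, the coproduct being a continuous homomorphism $U\to U\hat\otimes U=\varprojlim_N\,U/I^N\otimes U/I^N$; * $\Delta(X^\mu)=D^\mu(X\otimes1,1\otimes X)$ and $\Delta(H_i)=(e^{\alpha\cdot X})^l_i\otimes H_l+H_i\otimes1$, where $D$ is the Campbell–Hausdorff series of the Lie algebra ${\bf V}^*$ with structure constants $\gamma$ and $(\alpha\cdot X)^l_i=\alpha_{\rho i}^{\ l}X^\rho$, and $\varepsilon(X^\mu)=\varepsilon(H_i)=0$; * $[X^\mu,X^\nu]=0$, $[H_i,H_j]=C(X)^l_{ij}H_l$, $[H_i,X^\mu]=A(X)_i^\mu$ for some power series with $C(0)^l_{ij}=C^l_{ij}$ and $\partial A_i^\mu/\partial X^\nu(0)=A_{i\nu}^{\ \mu}$. Each ${\bf L}$ has a quantization. Let $U_q({\bf L})$ be a quantization of ${\bf L}$, and let $U_q({\bf L})^*$ be the space of linear functionals on it that vanish on some $I^N$. Let $\zeta_\mu,\eta^i\in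 U_q({\bf L})^*$ be given by $$\langle\zeta_\mu,f(X)\psi(H)\rangle=\tfrac{\partial f}{\partial X^\mu}(0)\,\varepsilon(\psi(H)),\qquad \langle\eta^i,f(X)\psi(H)\rangle=f(0)\langle\eta^i,\psi(H)\rangle,$$ for all symmetrized monomials $\psi(H)$, where $\langle\eta^i,\psi(H)\rangle=1$ if $\psi(H)=H_i$ and $0$ for every other symmetrized monomial. Then: 1. With the transposed operations, $U_q({\bf L})^*$ is a Hopf algebra of the same kind, with the adic topology of the ideal generated by the $\eta^i$ (and $U_q({\bf L})$ is its continuous dual). With the $\zeta_\mu$ in the role of the generators $H_i$ and the $\eta^i$ in the role of the generators $X^\mu$, it is a quantization of ${\bf L}^*$; in particular it is generated by the $\zeta_\mu$ and by power series in the $\eta^i$. It is the unique one: any other quantization of ${\bf L}^*$ is isomorphic to it, as a topological Hopf algebra, by a unique isomorphism that respects the generators. 2. Let $T\in U_q({\bf L})^*_{op}\,\hat\otimes\,U_q({\bf L})$ be the canonical element of the pairing of $U_q({\bf L})^*$ with $U_q({\bf L})$, where $op$ denotes the opposite multiplication. Then $$T=\exp(\zeta_\mu\otimes X^\mu)\,\exp(\eta^i\otimes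 H_i),$$ where $(\zeta_\mu\otimes X^\mu)^N=0$ and $(\eta^i\otimes H_i)^N=0$ in the $N$-th quotient for each $N$, so that the exponentials make sense. 3. The transposition also takes morphisms to morphisms: if a continuous Hopf homomorphism $\Phi:U_q({\bf L})\to U_q({\bf L}')$ is given on generators by linear maps ${\bf H}\to{\bf H}'$ and ${\bf V}\to{\bf V}'$, then its transpose $U_q({\bf L}')^*\to U_q({\bf L})^*$ exists and is a continuous Hopf homomorphism, given on the generators by the transposed linear maps. Thus the category of these quantizations is stable under dualization. -/

import Mathlib

open scoped TensorProduct Nat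

universe u

/-- The structure constants, in bases `H i` of `𝐇` and `X μ` of `𝐕`, of a Lie bialgebra
`𝐋 = 𝐇 ▷ 𝐕` of the category `ℬ`:
`[H i, H j] = ∑ l, C i j l • H l`, `[H i, X μ] = ∑ ν, A i ν μ • X ν`, `[X μ, X ν] = 0`,
`δ (X μ) = ∑ ρ σ, γ ρ σ μ • X ρ ⊗ X σ`,
`δ (H i) = ∑ ρ l, α ρ i l • (X ρ ⊗ H l - H l ⊗ X ρ)`.
The lower indices come first, the upper index comes last. -/
structure InhomBialgebra (k : Type u) [Field k] (m n : ℕ) where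
  C : Fin m → Fin m → Fin m → k
  A : Fin m → Fin n → Fin n → k
  γ : Fin n → Fin n → Fin n → k
  α : Fin n → Fin m → Fin m → k
  C_skew : ∀ i j l, C i j l = -C j i l
  γ_skew : ∀ ρ σ μ, γ ρ σ μ = -γ σ ρ μ
  C_jacobi : ∀ i j l q,
    ∑ p, (C i j p * C p l q + C j l p * C p i q + C l i p * C p j q) = 0
  γ_jacobi : ∀ ρ σ τ μ,
    ∑ ν, (γ ρ σ ν * γ ν τ μ + γ σ τ ν * γ ν ρ μ + γ τ ρ ν * γ ν σ μ) = 0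
  /-- `[H i, [H j, X μ]] - [H j, [H i, X μ]] = [[H i, H j], X μ]` -/
  A_rep : ∀ i j ρ μ,
    ∑ ν, (A j ν μ * A i ρ ν - A i ν μ * A j ρ ν) = ∑ p, C i j p * A p ρ μ
  /-- the analogous identity in the dual Lie algebra, where `[ζ ρ, η l] = ∑ i, α ρ i l • η i` -/
  α_rep : ∀ ρ σ i l,
    ∑ p, (α σ p l * α ρ i p - α ρ p l * α σ i p) = ∑ τ, γ ρ σ τ * α τ i l
  cond1 : ∀ i ρ σ μ,
    ∑ ν, (A i ν μ * γ ρ σ ν - γ ν σ μ * A i ρ ν - γ ρ ν μ * A i σ ν) =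
      ∑ l, (A l σ μ * α ρ i l - A l ρ μ * α σ i l)
  cond2 : ∀ μ i j l,
    ∑ p, (α μ p l * C i j p - C i p l * α μ j p - C p j l * α μ i p) =
      ∑ ν, (α ν j l * A i μ ν - α ν i l * A j μ ν)

/-- The dual Lie bialgebra `𝐋* = 𝐕* ▷ 𝐇*` in the dual bases `ζ μ` of `𝐕*` and `η i` of `𝐇*`:
`[ζ ρ, ζ σ] = ∑ μ, γ ρ σ μ • ζ μ`, `[ζ ρ, η l] = ∑ i, α ρ i l • η i`, `[η i, η j] = 0`, and the
cobracket is dual to the bracket of `𝐋`. -/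
def InhomBialgebra.dual {k : Type u} [Field k] {m n : ℕ} (L : InhomBialgebra k m n) :
    InhomBialgebra k n m where
  C := L.γ
  A := L.α
  γ := L.C
  α := L.A
  C_skew := L.γ_skew
  γ_skew := L.C_skew
  C_jacobi := L.γ_jacobi
  γ_jacobi := L.C_jacobi
  A_rep := L.α_rep
  α_rep := L.A_rep
  cond1 := fun μ i j l => by
    rw [← L.cond2 μ i j l]
    exact Finset.sum_congr rfl fun p _ => by ring
  cond2 := fun i ρ σ μ => by
    rw [← L.cond1 i ρ σ μ]
    exact Finset.sum_congr rfl fun p _ => by ring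

/-! ### The Campbell–Hausdorff series -/

/-- The coefficient of the word `w` in `e^x e^y - 1`, with `false` for `x` and `true` for `y`. -/
def expExpCoeff (w : List Bool) : ℚ :=
  if w ≠ [] ∧ w = List.replicate (w.count false) false ++ List.replicate (w.count true) true then
    ((w.count false) ! * (w.count true) ! : ℚ)⁻¹
  else 0

/-- The coefficient of the word `w` in `(e^x e^y - 1) ^ q`. -/
def expExpPowCoeff : ℕ → List Bool → ℚ
  | 0, w => if w = [] then 1 else 0
  | q + 1, w => ∑ j ∈ Finset.range (w.length + 1),
      expExpCoeff (w.take j) * expExpPowCoeff q (w.drop j)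

/-- The coefficient of the word `w` in `log (e^x e^y)`. -/
def logCoeff (w : List Bool) : ℚ :=
  ∑ q ∈ Finset.Icc 1 w.length, (-1) ^ (q + 1) / (q : ℚ) * expExpPowCoeff q w

/-- The bracket with structure constants `γ`, extended to coefficients in `R`. -/
def scBracket {k : Type u} [Field k] {n : ℕ} (γ : Fin n → Fin n → Fin n → k)
    {R : Type u} [CommRing R] [Algebra k R] (x y : Fin n → R) : Fin n → R :=
  fun σ => ∑ μ, ∑ ν, γ μ ν σ • (x μ * y ν)

/-- The right-nested bracket `[w₁, [w₂, [⋯, w_r]]]` of a word in the letters `x` and `y`. -/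
def nestedBracket {k : Type u} [Field k] {n : ℕ} (γ : Fin n → Fin n → Fin n → k)
    {R : Type u} [CommRing R] [Algebra k R] (x y : Fin n → R) : List Bool → (Fin n → R)
  | [] => 0
  | [b] => if b then y else x
  | b :: c :: w => scBracket γ (if b then y else x) (nestedBracket γ x y (c :: w))

/-- The component `D^μ(X', X'')` of the Campbell–Hausdorff series of the Lie algebra with structure
constants `γ` (in Dynkin's form); the variables `X'` and `X''` are indexed by `Sum.inl` and
`Sum.inr`. The homogeneous part of degree `r` comes from the words of length `r`. -/
noncomputable def chSeries {k : Type u} [Field k] {n : ℕ} (γ : Fin n → Fin n → Fin n → k)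
    (μ : Fin n) : MvPowerSeries (Fin n ⊕ Fin n) k :=
  fun d => ∑ w : Fin d.degree → Bool,
    ((logCoeff (List.ofFn w) / (d.degree : ℚ) : ℚ) : k) *
      MvPolynomial.coeff d
        (nestedBracket (R := MvPolynomial (Fin n ⊕ Fin n) k) γ
          (fun ν => MvPolynomial.X (Sum.inl ν)) (fun ν => MvPolynomial.X (Sum.inr ν))
          (List.ofFn w) μ)

/-- The matrix `α · X`, with entry `∑ ρ, α ρ i l • X ρ` in the row `l` and the column `i`. -/
noncomputable def alphaX {k : Type u} [Field k] {m n : ℕ} (α : Fin n → Fin m → Fin m → k) :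
    Matrix (Fin m) (Fin m) (MvPolynomial (Fin n) k) :=
  Matrix.of fun l i => ∑ ρ, MvPolynomial.C (α ρ i l) * MvPolynomial.X ρ

/-- The entry in the row `l` and the column `i` of the matrix `e^{α · X}` of power series. Its part
of degree `r` is the entry of `(α · X) ^ r / r!`. -/
noncomputable def expAlphaX {k : Type u} [Field k] {m n : ℕ} (α : Fin n → Fin m → Fin m → k)
    (l i : Fin m) : MvPowerSeries (Fin n) k :=
  fun d => ((d.degree ! : ℕ) : k)⁻¹ * MvPolynomial.coeff d ((alphaX α ^ d.degree) l i)

/-! ### Adic Hopf algebras -/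

/-- An algebra with a two-sided ideal, considered with the adic topology of that ideal. -/
structure AdicAlgebra (k : Type u) [Field k] where
  carrier : Type u
  [ring : Ring carrier]
  [algebra : Algebra k carrier]
  ideal : Ideal carrier
  [twoSided : ideal.IsTwoSided]

attribute [instance] AdicAlgebra.ring AdicAlgebra.algebra AdicAlgebra.twoSided

/-- The discrete quotient `U / I ^ N`. -/
abbrev AdicAlgebra.Quo {k : Type u} [Field k] (U : AdicAlgebra k) (N : ℕ) : Type u :=
  U.carrier ⧸ (U.ideal ^ N)

abbrev AdicAlgebra.mk' {k : Type u} [Field k] (U : AdicAlgebra k) (N : ℕ) :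
    U.carrier →ₐ[k] U.Quo N :=
  Ideal.Quotient.mkₐ k (U.ideal ^ N)

abbrev AdicAlgebra.proj {k : Type u} [Field k] (U : AdicAlgebra k) {M N : ℕ} (h : N ≤ M) :
    U.Quo M →ₐ[k] U.Quo N :=
  Ideal.Quotient.factorₐ k (Ideal.pow_le_pow_right h)

/-- The linear map on `U / J` induced by a linear map on `U` that vanishes on `J`. -/
noncomputable def idealLift {k : Type u} [Field k] {U V : Type u} [Ring U] [Algebra k U]
    [AddCommGroup V] [Module k V] (J : Ideal U) [J.IsTwoSided] (f : U →ₗ[k] V)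
    (h : ∀ a ∈ J, f a = 0) : (U ⧸ J) →ₗ[k] V :=
  (Submodule.liftQ (J.restrictScalars k) f h) ∘ₗ
    (Submodule.Quotient.restrictScalarsEquiv k J).symm.toLinearMap

theorem idealLift_mk {k : Type u} [Field k] {U V : Type u} [Ring U] [Algebra k U]
    [AddCommGroup V] [Module k V] (J : Ideal U) [J.IsTwoSided] (f : U →ₗ[k] V)
    (h : ∀ a ∈ J, f a = 0) (a : U) : idealLift J f h (Ideal.Quotient.mkₐ k J a) = f a := rfl

/-- A topological Hopf algebra with an adic topology. The coproduct takes its values in the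
completed tensor product `U ⊗̂ U = lim (U / I ^ N) ⊗ (U / I ^ N)`; it is given by its components
`comul N`. -/
structure AdicHopf (k : Type u) [Field k] extends AdicAlgebra k where
  comul : ∀ N, carrier →ₐ[k] toAdicAlgebra.Quo N ⊗[k] toAdicAlgebra.Quo N
  comul_compat : ∀ N a,
    Algebra.TensorProduct.map (toAdicAlgebra.proj N.le_succ) (toAdicAlgebra.proj N.le_succ)
      (comul (N + 1) a) = comul N a
  /-- `Δ I ⊆ I ⊗̂ U + U ⊗̂ I` -/
  comul_cont : ∀ N, ∀ a ∈ ideal ^ (2 * N), comul N a = 0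
  coassoc : ∀ N a,
    Algebra.TensorProduct.assoc k k k _ _ _
      (Algebra.TensorProduct.map
        (Ideal.Quotient.liftₐ (ideal ^ (2 * N)) (comul N) (comul_cont N))
        (toAdicAlgebra.proj (Nat.le_mul_of_pos_left N two_pos)) (comul (2 * N) a)) =
      Algebra.TensorProduct.map
        (toAdicAlgebra.proj (Nat.le_mul_of_pos_left N two_pos))
        (Ideal.Quotient.liftₐ (ideal ^ (2 * N)) (comul N) (comul_cont N)) (comul (2 * N) a)
  counit : carrier →ₐ[k] k
  counit_cont : ∀ a ∈ ideal, counit a = 0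
  counit_comul : ∀ N a,
    Algebra.TensorProduct.lid k _
      (Algebra.TensorProduct.map
        (Ideal.Quotient.liftₐ (ideal ^ (N + 1)) counit
          fun a ha => counit_cont a (Ideal.pow_le_self N.succ_ne_zero ha))
        (AlgHom.id k (toAdicAlgebra.Quo (N + 1))) (comul (N + 1) a)) =
      toAdicAlgebra.mk' (N + 1) a
  comul_counit : ∀ N a,
    Algebra.TensorProduct.rid k k _
      (Algebra.TensorProduct.map (AlgHom.id k (toAdicAlgebra.Quo (N + 1)))
        (Ideal.Quotient.liftₐ (ideal ^ (N + 1)) counit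
          fun a ha => counit_cont a (Ideal.pow_le_self N.succ_ne_zero ha))
        (comul (N + 1) a)) =
      toAdicAlgebra.mk' (N + 1) a
  antipode : carrier →ₗ[k] carrier
  antipode_cont : ∀ N, ∀ a ∈ ideal ^ N,
    ((toAdicAlgebra.mk' N).toLinearMap ∘ₗ antipode) a = 0
  antipode_left : ∀ N a,
    LinearMap.mul' k (toAdicAlgebra.Quo N)
      (TensorProduct.map
        (idealLift (ideal ^ N) ((toAdicAlgebra.mk' N).toLinearMap ∘ₗ antipode) (antipode_cont N))
        LinearMap.id (comul N a)) =
      algebraMap k (toAdicAlgebra.Quo N) (counit a)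
  antipode_right : ∀ N a,
    LinearMap.mul' k (toAdicAlgebra.Quo N)
      (TensorProduct.map LinearMap.id
        (idealLift (ideal ^ N) ((toAdicAlgebra.mk' N).toLinearMap ∘ₗ antipode) (antipode_cont N))
        (comul N a)) =
      algebraMap k (toAdicAlgebra.Quo N) (counit a)

/-- Continuous homomorphisms of adic Hopf algebras. -/
structure IsHopfHom {k : Type u} [Field k] (U U' : AdicHopf k)
    (Φ : U.carrier →ₐ[k] U'.carrier) : Prop where
  map_ideal : ∀ N, U.ideal ^ N ≤ (U'.ideal ^ N).comap Φ
  map_comul : ∀ N a,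
    Algebra.TensorProduct.map (Ideal.quotientMapₐ (U'.ideal ^ N) Φ (map_ideal N))
      (Ideal.quotientMapₐ (U'.ideal ^ N) Φ (map_ideal N)) (U.comul N a) = U'.comul N (Φ a)
  map_counit : ∀ a, U'.counit (Φ a) = U.counit a
  map_antipode : ∀ a, Φ (U.antipode a) = U'.antipode (Φ a)

/-- The continuous linear functionals on `U`, that is, those that vanish on some `I ^ N`. -/
def AdicAlgebra.contDual {k : Type u} [Field k] (U : AdicAlgebra k) :
    Submodule k (U.carrier →ₗ[k] k) where
  carrier := {f | ∃ N, ∀ a ∈ U.ideal ^ N, f a = 0}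
  zero_mem' := ⟨0, fun _ _ => rfl⟩
  add_mem' := by
    rintro f g ⟨M, hM⟩ ⟨N, hN⟩
    refine ⟨max M N, fun a ha => ?_⟩
    rw [LinearMap.add_apply, hM a (Ideal.pow_le_pow_right (le_max_left M N) ha),
      hN a (Ideal.pow_le_pow_right (le_max_right M N) ha), add_zero]
  smul_mem' := by
    rintro c f ⟨N, hN⟩
    exact ⟨N, fun a ha => by rw [LinearMap.smul_apply, hN a ha, smul_zero]⟩

/-- The value of `f ⊗ g` on a tensor. -/
noncomputable def pairTensor {k : Type u} [Field k] {V W : Type u} [AddCommGroup V] [Module k V]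
    [AddCommGroup W] [Module k W] (f : V →ₗ[k] k) (g : W →ₗ[k] k) : V ⊗[k] W →ₗ[k] k :=
  LinearMap.mul' k k ∘ₗ TensorProduct.map f g

/-- The pairing `B` identifies `W` with the dual Hopf algebra of `U`: as a vector space `W` is the
space of continuous functionals on `U` (and `U` is that of `W`), and the operations of `W` are the
transposes of the operations of `U`. -/
structure IsHopfDual {k : Type u} [Field k] (U W : AdicHopf k)
    (B : W.carrier →ₗ[k] U.carrier →ₗ[k] k) : Prop where
  left_injective : Function.Injective B
  left_range : LinearMap.range B = U.contDual
  right_injective : Function.Injective B.flip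
  right_range : LinearMap.range B.flip = W.contDual
  mul : ∀ N (w w' : W.carrier) (hw : ∀ a ∈ U.ideal ^ N, B w a = 0)
    (hw' : ∀ a ∈ U.ideal ^ N, B w' a = 0) (a : U.carrier),
    B (w * w') a = pairTensor (idealLift _ (B w) hw) (idealLift _ (B w') hw') (U.comul N a)
  one : ∀ a, B 1 a = U.counit a
  comul : ∀ N (a b : U.carrier) (ha : ∀ w ∈ W.ideal ^ N, B.flip a w = 0)
    (hb : ∀ w ∈ W.ideal ^ N, B.flip b w = 0) (w : W.carrier),
    pairTensor (idealLift _ (B.flip a) ha) (idealLift _ (B.flip b) hb) (W.comul N w) = B w (a * b)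
  counit : ∀ w, W.counit w = B w 1
  antipode : ∀ w a, B (W.antipode w) a = B w (U.antipode a)

/-! ### The quantization -/

/-- The words of content `d`: those in which each letter `i` occurs `d i` times. -/
noncomputable def wordsOfContent {m : ℕ} (d : Fin m →₀ ℕ) : Finset (Fin d.degree → Fin m) :=
  Finset.univ.filter fun w => ∑ j, Finsupp.single (w j) 1 = d

/-- The symmetrized monomial of content `d` in the elements `h i`: the average of the products
of all the words of content `d`. -/
noncomputable def symMonomial (k : Type u) [Field k] {m : ℕ} {U : Type u} [Ring U] [Algebra k U]
    (h : Fin m → U) (d : Fin m →₀ ℕ) : U :=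
  ((wordsOfContent d).card : k)⁻¹ •
    ∑ w ∈ wordsOfContent d, (List.ofFn fun j => h (w j)).prod

/-- The quantization of `𝐋`: a Hopf algebra generated by elements `H i` and (power series in)
commuting elements `X μ`, with the adic topology of the ideal that the `X μ` generate. -/
structure Quantization {k : Type u} [Field k] {m n : ℕ} (L : InhomBialgebra k m n)
    extends AdicHopf k where
  H : Fin m → carrier
  /-- the substitution of the elements `X μ` into power series -/
  ser : MvPowerSeries (Fin n) k →ₐ[k] carrier
  /-- `ideal` is the two-sided ideal generated by the `X μ` -/
  ideal_eq : ideal = Ideal.span {x | ∃ μ b, x = ser (MvPowerSeries.X μ) * b}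
  /-- As a linear space, `U_q(𝐋)` is the tensor product of `U_q(𝐕) = k[[X]]` and `U(𝐇)`: each
  element is in exactly one way a finite sum of products of a power series in the `X μ` and a
  symmetrized monomial in the `H i`. -/
  pbw : Function.Bijective fun c : (Fin m →₀ ℕ) →₀ MvPowerSeries (Fin n) k =>
    c.sum fun d f => ser f * symMonomial k H d
  /-- `Δ (X μ) = D^μ(X ⊗ 1, 1 ⊗ X)`; the terms left out below vanish in the quotient -/
  comul_X : ∀ N μ, comul N (ser (MvPowerSeries.X μ)) =
    ∑ a : Fin n → Fin N, ∑ b : Fin n → Fin N,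
      MvPowerSeries.coeff
        (Finsupp.equivFunOnFinite.symm (Sum.elim (fun j => (a j : ℕ)) (fun j => (b j : ℕ))))
        (chSeries L.γ μ) •
      (toAdicAlgebra.mk' N (ser (∏ j, MvPowerSeries.X j ^ (a j : ℕ))) ⊗ₜ[k]
        toAdicAlgebra.mk' N (ser (∏ j, MvPowerSeries.X j ^ (b j : ℕ))))
  /-- `Δ (H i) = ∑ l, (e^{α · X})^l_i ⊗ H l + H i ⊗ 1` -/
  comul_H : ∀ N i, comul N (H i) =
    ∑ l, toAdicAlgebra.mk' N (ser (expAlphaX L.α l i)) ⊗ₜ[k] toAdicAlgebra.mk' N (H l) +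
      toAdicAlgebra.mk' N (H i) ⊗ₜ[k] 1
  counit_X : ∀ μ, counit (ser (MvPowerSeries.X μ)) = 0
  counit_H : ∀ i, counit (H i) = 0
  comm_HH : ∃ CX : Fin m → Fin m → Fin m → MvPowerSeries (Fin n) k,
    (∀ i j, H i * H j - H j * H i = ∑ l, ser (CX i j l) * H l) ∧
    ∀ i j l, MvPowerSeries.constantCoeff (CX i j l) = L.C i j l
  comm_HX : ∃ AX : Fin m → Fin n → MvPowerSeries (Fin n) k,
    (∀ i μ, H i * ser (MvPowerSeries.X μ) - ser (MvPowerSeries.X μ) * H i = ser (AX i μ)) ∧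
    ∀ i μ ν, MvPowerSeries.coeff (Finsupp.single ν 1) (AX i μ) = L.A i ν μ

/-- The generator `X μ`. -/
noncomputable def Quantization.X {k : Type u} [Field k] {m n : ℕ} {L : InhomBialgebra k m n}
    (U : Quantization L) (μ : Fin n) : U.carrier :=
  U.ser (MvPowerSeries.X μ)

/-- Morphisms of the category `ℋ` from `U_q(𝐋)` to `U_q(𝐋')`: the Hopf homomorphisms that are given
on the generators by a linear map `𝐇 → 𝐇'` with matrix `p` and a linear map `𝐕 → 𝐕'` with
matrix `q`. -/
structure Quantization.IsMorphism {k : Type u} [Field k] {m n m' n' : ℕ}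
    {L : InhomBialgebra k m n} {L' : InhomBialgebra k m' n'}
    (U : Quantization L) (U' : Quantization L')
    (p : Matrix (Fin m') (Fin m) k) (q : Matrix (Fin n') (Fin n) k)
    (Φ : U.carrier →ₐ[k] U'.carrier) : Prop extends IsHopfHom U.toAdicHopf U'.toAdicHopf Φ where
  map_H : ∀ i, Φ (U.H i) = ∑ i', p i' i • U'.H i'
  map_X : ∀ μ, Φ (U.X μ) = ∑ μ', q μ' μ • U'.X μ'

/-- The pairing `B` identifies the quantization `W` of `𝐋*` with the dual Hopf algebra of `U`, in
such a way that the generators of `W` are the following functionals: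
`⟨ζ μ, f(X) ψ(H)⟩ = (∂f/∂X^μ)(0) ε(ψ)` and `⟨η i, f(X) ψ(H)⟩ = f(0) ⟨η i, ψ(H)⟩`, where `η i` is
the element of the basis of `U*(𝐇)` dual to the symmetrized monomials that corresponds to `H i`. -/
structure Quantization.IsDual {k : Type u} [Field k] {m n : ℕ} {L : InhomBialgebra k m n}
    (U : Quantization L) (W : Quantization L.dual)
    (B : W.carrier →ₗ[k] U.carrier →ₗ[k] k) : Prop
    extends IsHopfDual U.toAdicHopf W.toAdicHopf B where
  zeta : ∀ μ f d, B (W.H μ) (U.ser f * symMonomial k U.H d) =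
    if d = 0 then MvPowerSeries.coeff (Finsupp.single μ 1) f else 0
  eta : ∀ i f d, B (W.X i) (U.ser f * symMonomial k U.H d) =
    if d = Finsupp.single i 1 then MvPowerSeries.constantCoeff f else 0

/-! ### The canonical element -/

/-- The `N`-th component of the completed tensor product `W_op ⊗̂ U`. -/
abbrev OpTensor {k : Type u} [Field k] (W U : AdicAlgebra k) (N : ℕ) : Type u :=
  (W.Quo N)ᵐᵒᵖ ⊗[k] U.Quo N

/-- The family `T` is an element of the completed tensor product `W_op ⊗̂ U`, and it is the
canonical element of the pairing `B`: pairing its first factor with `a` gives `a`, and pairing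
its second factor with `w` gives `w`. -/
structure IsCanonicalElement {k : Type u} [Field k] (W U : AdicAlgebra k)
    (B : W.carrier →ₗ[k] U.carrier →ₗ[k] k) (T : ∀ N, OpTensor W U N) : Prop where
  compat : ∀ N, Algebra.TensorProduct.map (AlgHom.op (W.proj N.le_succ)) (U.proj N.le_succ)
    (T (N + 1)) = T N
  left : ∀ N (a : U.carrier) (ha : ∀ w ∈ W.ideal ^ N, B.flip a w = 0),
    TensorProduct.lid k (U.Quo N)
      (TensorProduct.map
        (idealLift _ (B.flip a) ha ∘ₗ (MulOpposite.opLinearEquiv k).symm.toLinearMap)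
        LinearMap.id (T N)) = U.mk' N a
  right : ∀ N (w : W.carrier) (hw : ∀ a ∈ U.ideal ^ N, B w a = 0),
    TensorProduct.rid k (W.Quo N)ᵐᵒᵖ
      (TensorProduct.map LinearMap.id (idealLift _ (B w) hw) (T N)) =
      MulOpposite.op (W.mk' N w)

/-- `∑ μ, ζ μ ⊗ X μ` in the `N`-th component. -/
noncomputable def zetaX {k : Type u} [Field k] {m n : ℕ} {L : InhomBialgebra k m n}
    (W : Quantization L.dual) (U : Quantization L) (N : ℕ) :
    OpTensor W.toAdicAlgebra U.toAdicAlgebra N :=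
  ∑ μ, MulOpposite.op (W.mk' N (W.H μ)) ⊗ₜ[k] U.mk' N (U.X μ)

/-- `∑ i, η i ⊗ H i` in the `N`-th component. -/
noncomputable def etaH {k : Type u} [Field k] {m n : ℕ} {L : InhomBialgebra k m n}
    (W : Quantization L.dual) (U : Quantization L) (N : ℕ) :
    OpTensor W.toAdicAlgebra U.toAdicAlgebra N :=
  ∑ i, MulOpposite.op (W.mk' N (W.X i)) ⊗ₜ[k] U.mk' N (U.H i)

/-- The exponential of an element `x` with `x ^ N = 0`. -/
noncomputable def expBelow (k : Type u) [Field k] {R : Type u} [Ring R] [Algebra k R] (N : ℕ)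
    (x : R) : R :=
  ∑ j ∈ Finset.range N, ((j ! : ℕ) : k)⁻¹ • x ^ j

/-! Let `G` be the formal group of the Lie algebra `𝐕*` in exponential coordinates, so that `k[[X]]`
is its algebra of functions and the Campbell–Hausdorff series is its multiplication. The
compatibility conditions of `𝐋` say that `𝐕* ⊕ 𝐇_op` is a Lie algebra with both summands as
subalgebras (`pc_factorLie`). Such a factorized Lie algebra acts on `G` by vector fields: the
Maurer–Cartan form of the field of `p` is the `𝐕*`-part of `e^{-ad x} p`. Elements of `𝐕*` give the
generators `L_μ` of left translations, elements of `𝐇` give the dressing fields `A_i`, and the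
`𝐇`-part of `e^{-ad x} H_i` is the matrix `e^{α·X}`. The commutators of these fields
(`fld_commutator`, `rfld_commutator`) contain what the Hopf algebra needs: the relations `[H_i, f] =
A_i f` and `[H_i, H_j] = C H`, and their compatibility with the coproduct (`dl_af`, `ee_cocycle`).

Most identities of formal series follow from one uniqueness principle (`family_eq_zero`): with `E`
the Euler operator, an equation `E y + c y = (terms of higher order)` determines `y` from its lowest
part. Since `∑ X_μ L_μ = E`, linear systems along the `L_μ` are of this kind (`eq_zero_of_fields`).
Symmetrized monomials fit the same pattern: divided by factorials, they are the coefficients `σ_d`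
of `exp (∑ T_μ X_μ)`, an exponential characterized by its Euler equation. The Taylor formula
`coeff_eq_sl` says that the `σ_a(L)`, evaluated at the origin, are dual to the monomials `X^a`; this
is the origin of the duality.

Existence. On the space of linear maps `ξ : k[[η]] → k[[X]]` power series act by multiplication and
`H_i` acts by `ξ ↦ A_i ∘ ξ + ξ ∘ L_i`, with `L_i` a left translation of the group dual to `G`. The
vector `g ↦ g(0)` shows that the products `f(X) σ_d(H)` are independent. An algebra with such a
basis and these relations has a universal property (`IsPBW.lift`), so coproduct, counit and antipode
are determined by their values on generators, and the Hopf axioms need checking there only.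
`chSeries_eq` identifies the coproduct of `X^μ` with Dynkin's series.

Rigidity. In an arbitrary quantization the coproduct forces the commutation relations to be the
standard ones (`Quantization.gens_comm`, `Quantization.ser_comm`); uniqueness then follows from the
universal property.

Duality. No Hopf structure is put on the space of functionals directly. Instead a quantization `W`
of `𝐋*` is paired with `U` by making the monomials `g(η) σ_e(ζ)` and `f(X) σ_d(H)` dual to each
other. This pairing is symmetric in the two sides and identifies `W` with the continuous dual of
`U`. The main point is that the product of `W` is convolution (`isConv_pairing`). By coassociativity
it is enough to multiply by generators: for series in `η` only the coproduct modulo the ideal in the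
first factor matters, and for `ζ_μ` a commutation rule (`ZetaRule`) holds simultaneously in `U` and
on the representation. The coproduct follows by symmetry, and the antipode from generators. The
canonical element is the sum over the dual bases, which factors into the two exponentials. Finally,
a continuous `Φ` composes continuous functionals with continuous functionals, which gives the
transpose. -/

set_option linter.unusedSectionVars false

namespace LieQuant

open MvPowerSeries

/-! ### The order filtration and the Euler operator on power series -/

section Order

variable {σ : Type*} {R : Type*} [Ring R]

/-- The coefficients of `f` of degree less than `N` vanish. -/
def OrdGE (N : ℕ) (f : MvPowerSeries σ R) : Prop :=
  ∀ d : σ →₀ ℕ, d.degree < N → coeff d f = 0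

theorem OrdGE.zero' (f : MvPowerSeries σ R) : OrdGE 0 f := fun _ h => absurd h (Nat.not_lt_zero _)

theorem ordGE_zero (N : ℕ) : OrdGE N (0 : MvPowerSeries σ R) := fun _ _ => by simp

theorem OrdGE.mono {M N : ℕ} (h : M ≤ N) {f : MvPowerSeries σ R} (hf : OrdGE N f) : OrdGE M f :=
  fun d hd => hf d (hd.trans_le h)

theorem OrdGE.add {N : ℕ} {f g : MvPowerSeries σ R} (hf : OrdGE N f) (hg : OrdGE N g) :
    OrdGE N (f + g) := fun d hd => by rw [map_add, hf d hd, hg d hd, add_zero]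

theorem OrdGE.neg {N : ℕ} {f : MvPowerSeries σ R} (hf : OrdGE N f) : OrdGE N (-f) :=
  fun d hd => by rw [map_neg, hf d hd, neg_zero]

theorem OrdGE.sub {N : ℕ} {f g : MvPowerSeries σ R} (hf : OrdGE N f) (hg : OrdGE N g) :
    OrdGE N (f - g) := fun d hd => by rw [map_sub, hf d hd, hg d hd, sub_zero]

theorem OrdGE.sum {N : ℕ} {ι : Type*} {s : Finset ι} {f : ι → MvPowerSeries σ R}
    (hf : ∀ i ∈ s, OrdGE N (f i)) : OrdGE N (∑ i ∈ s, f i) := fun d hd => by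
  rw [map_sum]; exact Finset.sum_eq_zero fun i hi => hf i hi d hd

theorem OrdGE.mul {M N : ℕ} {f g : MvPowerSeries σ R} (hf : OrdGE M f) (hg : OrdGE N g) :
    OrdGE (M + N) (f * g) := fun d hd => by
  classical
  rw [coeff_mul]
  refine Finset.sum_eq_zero fun p hp => ?_
  rw [Finset.HasAntidiagonal.mem_antidiagonal] at hp
  have hdeg : p.1.degree + p.2.degree = d.degree := by rw [← hp, map_add]
  by_cases h1 : p.1.degree < M
  · rw [hf _ h1, zero_mul]
  · rw [hg _ (by omega), mul_zero]

theorem OrdGE.mul_left {N : ℕ} {f : MvPowerSeries σ R} (g : MvPowerSeries σ R) (hf : OrdGE N f) :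
    OrdGE N (g * f) := by simpa using (OrdGE.zero' g).mul hf

theorem OrdGE.mul_right {N : ℕ} {f : MvPowerSeries σ R} (g : MvPowerSeries σ R) (hf : OrdGE N f) :
    OrdGE N (f * g) := by simpa using hf.mul (OrdGE.zero' g)

theorem OrdGE.pow {f : MvPowerSeries σ R} (hf : OrdGE 1 f) (r : ℕ) : OrdGE r (f ^ r) := by
  induction r with
  | zero => exact OrdGE.zero' _
  | succ r ih => rw [pow_succ]; exact ih.mul hf

theorem OrdGE.smul {S : Type*} [CommRing S] [Algebra S R] {N : ℕ} {f : MvPowerSeries σ R}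
    (c : S) (hf : OrdGE N f) : OrdGE N (c • f) := fun d hd => by
  have : coeff d (c • f) = c • coeff d f := rfl
  rw [this, hf d hd, smul_zero]

theorem ordGE_X (s : σ) : OrdGE 1 (X s : MvPowerSeries σ R) := fun d hd => by
  have : d = 0 := (Finsupp.degree_eq_zero_iff d).mp (by omega)
  rw [this, coeff_zero_X]

theorem ordGE_one_iff {f : MvPowerSeries σ R} : OrdGE 1 f ↔ constantCoeff f = 0 := by
  refine ⟨fun h => by simpa using h 0 (by simp), fun h d hd => ?_⟩
  have : d = 0 := (Finsupp.degree_eq_zero_iff d).mp (by omega)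
  rw [this, coeff_zero_eq_constantCoeff_apply, h]

theorem eq_zero_of_ordGE {f : MvPowerSeries σ R} (h : ∀ N, OrdGE N f) : f = 0 := by
  ext d; rw [h (d.degree + 1) d (Nat.lt_succ_self _), coeff_zero]

/-- The Euler operator, which multiplies the part of degree `r` by `r`. -/
noncomputable def euler : MvPowerSeries σ R →+ MvPowerSeries σ R where
  toFun f := fun d => d.degree • coeff d f
  map_zero' := by ext d; exact smul_zero _
  map_add' f g := by ext d; exact smul_add _ _ _

theorem coeff_euler (f : MvPowerSeries σ R) (d : σ →₀ ℕ) :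
    coeff d (euler f) = d.degree • coeff d f := rfl

theorem euler_mul (f g : MvPowerSeries σ R) : euler (f * g) = euler f * g + f * euler g := by
  classical
  ext d
  rw [coeff_euler, map_add, coeff_mul, coeff_mul, coeff_mul, ← Finset.sum_add_distrib,
    Finset.smul_sum]
  refine Finset.sum_congr rfl fun p hp => ?_
  rw [Finset.HasAntidiagonal.mem_antidiagonal] at hp
  rw [coeff_euler, coeff_euler, ← hp, map_add, add_smul, smul_mul_assoc, mul_smul_comm]

theorem euler_smul {S : Type*} [CommRing S] [Algebra S R] (c : S) (f : MvPowerSeries σ R) :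
    euler (c • f) = c • euler f := by
  ext d; exact smul_comm d.degree c (coeff d f)

theorem euler_X (s : σ) : euler (X s : MvPowerSeries σ R) = X s := by
  classical
  ext d
  rw [coeff_euler, coeff_X]
  split_ifs with h
  · simp [h]
  · simp

theorem euler_C (r : R) : euler (C r : MvPowerSeries σ R) = 0 := by
  classical
  ext d
  rw [coeff_euler, coeff_C]
  split_ifs with h <;> simp [h]

theorem euler_one : euler (1 : MvPowerSeries σ R) = 0 := euler_C 1

/-- On the part of degree `N` the operator `E + c` is multiplication by the nonzero integer `N + c`,
which is injective when `R` is torsion free. -/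
theorem ordGE_succ_iff_euler [IsAddTorsionFree R] {N : ℕ} (c : ℤ) (hc : (N : ℤ) + c ≠ 0)
    {f : MvPowerSeries σ R} (hf : OrdGE N f) (h : OrdGE (N + 1) (LieQuant.euler f + c • f)) :
    OrdGE (N + 1) f := fun d hd => by
  rcases Nat.lt_succ_iff_lt_or_eq.mp hd with h' | h'
  · exact hf d h'
  · have := h d hd
    rw [map_add, coeff_euler, map_zsmul, ← natCast_zsmul, ← add_zsmul, h'] at this
    exact (smul_eq_zero_iff_right hc).mp this

/-- Uniqueness of solutions of equations `E y + c y = (terms of higher order)`. -/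
theorem family_eq_zero [IsAddTorsionFree R] {S : Type*} (y : S → MvPowerSeries σ R) (c : ℤ)
    (N₀ : ℕ) (h₀ : ∀ s, OrdGE N₀ (y s)) (hc : ∀ N, N₀ ≤ N → (N : ℤ) + c ≠ 0)
    (h : ∀ N, (∀ s, OrdGE N (y s)) → ∀ s, OrdGE (N + 1) (euler (y s) + c • y s)) :
    ∀ s, y s = 0 := by
  have key : ∀ N, ∀ s, OrdGE N (y s) := by
    intro N
    induction N with
    | zero => exact fun s => OrdGE.zero' _
    | succ N ih =>
      intro s
      by_cases hN : N₀ ≤ N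
      · exact ordGE_succ_iff_euler c (hc N hN) (ih s) (h N ih s)
      · exact (h₀ s).mono (by omega)
  exact fun s => eq_zero_of_ordGE fun N => key N s

end Order

/-! ### One-variable series evaluated at series with noncommuting coefficients -/

section Alg

variable {k : Type*} [Field k] {σ : Type*} {R : Type*} [Ring R] [Algebra k R]

theorem coeff_smul' (c : k) (f : MvPowerSeries σ R) (d : σ →₀ ℕ) :
    coeff d (c • f) = c • coeff d f := rfl

/-- The substitution of a power series `u` without constant term into a power series `c` in one
variable; the coefficients of `u` need not commute. -/
noncomputable def fc (c : PowerSeries k) (u : MvPowerSeries σ R) : MvPowerSeries σ R :=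
  fun d => coeff d (∑ r ∈ Finset.range (d.degree + 1), PowerSeries.coeff r c • u ^ r)

theorem fc_eq_sum (c : PowerSeries k) {u : MvPowerSeries σ R} (hu : OrdGE 1 u) (N : ℕ)
    (d : σ →₀ ℕ) (hd : d.degree < N) :
    coeff d (fc c u) = coeff d (∑ r ∈ Finset.range N, PowerSeries.coeff r c • u ^ r) := by
  change coeff d (∑ r ∈ Finset.range (d.degree + 1), PowerSeries.coeff r c • u ^ r) = _
  rw [map_sum, map_sum]
  refine Finset.sum_subset (fun r hr => ?_) fun r _ hr => ?_
  · simp only [Finset.mem_range] at *; omega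
  · simp only [Finset.mem_range] at hr
    rw [coeff_smul', hu.pow r d (by omega), smul_zero]

/-- Truncation replaces `c` by a polynomial at the cost of terms of order `N`, so identities for
`fc` reduce to identities for polynomials in `u`. -/
theorem fc_sub_ordGE (c : PowerSeries k) {u : MvPowerSeries σ R} (hu : OrdGE 1 u) (N : ℕ) :
    OrdGE N (fc c u - Polynomial.aeval u (PowerSeries.trunc N c)) := fun d hd => by
  rw [map_sub, fc_eq_sum c hu N d hd, sub_eq_zero,
    show PowerSeries.trunc N c = ∑ m ∈ Finset.Ico 0 N,
      Polynomial.monomial m (PowerSeries.coeff m c) from rfl, map_sum, map_sum, map_sum,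
    Nat.Ico_zero_eq_range]
  refine Finset.sum_congr rfl fun r _ => ?_
  rw [Polynomial.aeval_monomial, Algebra.smul_def]

theorem eq_of_ordGE_sub {f g : MvPowerSeries σ R} (h : ∀ N, OrdGE N (f - g)) : f = g :=
  sub_eq_zero.mp (eq_zero_of_ordGE h)

theorem fc_mul (c c' : PowerSeries k) {u : MvPowerSeries σ R} (hu : OrdGE 1 u) :
    fc (c * c') u = fc c u * fc c' u := by
  refine eq_of_ordGE_sub fun N => ?_
  have h1 := fc_sub_ordGE c hu N
  have h2 := fc_sub_ordGE c' hu N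
  have h3 := fc_sub_ordGE (c * c') hu N
  set p := PowerSeries.trunc N c
  set q := PowerSeries.trunc N c'
  have hdvd : Polynomial.X ^ N ∣ PowerSeries.trunc N (c * c') - p * q := by
    rw [Polynomial.X_pow_dvd_iff]
    intro d hd
    rw [Polynomial.coeff_sub, PowerSeries.coeff_trunc, if_pos hd, sub_eq_zero,
      PowerSeries.coeff_mul, Polynomial.coeff_mul]
    refine Finset.sum_congr rfl fun x hx => ?_
    rw [Finset.HasAntidiagonal.mem_antidiagonal] at hx
    rw [PowerSeries.coeff_trunc, PowerSeries.coeff_trunc, if_pos (by omega), if_pos (by omega)]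
  obtain ⟨s, hs⟩ := hdvd
  have h4 : OrdGE N (Polynomial.aeval u (PowerSeries.trunc N (c * c'))
      - Polynomial.aeval u p * Polynomial.aeval u q) := by
    rw [← map_mul, ← map_sub, hs, map_mul, map_pow, Polynomial.aeval_X]
    exact (hu.pow N).mul_right _
  have h5 : OrdGE N (fc c u * fc c' u - Polynomial.aeval u p * Polynomial.aeval u q) := by
    have : fc c u * fc c' u - Polynomial.aeval u p * Polynomial.aeval u q =
      (fc c u - Polynomial.aeval u p) * fc c' u
        + Polynomial.aeval u p * (fc c' u - Polynomial.aeval u q) := by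
      rw [sub_mul, mul_sub]; abel
    rw [this]
    exact (h1.mul_right _).add (h2.mul_left _)
  have : fc (c * c') u - fc c u * fc c' u =
      (fc (c * c') u - Polynomial.aeval u (PowerSeries.trunc N (c * c')))
      + (Polynomial.aeval u (PowerSeries.trunc N (c * c'))
          - Polynomial.aeval u p * Polynomial.aeval u q)
      - (fc c u * fc c' u - Polynomial.aeval u p * Polynomial.aeval u q) := by abel
  rw [this]
  exact (h3.add h4).sub h5

theorem fc_add (c c' : PowerSeries k) (u : MvPowerSeries σ R) :
    fc (c + c') u = fc c u + fc c' u := by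
  ext d
  rw [map_add]
  change coeff d (∑ r ∈ Finset.range (d.degree + 1), _) = coeff d (∑ r ∈ Finset.range (d.degree + 1), _) + coeff d (∑ r ∈ Finset.range (d.degree + 1), _)
  rw [← map_add, ← Finset.sum_add_distrib]
  simp only [map_add, add_smul]

theorem fc_one (u : MvPowerSeries σ R) : fc (1 : PowerSeries k) u = 1 := by
  ext d
  change coeff d (∑ r ∈ Finset.range (d.degree + 1), _) = _
  rw [Finset.sum_range_succ']
  simp [PowerSeries.coeff_one]

theorem fc_sub (c c' : PowerSeries k) (u : MvPowerSeries σ R) :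
    fc (c - c') u = fc c u - fc c' u := by
  rw [eq_sub_iff_add_eq, ← fc_add, sub_add_cancel]

theorem fc_X {u : MvPowerSeries σ R} (hu : OrdGE 1 u) : fc (PowerSeries.X : PowerSeries k) u = u := by
  refine eq_of_ordGE_sub fun N => ?_
  intro d hd
  rw [map_sub, fc_eq_sum _ hu (N + 2) d (by omega), ← map_sub]
  rw [Finset.sum_eq_single 1]
  · simp
  · intro b _ hb
    rw [PowerSeries.coeff_X, if_neg hb, zero_smul]
  · simp

theorem constantCoeff_fc (c : PowerSeries k) (u : MvPowerSeries σ R) :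
    coeff 0 (fc c u) = algebraMap k R (PowerSeries.constantCoeff c) := by
  change coeff 0 (∑ r ∈ Finset.range ((0 : σ →₀ ℕ).degree + 1), _) = _
  rw [map_zero, Finset.sum_range_one, pow_zero, coeff_smul', coeff_zero_one,
    Algebra.algebraMap_eq_smul_one, PowerSeries.coeff_zero_eq_constantCoeff_apply]

theorem commute_fc {c : PowerSeries k} {u v : MvPowerSeries σ R} (hu : OrdGE 1 u)
    (h : Commute v u) : Commute v (fc c u) := by
  refine eq_of_ordGE_sub fun N => ?_
  have h1 := fc_sub_ordGE c hu N
  set p := PowerSeries.trunc N c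
  have h2 : v * Polynomial.aeval u p = Polynomial.aeval u p * v := by
    have : Commute v (Polynomial.aeval u p) := by
      rw [Polynomial.aeval_eq_sum_range]
      exact Commute.sum_right _ _ _ fun i _ => (h.pow_right i).smul_right _
    exact this
  have : v * fc c u - fc c u * v = v * (fc c u - Polynomial.aeval u p)
      - (fc c u - Polynomial.aeval u p) * v := by
    rw [mul_sub, sub_mul, h2]; abel
  rw [this]
  exact (h1.mul_left _).sub (h1.mul_right _)

theorem euler_pow_of_eq {u : MvPowerSeries σ R} (hu : euler u = u) (r : ℕ) :
    euler (u ^ r) = r • u ^ r := by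
  induction r with
  | zero => simp [euler_one]
  | succ r ih => rw [pow_succ, euler_mul, ih, hu, add_smul, one_smul, smul_mul_assoc]

/-- `E (c(u)) = (z c')(u)` if `u` is homogeneous of degree one. -/
theorem euler_fc {c c' : PowerSeries k} {u : MvPowerSeries σ R}
    (hE : euler u = u) (hc : ∀ r, PowerSeries.coeff r c' = (r : k) * PowerSeries.coeff r c) :
    euler (fc c u) = fc c' u := by
  ext d
  rw [coeff_euler]
  change _ • coeff d (∑ r ∈ Finset.range (d.degree + 1), _) = coeff d (∑ r ∈ Finset.range (d.degree + 1), _)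
  rw [← coeff_euler, map_sum]
  congr 1
  refine Finset.sum_congr rfl fun r _ => ?_
  rw [euler_smul, euler_pow_of_eq hE, hc, mul_comm, mul_smul, Nat.cast_smul_eq_nsmul]

end Alg

/-! ### Divided symmetric monomials -/

section Gen

variable {k : Type*} [Field k] [CharZero k] {ι : Type*} [Fintype ι] [DecidableEq ι]
  {R : Type*} [Ring R] [Algebra k R]

theorem isAddTorsionFree_of_algebra (k : Type*) [Field k] [CharZero k] (R : Type*) [AddCommGroup R]
    [Module k R] : IsAddTorsionFree R where
  nsmul_right_injective n hn x y h := by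
    have h' : (n : k) • x = (n : k) • y := by simpa [Nat.cast_smul_eq_nsmul] using h
    exact smul_right_injective R (Nat.cast_ne_zero.mpr hn) h'

/-- The linear form `∑ μ, T μ * X μ`. -/
noncomputable def linForm (T : ι → R) : MvPowerSeries ι R :=
  ∑ μ, monomial (Finsupp.single μ 1) (T μ)

theorem ordGE_linForm (T : ι → R) : OrdGE 1 (linForm T) := by
  refine OrdGE.sum fun μ _ d hd => ?_
  have : d = 0 := (Finsupp.degree_eq_zero_iff d).mp (by omega)
  rw [this, coeff_monomial, if_neg]
  exact (Finsupp.single_ne_zero.mpr one_ne_zero).symm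

theorem euler_linForm (T : ι → R) : euler (linForm T) = linForm T := by
  rw [linForm, map_sum]
  refine Finset.sum_congr rfl fun μ _ => ?_
  ext d
  rw [coeff_euler, coeff_monomial]
  split_ifs with h
  · simp [h]
  · simp

theorem coeff_linForm_mul (T : ι → R) (f : MvPowerSeries ι R) (d : ι →₀ ℕ) :
    coeff d (linForm T * f) =
      ∑ μ, if Finsupp.single μ 1 ≤ d then T μ * coeff (d - Finsupp.single μ 1) f else 0 := by
  rw [linForm, Finset.sum_mul, map_sum]
  exact Finset.sum_congr rfl fun μ _ => coeff_monomial_mul _ _ _ _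

theorem coeff_mul_linForm (T : ι → R) (f : MvPowerSeries ι R) (d : ι →₀ ℕ) :
    coeff d (f * linForm T) =
      ∑ μ, if Finsupp.single μ 1 ≤ d then coeff (d - Finsupp.single μ 1) f * T μ else 0 := by
  rw [linForm, Finset.mul_sum, map_sum]
  exact Finset.sum_congr rfl fun μ _ => coeff_mul_monomial _ _ _ _

theorem linForm_pow (T : ι → R) (r : ℕ) :
    linForm T ^ r = ∑ w : Fin r → ι, monomial (∑ j, Finsupp.single (w j) 1)
      ((List.ofFn fun j => T (w j)).prod) := by
  induction r with
  | zero => simp [monomial_zero_one]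
  | succ r ih =>
    rw [pow_succ', ih, linForm, Finset.sum_mul_sum,
      ← (Fin.consEquiv fun _ : Fin (r + 1) => ι).sum_comp, Fintype.sum_prod_type]
    refine Finset.sum_congr rfl fun μ _ => Finset.sum_congr rfl fun w _ => ?_
    rw [monomial_mul_monomial]
    simp [Fin.sum_univ_succ, Fin.consEquiv]

/-- The exponential `exp (∑ μ, T μ * X μ)`. -/
noncomputable def gen (k : Type*) [Field k] [CharZero k] [Algebra k R] (T : ι → R) :
    MvPowerSeries ι R := fc (PowerSeries.exp k) (linForm T)

/-- The coefficient of `X ^ d` in `exp (∑ μ, T μ * X μ)`, that is, the symmetrized monomial of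
content `d` divided by `∏ μ, (d μ)!`. -/
noncomputable def sig (k : Type*) [Field k] [CharZero k] [Algebra k R] (T : ι → R) (d : ι →₀ ℕ) :
    R := coeff d (gen k T)

theorem coeff_exp' (r : ℕ) : PowerSeries.coeff r (PowerSeries.exp k) = ((r ! : ℕ) : k)⁻¹ := by
  rw [PowerSeries.coeff_exp]; simp

theorem coeff_gen (T : ι → R) (d : ι →₀ ℕ) : coeff d (gen k T) = sig k T d := rfl

/-- The variables are central, so `X^d` records only the content of a word; for reasons of degree
only the power `|d|` of the linear form contributes. -/
theorem sig_eq_words (T : ι → R) (d : ι →₀ ℕ) :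
    sig k T d = ((d.degree ! : ℕ) : k)⁻¹ •
      ∑ w ∈ Finset.univ.filter fun w : Fin d.degree → ι => ∑ j, Finsupp.single (w j) 1 = d,
        (List.ofFn fun j => T (w j)).prod := by
  change coeff d (∑ r ∈ Finset.range (d.degree + 1), _) = _
  have hdeg : ∀ r (w : Fin r → ι), (∑ j, Finsupp.single (w j) (1 : ℕ)).degree = r := by
    intro r w; simp [map_sum]
  rw [map_sum, Finset.sum_eq_single d.degree]
  · rw [coeff_smul', coeff_exp', linForm_pow, map_sum, Finset.sum_filter]
    congr 1
    refine Finset.sum_congr rfl fun w _ => ?_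
    rw [coeff_monomial]
    simp only [eq_comm]
  · intro r _ hr
    rw [coeff_smul', linForm_pow, map_sum, Finset.sum_eq_zero, smul_zero]
    intro w _
    rw [coeff_monomial, if_neg]
    rintro rfl
    exact hr (hdeg r w).symm
  · simp

/-- With the value 1 at the origin this equation characterizes the exponential (`gen_unique`). The
`T μ` need not commute with one another, since only powers of the single series `∑ T_μ X_μ` occur.
-/
theorem euler_gen (T : ι → R) : euler (gen k T) = linForm T * gen k T := by
  rw [gen, euler_fc (c' := PowerSeries.X * PowerSeries.exp k) (euler_linForm T),
    fc_mul _ _ (ordGE_linForm T), fc_X (ordGE_linForm T)]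
  intro r
  cases r with
  | zero => simp
  | succ r =>
    rw [PowerSeries.coeff_succ_X_mul, coeff_exp', coeff_exp', Nat.factorial_succ]
    have : ((r + 1 : ℕ) : k) ≠ 0 := Nat.cast_ne_zero.mpr (Nat.succ_ne_zero r)
    rw [Nat.cast_mul, mul_inv, mul_inv_cancel_left₀ this]

theorem gen_commute (T : ι → R) : Commute (linForm T) (gen k T) :=
  commute_fc (ordGE_linForm T) (Commute.refl _)

theorem euler_gen' (T : ι → R) : euler (gen k T) = gen k T * linForm T := by
  rw [euler_gen, (gen_commute T).eq]

@[simp] theorem sig_zero (T : ι → R) : sig k T 0 = 1 := by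
  rw [sig, gen, constantCoeff_fc]; simp

theorem sig_rec (T : ι → R) (d : ι →₀ ℕ) : d.degree • sig k T d =
    ∑ μ, if Finsupp.single μ 1 ≤ d then T μ * sig k T (d - Finsupp.single μ 1) else 0 := by
  rw [sig, ← coeff_euler, euler_gen, coeff_linForm_mul]; rfl

/-- The linear form commutes with its exponential, so the last letter can be split off instead of
the first. Having both recursions lets symmetrized monomials pass to opposite algebras and to
transposed operators. -/
theorem sig_rec' (T : ι → R) (d : ι →₀ ℕ) : d.degree • sig k T d =
    ∑ μ, if Finsupp.single μ 1 ≤ d then sig k T (d - Finsupp.single μ 1) * T μ else 0 := by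
  rw [sig, ← coeff_euler, euler_gen', coeff_mul_linForm]; rfl

theorem OrdGE.one_of_coeff_eq {f g : MvPowerSeries ι R} (h : coeff 0 f = coeff 0 g) :
    OrdGE 1 (f - g) := by
  rw [ordGE_one_iff, ← coeff_zero_eq_constantCoeff_apply, map_sub, h, sub_self]

theorem gen_unique (T : ι → R) {y : MvPowerSeries ι R} (h0 : coeff 0 y = 1)
    (h : euler y = linForm T * y) : y = gen k T := by
  have := isAddTorsionFree_of_algebra k R
  have := family_eq_zero (fun _ : Unit => y - gen k T) 0 1
    (fun _ => OrdGE.one_of_coeff_eq (by rw [h0]; exact (sig_zero T).symm)) (fun N hN => by omega)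
    (fun N hy _ => by
      rw [zero_smul, add_zero, map_sub, h, euler_gen, ← mul_sub, add_comm]
      exact (ordGE_linForm T).mul (hy ())) ()
  exact sub_eq_zero.mp this

/-- The working tool for `sig`: behaviour under homomorphisms, scaling and opposites is read off by
verifying the recursion. -/
theorem sig_unique (T : ι → R) (y : (ι →₀ ℕ) → R) (h0 : y 0 = 1)
    (h : ∀ d, d.degree • y d =
      ∑ μ, if Finsupp.single μ 1 ≤ d then T μ * y (d - Finsupp.single μ 1) else 0)
    (d : ι →₀ ℕ) : y d = sig k T d := by
  let z : MvPowerSeries ι R := y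
  have : z = gen k T := by
    refine gen_unique T h0 ?_
    ext d
    rw [coeff_euler, coeff_linForm_mul]
    exact h d
  exact congrFun this d

theorem gen_add (S T : ι → R) (h : ∀ μ ν, Commute (S μ) (T ν)) :
    gen k (S + T) = gen k S * gen k T := by
  have hl : linForm (S + T) = linForm S + linForm T := by
    simp [linForm, Finset.sum_add_distrib]
  have hc : Commute (linForm T) (linForm S) := by
    refine Commute.sum_left _ _ _ fun μ _ => Commute.sum_right _ _ _ fun ν _ => ?_
    change _ * _ = _ * _
    rw [monomial_mul_monomial, monomial_mul_monomial, add_comm, (h ν μ).eq]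
  symm
  refine gen_unique _ ?_ ?_
  · have h1 : coeff 0 (gen k S) = 1 := sig_zero S
    have h2 : coeff 0 (gen k T) = 1 := sig_zero T
    rw [coeff_zero_eq_constantCoeff_apply] at *
    rw [map_mul, h1, h2, mul_one]
  · rw [euler_mul, euler_gen, euler_gen, hl, add_mul, mul_assoc, ← mul_assoc (gen k S),
      ← (show Commute (linForm T) (gen k S) from commute_fc (ordGE_linForm S) hc).eq, mul_assoc]

theorem sig_add (S T : ι → R) (h : ∀ μ ν, Commute (S μ) (T ν)) (d : ι →₀ ℕ) :
    sig k (S + T) d = ∑ p ∈ Finset.HasAntidiagonal.antidiagonal d, sig k S p.1 * sig k T p.2 := by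
  rw [sig, gen_add S T h, coeff_mul]; rfl

theorem map_sig {S : Type*} [Ring S] [Algebra k S] (Φ : R →ₐ[k] S) (T : ι → R) (d : ι →₀ ℕ) :
    Φ (sig k T d) = sig k (fun μ => Φ (T μ)) d := by
  refine sig_unique (fun μ => Φ (T μ)) (fun d => Φ (sig k T d)) (by simp) (fun d => ?_) d
  rw [← map_nsmul, sig_rec, map_sum]
  refine Finset.sum_congr rfl fun μ _ => ?_
  split_ifs <;> simp

theorem op_sig (T : ι → R) (d : ι →₀ ℕ) :
    MulOpposite.op (sig k T d) = sig k (fun μ => MulOpposite.op (T μ)) d := by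
  refine sig_unique (fun μ => MulOpposite.op (T μ)) (fun d => MulOpposite.op (sig k T d))
    (by simp) (fun d => ?_) d
  rw [← MulOpposite.op_smul, sig_rec', Finset.op_sum]
  refine Finset.sum_congr rfl fun μ _ => ?_
  split_ifs <;> simp

theorem sig_smul (c : k) (T : ι → R) (d : ι →₀ ℕ) :
    sig k (fun μ => c • T μ) d = c ^ d.degree • sig k T d := by
  symm
  refine sig_unique (fun μ => c • T μ) (fun d => c ^ d.degree • sig k T d) (by simp) (fun d => ?_) d
  rw [smul_comm, sig_rec, Finset.smul_sum]
  refine Finset.sum_congr rfl fun μ _ => ?_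
  split_ifs with h
  · have : d.degree = (d - Finsupp.single μ 1).degree + 1 := by
      conv_lhs => rw [← tsub_add_cancel_of_le h, map_add, Finsupp.degree_single]
    rw [this, pow_succ, smul_mul_assoc, mul_smul_comm, smul_smul, mul_comm]
  · simp

theorem sig_single (T : ι → R) (μ : ι) : sig k T (Finsupp.single μ 1) = T μ := by
  have := sig_rec (k := k) T (Finsupp.single μ 1)
  rw [Finsupp.degree_single, one_smul, Finset.sum_eq_single μ] at this
  · simpa using this
  · intro ν _ hν
    rw [if_neg]
    rw [Finsupp.single_le_iff, Finsupp.single_apply, if_neg hν.symm]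
    omega
  · simp

theorem sig_comm {R : Type*} [CommRing R] [Algebra k R] (T : ι → R) (d : ι →₀ ℕ) :
    sig k T d = (∏ i, ((d i)! : k))⁻¹ • ∏ i, T i ^ d i := by
  symm
  refine sig_unique T (fun d => (∏ i, ((d i)! : k))⁻¹ • ∏ i, T i ^ d i) (by simp) (fun d => ?_) d
  have : ∀ μ, (if Finsupp.single μ 1 ≤ d then T μ * ((∏ i, (((d - Finsupp.single μ 1 : ι →₀ ℕ) i)! : k))⁻¹ •
      ∏ i, T i ^ (d - Finsupp.single μ 1 : ι →₀ ℕ) i) else 0) =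
      d μ • ((∏ i, ((d i)! : k))⁻¹ • ∏ i, T i ^ d i) := by
    intro μ
    split_ifs with h <;> rw [Finsupp.single_le_iff] at h
    · obtain ⟨e, he⟩ : ∃ e, d μ = e + 1 := ⟨d μ - 1, by omega⟩
      rw [← Finset.mul_prod_erase _ _ (Finset.mem_univ μ),
        ← Finset.mul_prod_erase _ _ (Finset.mem_univ μ),
        ← Finset.mul_prod_erase _ (fun i => ((d i)! : k)) (Finset.mem_univ μ),
        ← Finset.mul_prod_erase _ (fun i => T i ^ d i) (Finset.mem_univ μ)]
      have h1 : ∀ i ∈ Finset.univ.erase μ, (d - Finsupp.single μ 1 : ι →₀ ℕ) i = d i := by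
        intro i hi
        rw [Finsupp.tsub_apply, Finsupp.single_apply, if_neg (Finset.ne_of_mem_erase hi).symm,
          tsub_zero]
      rw [Finset.prod_congr rfl fun i hi => by rw [h1 i hi],
        Finset.prod_congr (g := fun i => T i ^ d i) rfl fun i hi => by rw [h1 i hi]]
      have h2 : (d - Finsupp.single μ 1 : ι →₀ ℕ) μ = e := by simp [he]
      rw [h2, he, pow_succ', ← Nat.cast_smul_eq_nsmul k, smul_smul, mul_smul_comm, mul_assoc,
        Nat.factorial_succ, Nat.cast_mul, mul_assoc, mul_inv ((e + 1 : ℕ) : k),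
        mul_inv_cancel_left₀ (Nat.cast_ne_zero.mpr (Nat.succ_ne_zero e))]
    · have : d μ = 0 := by omega
      rw [this, zero_smul]
  rw [Finset.sum_congr rfl fun μ _ => this μ, ← Finset.sum_smul, Finsupp.degree_eq_sum]

/-- The reindexing `a = b + e_μ`, which turns a sum of recursions over degree `j + 1` into a sum
over degree `j`. -/
theorem sum_degree_succ {M : Type*} [AddCommMonoid M] (j : ℕ) (F : ι → (ι →₀ ℕ) → M) :
    ∑ a ∈ Finset.univ.finsuppAntidiag (j + 1),
      (∑ μ, if Finsupp.single μ 1 ≤ a then F μ (a - Finsupp.single μ 1) else 0) =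
    ∑ μ, ∑ b ∈ Finset.univ.finsuppAntidiag j, F μ b := by
  rw [Finset.sum_comm]
  refine Finset.sum_congr rfl fun μ _ => ?_
  rw [← Finset.sum_filter]
  have hmem : ∀ (r : ℕ) (a : ι →₀ ℕ), a ∈ Finset.univ.finsuppAntidiag r ↔ a.degree = r := by
    intro r a; simp [Finset.mem_finsuppAntidiag, Finsupp.degree_eq_sum]
  refine Finset.sum_nbij' (fun a => a - Finsupp.single μ 1) (fun b => b + Finsupp.single μ 1)
    ?_ ?_ ?_ ?_ ?_
  · intro a ha
    rw [Finset.mem_filter, hmem] at ha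
    rw [hmem]
    have : (a - Finsupp.single μ 1 + Finsupp.single μ 1).degree = j + 1 := by
      rw [tsub_add_cancel_of_le ha.2, ha.1]
    rw [map_add, Finsupp.degree_single] at this
    omega
  · intro b hb
    rw [hmem] at hb
    rw [Finset.mem_filter, hmem, map_add, hb, Finsupp.degree_single]
    exact ⟨rfl, le_add_self⟩
  · intro a ha
    exact tsub_add_cancel_of_le (Finset.mem_filter.mp ha).2
  · intro b _
    exact add_tsub_cancel_right _ _
  · intro a _; rfl

/-- The multinomial theorem for `∑ μ, S μ * T μ`, where the `T μ` commute with each other and with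
the `S μ`, and `t a` is the monomial `T ^ a`. -/
theorem sum_mul_pow (S T : ι → R) (t : (ι →₀ ℕ) → R) (t0 : t 0 = 1)
    (tS : ∀ μ b, t (b + Finsupp.single μ 1) = T μ * t b)
    (hc : ∀ μ ν, Commute (T μ) (S ν)) (j : ℕ) :
    ((j ! : ℕ) : k)⁻¹ • (∑ μ, S μ * T μ) ^ j =
      ∑ a ∈ Finset.univ.finsuppAntidiag j, sig k S a * t a := by
  have hcs : ∀ μ a, Commute (T μ) (sig k S a) := by
    intro μ a
    rw [sig_eq_words]
    refine Commute.smul_right (Commute.sum_right _ _ _ fun w _ => ?_) _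
    refine Commute.list_prod_right _ _ fun x hx => ?_
    obtain ⟨i, rfl⟩ := (List.mem_ofFn' _ _).mp hx
    exact hc _ _
  induction j with
  | zero => simp [t0]
  | succ j ih =>
    have h1 : ((j + 1 : ℕ) : k) ≠ 0 := Nat.cast_ne_zero.mpr (Nat.succ_ne_zero j)
    refine smul_right_injective R h1 ?_
    change ((j + 1 : ℕ) : k) • _ = ((j + 1 : ℕ) : k) • _
    rw [smul_smul, Nat.factorial_succ, Nat.cast_mul, mul_inv, mul_inv_cancel_left₀ h1, pow_succ',
      ← mul_smul_comm, ih, Finset.smul_sum, Finset.sum_mul_sum,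
      ← sum_degree_succ j fun μ b => S μ * T μ * (sig k S b * t b)]
    refine Finset.sum_congr rfl fun a ha => ?_
    have hdeg : a.degree = j + 1 := by
      simpa [Finset.mem_finsuppAntidiag, Finsupp.degree_eq_sum] using ha
    rw [Nat.cast_smul_eq_nsmul, ← smul_mul_assoc, ← hdeg, sig_rec, Finset.sum_mul]
    refine Finset.sum_congr rfl fun μ _ => ?_
    split_ifs with h
    · conv_rhs => rw [← tsub_add_cancel_of_le h, tS]
      rw [← mul_assoc, ← mul_assoc, mul_assoc (S μ) (T μ), (hcs μ _).eq]
      simp [mul_assoc]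
    · rw [zero_mul]

end Gen

/-! ### Derivations of the algebra of power series -/

section Calculus

variable {k : Type*} [Field k] [CharZero k] {σ : Type*} [Fintype σ] [DecidableEq σ]

theorem coeff_X_mul' {R : Type*} [Ring R] (s : σ) (f : MvPowerSeries σ R) (d : σ →₀ ℕ) :
    coeff d (X s * f) =
      if Finsupp.single s 1 ≤ d then coeff (d - Finsupp.single s 1) f else 0 := by
  rw [X_def, coeff_monomial_mul]
  split_ifs <;> simp

theorem sum_X_mul_pderiv (f : MvPowerSeries σ k) :
    ∑ s, X s * pderiv k s f = euler f := by
  ext d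
  rw [map_sum, coeff_euler, Finsupp.degree_eq_sum, Finset.sum_smul]
  refine Finset.sum_congr rfl fun s _ => ?_
  rw [coeff_X_mul']
  split_ifs with h
  · rw [coeff_pderiv, tsub_add_cancel_of_le h, Finsupp.tsub_apply, Finsupp.single_eq_same]
    rw [Finsupp.single_le_iff] at h
    rw [Nat.cast_sub h, nsmul_eq_mul]
    push_cast
    ring
  · rw [Finsupp.single_le_iff] at h
    have : d s = 0 := by omega
    rw [this, zero_smul]

theorem OrdGE.pderiv {N : ℕ} {f : MvPowerSeries σ k} (hf : OrdGE (N + 1) f) (s : σ) :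
    OrdGE N (pderiv k s f) := fun d hd => by
  rw [coeff_pderiv, hf _ (by rw [map_add, Finsupp.degree_single]; omega), zero_mul]

/-- An inverse of the Euler operator. -/
noncomputable def eulerInv (f : MvPowerSeries σ k) : MvPowerSeries σ k :=
  fun d => (d.degree : k)⁻¹ * coeff d f

theorem coeff_eulerInv (f : MvPowerSeries σ k) (d : σ →₀ ℕ) :
    coeff d (eulerInv f) = (d.degree : k)⁻¹ * coeff d f := rfl

/-- The coefficients `g s` in a decomposition `f = f(0) + ∑ s, X s * g s`. -/
noncomputable def quot (s : σ) (f : MvPowerSeries σ k) : MvPowerSeries σ k :=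
  pderiv k s (eulerInv f)

theorem eq_add_sum_quot (f : MvPowerSeries σ k) :
    f = C (constantCoeff f) + ∑ s, X s * quot s f := by
  unfold quot
  rw [sum_X_mul_pderiv]
  ext d
  rw [map_add, coeff_euler, coeff_C, coeff_eulerInv]
  split_ifs with h
  · simp [h]
  · have : (d.degree : k) ≠ 0 := Nat.cast_ne_zero.mpr fun h' =>
      h ((Finsupp.degree_eq_zero_iff d).mp h')
    rw [zero_add, nsmul_eq_mul, mul_inv_cancel_left₀ this]

theorem OrdGE.quot {N : ℕ} {f : MvPowerSeries σ k} (hf : OrdGE (N + 1) f) (s : σ) :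
    OrdGE N (quot s f) := by
  refine OrdGE.pderiv (fun d hd => ?_) s
  rw [coeff_eulerInv, hf d hd, mul_zero]

/-- No continuity of `D` is assumed. Hadamard's decomposition gives `D f = ∑ (D X_s) g_s + X_s (D
g_s)` with `g_s` of order one less than `f`, and induction applies to `D g_s`. -/
theorem OrdGE.derivation {N : ℕ} {f : MvPowerSeries σ k} (hf : OrdGE (N + 1) f)
    (D : Derivation k (MvPowerSeries σ k) (MvPowerSeries σ k)) : OrdGE N (D f) := by
  induction N generalizing f with
  | zero => exact OrdGE.zero' _
  | succ N ih =>
    rw [eq_add_sum_quot f, ordGE_one_iff.mp (hf.mono (by omega)), map_zero, zero_add, map_sum]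
    refine OrdGE.sum fun s _ => ?_
    rw [Derivation.leibniz, smul_eq_mul, smul_eq_mul]
    refine OrdGE.add ?_ ((hf.quot s).mul_right _)
    rw [add_comm]
    exact (ordGE_X s).mul (ih (hf.quot s))

/-- Again without continuity: `D f = ∑ X_s (D g_s)`, and iteration puts `D f` into every power of
the ideal of the variables. -/
theorem derivation_eq_zero (D : Derivation k (MvPowerSeries σ k) (MvPowerSeries σ k))
    (h : ∀ s, D (X s) = 0) : D = 0 := by
  ext1 f
  refine eq_zero_of_ordGE fun N => ?_
  induction N generalizing f with
  | zero => exact OrdGE.zero' _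
  | succ N ih =>
    have hC : D (C (constantCoeff f)) = 0 := by
      rw [c_eq_algebraMap, Derivation.map_algebraMap]
    rw [eq_add_sum_quot f, map_add, hC, zero_add, map_sum]
    refine OrdGE.sum fun s _ => ?_
    rw [Derivation.leibniz, h s, smul_zero, add_zero, smul_eq_mul, add_comm]
    exact (ordGE_X s).mul (ih _)

theorem derivation_ext {D D' : Derivation k (MvPowerSeries σ k) (MvPowerSeries σ k)}
    (h : ∀ s, D (X s) = D' (X s)) : D = D' :=
  sub_eq_zero.mp (derivation_eq_zero _ fun s => by rw [Derivation.sub_apply, h s, sub_self])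

/-- The derivation `∑ s, a s * ∂ s`. -/
noncomputable def vf (a : σ → MvPowerSeries σ k) :
    Derivation k (MvPowerSeries σ k) (MvPowerSeries σ k) := ∑ s, a s • pderiv k s

theorem vf_apply (a : σ → MvPowerSeries σ k) (f : MvPowerSeries σ k) :
    vf a f = ∑ s, a s * pderiv k s f := by
  have := congrFun (map_sum (Derivation.coeFnAddMonoidHom (R := k) (A := MvPowerSeries σ k)
    (M := MvPowerSeries σ k)) (fun s => a s • pderiv k s) Finset.univ) f
  rw [Finset.sum_apply] at this
  exact this

@[simp] theorem vf_X (a : σ → MvPowerSeries σ k) (s : σ) : vf a (X s) = a s := by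
  rw [vf_apply, Finset.sum_eq_single s]
  · rw [pderiv_X_self, mul_one]
  · intro t _ ht; rw [pderiv_X_of_ne ht.symm, mul_zero]
  · simp

theorem vf_comm (a b : σ → MvPowerSeries σ k) :
    ⁅vf a, vf b⁆ = vf fun s => vf a (b s) - vf b (a s) :=
  derivation_ext fun s => by rw [Derivation.commutator_apply, vf_X, vf_X, vf_X]

theorem euler_pderiv (s : σ) (f : MvPowerSeries σ k) :
    euler (pderiv k s f) = pderiv k s (euler f) - pderiv k s f := by
  ext d
  rw [coeff_euler, map_sub, coeff_pderiv, coeff_pderiv, coeff_euler, map_add,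
    Finsupp.degree_single, add_smul, one_smul]
  rw [add_mul, smul_mul_assoc]; abel

/-- Entries of power series with matrix coefficients. -/
def ent {a b : Type*} (f : MvPowerSeries σ (Matrix a b k)) (q : a) (p : b) : MvPowerSeries σ k :=
  fun d => f d q p

section Ent

variable {a : Type*} [Fintype a] [DecidableEq a]

theorem coeff_ent (f : MvPowerSeries σ (Matrix a a k)) (q p : a) (d : σ →₀ ℕ) :
    coeff d (ent f q p) = coeff d f q p := rfl

theorem ent_mul (f g : MvPowerSeries σ (Matrix a a k)) (q p : a) :
    ent (f * g) q p = ∑ r, ent f q r * ent g r p := by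
  ext d
  rw [coeff_ent, coeff_mul, Matrix.sum_apply, map_sum]
  simp only [coeff_mul, Matrix.mul_apply, coeff_ent]
  exact Finset.sum_comm

theorem ent_add (f g : MvPowerSeries σ (Matrix a a k)) (q p : a) :
    ent (f + g) q p = ent f q p + ent g q p := rfl

theorem ent_sub (f g : MvPowerSeries σ (Matrix a a k)) (q p : a) :
    ent (f - g) q p = ent f q p - ent g q p := rfl

theorem ent_one (q p : a) :
    ent (1 : MvPowerSeries σ (Matrix a a k)) q p = if q = p then 1 else 0 := by
  ext d
  rw [coeff_ent, coeff_one]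
  split_ifs with h h' h' <;> simp [coeff_one, h, h', Matrix.one_apply]

theorem ent_euler (f : MvPowerSeries σ (Matrix a a k)) (q p : a) :
    ent (euler f) q p = euler (ent f q p) := rfl

theorem ent_ext {f g : MvPowerSeries σ (Matrix a a k)} (h : ∀ q p, ent f q p = ent g q p) :
    f = g := by
  ext d q p
  exact congrFun (h q p) d

theorem ent_linForm (T : σ → Matrix a a k) (q p : a) :
    ent (linForm T) q p = ∑ μ, T μ q p • X μ := by
  ext d
  rw [coeff_ent, linForm, map_sum, map_sum, Matrix.sum_apply]
  refine Finset.sum_congr rfl fun μ _ => ?_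
  rw [coeff_monomial, coeff_smul, coeff_X]
  split_ifs <;> simp

end Ent

end Calculus

/-! ### The vector fields of a factorized Lie algebra -/

section Lie

variable {k : Type*} [Field k] [CharZero k] {σ τ : Type*} [Fintype σ] [DecidableEq σ]
  [Fintype τ] [DecidableEq τ]

/-- The bracket with structure constants `c`, extended to coefficients in `S`. -/
noncomputable def br {ι : Type*} [Fintype ι] (c : ι → ι → ι → k) {S : Type*} [CommRing S]
    [Algebra k S] : (ι → S) →ₗ[S] (ι → S) →ₗ[S] (ι → S) :=
  LinearMap.mk₂ S (fun v w q => ∑ p, ∑ r, c p r q • (v p * w r))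
    (fun v v' w => by
      funext q
      simp only [Pi.add_apply, add_mul, smul_add, Finset.sum_add_distrib])
    (fun s v w => by
      funext q
      simp only [Pi.smul_apply, smul_eq_mul, mul_assoc, Finset.mul_sum, mul_smul_comm])
    (fun v w w' => by
      funext q
      simp only [Pi.add_apply, mul_add, smul_add, Finset.sum_add_distrib])
    (fun s v w => by
      funext q
      simp only [Pi.smul_apply, smul_eq_mul, Finset.mul_sum, mul_smul_comm, mul_left_comm])

section Br

variable {ι : Type*} [Fintype ι] [DecidableEq ι] {c : ι → ι → ι → k} {S : Type*} [CommRing S]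
  [Algebra k S]

theorem br_apply (v w : ι → S) (q : ι) : br c v w q = ∑ p, ∑ r, c p r q • (v p * w r) := rfl

theorem br_skew (hs : ∀ p r q, c p r q = -c r p q) (v w : ι → S) : br c v w = -br c w v := by
  funext q
  rw [Pi.neg_apply, br_apply, br_apply, Finset.sum_comm, ← Finset.sum_neg_distrib]
  refine Finset.sum_congr rfl fun p _ => ?_
  rw [← Finset.sum_neg_distrib]
  refine Finset.sum_congr rfl fun r _ => ?_
  rw [hs r p q, neg_smul, mul_comm]

theorem br_br_apply (u v w : ι → S) (f : ι) : br c (br c u v) w f =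
    ∑ a, ∑ b, ∑ d, (∑ e, c a b e * c e d f) • (u a * v b * w d) := by
  have : br c (br c u v) w f =
      ∑ e, ∑ d, ∑ a, ∑ b, (c a b e * c e d f) • (u a * v b * w d) := by
    rw [br_apply]
    refine Finset.sum_congr rfl fun e _ => Finset.sum_congr rfl fun d _ => ?_
    rw [br_apply, Finset.sum_mul, Finset.smul_sum]
    refine Finset.sum_congr rfl fun a _ => ?_
    rw [Finset.sum_mul, Finset.smul_sum]
    refine Finset.sum_congr rfl fun b _ => ?_
    rw [smul_mul_assoc, smul_smul, mul_comm (c e d f)]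
  rw [this]
  simp only [Finset.sum_smul]
  rw [Finset.sum_congr rfl fun e _ => Finset.sum_comm, Finset.sum_comm]
  refine Finset.sum_congr rfl fun a _ => ?_
  rw [Finset.sum_congr rfl fun e _ => Finset.sum_comm, Finset.sum_comm]
  refine Finset.sum_congr rfl fun b _ => ?_
  rw [Finset.sum_comm]

theorem br_jacobi (hj : ∀ a b d f, ∑ e, (c a b e * c e d f + c b d e * c e a f +
    c d a e * c e b f) = 0) (u v w : ι → S) :
    br c (br c u v) w + br c (br c v w) u + br c (br c w u) v = 0 := by
  funext f
  simp only [Pi.add_apply, Pi.zero_apply]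
  rw [br_br_apply, br_br_apply v, br_br_apply w]
  have h2 : ∑ b, ∑ d, ∑ a, (∑ e, c b d e * c e a f) • (v b * w d * u a) =
      ∑ a, ∑ b, ∑ d, (∑ e, c b d e * c e a f) • (u a * v b * w d) := by
    rw [Finset.sum_congr rfl fun b _ => Finset.sum_comm, Finset.sum_comm]
    refine Finset.sum_congr rfl fun a _ => Finset.sum_congr rfl fun b _ =>
      Finset.sum_congr rfl fun d _ => ?_
    congr 1; ring
  have h3 : ∑ d, ∑ a, ∑ b, (∑ e, c d a e * c e b f) • (w d * u a * v b) =
      ∑ a, ∑ b, ∑ d, (∑ e, c d a e * c e b f) • (u a * v b * w d) := by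
    rw [Finset.sum_comm]
    refine Finset.sum_congr rfl fun a _ => ?_
    rw [Finset.sum_comm]
    refine Finset.sum_congr rfl fun b _ => Finset.sum_congr rfl fun d _ => ?_
    congr 1; ring
  rw [h2, h3, ← Finset.sum_add_distrib, ← Finset.sum_add_distrib]
  refine Finset.sum_eq_zero fun a _ => ?_
  rw [← Finset.sum_add_distrib, ← Finset.sum_add_distrib]
  refine Finset.sum_eq_zero fun b _ => ?_
  rw [← Finset.sum_add_distrib, ← Finset.sum_add_distrib]
  refine Finset.sum_eq_zero fun d _ => ?_
  rw [← add_smul, ← add_smul, ← Finset.sum_add_distrib, ← Finset.sum_add_distrib, hj, zero_smul]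

theorem br_leibniz (hs : ∀ p r q, c p r q = -c r p q)
    (hj : ∀ a b d f, ∑ e, (c a b e * c e d f + c b d e * c e a f +
    c d a e * c e b f) = 0) (x u v : ι → S) :
    br c x (br c u v) = br c (br c x u) v + br c u (br c x v) := by
  have h := br_jacobi hj x u v
  rw [br_skew hs (br c u v) x, br_skew hs v x, map_neg, LinearMap.neg_apply,
    br_skew hs (br c x v) u, neg_neg] at h
  rw [add_right_comm, add_assoc] at h
  exact (sub_eq_zero.mp (by rw [sub_eq_add_neg, ← h]; abel)).symm

theorem br_map (D : S →+ S) (hD : ∀ f g, D (f * g) = D f * g + f * D g)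
    (hk : ∀ (a : k) f, D (a • f) = a • D f) (v w : ι → S) (q : ι) :
    D (br c v w q) = br c (fun p => D (v p)) w q + br c v (fun p => D (w p)) q := by
  rw [br_apply, br_apply, br_apply, map_sum, ← Finset.sum_add_distrib]
  refine Finset.sum_congr rfl fun p _ => ?_
  rw [map_sum, ← Finset.sum_add_distrib]
  refine Finset.sum_congr rfl fun r _ => ?_
  rw [hk, hD, smul_add]

end Br

/-- Structure constants `c` of a Lie algebra that is the direct sum of two subalgebras. -/
structure FactorLie (c : σ ⊕ τ → σ ⊕ τ → σ ⊕ τ → k) : Prop where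
  skew : ∀ p r q, c p r q = -c r p q
  jacobi : ∀ a b d f, ∑ e, (c a b e * c e d f + c b d e * c e a f + c d a e * c e b f) = 0
  left : ∀ a b d, c (Sum.inl a) (Sum.inl b) (Sum.inr d) = 0
  right : ∀ a b d, c (Sum.inr a) (Sum.inr b) (Sum.inl d) = 0

variable (c : σ ⊕ τ → σ ⊕ τ → σ ⊕ τ → k)

/-- The generic point of the first summand. -/
noncomputable def gpt : σ ⊕ τ → MvPowerSeries σ k := Sum.elim (fun μ => X μ) 0

/-- The matrix of the adjoint action. -/
def adMat (p : σ ⊕ τ) : Matrix (σ ⊕ τ) (σ ⊕ τ) k := Matrix.of fun q r => c p r q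

/-- The vector `e^{-ad x} p` for the generic point `x`. -/
noncomputable def kap (p : σ ⊕ τ) : σ ⊕ τ → MvPowerSeries σ k :=
  fun q => ent (gen k fun μ => -adMat c (Sum.inl μ)) q p

/-- The matrix of the adjoint action of the first summand on itself. -/
def adL (μ : σ) : Matrix σ σ k := Matrix.of fun ν ρ => c (Sum.inl μ) (Sum.inl ρ) (Sum.inl ν)

/-- The power series `(1 - e^{-z}) / z`. -/
noncomputable def phiSeries (k : Type*) [Field k] : PowerSeries k :=
  PowerSeries.mk fun r => (-1) ^ r * (((r + 1)! : ℕ) : k)⁻¹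

/-- The Maurer-Cartan form `((1 - e^{-ad x}) / ad x) d x`. -/
noncomputable def omg (μ : σ) : σ ⊕ τ → MvPowerSeries σ k :=
  Sum.elim (fun ν => ent (fc (phiSeries k) (linForm (adL c))) ν μ) 0

theorem linForm_br (v : σ ⊕ τ → MvPowerSeries σ k) (q : σ ⊕ τ) :
    br c gpt v q = ∑ r, (∑ μ, c (Sum.inl μ) r q • X μ) * v r := by
  rw [br_apply, Fintype.sum_sum_type]
  simp only [gpt, Sum.elim_inl, Sum.elim_inr, Pi.zero_apply, zero_mul, smul_zero,
    Finset.sum_const_zero, add_zero]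
  rw [Finset.sum_comm]
  refine Finset.sum_congr rfl fun r _ => ?_
  rw [Finset.sum_mul]
  exact Finset.sum_congr rfl fun μ _ => by rw [smul_mul_assoc]

theorem euler_kap (p q : σ ⊕ τ) : euler (kap c p q) = -br c gpt (kap c p) q := by
  rw [kap, ← ent_euler, euler_gen, ent_mul, linForm_br, ← Finset.sum_neg_distrib]
  refine Finset.sum_congr rfl fun r _ => ?_
  rw [ent_linForm, ← neg_mul, ← Finset.sum_neg_distrib]
  simp [adMat, kap]

theorem coeff_zero_kap (p q : σ ⊕ τ) : coeff 0 (kap c p q) = if q = p then 1 else 0 := by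
  rw [kap, coeff_ent, coeff_gen, sig_zero, Matrix.one_apply]

variable {c}

/-- The series `φ(z) = (1 - e^{-z}) / z` satisfies `z φ' + φ + z φ = 1`; this is that equation at `z
= ad x`, applied to a basis vector. It determines the form `ω` and replaces explicit formulas from
here on. -/
theorem euler_omg (hc : FactorLie c) (μ : σ) (q : σ ⊕ τ) :
    euler (omg c μ q) + omg c μ q + br c gpt (omg c μ) q =
      (Pi.single (Sum.inl μ) 1 : σ ⊕ τ → MvPowerSeries σ k) q := by
  have hl : OrdGE 1 (linForm (adL c)) := ordGE_linForm _
  set F := fc (phiSeries k) (linForm (adL c)) with hF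
  have key : euler F + F + linForm (adL c) * F = 1 := by
    rw [hF, euler_fc (c' := 1 - PowerSeries.X * phiSeries k - phiSeries k) (euler_linForm _),
      fc_sub, fc_sub, fc_mul _ _ hl, fc_X hl, fc_one]
    · abel
    · intro r
      have h1 : ((r : k) + 1) ≠ 0 := by exact_mod_cast Nat.succ_ne_zero r
      have h2 : ((r ! : ℕ) : k) ≠ 0 := Nat.cast_ne_zero.mpr (Nat.factorial_ne_zero r)
      rw [map_sub, map_sub, phiSeries, PowerSeries.coeff_mk, Nat.factorial_succ]
      cases r with
      | zero => simp
      | succ r =>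
        rw [PowerSeries.coeff_succ_X_mul, PowerSeries.coeff_mk, PowerSeries.coeff_one,
          if_neg (Nat.succ_ne_zero r)]
        push_cast at *
        field_simp
        ring
  rw [linForm_br, Fintype.sum_sum_type]
  rcases q with ν | i
  · have := congrArg (fun f => ent f ν μ) key
    simp only [ent_add, ent_euler, ent_mul, ent_one, ent_linForm] at this
    simp only [omg, Sum.elim_inl, Sum.elim_inr, Pi.zero_apply, mul_zero, Finset.sum_const_zero,
      add_zero]
    rw [← hF]
    simp only [adL, Matrix.of_apply] at this
    rw [this, Pi.single_apply]
    simp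
  · simp only [omg, Sum.elim_inl, Sum.elim_inr, Pi.zero_apply, mul_zero, Finset.sum_const_zero,
      add_zero, hc.left, zero_smul, zero_mul]
    simp

theorem OrdGE.br_gpt {N : ℕ} {v : σ ⊕ τ → MvPowerSeries σ k} (hv : ∀ q, OrdGE N (v q))
    (q : σ ⊕ τ) : OrdGE (N + 1) (br c gpt v q) := by
  rw [linForm_br]
  refine OrdGE.sum fun r _ => ?_
  rw [add_comm]
  exact OrdGE.mul (OrdGE.sum fun μ _ => (ordGE_X μ).smul _) (hv r)

/-- Bracketing with the generic point raises the order by one, so `family_eq_zero` applies. The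
identities for `e^{-ad x}` and `ω` below are all proved by showing that a difference satisfies such
an equation. -/
theorem vec_eq_zero (v : σ ⊕ τ → MvPowerSeries σ k) (a : ℤ) (N₀ : ℕ) (h₀ : ∀ q, OrdGE N₀ (v q))
    (ha : ∀ N, N₀ ≤ N → (N : ℤ) + a ≠ 0)
    (h : ∀ q, euler (v q) + a • v q = -br c gpt v q) : v = 0 := by
  funext q
  have := isAddTorsionFree_of_algebra k k
  refine family_eq_zero v a N₀ h₀ ha (fun N hN s => ?_) q
  rw [h]
  exact (OrdGE.br_gpt hN s).neg

theorem euler_br (v w : σ ⊕ τ → MvPowerSeries σ k) (q : σ ⊕ τ) :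
    euler (br c v w q) = br c (fun p => euler (v p)) w q + br c v (fun p => euler (w p)) q :=
  br_map euler euler_mul (fun a f => euler_smul a f) v w q

theorem der_br (D : Derivation k (MvPowerSeries σ k) (MvPowerSeries σ k))
    (v w : σ ⊕ τ → MvPowerSeries σ k) (q : σ ⊕ τ) :
    D (br c v w q) = br c (fun p => D (v p)) w q + br c v (fun p => D (w p)) q := by
  refine br_map (D : MvPowerSeries σ k →ₗ[k] MvPowerSeries σ k).toAddMonoidHom (fun f g => ?_)
    (fun a f => ?_) v w q
  · change D (f * g) = D f * g + f * D g
    rw [Derivation.leibniz, smul_eq_mul, smul_eq_mul]; ring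
  · exact D.map_smul a f

/-- The map `e^{-ad x}` is an automorphism: by the Jacobi identity both sides solve `E v = -[x, v]`,
and they agree at the origin. -/
theorem kap_br (hc : FactorLie c) (p q : σ ⊕ τ) :
    br c (kap c p) (kap c q) = ∑ r, c p q r • kap c r := by
  rw [← sub_eq_zero]
  refine vec_eq_zero (c := c) _ 0 1 (fun s => ?_) (fun N hN => by omega) (fun s => ?_)
  · rw [ordGE_one_iff, ← coeff_zero_eq_constantCoeff_apply, Pi.sub_apply, map_sub, br_apply,
      Finset.sum_apply, map_sum, map_sum]
    have h1 : ∀ i, coeff 0 (∑ r, c i r s • (kap c p i * kap c q r)) =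
        ∑ r, c i r s * ((if i = p then 1 else 0) * if r = q then 1 else 0) := by
      intro i
      rw [map_sum]
      refine Finset.sum_congr rfl fun r _ => ?_
      rw [coeff_smul', smul_eq_mul, coeff_zero_eq_constantCoeff_apply, map_mul,
        ← coeff_zero_eq_constantCoeff_apply, ← coeff_zero_eq_constantCoeff_apply, coeff_zero_kap,
        coeff_zero_kap]
    simp only [h1, Pi.smul_apply, coeff_smul', smul_eq_mul, coeff_zero_kap]
    simp
  · have e1 : ∀ p, (fun q => euler (kap c p q)) = -br c gpt (kap c p) := fun p =>
      funext fun q => euler_kap c p q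
    rw [zero_smul, add_zero, Pi.sub_apply, map_sub, euler_br, e1, e1, map_sub,
      br_leibniz hc.skew hc.jacobi, Finset.sum_apply, map_sum, map_sum]
    simp only [map_neg, LinearMap.neg_apply, Pi.neg_apply, Pi.sub_apply, Pi.add_apply,
      Finset.sum_apply, Pi.smul_apply]
    have : ∀ r, euler (c p q r • kap c r s) = -br c gpt (c p q r • kap c r) s := by
      intro r
      have hbr : br c gpt (c p q r • kap c r) = c p q r • br c gpt (kap c r) := by
        rw [LinearMap.map_smul_of_tower]
      rw [euler_smul, euler_kap, hbr, Pi.smul_apply, smul_neg]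
    simp only [this, Finset.sum_neg_distrib]
    abel

theorem pderiv_gpt (ν : σ) :
    (fun p => pderiv k ν ((gpt : σ ⊕ τ → MvPowerSeries σ k) p)) = Pi.single (Sum.inl ν) 1 := by
  funext p
  rcases p with μ | i
  · simp [gpt, pderiv_X, Pi.single_apply, eq_comm]
  · simp [gpt]

/-- For `g = e^x` this is the derivative of `Ad(g⁻¹) p`. The sum of `∂_ν κ` and `[ω_ν, κ]` solves `E
v + v = -[x, v]`, whose only solution is zero. -/
theorem pderiv_kap (hc : FactorLie c) (ν : σ) (p : σ ⊕ τ) :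
    (fun q => pderiv k ν (kap c p q)) = -br c (omg c ν) (kap c p) := by
  rw [← add_eq_zero_iff_eq_neg]
  refine vec_eq_zero (c := c) _ 1 0 (fun s => OrdGE.zero' _) (fun N hN => by omega) (fun s => ?_)
  have e1 : (fun q => euler (kap c p q)) = -br c gpt (kap c p) := funext fun q => euler_kap c p q
  have e2 : (fun q => euler (omg c ν q)) =
      Pi.single (Sum.inl ν) 1 - omg c ν - br c gpt (omg c ν) := by
    funext q
    simp only [Pi.sub_apply, ← euler_omg hc ν q]
    abel
  have e3 : pderiv k ν (br c gpt (kap c p) s) = br c (Pi.single (Sum.inl ν) 1) (kap c p) s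
      + br c gpt (fun q => pderiv k ν (kap c p q)) s := by
    rw [der_br, pderiv_gpt]
  rw [one_smul, Pi.add_apply, map_add, euler_pderiv, euler_kap, map_neg, e3, euler_br, e1, e2,
    map_add, br_leibniz hc.skew hc.jacobi]
  simp only [map_neg, map_sub, LinearMap.sub_apply, Pi.neg_apply,
    Pi.sub_apply, Pi.add_apply]
  abel

/-- The equation `dω + [ω, ω]/2 = 0` in coordinates. The differentiation and the form each
contribute one to the constant, so the defect solves `E v + 2 v = -[x, v]`. -/
theorem maurer_cartan (hc : FactorLie c) (μ ν : σ) :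
    (fun q => pderiv k μ (omg c ν q)) - (fun q => pderiv k ν (omg c μ q)) =
      -br c (omg c μ) (omg c ν) := by
  rw [← add_eq_zero_iff_eq_neg]
  refine vec_eq_zero (c := c) _ 2 0 (fun s => OrdGE.zero' _) (fun N hN => by omega) (fun s => ?_)
  have e2 : ∀ ν, (fun q => euler (omg c ν q)) =
      Pi.single (Sum.inl ν) 1 - omg c ν - br c gpt (omg c ν) := by
    intro ν
    funext q
    simp only [Pi.sub_apply, ← euler_omg hc ν q]
    abel
  have e3 : ∀ μ ν, euler (pderiv k μ (omg c ν s)) = -(2 : ℤ) • pderiv k μ (omg c ν s)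
      - br c (Pi.single (Sum.inl μ) 1) (omg c ν) s
      - br c gpt (fun q => pderiv k μ (omg c ν q)) s := by
    intro μ ν
    have h1 := congrFun (e2 ν) s
    have h2 : pderiv k μ ((Pi.single (Sum.inl ν) 1 : σ ⊕ τ → MvPowerSeries σ k) s) = 0 := by
      rw [Pi.single_apply]
      split_ifs <;> simp
    simp only [Pi.sub_apply] at h1
    rw [euler_pderiv, h1, map_sub, map_sub, der_br, pderiv_gpt, h2, neg_smul, two_smul]
    abel
  rw [Pi.add_apply, Pi.sub_apply, map_add, map_sub, e3, e3, euler_br, e2, e2, map_add, map_sub,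
    br_leibniz hc.skew hc.jacobi]
  simp only [map_sub, LinearMap.sub_apply, Pi.sub_apply, Pi.add_apply, two_smul,
    neg_smul]
  rw [br_skew hc.skew (omg c μ) (Pi.single _ _), Pi.neg_apply]
  abel

end Lie

/-! ### The Maurer–Cartan form and the dressing vector fields -/

section Fields

variable {k : Type*} [Field k] [CharZero k] {σ τ : Type*} [Fintype σ] [DecidableEq σ]
  [Fintype τ] [DecidableEq τ] {c : σ ⊕ τ → σ ⊕ τ → σ ⊕ τ → k}

/-- The value of the Maurer-Cartan form on a vector field. -/
noncomputable def om (c : σ ⊕ τ → σ ⊕ τ → σ ⊕ τ → k) :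
    (σ → MvPowerSeries σ k) →ₗ[MvPowerSeries σ k] (σ ⊕ τ → MvPowerSeries σ k) :=
  Fintype.linearCombination (MvPowerSeries σ k) (omg c)

theorem om_apply (a : σ → MvPowerSeries σ k) : om c a = ∑ ν, a ν • omg c ν :=
  Fintype.linearCombination_apply _ _ _

theorem om_apply' (a : σ → MvPowerSeries σ k) (q : σ ⊕ τ) :
    om c a q = ∑ ν, a ν * omg c ν q := by
  rw [om_apply, Finset.sum_apply]; rfl

theorem om_inr (a : σ → MvPowerSeries σ k) (i : τ) : om c a (Sum.inr i) = 0 := by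
  rw [om_apply']
  exact Finset.sum_eq_zero fun ν _ => mul_zero _

/-- The matrix inverse to the Maurer-Cartan form. -/
noncomputable def omInv (c : σ ⊕ τ → σ ⊕ τ → σ ⊕ τ → k) (ν ρ : σ) : MvPowerSeries σ k :=
  ent (fc (phiSeries k)⁻¹ (linForm (adL c))) ν ρ

theorem constantCoeff_phiSeries : PowerSeries.constantCoeff (phiSeries k) = 1 := by
  rw [← PowerSeries.coeff_zero_eq_constantCoeff_apply, phiSeries, PowerSeries.coeff_mk]
  simp

theorem phiSeries_mul_inv : phiSeries k * (phiSeries k)⁻¹ = 1 :=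
  PowerSeries.mul_inv_cancel _ (by rw [constantCoeff_phiSeries]; exact one_ne_zero)

theorem sum_omg_mul_omInv (ν ρ : σ) :
    ∑ μ, omInv c μ ρ * omg c μ (Sum.inl ν) = if ν = ρ then 1 else 0 := by
  have := congrArg (fun f => ent f ν ρ) ((fc_mul (phiSeries k) (phiSeries k)⁻¹
    (ordGE_linForm (adL c))).symm.trans (by rw [phiSeries_mul_inv, fc_one]))
  simp only [ent_mul, ent_one] at this
  rw [← this]
  exact Finset.sum_congr rfl fun μ _ => mul_comm _ _

theorem sum_omInv_mul_omg (ν ρ : σ) :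
    ∑ μ, omg c ρ (Sum.inl μ) * omInv c ν μ = if ν = ρ then 1 else 0 := by
  have := congrArg (fun f => ent f ν ρ) ((fc_mul (phiSeries k)⁻¹ (phiSeries k)
    (ordGE_linForm (adL c))).symm.trans (by rw [mul_comm, phiSeries_mul_inv, fc_one]))
  simp only [ent_mul, ent_one] at this
  rw [← this]
  exact Finset.sum_congr rfl fun μ _ => mul_comm _ _

/-- The vector field with a given value of the Maurer-Cartan form. -/
noncomputable def fieldOf (c : σ ⊕ τ → σ ⊕ τ → σ ⊕ τ → k) (v : σ → MvPowerSeries σ k) :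
    σ → MvPowerSeries σ k := fun ν => ∑ ρ, v ρ * omInv c ν ρ

theorem om_fieldOf (v : σ → MvPowerSeries σ k) : om c (fieldOf c v) = Sum.elim v 0 := by
  funext q
  rcases q with ν | i
  · rw [om_apply', Sum.elim_inl]
    simp only [fieldOf, Finset.sum_mul, mul_assoc]
    rw [Finset.sum_comm]
    simp only [← Finset.mul_sum, sum_omg_mul_omInv]
    simp
  · rw [om_inr]; rfl

theorem fieldOf_om (a : σ → MvPowerSeries σ k) : fieldOf c (fun ρ => om c a (Sum.inl ρ)) = a := by
  funext ν
  simp only [fieldOf, om_apply', Finset.sum_mul, mul_assoc]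
  rw [Finset.sum_comm]
  simp only [← Finset.mul_sum, sum_omInv_mul_omg]
  simp

theorem om_injective : Function.Injective (om c) := fun a b h => by
  rw [← fieldOf_om (c := c) a, h, fieldOf_om]

theorem vf_add (a b : σ → MvPowerSeries σ k) : vf (a + b) = vf a + vf b :=
  derivation_ext fun s => by rw [Derivation.add_apply, vf_X, vf_X, vf_X]; rfl

theorem vf_neg (a : σ → MvPowerSeries σ k) : vf (-a) = -vf a :=
  derivation_ext fun s => by rw [Derivation.neg_apply, vf_X, vf_X]; rfl

theorem vf_smul (g : MvPowerSeries σ k) (a : σ → MvPowerSeries σ k) : vf (g • a) = g • vf a :=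
  derivation_ext fun s => by rw [Derivation.smul_apply, vf_X, vf_X]; rfl

theorem vf_sum {ι : Type*} (s : Finset ι) (a : ι → σ → MvPowerSeries σ k) :
    vf (∑ i ∈ s, a i) = ∑ i ∈ s, vf (a i) := by
  classical
  induction s using Finset.induction_on with
  | empty => exact derivation_ext fun s => by rw [vf_X]; simp
  | insert i s hi ih => rw [Finset.sum_insert hi, Finset.sum_insert hi, vf_add, ih]

theorem vf_kap (hc : FactorLie c) (a : σ → MvPowerSeries σ k) (p q : σ ⊕ τ) :
    vf a (kap c p q) = -br c (om c a) (kap c p) q := by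
  rw [om_apply, map_sum, LinearMap.sum_apply, Finset.sum_apply, vf_apply, ← Finset.sum_neg_distrib]
  refine Finset.sum_congr rfl fun ν _ => ?_
  rw [map_smul, LinearMap.smul_apply, Pi.smul_apply, smul_eq_mul, ← mul_neg]
  exact congrArg _ (congrFun (pderiv_kap hc ν p) q)

/-- Cartan's formula for `dω` on two fields, combined with the Maurer–Cartan equation. -/
theorem om_commutator (hc : FactorLie c) (a b : σ → MvPowerSeries σ k) (q : σ ⊕ τ) :
    om c (fun ν => vf a (b ν) - vf b (a ν)) q =
      vf a (om c b q) - vf b (om c a q) + br c (om c a) (om c b) q := by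
  have h1 : ∀ a b : σ → MvPowerSeries σ k, vf a (om c b q) =
      ∑ ν, vf a (b ν) * omg c ν q + ∑ μ, ∑ ν, a μ * b ν * pderiv k μ (omg c ν q) := by
    intro a b
    rw [om_apply', map_sum, Finset.sum_comm, ← Finset.sum_add_distrib]
    refine Finset.sum_congr rfl fun ν _ => ?_
    rw [Derivation.leibniz, smul_eq_mul, smul_eq_mul, add_comm, mul_comm]
    congr 1
    rw [vf_apply, Finset.mul_sum]
    exact Finset.sum_congr rfl fun μ _ => by ring
  have h2 : br c (om c a) (om c b) q = ∑ μ, ∑ ν, a μ * b ν * br c (omg c μ) (omg c ν) q := by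
    rw [om_apply, om_apply, map_sum (br c), LinearMap.sum_apply, Finset.sum_apply]
    refine Finset.sum_congr rfl fun μ _ => ?_
    rw [map_smul, LinearMap.smul_apply, Pi.smul_apply, map_sum, Finset.sum_apply, smul_eq_mul,
      Finset.mul_sum]
    refine Finset.sum_congr rfl fun ν _ => ?_
    rw [map_smul, Pi.smul_apply, smul_eq_mul, mul_assoc]
  have h3 : ∑ μ, ∑ ν, b μ * a ν * pderiv k μ (omg c ν q) =
      ∑ μ, ∑ ν, a μ * b ν * pderiv k ν (omg c μ q) := by
    rw [Finset.sum_comm]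
    exact Finset.sum_congr rfl fun μ _ => Finset.sum_congr rfl fun ν _ => by ring
  have h4 : ∑ μ, ∑ ν, a μ * b ν * pderiv k μ (omg c ν q) -
      ∑ μ, ∑ ν, a μ * b ν * pderiv k ν (omg c μ q) +
      ∑ μ, ∑ ν, a μ * b ν * br c (omg c μ) (omg c ν) q = 0 := by
    rw [← Finset.sum_sub_distrib, ← Finset.sum_add_distrib]
    refine Finset.sum_eq_zero fun μ _ => ?_
    rw [← Finset.sum_sub_distrib, ← Finset.sum_add_distrib]
    refine Finset.sum_eq_zero fun ν _ => ?_
    have := congrFun (maurer_cartan hc μ ν) q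
    simp only [Pi.sub_apply, Pi.neg_apply] at this
    linear_combination (a μ * b ν) * this
  rw [h1, h1, h2, h3, om_apply']
  simp only [sub_mul, Finset.sum_sub_distrib]
  linear_combination -h4

/-- The components of the vector field `A_p`: its Maurer-Cartan form is the projection of
`e^{-ad x} p` to the first summand. -/
noncomputable def fld (c : σ ⊕ τ → σ ⊕ τ → σ ⊕ τ → k) (p : σ ⊕ τ) : σ → MvPowerSeries σ k :=
  fieldOf c fun ρ => kap c p (Sum.inl ρ)

/-- The components of the right-invariant vector field `R_μ`. -/
noncomputable def rfld (c : σ ⊕ τ → σ ⊕ τ → σ ⊕ τ → k) (μ : σ) : σ → MvPowerSeries σ k :=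
  fieldOf c (Pi.single μ 1)

/-- The projection to the first summand. -/
def lpart (v : σ ⊕ τ → MvPowerSeries σ k) : σ ⊕ τ → MvPowerSeries σ k :=
  Sum.elim (fun ρ => v (Sum.inl ρ)) 0

/-- The projection to the second summand. -/
def rpart (v : σ ⊕ τ → MvPowerSeries σ k) : σ ⊕ τ → MvPowerSeries σ k :=
  Sum.elim 0 (fun ρ => v (Sum.inr ρ))

theorem lpart_add_rpart (v : σ ⊕ τ → MvPowerSeries σ k) : lpart v + rpart v = v := by
  funext q
  rcases q with q | q <;> simp [lpart, rpart]

theorem om_fld (p : σ ⊕ τ) : om c (fld c p) = lpart (kap c p) := om_fieldOf _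

theorem om_rfld (μ : σ) : om c (rfld c μ) = Pi.single (Sum.inl μ) 1 := by
  rw [rfld, om_fieldOf]
  funext q
  rcases q with q | q <;> simp [Pi.single_apply]

theorem br_rpart_inl (hc : FactorLie c) (v w : σ ⊕ τ → MvPowerSeries σ k) (i : σ) :
    br c (rpart v) (rpart w) (Sum.inl i) = 0 := by
  rw [br_apply]
  refine Finset.sum_eq_zero fun p _ => Finset.sum_eq_zero fun r _ => ?_
  rcases p with p | p <;> rcases r with r | r <;> simp [rpart, hc.right]

theorem kap_inl_inr (hc : FactorLie c) (μ : σ) (i : τ) : kap c (Sum.inl μ) (Sum.inr i) = 0 := by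
  have := isAddTorsionFree_of_algebra k k
  refine family_eq_zero (fun i => kap c (Sum.inl μ) (Sum.inr i)) 0 1 (fun i => ?_)
    (fun N hN => by omega) (fun N hN i => ?_) i
  · rw [ordGE_one_iff, ← coeff_zero_eq_constantCoeff_apply, coeff_zero_kap, if_neg (by simp)]
  · rw [zero_smul, add_zero, euler_kap, linForm_br, Fintype.sum_sum_type]
    refine OrdGE.neg (OrdGE.add (OrdGE.sum fun ρ _ => ?_) (OrdGE.sum fun j _ => ?_))
    · simp only [hc.left, zero_smul, Finset.sum_const_zero, zero_mul]
      exact ordGE_zero _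
    · rw [add_comm N 1]
      exact OrdGE.mul (OrdGE.sum fun μ _ => (ordGE_X μ).smul _) (hN j)

theorem lpart_kap_inl (hc : FactorLie c) (μ : σ) :
    lpart (kap c (Sum.inl μ)) = kap c (Sum.inl μ) := by
  funext q
  rcases q with q | q
  · rfl
  · exact (kap_inl_inr hc μ q).symm

/-- This is the infinitesimal action of the whole Lie algebra on the quotient by the second
subgroup. Write `κ_p = P + P'` and `κ_q = Q + Q'` along the two summands. By `om_commutator` and
`vf_kap` the form of the commutator is the first component of `-[P, Q] - [P, Q'] - [P', Q]`, which
equals that of `-[κ_p, κ_q]` because `[P', Q']` lies in the second summand. -/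
theorem fld_commutator (hc : FactorLie c) (p q : σ ⊕ τ) :
    ⁅vf (fld c p), vf (fld c q)⁆ = -∑ r, c p q r • vf (fld c r) := by
  rw [vf_comm]
  have : (fun s => vf (fld c p) (fld c q s) - vf (fld c q) (fld c p s)) =
      -∑ r, c p q r • fld c r := by
    refine om_injective (c := c) ?_
    funext s
    have h3 : om c (-∑ r, c p q r • fld c r) = -∑ r, c p q r • lpart (kap c r) := by
      rw [map_neg, map_sum]
      congr 1
      refine Finset.sum_congr rfl fun r _ => ?_
      rw [LinearMap.map_smul_of_tower, om_fld]
    rcases s with s | s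
    · rw [om_commutator hc, h3, om_fld, om_fld]
      change vf (fld c p) (kap c q (Sum.inl s)) - vf (fld c q) (kap c p (Sum.inl s)) + _ = _
      rw [vf_kap hc, vf_kap hc, om_fld, om_fld]
      have h4 : (-∑ r, c p q r • lpart (kap c r)) (Sum.inl s) =
          -br c (kap c p) (kap c q) (Sum.inl s) := by
        rw [kap_br hc, Pi.neg_apply, Finset.sum_apply, Finset.sum_apply]; rfl
      rw [h4]
      have e := br_rpart_inl hc (kap c p) (kap c q) s
      rw [← lpart_add_rpart (kap c p), ← lpart_add_rpart (kap c q)]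
      generalize hP : lpart (kap c p) = P at *
      generalize hP' : rpart (kap c p) = P' at *
      generalize hQ : lpart (kap c q) = Q at *
      generalize hQ' : rpart (kap c q) = Q' at *
      have l1 : lpart (P + P') = P := by rw [← hP, ← hP', lpart_add_rpart]
      have l2 : lpart (Q + Q') = Q := by rw [← hQ, ← hQ', lpart_add_rpart]
      try rw [l1, l2]
      simp only [map_add, LinearMap.add_apply, Pi.add_apply]
      rw [br_skew hc.skew Q P, br_skew hc.skew Q P', e]
      simp only [Pi.neg_apply]
      ring
    · rw [om_inr, h3, Pi.neg_apply, Finset.sum_apply, eq_comm, neg_eq_zero]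
      exact Finset.sum_eq_zero fun r _ => by rw [Pi.smul_apply]; exact smul_zero _
  rw [this, vf_neg, vf_sum]
  congr 1
  exact Finset.sum_congr rfl fun r _ =>
    derivation_ext fun s => by rw [Derivation.smul_apply, vf_X, vf_X]; rfl

/-- The form of the commutator is the first component of `-[e_μ, κ_p] + [e_μ, P]`, with `P` the
first part of `κ_p`, so only the second part of `κ_p` survives. In particular `R_μ` commutes with
the fields of the first summand, as right translations commute with left ones. -/
theorem rfld_commutator (hc : FactorLie c) (μ : σ) (p : σ ⊕ τ) :
    ⁅vf (rfld c μ), vf (fld c p)⁆ =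
      -∑ l, ∑ ν, (c (Sum.inl μ) (Sum.inr l) (Sum.inl ν) • kap c p (Sum.inr l)) •
        vf (rfld c ν) := by
  rw [vf_comm]
  have : (fun s => vf (rfld c μ) (fld c p s) - vf (fld c p) (rfld c μ s)) =
      -∑ l, ∑ ν, (c (Sum.inl μ) (Sum.inr l) (Sum.inl ν) • kap c p (Sum.inr l)) • rfld c ν := by
    refine om_injective (c := c) ?_
    funext s
    have h3 : om c (-∑ l, ∑ ν, (c (Sum.inl μ) (Sum.inr l) (Sum.inl ν) • kap c p (Sum.inr l)) •
        rfld c ν) = -∑ l, ∑ ν, (c (Sum.inl μ) (Sum.inr l) (Sum.inl ν) • kap c p (Sum.inr l)) •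
          Pi.single (Sum.inl ν) 1 := by
      rw [map_neg, map_sum]
      congr 1
      refine Finset.sum_congr rfl fun l _ => ?_
      rw [map_sum]
      refine Finset.sum_congr rfl fun r _ => ?_
      rw [map_smul, om_rfld]
    rcases s with s | s
    · rw [om_commutator hc, h3, om_fld, om_rfld]
      have h0 : ∀ q, vf (fld c p) ((Pi.single (Sum.inl μ) 1 : σ ⊕ τ → MvPowerSeries σ k) q) = 0 := by
        intro q
        rw [Pi.single_apply]
        split_ifs <;> simp
      rw [h0, sub_zero]
      change vf (rfld c μ) (kap c p (Sum.inl s)) + _ = _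
      rw [vf_kap hc, om_rfld]
      have h5 : br c (Pi.single (Sum.inl μ) 1) (kap c p) (Sum.inl s) =
          br c (Pi.single (Sum.inl μ) 1) (lpart (kap c p)) (Sum.inl s) +
          br c (Pi.single (Sum.inl μ) 1) (rpart (kap c p)) (Sum.inl s) := by
        conv_lhs => rw [← lpart_add_rpart (kap c p), map_add]
        rfl
      rw [h5, neg_add, neg_add_cancel_comm]
      rw [Pi.neg_apply, Finset.sum_apply, br_apply, Finset.sum_eq_single (Sum.inl μ)]
      · congr 1
        rw [Fintype.sum_sum_type]
        simp [rpart, Pi.single_apply]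
      · intro b _ hb; simp [hb]
      · simp
    · rw [om_inr, h3, Pi.neg_apply, Finset.sum_apply, eq_comm, neg_eq_zero]
      refine Finset.sum_eq_zero fun r _ => ?_
      rw [Finset.sum_apply]
      exact Finset.sum_eq_zero fun r _ => by simp
  rw [this, vf_neg, vf_sum]
  congr 1
  refine Finset.sum_congr rfl fun r _ => ?_
  rw [vf_sum]
  exact Finset.sum_congr rfl fun r _ => vf_smul _ _

/-- In other words `φ(ad x) x = x`, because `[x, x] = 0`. -/
theorem sum_X_smul_omg (hc : FactorLie c) : ∑ ν, (X ν : MvPowerSeries σ k) • omg c ν = gpt := by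
  rw [← sub_eq_zero]
  refine vec_eq_zero (c := c) _ 0 1 (fun s => ?_) (fun N hN => by omega) (fun s => ?_)
  · rw [Pi.sub_apply, Finset.sum_apply]
    refine OrdGE.sub (OrdGE.sum fun ν _ => (ordGE_X ν).mul_right _) ?_
    rcases s with s | s
    · exact ordGE_X s
    · exact ordGE_zero _
  · rw [zero_smul, add_zero, map_sub, map_sum]
    have hg : br c gpt (gpt : σ ⊕ τ → MvPowerSeries σ k) = 0 := by
      have := isAddTorsionFree_of_algebra k (σ ⊕ τ → MvPowerSeries σ k)
      exact self_eq_neg.mp (br_skew hc.skew _ _)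
    have h1 : euler ((gpt : σ ⊕ τ → MvPowerSeries σ k) s) = gpt s := by
      rcases s with s | s
      · exact euler_X s
      · exact map_zero _
    have h2 : ∑ ν, (X ν : MvPowerSeries σ k) *
        (Pi.single (Sum.inl ν) 1 : σ ⊕ τ → MvPowerSeries σ k) s = gpt s := by
      rcases s with s | s <;> simp [gpt, Pi.single_apply]
    rw [Pi.sub_apply, Finset.sum_apply, map_sub, map_sum, h1, hg, sub_zero,
      Finset.sum_apply, ← Finset.sum_neg_distrib, sub_eq_iff_eq_add, ← h2,
      ← Finset.sum_add_distrib]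
    refine Finset.sum_congr rfl fun ν _ => ?_
    rw [Pi.smul_apply, smul_eq_mul, euler_mul, euler_X, map_smul, Pi.smul_apply, smul_eq_mul,
      ← euler_omg hc ν s]
    ring

theorem sum_X_smul_kap (hc : FactorLie c) :
    ∑ μ, (X μ : MvPowerSeries σ k) • kap c (Sum.inl μ) = gpt := by
  have h2 : ∀ s, ∑ ν, (X ν : MvPowerSeries σ k) *
      (Pi.single (Sum.inl ν) 1 : σ ⊕ τ → MvPowerSeries σ k) s = gpt s := by
    intro s
    rcases s with s | s <;> simp [gpt, Pi.single_apply]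
  rw [← sub_eq_zero]
  -- The equation `E v - v = -[x, v]` has the nonzero solution `v = x` of order one, so agreement
  -- through degree one must be checked separately.
  refine vec_eq_zero (c := c) _ (-1) 2 (fun s => ?_) (fun N hN => by omega) (fun s => ?_)
  · rw [Pi.sub_apply, Finset.sum_apply, ← h2, ← Finset.sum_sub_distrib]
    refine OrdGE.sum fun ν _ => ?_
    rw [Pi.smul_apply, smul_eq_mul, ← mul_sub]
    refine (ordGE_X ν).mul (N := 1) (OrdGE.one_of_coeff_eq ?_)
    rw [coeff_zero_kap, Pi.single_apply]
    split_ifs <;> simp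
  · have hg : br c gpt (gpt : σ ⊕ τ → MvPowerSeries σ k) = 0 := by
      have := isAddTorsionFree_of_algebra k (σ ⊕ τ → MvPowerSeries σ k)
      exact self_eq_neg.mp (br_skew hc.skew _ _)
    have h1 : euler ((gpt : σ ⊕ τ → MvPowerSeries σ k) s) = gpt s := by
      rcases s with s | s
      · exact euler_X s
      · exact map_zero _
    rw [map_sub, map_sum, hg, sub_zero, Pi.sub_apply, Finset.sum_apply, map_sub, map_sum, h1,
      Finset.sum_apply, neg_smul, one_smul, neg_sub, sub_add_sub_cancel,
      sub_eq_iff_eq_add, ← Finset.sum_neg_distrib, ← Finset.sum_add_distrib]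
    refine Finset.sum_congr rfl fun ν _ => ?_
    rw [Pi.smul_apply, smul_eq_mul, euler_mul, euler_X, map_smul, Pi.smul_apply, smul_eq_mul,
      euler_kap]
    ring

/-- The form of the Euler field `∑ X_μ ∂_μ` is `x`, and `ω` is injective on fields; so any frame
with `∑ X_μ ω(F_μ) = x` combines to `E`. Both translation frames have this property, which makes
equations along them Euler equations. -/
theorem sum_X_mul_vf {F : σ → σ → MvPowerSeries σ k}
    (hF : ∑ μ, (X μ : MvPowerSeries σ k) • om c (F μ) = gpt) (hc : FactorLie c)
    (f : MvPowerSeries σ k) : ∑ μ, X μ * vf (F μ) f = euler f := by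
  have h : ∑ μ, (X μ : MvPowerSeries σ k) • F μ = X := by
    refine om_injective (c := c) ?_
    rw [map_sum, om_apply, sum_X_smul_omg hc, ← hF]
    exact Finset.sum_congr rfl fun μ _ => map_smul _ _ _
  rw [← sum_X_mul_pderiv, ← vf_apply]
  refine Eq.trans ?_ (congrArg (fun a => vf a f) h)
  simp only [vf_sum]
  have := congrFun (map_sum (Derivation.coeFnAddMonoidHom (R := k) (A := MvPowerSeries σ k)
    (M := MvPowerSeries σ k)) (fun μ => vf ((X μ : MvPowerSeries σ k) • F μ)) Finset.univ) f
  refine Eq.trans ?_ (this.symm)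
  rw [Finset.sum_apply]
  refine Finset.sum_congr rfl fun μ _ => ?_
  change _ = vf ((X μ : MvPowerSeries σ k) • F μ) f
  rw [vf_smul]; rfl

theorem sum_X_mul_fld (hc : FactorLie c) (f : MvPowerSeries σ k) :
    ∑ μ, X μ * vf (fld c (Sum.inl μ)) f = euler f := by
  refine sum_X_mul_vf ?_ hc f
  simp only [om_fld, lpart_kap_inl hc]
  exact sum_X_smul_kap hc

theorem sum_X_mul_rfld (hc : FactorLie c) (f : MvPowerSeries σ k) :
    ∑ μ, X μ * vf (rfld c μ) f = euler f := by
  refine sum_X_mul_vf ?_ hc f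
  simp only [om_rfld]
  funext s
  rw [Finset.sum_apply]
  rcases s with s | s <;> simp [gpt, Pi.single_apply]

theorem ordGE_fld_inr (i : τ) (ν : σ) : OrdGE 1 (fld c (Sum.inr i) ν) := by
  refine OrdGE.sum fun ρ _ => OrdGE.mul_right _ ?_
  rw [ordGE_one_iff, ← coeff_zero_eq_constantCoeff_apply, coeff_zero_kap, if_neg (by simp)]

theorem OrdGE.fld_inr {N : ℕ} {f : MvPowerSeries σ k} (hf : OrdGE N f) (i : τ) :
    OrdGE N (vf (fld c (Sum.inr i)) f) := by
  rw [vf_apply]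
  refine OrdGE.sum fun s _ => ?_
  cases N with
  | zero => exact OrdGE.zero' _
  | succ N =>
    rw [add_comm]
    exact (ordGE_fld_inr i s).mul (hf.pderiv s)

theorem fld_kap (hc : FactorLie c) (μ : σ) (p q : σ ⊕ τ) :
    vf (fld c (Sum.inl μ)) (kap c p q) = -∑ r, c (Sum.inl μ) p r • kap c r q := by
  rw [vf_kap hc, om_fld, lpart_kap_inl hc, kap_br hc, Finset.sum_apply]; rfl

end Fields

/-! ### The Lie algebra `𝐕* ⊕ 𝐇_op` and its action on `k[[X]]` -/

section Structure

variable {k : Type u} [Field k] {m n : ℕ} (L : InhomBialgebra k m n)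

/-- The structure constants of the Lie algebra `𝐕* ⊕ 𝐇_op` in which `𝐕*` and `𝐇_op` are
subalgebras that act on one another. -/
def pc : Fin n ⊕ Fin m → Fin n ⊕ Fin m → Fin n ⊕ Fin m → k
  | Sum.inl ρ, Sum.inl σ, Sum.inl μ => L.γ ρ σ μ
  | Sum.inl _, Sum.inl _, Sum.inr _ => 0
  | Sum.inr i, Sum.inl ρ, Sum.inl μ => L.A i ρ μ
  | Sum.inr i, Sum.inl ρ, Sum.inr l => L.α ρ i l
  | Sum.inl ρ, Sum.inr i, Sum.inl μ => -L.A i ρ μ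
  | Sum.inl ρ, Sum.inr i, Sum.inr l => -L.α ρ i l
  | Sum.inr i, Sum.inr j, Sum.inr l => -L.C i j l
  | Sum.inr _, Sum.inr _, Sum.inl _ => 0

theorem pc_skew (p r q) : pc L p r q = -pc L r p q := by
  rcases p with p | p <;> rcases r with r | r <;> rcases q with q | q <;>
    simp only [pc, neg_zero, neg_neg]
  · exact L.γ_skew _ _ _
  · rw [L.C_skew p r q, neg_neg]

theorem pc_jacobi_llr (ρ σ : Fin n) (i : Fin m) (f) :
    ∑ e, (pc L (Sum.inl ρ) (Sum.inl σ) e * pc L e (Sum.inr i) f +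
      pc L (Sum.inl σ) (Sum.inr i) e * pc L e (Sum.inl ρ) f +
      pc L (Sum.inr i) (Sum.inl ρ) e * pc L e (Sum.inl σ) f) = 0 := by
  rw [Fintype.sum_sum_type]
  rcases f with μ | l
  · have h := L.cond1 i ρ σ μ
    simp only [Finset.sum_add_distrib, Finset.sum_sub_distrib, pc, mul_neg, neg_mul,
      Finset.sum_neg_distrib, mul_zero, Finset.sum_const_zero] at h ⊢
    have e1 : ∑ ν, L.A i σ ν * L.γ ν ρ μ = -∑ ν, L.γ ρ ν μ * L.A i σ ν := by
      rw [← Finset.sum_neg_distrib]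
      exact Finset.sum_congr rfl fun ν _ => by rw [L.γ_skew ν ρ]; ring
    have e2 : ∑ ν, L.γ ρ σ ν * L.A i ν μ = ∑ ν, L.A i ν μ * L.γ ρ σ ν :=
      Finset.sum_congr rfl fun ν _ => mul_comm _ _
    have e3 : ∑ ν, L.A i ρ ν * L.γ ν σ μ = ∑ ν, L.γ ν σ μ * L.A i ρ ν :=
      Finset.sum_congr rfl fun ν _ => mul_comm _ _
    have e4 : ∑ l, L.α σ i l * L.A l ρ μ = ∑ l, L.A l ρ μ * L.α σ i l :=
      Finset.sum_congr rfl fun ν _ => mul_comm _ _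
    have e5 : ∑ l, L.α ρ i l * L.A l σ μ = ∑ l, L.A l σ μ * L.α ρ i l :=
      Finset.sum_congr rfl fun ν _ => mul_comm _ _
    rw [e1, e2, e3, e4, e5]
    linear_combination -h
  · have h := L.α_rep ρ σ i l
    simp only [Finset.sum_add_distrib, Finset.sum_sub_distrib, pc, mul_neg, neg_mul,
      Finset.sum_neg_distrib, zero_mul, mul_zero, Finset.sum_const_zero] at h ⊢
    have e4 : ∑ p, L.α σ i p * L.α ρ p l = ∑ p, L.α ρ p l * L.α σ i p :=
      Finset.sum_congr rfl fun ν _ => mul_comm _ _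
    have e5 : ∑ p, L.α ρ i p * L.α σ p l = ∑ p, L.α σ p l * L.α ρ i p :=
      Finset.sum_congr rfl fun ν _ => mul_comm _ _
    rw [e4, e5]
    linear_combination h

theorem pc_jacobi_rrl (i j : Fin m) (ρ : Fin n) (f) :
    ∑ e, (pc L (Sum.inr i) (Sum.inr j) e * pc L e (Sum.inl ρ) f +
      pc L (Sum.inr j) (Sum.inl ρ) e * pc L e (Sum.inr i) f +
      pc L (Sum.inl ρ) (Sum.inr i) e * pc L e (Sum.inr j) f) = 0 := by
  rw [Fintype.sum_sum_type]
  rcases f with μ | l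
  · have h := L.A_rep i j ρ μ
    simp only [Finset.sum_add_distrib, Finset.sum_sub_distrib, pc, mul_neg, neg_mul,
      Finset.sum_neg_distrib, zero_mul, mul_zero, Finset.sum_const_zero] at h ⊢
    have e4 : ∑ p, L.A j ρ p * L.A i p μ = ∑ p, L.A i p μ * L.A j ρ p :=
      Finset.sum_congr rfl fun ν _ => mul_comm _ _
    have e5 : ∑ p, L.A i ρ p * L.A j p μ = ∑ p, L.A j p μ * L.A i ρ p :=
      Finset.sum_congr rfl fun ν _ => mul_comm _ _
    rw [e4, e5]
    linear_combination h
  · have h := L.cond2 ρ i j l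
    simp only [Finset.sum_add_distrib, Finset.sum_sub_distrib, pc, mul_neg, neg_mul,
      Finset.sum_neg_distrib, mul_zero, Finset.sum_const_zero] at h ⊢
    have e1 : ∑ p, L.α ρ j p * L.C p i l = -∑ p, L.C i p l * L.α ρ j p := by
      rw [← Finset.sum_neg_distrib]
      exact Finset.sum_congr rfl fun ν _ => by rw [L.C_skew ν i]; ring
    have e2 : ∑ p, L.C i j p * L.α ρ p l = ∑ p, L.α ρ p l * L.C i j p :=
      Finset.sum_congr rfl fun ν _ => mul_comm _ _
    have e3 : ∑ p, L.α ρ i p * L.C p j l = ∑ p, L.C p j l * L.α ρ i p :=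
      Finset.sum_congr rfl fun ν _ => mul_comm _ _
    have e4 : ∑ ν, L.A j ρ ν * L.α ν i l = ∑ ν, L.α ν i l * L.A j ρ ν :=
      Finset.sum_congr rfl fun ν _ => mul_comm _ _
    have e5 : ∑ ν, L.A i ρ ν * L.α ν j l = ∑ ν, L.α ν j l * L.A i ρ ν :=
      Finset.sum_congr rfl fun ν _ => mul_comm _ _
    rw [e1, e2, e3, e4, e5]
    linear_combination -h

/-- The Jacobi identities inside the summands are those of `γ` and `C`; the mixed ones split into
components that are precisely `cond1`, `α_rep`, `A_rep` and `cond2`. -/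
theorem pc_factorLie : FactorLie (pc L) where
  skew := pc_skew L
  left _ _ _ := rfl
  right _ _ _ := rfl
  jacobi a b d f := by
    rcases a with a | a <;> rcases b with b | b <;> rcases d with d | d
    · rw [Fintype.sum_sum_type]
      rcases f with f | f
      · simpa [pc] using L.γ_jacobi a b d f
      · simp [pc]
    · exact pc_jacobi_llr L a b d f
    · rw [← pc_jacobi_llr L d a b f]
      exact Finset.sum_congr rfl fun e _ => by ring
    · rw [← pc_jacobi_rrl L b d a f]
      exact Finset.sum_congr rfl fun e _ => by ring
    · rw [← pc_jacobi_llr L b d a f]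
      exact Finset.sum_congr rfl fun e _ => by ring
    · rw [← pc_jacobi_rrl L d a b f]
      exact Finset.sum_congr rfl fun e _ => by ring
    · exact pc_jacobi_rrl L a b d f
    · rw [Fintype.sum_sum_type]
      rcases f with f | f
      · simp [pc]
      · simpa [pc] using L.C_jacobi a b d f

variable [CharZero k]

/-- The derivation `L_μ` of the algebra of power series. -/
noncomputable def lf (μ : Fin n) : Derivation k (MvPowerSeries (Fin n) k)
    (MvPowerSeries (Fin n) k) := vf (fld (pc L) (Sum.inl μ))

/-- The right-invariant derivation `R_μ` of the algebra of power series. -/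
noncomputable def rf (μ : Fin n) : Derivation k (MvPowerSeries (Fin n) k)
    (MvPowerSeries (Fin n) k) := vf (rfld (pc L) μ)

/-- The derivation `A_i` of the algebra of power series: the commutator with `H_i`. -/
noncomputable def af (i : Fin m) : Derivation k (MvPowerSeries (Fin n) k)
    (MvPowerSeries (Fin n) k) := vf (fld (pc L) (Sum.inr i))

/-- The matrix `e^{α · X}`. -/
noncomputable def ee (i l : Fin m) : MvPowerSeries (Fin n) k := expAlphaX L.α l i

theorem neg_sum_smul_apply {ι : Type*} (s : Finset ι) (a : ι → k)
    (D : ι → Derivation k (MvPowerSeries (Fin n) k) (MvPowerSeries (Fin n) k))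
    (f : MvPowerSeries (Fin n) k) : (-∑ r ∈ s, a r • D r) f = -∑ r ∈ s, a r • D r f := by
  rw [Derivation.neg_apply]
  congr 1
  refine (congrFun (map_sum (Derivation.coeFnAddMonoidHom (R := k)
    (A := MvPowerSeries (Fin n) k) (M := MvPowerSeries (Fin n) k)) _ s) f).trans ?_
  rw [Finset.sum_apply]; rfl

theorem lf_lf (μ ν : Fin n) (f : MvPowerSeries (Fin n) k) :
    lf L μ (lf L ν f) - lf L ν (lf L μ f) = -∑ τ, L.γ μ ν τ • lf L τ f := by
  have := DFunLike.congr_fun (fld_commutator (pc_factorLie L) (Sum.inl μ) (Sum.inl ν)) f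
  rw [Derivation.commutator_apply, neg_sum_smul_apply, Fintype.sum_sum_type] at this
  refine this.trans ?_
  simp [pc, lf]

theorem lf_af (μ : Fin n) (i : Fin m) (f : MvPowerSeries (Fin n) k) :
    lf L μ (af L i f) - af L i (lf L μ f) =
      ∑ ν, L.A i μ ν • lf L ν f + ∑ l, L.α μ i l • af L l f := by
  have := DFunLike.congr_fun (fld_commutator (pc_factorLie L) (Sum.inl μ) (Sum.inr i)) f
  rw [Derivation.commutator_apply, neg_sum_smul_apply, Fintype.sum_sum_type] at this
  refine this.trans ?_
  simp [pc, lf, af, add_comm]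

theorem af_af (i j : Fin m) (f : MvPowerSeries (Fin n) k) :
    af L i (af L j f) - af L j (af L i f) = ∑ l, L.C i j l • af L l f := by
  have := DFunLike.congr_fun (fld_commutator (pc_factorLie L) (Sum.inr i) (Sum.inr j)) f
  rw [Derivation.commutator_apply, neg_sum_smul_apply, Fintype.sum_sum_type] at this
  refine this.trans ?_
  simp [pc, af]

theorem alphaX_pow_map (r : ℕ) (l i : Fin m) (d : Fin n →₀ ℕ) :
    MvPolynomial.coeff d ((alphaX L.α ^ r) l i) =
      coeff d (ent (linForm (fun ρ => Matrix.of fun l i => L.α ρ i l) ^ r) l i) := by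
  induction r generalizing l i d with
  | zero =>
    rw [pow_zero, pow_zero, ent_one, Matrix.one_apply]
    split_ifs
    · rw [← MvPolynomial.coeff_coe, MvPolynomial.coe_one]
    · simp
  | succ r ih =>
    rw [pow_succ, pow_succ, ent_mul, Matrix.mul_apply, MvPolynomial.coeff_sum, map_sum]
    refine Finset.sum_congr rfl fun p _ => ?_
    rw [MvPolynomial.coeff_mul, coeff_mul]
    refine Finset.sum_congr rfl fun e _ => ?_
    rw [ih, ent_linForm, alphaX, Matrix.of_apply, MvPolynomial.coeff_sum, map_sum]
    congr 1
    refine Finset.sum_congr rfl fun ρ _ => ?_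
    rw [MvPolynomial.coeff_C_mul, coeff_smul', Matrix.of_apply, smul_eq_mul,
      ← MvPolynomial.coeff_coe, MvPolynomial.coe_X]

theorem ee_eq_ent (i l : Fin m) :
    ee L i l = ent (gen k fun ρ => Matrix.of fun l i => L.α ρ i l) l i := by
  ext d
  change ((d.degree ! : ℕ) : k)⁻¹ * MvPolynomial.coeff d ((alphaX L.α ^ d.degree) l i) = _
  rw [alphaX_pow_map, coeff_ent, coeff_ent, coeff_gen, sig_eq_words, linForm_pow, map_sum,
    Matrix.smul_apply, smul_eq_mul, Finset.sum_filter]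
  congr 1
  refine congrFun (congrFun (Finset.sum_congr rfl fun w _ => ?_) l) i
  rw [coeff_monomial]
  split_ifs with h1 h2 h2
  · rfl
  · exact absurd h1.symm h2
  · exact absurd h2.symm h1
  · rfl

theorem coeff_zero_ee (i l : Fin m) : coeff 0 (ee L i l) = if i = l then 1 else 0 := by
  rw [ee_eq_ent, coeff_ent, coeff_gen, sig_zero, Matrix.one_apply]
  simp only [eq_comm]

theorem euler_ee (i l : Fin m) :
    euler (ee L i l) = ∑ p, (∑ ρ, L.α ρ p l • X ρ) * ee L i p := by
  rw [ee_eq_ent, ← ent_euler, euler_gen, ent_mul]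
  refine Finset.sum_congr rfl fun p _ => ?_
  rw [ent_linForm, ee_eq_ent]; rfl

/-- Since `𝐕*` is a subalgebra, the `𝐕*`-part of `e^{-ad x} H_i` does not feed back into its
`𝐇`-part, on which `-ad x` acts as `α · X`. So the twist in the coproduct of `H_i` is a block of the
adjoint action. -/
theorem ee_eq_kap (i l : Fin m) : ee L i l = kap (pc L) (Sum.inr i) (Sum.inr l) := by
  rw [← sub_eq_zero]
  have := isAddTorsionFree_of_algebra k k
  refine family_eq_zero (fun l => ee L i l - kap (pc L) (Sum.inr i) (Sum.inr l)) 0 1 (fun l => ?_)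
    (fun N hN => by omega) (fun N hN l => ?_) l
  · refine OrdGE.one_of_coeff_eq ?_
    rw [coeff_zero_ee, coeff_zero_kap]
    simp [eq_comm]
  · have : euler (ee L i l - kap (pc L) (Sum.inr i) (Sum.inr l)) =
        ∑ p, (∑ ρ, L.α ρ p l • X ρ) * (ee L i p - kap (pc L) (Sum.inr i) (Sum.inr p)) := by
      rw [map_sub, euler_ee, euler_kap, linForm_br, Fintype.sum_sum_type]
      simp [pc, mul_sub]
    rw [zero_smul, add_zero, this]
    refine OrdGE.sum fun p _ => ?_
    rw [add_comm]
    exact OrdGE.mul (OrdGE.sum fun ρ _ => (ordGE_X ρ).smul _) (hN p)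

theorem lf_ee (μ : Fin n) (i l : Fin m) :
    lf L μ (ee L i l) = ∑ p, L.α μ i p • ee L p l := by
  rw [ee_eq_kap, lf, fld_kap (pc_factorLie L), Fintype.sum_sum_type]
  simp [pc, kap_inl_inr (pc_factorLie L), ee_eq_kap]

theorem rf_lf (μ ν : Fin n) (f : MvPowerSeries (Fin n) k) :
    rf L μ (lf L ν f) = lf L ν (rf L μ f) := by
  have := DFunLike.congr_fun (rfld_commutator (pc_factorLie L) μ (Sum.inl ν)) f
  rw [Derivation.commutator_apply] at this
  rw [← sub_eq_zero]
  refine this.trans ?_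
  simp [kap_inl_inr (pc_factorLie L)]

theorem rf_af (μ : Fin n) (i : Fin m) (f : MvPowerSeries (Fin n) k) :
    rf L μ (af L i f) - af L i (rf L μ f) =
      ∑ l, ∑ ν, L.A l μ ν • (ee L i l * rf L ν f) := by
  have := DFunLike.congr_fun (rfld_commutator (pc_factorLie L) μ (Sum.inr i)) f
  rw [Derivation.commutator_apply] at this
  refine this.trans ?_
  rw [← Finset.sum_neg_distrib]
  refine (congrFun (map_sum (Derivation.coeFnAddMonoidHom (R := k)
    (A := MvPowerSeries (Fin n) k) (M := MvPowerSeries (Fin n) k)) _ Finset.univ) f).trans ?_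
  rw [Finset.sum_apply]
  refine Finset.sum_congr rfl fun l _ => ?_
  rw [← Finset.sum_neg_distrib]
  refine (congrFun (map_sum (Derivation.coeFnAddMonoidHom (R := k)
    (A := MvPowerSeries (Fin n) k) (M := MvPowerSeries (Fin n) k)) _ Finset.univ) f).trans ?_
  rw [Finset.sum_apply]
  refine Finset.sum_congr rfl fun ν _ => ?_
  change (-((pc L (Sum.inl μ) (Sum.inr l) (Sum.inl ν) • kap (pc L) (Sum.inr i) (Sum.inr l)) •
    vf (rfld (pc L) ν))) f = _
  rw [Derivation.neg_apply, Derivation.smul_apply, ← ee_eq_kap, smul_assoc, rf]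
  simp [pc]

theorem sum_X_mul_lf (f : MvPowerSeries (Fin n) k) : ∑ μ, X μ * lf L μ f = euler f :=
  sum_X_mul_fld (pc_factorLie L) f

theorem sum_X_mul_rf (f : MvPowerSeries (Fin n) k) : ∑ μ, X μ * rf L μ f = euler f :=
  sum_X_mul_rfld (pc_factorLie L) f

theorem OrdGE.af {N : ℕ} {f : MvPowerSeries (Fin n) k} (hf : OrdGE N f) (i : Fin m) :
    OrdGE N (af L i f) := OrdGE.fld_inr hf i

theorem constantCoeff_af (i : Fin m) (f : MvPowerSeries (Fin n) k) :
    constantCoeff (af L i f) = 0 := by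
  rw [← ordGE_one_iff]
  have h : LieQuant.af L i f = LieQuant.af L i (f - C (constantCoeff f)) := by
    rw [map_sub, MvPowerSeries.c_eq_algebraMap, Derivation.map_algebraMap, sub_zero]
  rw [h]
  exact OrdGE.af L (ordGE_one_iff.mpr (by simp)) i

end Structure

/-- A family whose derivatives along a frame are combinations of the family and which vanishes
at the origin vanishes. -/
theorem eq_zero_of_fields {k : Type u} [Field k] [CharZero k] {n : ℕ}
    (D : Fin n → MvPowerSeries (Fin n) k → MvPowerSeries (Fin n) k)
    (hD : ∀ f, ∑ μ, X μ * D μ f = euler f) {S : Type*}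
    (y : S → MvPowerSeries (Fin n) k) (h0 : ∀ s, constantCoeff (y s) = 0)
    (h : ∀ N, (∀ s, OrdGE N (y s)) → ∀ μ s, OrdGE N (D μ (y s))) (s : S) : y s = 0 := by
  have := isAddTorsionFree_of_algebra k k
  refine family_eq_zero y 0 1 (fun s => ordGE_one_iff.mpr (h0 s)) (fun N hN => by omega)
    (fun N hN s => ?_) s
  rw [zero_smul, add_zero, ← hD]
  refine OrdGE.sum fun μ _ => ?_
  rw [add_comm]
  exact (ordGE_X μ).mul (h N hN μ s)

/-- Only the recursion is used, so `Φ` may be any linear map that intertwines the operators. -/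
theorem sig_intertwine {k : Type*} [Field k] [CharZero k] {ι : Type*} [Fintype ι] [DecidableEq ι]
    {V W : Type*} [AddCommGroup V] [Module k V] [AddCommGroup W] [Module k W]
    (Φ : V →ₗ[k] W) (S : ι → Module.End k V) (T : ι → Module.End k W)
    (h : ∀ μ v, Φ (S μ v) = T μ (Φ v)) (d : ι →₀ ℕ) (v : V) :
    Φ (sig k S d v) = sig k T d (Φ v) := by
  have := isAddTorsionFree_of_algebra k W
  induction hN : d.degree generalizing d with
  | zero =>
    have : d = 0 := (Finsupp.degree_eq_zero_iff d).mp hN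
    rw [this, sig_zero, sig_zero]; rfl
  | succ N ih =>
    refine nsmul_right_injective (M := W) (n := d.degree) (by omega) ?_
    change d.degree • Φ (sig k S d v) = d.degree • sig k T d (Φ v)
    rw [← map_nsmul, ← LinearMap.smul_apply, ← LinearMap.smul_apply, sig_rec, sig_rec,
      LinearMap.sum_apply, LinearMap.sum_apply, map_sum]
    refine Finset.sum_congr rfl fun μ _ => ?_
    split_ifs with hμ
    · rw [Module.End.mul_apply, Module.End.mul_apply, h, ih]
      have := congrArg Finsupp.degree (tsub_add_cancel_of_le hμ)
      rw [map_add, Finsupp.degree_single] at this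
      omega
    · simp

/-! ### Left translations and the coproduct after applying a functional -/

section Shift

variable {k : Type u} [Field k] [CharZero k] {m n : ℕ} (L : InhomBialgebra k m n)

/-- The symmetrized monomials in the derivations `L_μ`, divided by factorials. -/
noncomputable def sl (a : Fin n →₀ ℕ) : Module.End k (MvPowerSeries (Fin n) k) :=
  sig k (fun μ => ((lf L μ : Derivation k _ _) : MvPowerSeries (Fin n) k →ₗ[k]
    MvPowerSeries (Fin n) k)) a

theorem sl_zero (f : MvPowerSeries (Fin n) k) : sl L 0 f = f := by rw [sl, sig_zero]; rfl

theorem sl_rec (a : Fin n →₀ ℕ) (f : MvPowerSeries (Fin n) k) : a.degree • sl L a f =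
    ∑ μ, if Finsupp.single μ 1 ≤ a then sl L (a - Finsupp.single μ 1) (lf L μ f) else 0 := by
  rw [← LinearMap.smul_apply, sl, sig_rec', LinearMap.sum_apply]
  refine Finset.sum_congr rfl fun μ _ => ?_
  split_ifs <;> rfl

theorem sl_rf (ν : Fin n) (a : Fin n →₀ ℕ) (f : MvPowerSeries (Fin n) k) :
    rf L ν (sl L a f) = sl L a (rf L ν f) :=
  sig_intertwine ((rf L ν : Derivation k _ _) : MvPowerSeries (Fin n) k →ₗ[k]
    MvPowerSeries (Fin n) k) _ _ (fun μ f => rf_lf L ν μ f) a f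

theorem OrdGE.sl {N : ℕ} (a : Fin n →₀ ℕ) {f : MvPowerSeries (Fin n) k}
    (hf : OrdGE (N + a.degree) f) : OrdGE N (sl L a f) := by
  have := isAddTorsionFree_of_algebra k k
  induction hM : a.degree generalizing a f with
  | zero =>
    have h0 : a = 0 := (Finsupp.degree_eq_zero_iff a).mp hM
    rw [h0, sl_zero]
    exact hf.mono (by omega)
  | succ M ih =>
    intro d hd
    refine nsmul_right_injective (M := k) (n := a.degree) (by omega) ?_
    change a.degree • coeff d _ = a.degree • (0 : k)
    rw [smul_zero, ← map_nsmul, sl_rec, map_sum]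
    refine Finset.sum_eq_zero fun μ _ => ?_
    split_ifs with hμ
    · have h2 := congrArg Finsupp.degree (tsub_add_cancel_of_le hμ)
      rw [map_add, Finsupp.degree_single] at h2
      refine ih (a - Finsupp.single μ 1) ?_ (by omega) d hd
      exact OrdGE.derivation (hf.mono (by omega)) _
    · simp

/-- The series `∑ a, λ (σ_a f) X ^ a`, where `σ_a` are the symmetrized monomials in the `L_μ`. -/
noncomputable def dl (lam : MvPowerSeries (Fin n) k →ₗ[k] k) :
    MvPowerSeries (Fin n) k →ₗ[k] MvPowerSeries (Fin n) k where
  toFun f := fun a => lam (sl L a f)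
  map_add' f g := by ext a; exact (congrArg lam (map_add (sl L a) f g)).trans (map_add lam _ _)
  map_smul' r f := by ext a; exact (congrArg lam (map_smul (sl L a) r f)).trans (map_smul lam _ _)

variable (lam : MvPowerSeries (Fin n) k →ₗ[k] k)

theorem coeff_dl (f : MvPowerSeries (Fin n) k) (a : Fin n →₀ ℕ) :
    coeff a (dl L lam f) = lam (sl L a f) := rfl

theorem coeff_zero_dl (f : MvPowerSeries (Fin n) k) : coeff 0 (dl L lam f) = lam f := by
  rw [coeff_dl, sl_zero]

theorem euler_dl (f : MvPowerSeries (Fin n) k) :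
    euler (dl L lam f) = ∑ μ, X μ * dl L lam (lf L μ f) := by
  ext a
  rw [coeff_euler, coeff_dl, ← map_nsmul, sl_rec, map_sum, map_sum]
  refine Finset.sum_congr rfl fun μ _ => ?_
  rw [coeff_X_mul']
  split_ifs
  · rfl
  · exact map_zero _

/-- At the origin the frame `L_μ` is the coordinate frame: compare the coefficients of `X_μ` in `∑
X_μ L_μ(X_ν) = X_ν`. -/
theorem lf_X_coeff_zero (μ ν : Fin n) :
    OrdGE 1 (lf L μ (X ν) - if μ = ν then 1 else 0) := by
  refine OrdGE.one_of_coeff_eq ?_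
  have h := congrArg (coeff (Finsupp.single μ 1)) (sum_X_mul_lf L (X ν))
  rw [map_sum, euler_X, coeff_X, Finset.sum_eq_single μ] at h
  · rw [coeff_X_mul', if_pos le_rfl, tsub_self] at h
    rw [h]
    have : (Finsupp.single μ 1 : Fin n →₀ ℕ) = Finsupp.single ν 1 ↔ μ = ν :=
      Finsupp.single_left_inj one_ne_zero
    simp only [this]
    split_ifs <;> simp
  · intro ρ _ hρ
    rw [coeff_X_mul', if_neg]
    intro hle
    have := hle ρ
    rw [Finsupp.single_eq_same, Finsupp.single_eq_of_ne hρ] at this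
    omega
  · simp

/-- The operator `dl λ` is `f ↦ (id ⊗ λ) Δ f`, an average of right translations, and so should
commute with left translations. The defect `D` is shown to vanish by an equation `E D + D = (higher
order)`: applying `L_μ` to `E (dl f)` in two ways gives `h1`, and computing `E` on `dl (L_μ f)`
gives `h2`; the brackets `[L_ν, L_μ]` enter both. -/
theorem lf_dl (μ : Fin n) (f : MvPowerSeries (Fin n) k) :
    lf L μ (dl L lam f) = dl L lam (lf L μ f) := by
  have := isAddTorsionFree_of_algebra k k
  rw [← sub_eq_zero]
  let D : Fin n × MvPowerSeries (Fin n) k → MvPowerSeries (Fin n) k :=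
    fun s => lf L s.1 (dl L lam s.2) - dl L lam (lf L s.1 s.2)
  refine family_eq_zero D 1 0 (fun s => OrdGE.zero' _) (fun N _ => by omega) ?_ (μ, f)
  rintro N hN ⟨μ, f⟩
  have hl : ∀ μ f, lf L μ (dl L lam f) = D (μ, f) + dl L lam (lf L μ f) := fun μ f => by
    simp only [D, sub_add_cancel]
  have h1 : euler (lf L μ (dl L lam f)) + ∑ ν, lf L μ (X ν) * lf L ν (dl L lam f) +
      ∑ ν, X ν * ∑ τ, L.γ ν μ τ • lf L τ (dl L lam f) =
      ∑ ν, lf L μ (X ν) * dl L lam (lf L ν f) +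
        ∑ ν, X ν * lf L μ (dl L lam (lf L ν f)) := by
    have e1 : lf L μ (euler (dl L lam f)) = ∑ ν, X ν * lf L μ (lf L ν (dl L lam f)) +
        ∑ ν, lf L μ (X ν) * lf L ν (dl L lam f) := by
      rw [← sum_X_mul_lf L, map_sum, ← Finset.sum_add_distrib]
      refine Finset.sum_congr rfl fun ν _ => ?_
      rw [Derivation.leibniz, smul_eq_mul, smul_eq_mul, mul_comm (lf L μ (X ν))]
    have e2 : lf L μ (euler (dl L lam f)) = ∑ ν, X ν * lf L μ (dl L lam (lf L ν f)) +
        ∑ ν, lf L μ (X ν) * dl L lam (lf L ν f) := by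
      rw [euler_dl, map_sum, ← Finset.sum_add_distrib]
      refine Finset.sum_congr rfl fun ν _ => ?_
      rw [Derivation.leibniz, smul_eq_mul, smul_eq_mul, mul_comm (lf L μ (X ν))]
    rw [← sum_X_mul_lf L (lf L μ (dl L lam f)), add_comm (∑ ν, lf L μ (X ν) * dl L lam (lf L ν f)),
      ← e2, e1, add_right_comm, ← Finset.sum_add_distrib]
    congr 1
    refine Finset.sum_congr rfl fun ν _ => ?_
    rw [← mul_add]
    congr 1
    linear_combination lf_lf L ν μ (dl L lam f)
  have h2 : euler (dl L lam (lf L μ f)) + ∑ ν, X ν * ∑ τ, L.γ ν μ τ • dl L lam (lf L τ f) =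
      ∑ ν, X ν * dl L lam (lf L μ (lf L ν f)) := by
    rw [euler_dl, ← Finset.sum_add_distrib]
    refine Finset.sum_congr rfl fun ν _ => ?_
    rw [← mul_add, ← sub_eq_zero, ← mul_sub]
    have : dl L lam (lf L ν (lf L μ f)) + ∑ τ, L.γ ν μ τ • dl L lam (lf L τ f) -
        dl L lam (lf L μ (lf L ν f)) = dl L lam (lf L ν (lf L μ f) - lf L μ (lf L ν f) +
          ∑ τ, L.γ ν μ τ • lf L τ f) := by
      rw [map_add, map_sub, map_sum]
      simp only [map_smul]
      abel
    rw [this, lf_lf, neg_add_cancel, map_zero, mul_zero]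
  have h3 : euler (D (μ, f)) + (1 : ℤ) • D (μ, f) =
      -∑ ν, (lf L μ (X ν) - if μ = ν then 1 else 0) * D (ν, f) -
        ∑ ν, X ν * ∑ τ, L.γ ν μ τ • D (τ, f) + ∑ ν, X ν * D (μ, lf L ν f) := by
    have e3 : ∑ ν, (lf L μ (X ν) - if μ = ν then 1 else 0) * D (ν, f) =
        ∑ ν, lf L μ (X ν) * D (ν, f) - D (μ, f) := by
      simp [sub_mul, Finset.sum_sub_distrib]
    rw [e3, one_smul]
    simp only [hl] at h1
    simp only [mul_add, Finset.sum_add_distrib, smul_add, map_add] at h1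
    linear_combination h1 - h2
  rw [h3]
  refine OrdGE.add (OrdGE.sub (OrdGE.neg (OrdGE.sum fun ν _ => ?_)) (OrdGE.sum fun ν _ => ?_))
    (OrdGE.sum fun ν _ => ?_)
  · rw [add_comm]; exact (lf_X_coeff_zero L μ ν).mul (hN _)
  · rw [add_comm]; exact (ordGE_X ν).mul (OrdGE.sum fun τ _ => (hN _).smul _)
  · rw [add_comm]; exact (ordGE_X ν).mul (hN _)

theorem sl_dl (a : Fin n →₀ ℕ) (f : MvPowerSeries (Fin n) k) :
    sl L a (dl L lam f) = dl L lam (sl L a f) :=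
  (sig_intertwine (dl L lam) _ _ (fun μ f => (lf_dl L lam μ f).symm) a f).symm

theorem dl_coeff_zero (f : MvPowerSeries (Fin n) k) : dl L (coeff 0) f = f := by
  have := isAddTorsionFree_of_algebra k k
  rw [← sub_eq_zero]
  refine family_eq_zero (fun f => dl L (coeff 0) f - f) 0 1
    (fun f => OrdGE.one_of_coeff_eq (coeff_zero_dl L _ f)) (fun N hN => by omega)
    (fun N hN f => ?_) f
  have : euler (dl L (coeff 0) f - f) = ∑ μ, X μ * (dl L (coeff 0) (lf L μ f) - lf L μ f) := by
    rw [map_sub, euler_dl, ← sum_X_mul_lf L f, ← Finset.sum_sub_distrib]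
    exact Finset.sum_congr rfl fun μ _ => (mul_sub _ _ _).symm
  rw [zero_smul, add_zero, this]
  refine OrdGE.sum fun μ _ => ?_
  rw [add_comm]
  exact (ordGE_X μ).mul (hN _)

/-- Taylor's formula in exponential coordinates: the symmetrized monomials in the `L_μ`, divided by
factorials and evaluated at the origin, extract the coefficients of `f`. It holds because `(id ⊗ ε)
Δ f = f`. -/
theorem coeff_eq_sl (a : Fin n →₀ ℕ) (f : MvPowerSeries (Fin n) k) :
    coeff 0 (sl L a f) = coeff a f := by
  conv_rhs => rw [← dl_coeff_zero L f]
  rfl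

/-- The matrix `e^{α·X}` is a representation of the group, so that `Δ (e_i^l) = ∑ e_i^p ⊗ e_p^l`;
here `λ` has been applied to the second factor. Both sides satisfy the same linear system along the
`L_μ` (`lf_ee`). -/
theorem dl_ee (i l : Fin m) :
    dl L lam (ee L i l) = ∑ p, lam (ee L p l) • ee L i p := by
  rw [← sub_eq_zero]
  refine eq_zero_of_fields (fun μ => lf L μ) (sum_X_mul_lf L)
    (fun i => dl L lam (ee L i l) - ∑ p, lam (ee L p l) • ee L i p) (fun i => ?_)
    (fun N hN μ i => ?_) i
  · rw [← coeff_zero_eq_constantCoeff_apply, map_sub, coeff_zero_dl, map_sum]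
    simp only [coeff_smul', coeff_zero_ee]
    simp
  · have : lf L μ (dl L lam (ee L i l) - ∑ p, lam (ee L p l) • ee L i p) =
        ∑ r, L.α μ i r • (dl L lam (ee L r l) - ∑ p, lam (ee L p l) • ee L r p) := by
      rw [map_sub, lf_dl, lf_ee, map_sum, map_sum]
      simp only [smul_sub, Finset.sum_sub_distrib, map_smul, Derivation.map_smul, lf_ee,
        Finset.smul_sum]
      congr 1
      rw [Finset.sum_comm]
      exact Finset.sum_congr rfl fun r _ => Finset.sum_congr rfl fun p _ => smul_comm _ _ _
    rw [this]
    exact OrdGE.sum fun r _ => (hN r).smul _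

/-- This encodes `Δ (A_i f) = (∑ e_i^l ⊗ A_l + A_i ⊗ 1) Δ f`, the compatibility of the coproduct
with the commutator with `H_i`. By the commutator of `L_μ` with `A_i`, the derivatives of the defect
along the frame are combinations of defects, and all defects vanish at the origin. -/
theorem dl_af (i : Fin m) (f : MvPowerSeries (Fin n) k) :
    dl L lam (af L i f) =
      ∑ l, ee L i l * dl L (lam ∘ₗ ((af L l : Derivation k _ _) : MvPowerSeries (Fin n) k →ₗ[k]
        MvPowerSeries (Fin n) k)) f + af L i (dl L lam f) := by
  rw [← sub_eq_zero]
  let A := fun l => ((af L l : Derivation k _ _) : MvPowerSeries (Fin n) k →ₗ[k]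
    MvPowerSeries (Fin n) k)
  refine eq_zero_of_fields (fun μ => lf L μ) (sum_X_mul_lf L)
    (fun s : Fin m × MvPowerSeries (Fin n) k => dl L lam (af L s.1 s.2) -
      (∑ l, ee L s.1 l * dl L (lam ∘ₗ A l) s.2 + af L s.1 (dl L lam s.2))) ?_ ?_ (i, f)
  · rintro ⟨i, f⟩
    rw [map_sub, map_add, constantCoeff_af, map_sum]
    simp only [map_mul, ← coeff_zero_eq_constantCoeff_apply, coeff_zero_dl, coeff_zero_ee]
    simp [A]
  · rintro N hN μ ⟨i, f⟩
    have : lf L μ (dl L lam (af L i f) -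
        (∑ l, ee L i l * dl L (lam ∘ₗ A l) f + af L i (dl L lam f))) =
        (dl L lam (af L i (lf L μ f)) -
        (∑ l, ee L i l * dl L (lam ∘ₗ A l) (lf L μ f) + af L i (dl L lam (lf L μ f)))) +
        ∑ p, L.α μ i p • (dl L lam (af L p f) -
        (∑ l, ee L p l * dl L (lam ∘ₗ A l) f + af L p (dl L lam f))) := by
      have e1 := sub_eq_iff_eq_add.mp (lf_af L μ i f)
      have e2 := sub_eq_iff_eq_add.mp (lf_af L μ i (dl L lam f))
      have e3 : ∑ l, lf L μ (ee L i l * dl L (lam ∘ₗ A l) f) =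
          ∑ l, ee L i l * dl L (lam ∘ₗ A l) (lf L μ f) +
          ∑ p, L.α μ i p • ∑ l, ee L p l * dl L (lam ∘ₗ A l) f := by
        simp only [Finset.smul_sum]
        rw [Finset.sum_comm, ← Finset.sum_add_distrib]
        refine Finset.sum_congr rfl fun l _ => ?_
        rw [Derivation.leibniz, smul_eq_mul, smul_eq_mul, lf_dl, lf_ee, Finset.mul_sum]
        congr 1
        refine Finset.sum_congr rfl fun p _ => ?_
        rw [mul_comm, smul_mul_assoc]
      rw [map_sub, map_add, lf_dl, e1, e2, map_sum (lf L μ), e3, map_add, map_add, map_sum, map_sum]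
      simp only [map_smul, smul_sub, smul_add, Finset.sum_sub_distrib, Finset.sum_add_distrib,
        lf_dl]
      abel
    change OrdGE N (lf L μ (dl L lam (af L i f) -
        (∑ l, ee L i l * dl L (lam ∘ₗ A l) f + af L i (dl L lam f))))
    rw [this]
    exact OrdGE.add (hN (i, lf L μ f)) (OrdGE.sum fun p _ => (hN (p, f)).smul _)

/-- The coefficient of `⊗ H_q` in the requirement that the elements `Δ H_i` have the brackets of the
`H_i`. The derivatives of the defect along the `L_μ` are combinations of defects; the terms in `A`
that arise cancel by `cond2`. -/
theorem ee_cocycle (i j q : Fin m) :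
    ∑ l, L.C i j l • ee L l q = ∑ l, ∑ p, L.C l p q • (ee L i l * ee L j p) +
      af L i (ee L j q) - af L j (ee L i q) := by
  rw [← sub_eq_zero]
  let Q : Fin m × Fin m → MvPowerSeries (Fin n) k := fun s =>
    ∑ l, L.C s.1 s.2 l • ee L l q - (∑ l, ∑ p, L.C l p q • (ee L s.1 l * ee L s.2 p) +
      af L s.1 (ee L s.2 q) - af L s.2 (ee L s.1 q))
  refine eq_zero_of_fields (fun μ => lf L μ) (sum_X_mul_lf L) Q ?_ ?_ (i, j)
  · rintro ⟨i, j⟩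
    simp only [Q]
    rw [map_sub, map_sub, map_add, constantCoeff_af, constantCoeff_af]
    have h1 : ∀ i l, constantCoeff (ee L i l) = if i = l then 1 else 0 := coeff_zero_ee L
    have h2 : ∀ (r : k) (f : MvPowerSeries (Fin n) k),
      constantCoeff (r • f) = r * constantCoeff f := fun _ _ => rfl
    simp only [map_sum, h2, map_mul, h1]
    simp
  · rintro N hN μ ⟨i, j⟩
    have : lf L μ (Q (i, j)) = ∑ r, L.α μ i r • Q (r, j) + ∑ r, L.α μ j r • Q (i, r) := by
      have e0 : lf L μ (∑ l, L.C i j l • ee L l q) =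
          ∑ p, (∑ l, L.α μ l p * L.C i j l) • ee L p q := by
        rw [map_sum]
        simp only [Finset.sum_smul, Derivation.map_smul, lf_ee, Finset.smul_sum, smul_smul]
        rw [Finset.sum_comm]
        exact Finset.sum_congr rfl fun r _ => Finset.sum_congr rfl fun p _ => by rw [mul_comm]
      have e1 : lf L μ (∑ l, ∑ p, L.C l p q • (ee L i l * ee L j p)) =
          ∑ r, L.α μ i r • (∑ l, ∑ p, L.C l p q • (ee L r l * ee L j p)) +
          ∑ r, L.α μ j r • (∑ l, ∑ p, L.C l p q • (ee L i l * ee L r p)) := by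
        simp only [map_sum, Finset.smul_sum]
        rw [Finset.sum_comm (s := (Finset.univ : Finset (Fin m)))
          (f := fun r l => ∑ p, L.α μ i r • L.C l p q • (ee L r l * ee L j p)),
          Finset.sum_comm (s := (Finset.univ : Finset (Fin m)))
          (f := fun r l => ∑ p, L.α μ j r • L.C l p q • (ee L i l * ee L r p)),
          ← Finset.sum_add_distrib]
        refine Finset.sum_congr rfl fun l _ => ?_
        rw [Finset.sum_comm (f := fun r p => L.α μ i r • L.C l p q • (ee L r l * ee L j p)),
          Finset.sum_comm (f := fun r p => L.α μ j r • L.C l p q • (ee L i l * ee L r p)),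
          ← Finset.sum_add_distrib]
        refine Finset.sum_congr rfl fun p _ => ?_
        rw [Derivation.map_smul, Derivation.leibniz, lf_ee, lf_ee, smul_eq_mul, smul_eq_mul, Finset.mul_sum,
          Finset.mul_sum, smul_add, Finset.smul_sum, Finset.smul_sum, add_comm]
        congr 1 <;> refine Finset.sum_congr rfl fun r _ => ?_
        · rw [mul_smul_comm, smul_comm, mul_comm]
        · rw [mul_smul_comm, smul_comm]
      have e2 : ∀ i j, lf L μ (af L i (ee L j q)) = ∑ r, L.α μ j r • af L i (ee L r q) +
          ∑ p, (∑ ν, L.α ν j p * L.A i μ ν) • ee L p q + ∑ l, L.α μ i l • af L l (ee L j q) := by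
        intro i j
        rw [sub_eq_iff_eq_add.mp (lf_af L μ i (ee L j q)), lf_ee, map_sum]
        simp only [Finset.sum_smul, Derivation.map_smul, lf_ee, Finset.smul_sum, smul_smul]
        rw [Finset.sum_comm (s := (Finset.univ : Finset (Fin n)))]
        simp only [mul_comm]
        abel
      have e3 : ∑ r, L.α μ i r • (∑ l, L.C r j l • ee L l q) +
          ∑ r, L.α μ j r • (∑ l, L.C i r l • ee L l q) =
          ∑ p, (∑ r, (L.C i r p * L.α μ j r + L.C r j p * L.α μ i r)) • ee L p q := by
        simp only [Finset.smul_sum, smul_smul, Finset.sum_smul]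
        rw [Finset.sum_comm (f := fun r l => (L.α μ i r * L.C r j l) • ee L l q),
          Finset.sum_comm (f := fun r l => (L.α μ j r * L.C i r l) • ee L l q),
          ← Finset.sum_add_distrib]
        refine Finset.sum_congr rfl fun p _ => ?_
        rw [← Finset.sum_add_distrib]
        refine Finset.sum_congr rfl fun r _ => ?_
        rw [← add_smul]
        congr 1
        ring
      have e4 : ∑ p, (∑ l, L.α μ l p * L.C i j l) • ee L p q -
          ∑ p, (∑ r, (L.C i r p * L.α μ j r + L.C r j p * L.α μ i r)) • ee L p q =
          ∑ p, (∑ ν, L.α ν j p * L.A i μ ν) • ee L p q -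
            ∑ p, (∑ ν, L.α ν i p * L.A j μ ν) • ee L p q := by
        rw [← Finset.sum_sub_distrib, ← Finset.sum_sub_distrib]
        refine Finset.sum_congr rfl fun p _ => ?_
        rw [← sub_smul, ← sub_smul, ← Finset.sum_sub_distrib, ← Finset.sum_sub_distrib,
          ← L.cond2 μ i j p]
        congr 1
        exact Finset.sum_congr rfl fun r _ => by ring
      simp only [Q]
      rw [map_sub, map_sub, map_add, e0, e1, e2, e2]
      simp only [smul_sub, smul_add, Finset.sum_sub_distrib, Finset.sum_add_distrib]
      rw [sub_eq_iff_eq_add] at e4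
      rw [e4, ← e3]
      abel
    rw [this]
    exact OrdGE.add (OrdGE.sum fun r _ => (hN _).smul _) (OrdGE.sum fun r _ => (hN _).smul _)

end Shift

/-! ### The substitution `X ↦ -X`, which is the inversion of the formal group -/

section Minus

variable {k : Type*} [Field k] [CharZero k] {σ : Type*} [Fintype σ] [DecidableEq σ]

/-- The substitution of `-X` for `X`. -/
noncomputable def minus : MvPowerSeries σ k →ₐ[k] MvPowerSeries σ k :=
  rescaleAlgHom fun _ => -1

theorem coeff_minus (f : MvPowerSeries σ k) (d : σ →₀ ℕ) :
    coeff d (minus f) = (-1) ^ d.degree * coeff d f := by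
  rw [minus, rescaleAlgHom_apply, coeff_rescale, Finsupp.degree_apply, Finsupp.prod,
    Finset.prod_pow_eq_pow_sum]

theorem minus_minus (f : MvPowerSeries σ k) : minus (minus f) = f := by
  ext d
  rw [coeff_minus, coeff_minus, ← mul_assoc, ← mul_pow]
  simp

theorem minus_X (s : σ) : minus (X s : MvPowerSeries σ k) = -X s := by
  ext d
  rw [coeff_minus, map_neg, coeff_X]
  split_ifs with h
  · simp [h]
  · simp

theorem OrdGE.minus {N : ℕ} {f : MvPowerSeries σ k} (hf : OrdGE N f) : OrdGE N (minus f) :=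
  fun d hd => by rw [coeff_minus, hf d hd, mul_zero]

theorem minus_pderiv (s : σ) (f : MvPowerSeries σ k) :
    minus (pderiv k s f) = -pderiv k s (minus f) := by
  ext d
  rw [coeff_minus, map_neg, coeff_pderiv, coeff_pderiv, coeff_minus, map_add,
    Finsupp.degree_single, pow_succ]
  ring

theorem minus_vf (a : σ → MvPowerSeries σ k) (f : MvPowerSeries σ k) :
    minus (vf a f) = vf (fun s => -minus (a s)) (minus f) := by
  rw [vf_apply, vf_apply, map_sum]
  refine Finset.sum_congr rfl fun s _ => ?_
  rw [map_mul, minus_pderiv]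
  ring

theorem linForm_pow_coeff {R : Type*} [Ring R] (T : σ → R) (r : ℕ) (d : σ →₀ ℕ)
    (h : d.degree ≠ r) : coeff d (linForm T ^ r) = 0 := by
  rw [linForm_pow, map_sum]
  refine Finset.sum_eq_zero fun w _ => ?_
  rw [coeff_monomial, if_neg]
  rintro rfl
  refine h ?_
  rw [map_sum]
  simp

theorem coeff_fc_linForm {R : Type*} [Ring R] [Algebra k R] (c : PowerSeries k) (T : σ → R)
    (d : σ →₀ ℕ) : coeff d (fc c (linForm T)) =
      PowerSeries.coeff d.degree c • coeff d (linForm T ^ d.degree) := by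
  change coeff d (∑ r ∈ Finset.range (d.degree + 1), _) = _
  rw [map_sum, Finset.sum_eq_single d.degree]
  · rfl
  · intro r _ hr
    rw [coeff_smul', linForm_pow_coeff T r d hr.symm, smul_zero]
  · simp

theorem minus_ent_fc {a : Type*} [Fintype a] [DecidableEq a] (c : PowerSeries k)
    (T : σ → Matrix a a k) (q p : a) :
    minus (ent (fc c (linForm T)) q p) =
      ent (fc (PowerSeries.rescale (-1) c) (linForm T)) q p := by
  ext d
  rw [coeff_minus, coeff_ent, coeff_ent, coeff_fc_linForm, coeff_fc_linForm,
    PowerSeries.coeff_rescale, Matrix.smul_apply, Matrix.smul_apply, smul_eq_mul, smul_eq_mul,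
    mul_assoc]

theorem fc_rescale {R : Type*} [Ring R] [Algebra k R] (c : PowerSeries k)
    (u : MvPowerSeries σ R) : fc (PowerSeries.rescale (-1) c) u = fc c (-u) := by
  ext d
  change coeff d (∑ r ∈ Finset.range (d.degree + 1), _) =
    coeff d (∑ r ∈ Finset.range (d.degree + 1), _)
  congr 1
  refine Finset.sum_congr rfl fun r _ => ?_
  rw [PowerSeries.coeff_rescale, neg_pow u, mul_comm, mul_smul]
  congr 1
  rcases Nat.even_or_odd r with h | h <;> simp [h.neg_one_pow]

theorem linForm_neg {R : Type*} [Ring R] (T : σ → R) :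
    linForm (fun μ => -T μ) = -linForm T := by
  rw [linForm, linForm, ← Finset.sum_neg_distrib]
  exact Finset.sum_congr rfl fun μ _ => map_neg _ _

theorem gen_neg {R : Type*} [Ring R] [Algebra k R] (T : σ → R) :
    gen k (fun μ => -T μ) = fc (PowerSeries.rescale (-1) (PowerSeries.exp k)) (linForm T) := by
  rw [gen, linForm_neg, fc_rescale]

theorem exp_mul_rescale : PowerSeries.exp k * PowerSeries.rescale (-1) (PowerSeries.exp k) = 1 :=
  PowerSeries.exp_mul_exp_neg_eq_one

theorem X_mul_phiSeries :
    PowerSeries.X * phiSeries k = 1 - PowerSeries.rescale (-1) (PowerSeries.exp k) := by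
  ext r
  rw [map_sub, PowerSeries.coeff_rescale, coeff_exp', PowerSeries.coeff_one]
  cases r with
  | zero => simp
  | succ r =>
    rw [PowerSeries.coeff_succ_X_mul, phiSeries, PowerSeries.coeff_mk, if_neg (Nat.succ_ne_zero r)]
    ring

theorem rescale_phiSeries :
    PowerSeries.rescale (-1) (phiSeries k) = PowerSeries.exp k * phiSeries k := by
  have h := congrArg (PowerSeries.rescale (-1 : k)) (X_mul_phiSeries (k := k))
  rw [map_mul, PowerSeries.rescale_neg_one_X, map_sub, map_one, PowerSeries.rescale_rescale,
    neg_one_mul, neg_neg, PowerSeries.rescale_one, RingHom.id_apply] at h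
  refine mul_left_cancel₀ (PowerSeries.X_ne_zero (R := k)) ?_
  have h2 := X_mul_phiSeries (k := k)
  have h3 := exp_mul_rescale (k := k)
  linear_combination -h - PowerSeries.exp k * h2 + h3

theorem rescale_inv_phiSeries : PowerSeries.rescale (-1)
    ((phiSeries k)⁻¹ * PowerSeries.rescale (-1) (PowerSeries.exp k)) = (phiSeries k)⁻¹ := by
  have h := congrArg (PowerSeries.rescale (-1 : k)) (phiSeries_mul_inv (k := k))
  rw [map_mul, map_one, rescale_phiSeries] at h
  rw [map_mul, PowerSeries.rescale_rescale, neg_one_mul, neg_neg, PowerSeries.rescale_one,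
    RingHom.id_apply]
  have h2 := phiSeries_mul_inv (k := k)
  linear_combination (phiSeries k)⁻¹ * h -
    (PowerSeries.rescale (-1) (phiSeries k)⁻¹ * PowerSeries.exp k) * h2

end Minus

/-! ### Behaviour of the fields under inversion, and the antipode identity for series -/

section Inverse

variable {k : Type u} [Field k] [CharZero k] {m n : ℕ} (L : InhomBialgebra k m n)

theorem kap_inl_inl (μ ρ : Fin n) : kap (pc L) (Sum.inl μ) (Sum.inl ρ) =
    ent (gen k fun μ => -adL (pc L) μ) ρ μ := by
  rw [← sub_eq_zero]
  have := isAddTorsionFree_of_algebra k k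
  refine family_eq_zero (fun ρ => kap (pc L) (Sum.inl μ) (Sum.inl ρ) -
    ent (gen k fun μ => -adL (pc L) μ) ρ μ) 0 1 (fun l => ?_)
    (fun N hN => by omega) (fun N hN l => ?_) ρ
  · refine OrdGE.one_of_coeff_eq ?_
    rw [coeff_ent, coeff_gen, sig_zero, coeff_zero_kap, Matrix.one_apply]
    simp
  · have : euler (kap (pc L) (Sum.inl μ) (Sum.inl l) -
        ent (gen k fun μ => -adL (pc L) μ) l μ) =
        -∑ p, (∑ ρ, L.γ ρ p l • X ρ) * (kap (pc L) (Sum.inl μ) (Sum.inl p) -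
          ent (gen k fun μ => -adL (pc L) μ) p μ) := by
      rw [map_sub, euler_kap, linForm_br, Fintype.sum_sum_type, ← ent_euler, euler_gen,
        linForm_neg, ent_mul, ← Finset.sum_neg_distrib]
      simp only [kap_inl_inr (pc_factorLie L), mul_zero, Finset.sum_const_zero, add_zero]
      rw [← Finset.sum_neg_distrib, ← Finset.sum_sub_distrib]
      refine Finset.sum_congr rfl fun p _ => ?_
      have h1 : ent (-linForm (adL (pc L))) l p = -∑ ρ, L.γ ρ p l • X ρ := by
        rw [← zero_sub, ent_sub, ent_linForm]
        exact zero_sub _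
      rw [h1]
      simp only [pc]
      ring
    rw [zero_smul, add_zero, this]
    refine OrdGE.neg (OrdGE.sum fun p _ => ?_)
    rw [add_comm]
    exact OrdGE.mul (OrdGE.sum fun ρ _ => (ordGE_X ρ).smul _) (hN p)

theorem rf_X (μ ν : Fin n) : rf L μ (X ν) =
    ent (fc (phiSeries k)⁻¹ (linForm (adL (pc L)))) ν μ := by
  rw [rf, vf_X, rfld, fieldOf, Finset.sum_eq_single μ]
  · rw [Pi.single_eq_same, one_mul]; rfl
  · intro b _ hb; rw [Pi.single_eq_of_ne hb, zero_mul]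
  · simp

theorem lf_X (μ ν : Fin n) : lf L μ (X ν) =
    ent (fc ((phiSeries k)⁻¹ * PowerSeries.rescale (-1) (PowerSeries.exp k))
      (linForm (adL (pc L)))) ν μ := by
  rw [lf, vf_X, fld, fieldOf, fc_mul _ _ (ordGE_linForm _), ← gen_neg, ent_mul]
  refine Finset.sum_congr rfl fun ρ _ => ?_
  rw [kap_inl_inl, mul_comm]; rfl

/-- Inversion exchanges left and right translations. The components of `R_μ` and `L_μ` are `φ⁻¹` and
`φ⁻¹ e^{-z}` at `z = ad x`, and `z ↦ -z` exchanges the two because `φ(-z) = e^z φ(z)`. -/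
theorem minus_lf (μ : Fin n) (f : MvPowerSeries (Fin n) k) :
    minus (lf L μ f) = -rf L μ (minus f) := by
  have h : ∀ s, minus (fld (pc L) (Sum.inl μ) s) = rfld (pc L) μ s := by
    intro s
    have h1 := lf_X L μ s
    have h2 := rf_X L μ s
    rw [lf, vf_X] at h1
    rw [rf, vf_X] at h2
    rw [h1, h2, minus_ent_fc, rescale_inv_phiSeries]
  rw [lf, minus_vf, rf, ← Derivation.neg_apply, ← vf_neg]
  refine congrArg (fun a => vf a (minus f)) ?_
  funext s
  rw [h]; rfl

theorem rf_minus (μ : Fin n) (f : MvPowerSeries (Fin n) k) :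
    rf L μ (minus f) = -minus (lf L μ f) := by rw [minus_lf, neg_neg]

theorem minus_ee (i l : Fin m) : minus (ee L i l) =
    ent (gen k fun ρ => -Matrix.of fun l i => L.α ρ i l) l i := by
  rw [ee_eq_ent, gen, minus_ent_fc, gen_neg]

theorem gen_mul_gen_neg {R : Type*} [Ring R] [Algebra k R] (T : Fin n → R) :
    gen k T * gen k (fun μ => -T μ) = 1 := by
  rw [gen_neg, gen, ← fc_mul _ _ (ordGE_linForm T), exp_mul_rescale, fc_one]

theorem gen_neg_mul_gen {R : Type*} [Ring R] [Algebra k R] (T : Fin n → R) :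
    gen k (fun μ => -T μ) * gen k T = 1 := by
  rw [gen_neg, gen, ← fc_mul _ _ (ordGE_linForm T), mul_comm, exp_mul_rescale, fc_one]

theorem sum_minus_ee_mul (i q : Fin m) :
    ∑ p, minus (ee L i p) * ee L p q = if i = q then 1 else 0 := by
  have := congrArg (fun f => ent f q i)
    (gen_mul_gen_neg (k := k) fun ρ => (Matrix.of fun l i => L.α ρ i l : Matrix (Fin m) (Fin m) k))
  simp only [ent_mul, ent_one] at this
  simp only [eq_comm (a := i), ← this]
  exact Finset.sum_congr rfl fun p _ => by rw [minus_ee, ee_eq_ent, mul_comm]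

theorem sum_ee_mul_minus (i q : Fin m) :
    ∑ p, ee L i p * minus (ee L p q) = if i = q then 1 else 0 := by
  have := congrArg (fun f => ent f q i)
    (gen_neg_mul_gen (k := k) fun ρ => (Matrix.of fun l i => L.α ρ i l : Matrix (Fin m) (Fin m) k))
  simp only [ent_mul, ent_one] at this
  simp only [eq_comm (a := i), ← this]
  exact Finset.sum_congr rfl fun p _ => by rw [minus_ee, ee_eq_ent, mul_comm]

/-- This is what makes `-∑ minus (e_i^l) H_l` a possible value of the antipode at `H_i`. As
inversion turns `L_μ` into `-R_μ`, the uniqueness argument runs along the right translations. -/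
theorem minus_af (i : Fin m) (f : MvPowerSeries (Fin n) k) :
    minus (af L i f) = ∑ l, minus (ee L i l) * af L l (minus f) := by
  rw [← sub_eq_zero]
  refine eq_zero_of_fields (fun μ => rf L μ) (sum_X_mul_rf L)
    (fun s : Fin m × MvPowerSeries (Fin n) k => minus (af L s.1 s.2) -
      ∑ l, minus (ee L s.1 l) * af L l (minus s.2)) ?_ ?_ (i, f)
  · rintro ⟨i, f⟩
    rw [map_sub, map_sum]
    have : constantCoeff (minus (af L i f)) = 0 := by
      rw [← coeff_zero_eq_constantCoeff_apply, coeff_minus, coeff_zero_eq_constantCoeff_apply,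
        constantCoeff_af, mul_zero]
    simp only [map_mul, constantCoeff_af, mul_zero, Finset.sum_const_zero, sub_zero]
    exact this
  · rintro N hN μ ⟨i, f⟩
    have : rf L μ (minus (af L i f) - ∑ l, minus (ee L i l) * af L l (minus f)) =
        -(minus (af L i (lf L μ f)) - ∑ l, minus (ee L i l) * af L l (minus (lf L μ f))) -
        ∑ p, L.α μ i p • (minus (af L p f) - ∑ l, minus (ee L p l) * af L l (minus f)) := by
      have e1 : ∀ l, rf L μ (minus (ee L i l) * af L l (minus f)) =
          -(∑ p, L.α μ i p • (minus (ee L p l) * af L l (minus f))) -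
            minus (ee L i l) * af L l (minus (lf L μ f)) -
            ∑ q, ∑ ν, L.A q μ ν • ((minus (ee L i l) * ee L l q) * minus (lf L ν f)) := by
        intro l
        rw [Derivation.leibniz, smul_eq_mul, smul_eq_mul, sub_eq_iff_eq_add.mp (rf_af L μ l _),
          rf_minus, rf_minus, lf_ee, map_sum, map_neg]
        simp only [rf_minus, mul_neg, smul_neg, Finset.sum_neg_distrib, map_smul, mul_add,
          Finset.mul_sum, mul_smul_comm, mul_assoc]
        simp only [mul_comm (af L l (minus f))]
        ring
      have e2 : ∑ l, ∑ q, ∑ ν, L.A q μ ν • ((minus (ee L i l) * ee L l q) * minus (lf L ν f)) =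
          ∑ ν, L.A i μ ν • minus (lf L ν f) := by
        rw [Finset.sum_comm]
        have : ∀ q, ∑ l, ∑ ν, L.A q μ ν • ((minus (ee L i l) * ee L l q) * minus (lf L ν f)) =
            if i = q then ∑ ν, L.A q μ ν • minus (lf L ν f) else 0 := by
          intro q
          rw [Finset.sum_comm]
          simp only [← Finset.smul_sum, ← Finset.sum_mul, sum_minus_ee_mul]
          split_ifs <;> simp
        simp only [this, Finset.sum_ite_eq, Finset.mem_univ, if_true]
      rw [map_sub, rf_minus, sub_eq_iff_eq_add.mp (lf_af L μ i f), map_sum (rf L μ)]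
      simp only [e1, Finset.sum_sub_distrib, Finset.sum_neg_distrib, e2]
      rw [Finset.sum_comm]
      simp only [map_add, map_sum, map_smul, smul_sub, Finset.sum_sub_distrib, Finset.smul_sum]
      abel
    change OrdGE N (rf L μ (minus (af L i f) - ∑ l, minus (ee L i l) * af L l (minus f)))
    rw [this]
    exact OrdGE.sub (OrdGE.neg (hN (i, lf L μ f))) (OrdGE.sum fun p _ => (hN (p, f)).smul _)

/-- The exponents of degree less than `N`. -/
def degLT (ι : Type*) [Fintype ι] [DecidableEq ι] (N : ℕ) : Finset (ι →₀ ℕ) :=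
  (Finset.range N).biUnion fun j => Finset.univ.finsuppAntidiag j

theorem mem_finsuppAntidiag_degree {ι : Type*} [Fintype ι] [DecidableEq ι] {a : ι →₀ ℕ} {j : ℕ} :
    a ∈ Finset.univ.finsuppAntidiag j ↔ a.degree = j := by
  rw [Finset.mem_finsuppAntidiag, Finsupp.degree_eq_sum]
  simp

theorem mem_degLT {ι : Type*} [Fintype ι] [DecidableEq ι] {N : ℕ} {a : ι →₀ ℕ} :
    a ∈ degLT ι N ↔ a.degree < N := by
  simp only [degLT, Finset.mem_biUnion, Finset.mem_range, mem_finsuppAntidiag_degree]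
  exact ⟨fun ⟨j, hj, h⟩ => h ▸ hj, fun h => ⟨_, h, rfl⟩⟩

theorem sum_degLT {ι : Type*} [Fintype ι] [DecidableEq ι] {M : Type*} [AddCommMonoid M] (N : ℕ)
    (F : (ι →₀ ℕ) → M) :
    ∑ a ∈ degLT _ N, F a = ∑ j ∈ Finset.range N, ∑ a ∈ Finset.univ.finsuppAntidiag j, F a := by
  rw [degLT, Finset.sum_biUnion]
  intro i _ j _ hij
  rw [Function.onFun, Finset.disjoint_left]
  intro a ha hb
  rw [mem_finsuppAntidiag_degree] at ha hb
  exact hij (ha.symm.trans hb)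

/-- The part of degree `j` in `X` of the evaluation of the shift at `-X`. -/
noncomputable def negShift (j : ℕ) (f : MvPowerSeries (Fin n) k) : MvPowerSeries (Fin n) k :=
  ∑ a ∈ Finset.univ.finsuppAntidiag j, minus (monomial a 1) * sl L a f

theorem minus_monomial (a : Fin n →₀ ℕ) :
    minus (monomial a 1 : MvPowerSeries (Fin n) k) = (-1 : k) ^ a.degree • monomial a 1 := by
  ext d
  rw [coeff_minus, coeff_smul', coeff_monomial, smul_eq_mul]
  split_ifs with h
  · rw [h]
  · simp

theorem ordGE_monomial (a : Fin n →₀ ℕ) (r : k) : OrdGE a.degree (monomial a r) := by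
  intro d hd
  rw [coeff_monomial, if_neg]
  rintro rfl
  exact lt_irrefl _ hd

theorem euler_monomial (a : Fin n →₀ ℕ) :
    euler (monomial a 1 : MvPowerSeries (Fin n) k) = a.degree • monomial a 1 := by
  ext d
  rw [coeff_euler, map_nsmul, coeff_monomial]
  split_ifs with h
  · rw [h]
  · simp

theorem ordGE_negShift (j : ℕ) (f : MvPowerSeries (Fin n) k) : OrdGE j (negShift L j f) := by
  refine OrdGE.sum fun a ha => OrdGE.mul_right _ ?_
  rw [mem_finsuppAntidiag_degree] at ha
  rw [← ha]
  exact (ordGE_monomial a 1).minus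

theorem euler_negShift (j : ℕ) (f : MvPowerSeries (Fin n) k) :
    euler (negShift L j f) = ∑ a ∈ Finset.univ.finsuppAntidiag j,
      minus (monomial a 1) * (a.degree • sl L a f) + ∑ ν, X ν * negShift L j (rf L ν f) := by
  rw [negShift, map_sum]
  simp only [negShift, Finset.mul_sum]
  rw [Finset.sum_comm (s := (Finset.univ : Finset (Fin n))), ← Finset.sum_add_distrib]
  refine Finset.sum_congr rfl fun a _ => ?_
  rw [euler_mul, minus_monomial, euler_smul, euler_monomial, ← sum_X_mul_rf L (sl L a f),
    Finset.mul_sum]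
  congr 1
  · rw [smul_comm, smul_mul_assoc, mul_smul_comm]
  · refine Finset.sum_congr rfl fun ν _ => ?_
    rw [sl_rf]
    ring

theorem euler_negShift_succ (j : ℕ) (f : MvPowerSeries (Fin n) k) :
    euler (negShift L (j + 1) f) = -∑ μ, X μ * negShift L j (lf L μ f) +
      ∑ ν, X ν * negShift L (j + 1) (rf L ν f) := by
  rw [euler_negShift]
  congr 1
  have : ∀ a ∈ Finset.univ.finsuppAntidiag (j + 1),
      minus (monomial a 1) * (a.degree • sl L a f) = ∑ μ, if Finsupp.single μ 1 ≤ a then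
        (fun μ b => -(X μ * (minus (monomial b 1) * sl L b (lf L μ f)))) μ
          (a - Finsupp.single μ 1) else 0 := by
    intro a _
    rw [sl_rec, Finset.mul_sum]
    refine Finset.sum_congr rfl fun μ _ => ?_
    split_ifs with h
    · have e : (monomial a 1 : MvPowerSeries (Fin n) k) =
          X μ * monomial (a - Finsupp.single μ 1) 1 := by
        rw [X_def, monomial_mul_monomial, add_tsub_cancel_of_le h, one_mul]
      rw [e, map_mul, minus_X]
      ring
    · rw [mul_zero]
  rw [Finset.sum_congr rfl this, sum_degree_succ j
    (fun μ b => -(X μ * (minus (monomial b 1) * sl L b (lf L μ f)))), ← Finset.sum_neg_distrib]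
  refine Finset.sum_congr rfl fun μ _ => ?_
  rw [negShift, Finset.mul_sum, Finset.sum_neg_distrib]

/-- Both `∑ X_μ L_μ` and `∑ X_μ R_μ` are the Euler operator, and the coefficient of `X_μ` in the
result is the constant term of the `μ`-th entry. -/
theorem constantCoeff_lf_eq_rf (μ : Fin n) (f : MvPowerSeries (Fin n) k) :
    constantCoeff (lf L μ f) = constantCoeff (rf L μ f) := by
  have h : ∀ D : Fin n → MvPowerSeries (Fin n) k,
      coeff (Finsupp.single μ 1) (∑ ν, X ν * D ν) = constantCoeff (D μ) := by
    intro D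
    rw [map_sum, Finset.sum_eq_single μ]
    · rw [coeff_X_mul', if_pos le_rfl, tsub_self, coeff_zero_eq_constantCoeff_apply]
    · intro ρ _ hρ
      rw [coeff_X_mul', if_neg]
      intro hle
      have := hle ρ
      rw [Finsupp.single_eq_same, Finsupp.single_eq_of_ne hρ] at this
      omega
    · simp
  rw [← h fun ν => lf L ν f, sum_X_mul_lf, ← sum_X_mul_rf L, h]

/-- A truncated form of `f(x⁻¹ x) = f(1)`. The Euler operator applied to the left side gives the
same expressions for `R_μ f` minus those for `L_μ f`, multiplied by `X_μ`; their constants cancel,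
so the order of the error grows step by step up to the truncation. -/
theorem negShift_sum (N : ℕ) (f : MvPowerSeries (Fin n) k) :
    OrdGE N (∑ a ∈ degLT _ N, minus (monomial a 1) * sl L a f - C (constantCoeff f)) := by
  rw [sum_degLT]
  change OrdGE N (∑ j ∈ Finset.range N, negShift L j f - C (constantCoeff f))
  cases N with
  | zero => exact OrdGE.zero' _
  | succ N =>
    -- By `euler_negShift_succ` the index of the `L_μ`-terms is shifted by one against that of the
    -- `R_μ`-terms, so cutting off at `N` leaves a last summand, which has order `N + 1`.
    have hz : ∀ f, euler (∑ j ∈ Finset.range (N + 1), negShift L j f) =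
        -∑ μ, X μ * ∑ j ∈ Finset.range (N + 1), negShift L j (lf L μ f) +
        ∑ μ, X μ * ∑ j ∈ Finset.range (N + 1), negShift L j (rf L μ f) +
        ∑ μ, X μ * negShift L N (lf L μ f) := by
      intro f
      rw [map_sum, Finset.sum_range_succ']
      simp only [euler_negShift_succ, Finset.sum_add_distrib, Finset.sum_neg_distrib]
      rw [euler_negShift, Finset.sum_eq_zero (f := fun a => minus (monomial a 1) *
        (a.degree • sl L a f)), zero_add]
      · have e1 : ∀ μ, ∑ j ∈ Finset.range (N + 1), negShift L j (lf L μ f) =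
            ∑ j ∈ Finset.range N, negShift L j (lf L μ f) + negShift L N (lf L μ f) :=
          fun μ => Finset.sum_range_succ _ _
        have e2 : ∀ μ, ∑ j ∈ Finset.range (N + 1), negShift L j (rf L μ f) =
            ∑ j ∈ Finset.range N, negShift L (j + 1) (rf L μ f) + negShift L 0 (rf L μ f) :=
          fun μ => Finset.sum_range_succ' _ _
        simp only [e1, e2, mul_add, Finset.sum_add_distrib, Finset.mul_sum]
        rw [Finset.sum_comm, Finset.sum_comm (s := Finset.range N)
          (f := fun j μ => X μ * negShift L (j + 1) (rf L μ f))]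
        ring
      · intro a ha
        rw [mem_finsuppAntidiag_degree.mp ha, zero_smul, mul_zero]
    have := isAddTorsionFree_of_algebra k k
    suffices h : ∀ j, j ≤ N → ∀ f, OrdGE (j + 1)
        (∑ j ∈ Finset.range (N + 1), negShift L j f - C (constantCoeff f)) from h N le_rfl f
    intro j
    induction j with
    | zero =>
      intro _ f
      rw [ordGE_one_iff, map_sub, Finset.sum_range_succ', map_add, map_sum,
        Finset.sum_eq_zero (fun j _ => ordGE_one_iff.mp ((ordGE_negShift L (j + 1) f).mono
          (by omega)))]
      have : negShift L 0 f = f := by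
        rw [negShift, Finset.finsuppAntidiag_zero, Finset.sum_singleton, sl_zero,
          minus_monomial, map_zero, pow_zero, one_smul, monomial_zero_one, one_mul]
      rw [this]
      simp
    | succ j ih =>
      intro hj f
      refine ordGE_succ_iff_euler 0 (by omega) (ih (by omega) f) ?_
      have e : euler (∑ j ∈ Finset.range (N + 1), negShift L j f - C (constantCoeff f)) +
          (0 : ℤ) • (∑ j ∈ Finset.range (N + 1), negShift L j f - C (constantCoeff f)) =
          -∑ μ, X μ * (∑ j ∈ Finset.range (N + 1), negShift L j (lf L μ f) -
            C (constantCoeff (lf L μ f))) +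
          ∑ μ, X μ * (∑ j ∈ Finset.range (N + 1), negShift L j (rf L μ f) -
            C (constantCoeff (rf L μ f))) +
          ∑ μ, X μ * negShift L N (lf L μ f) := by
        rw [zero_smul, add_zero, map_sub, euler_C, sub_zero, hz]
        simp only [constantCoeff_lf_eq_rf, mul_sub, Finset.sum_sub_distrib]
        ring
      rw [e]
      refine OrdGE.add (OrdGE.add (OrdGE.neg (OrdGE.sum fun μ _ => ?_)) (OrdGE.sum fun μ _ => ?_))
        (OrdGE.sum fun μ _ => ?_)
      · rw [add_comm]; exact (ordGE_X μ).mul (ih (by omega) _)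
      · rw [add_comm]; exact (ordGE_X μ).mul (ih (by omega) _)
      · rw [add_comm]; exact (ordGE_X μ).mul ((ordGE_negShift L N _).mono hj)

end Inverse

/-! ### Composition of one-variable series and the logarithm -/

section FcComp

variable {k : Type*} [Field k] [CharZero k]

/-- The substitution of `u` as an algebra homomorphism. -/
noncomputable def fcHom {σ R : Type*} [Ring R] [Algebra k R] {u : MvPowerSeries σ R}
    (hu : OrdGE 1 u) : PowerSeries k →ₐ[k] MvPowerSeries σ R :=
  AlgHom.ofLinearMap
    { toFun := fun c => fc c u
      map_add' := fun c c' => fc_add c c' u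
      map_smul' := fun r c => by
        ext d
        rw [RingHom.id_apply, coeff_smul']
        change coeff d (∑ q ∈ Finset.range (d.degree + 1), PowerSeries.coeff q (r • c) • u ^ q) =
          r • coeff d (∑ q ∈ Finset.range (d.degree + 1), PowerSeries.coeff q c • u ^ q)
        simp only [map_sum, Finset.smul_sum, coeff_smul', PowerSeries.coeff_smul, smul_eq_mul,
          mul_smul] }
    (fc_one u) (fun c c' => fc_mul c c' hu)

theorem fcHom_apply {σ R : Type*} [Ring R] [Algebra k R] {u : MvPowerSeries σ R}
    (hu : OrdGE 1 u) (c : PowerSeries k) : fcHom hu c = fc c u := rfl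

theorem ordGE_fc {σ R : Type*} [Ring R] [Algebra k R] {u : MvPowerSeries σ R}
    (hu : OrdGE 1 u) {N : ℕ} {c : PowerSeries k} (hc : ∀ r < N, PowerSeries.coeff r c = 0) :
    OrdGE N (fc c u) := by
  intro d hd
  rw [fc_eq_sum c hu N d hd, map_sum]
  refine Finset.sum_eq_zero fun r hr => ?_
  rw [hc r (Finset.mem_range.mp hr), zero_smul, map_zero]

theorem fc_subst {σ R : Type*} [Ring R] [Algebra k R] {u : MvPowerSeries σ R}
    (hu : OrdGE 1 u) (c d : PowerSeries k) (hd : PowerSeries.constantCoeff d = 0) :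
    fc (c.subst d) u = fc c (fc d u) := by
  have hs : PowerSeries.HasSubst d := PowerSeries.HasSubst.of_constantCoeff_zero' hd
  have hv : OrdGE 1 (fc d u) := ordGE_fc hu fun r hr => by
    have : r = 0 := by omega
    rw [this, PowerSeries.coeff_zero_eq_constantCoeff_apply, hd]
  refine eq_of_ordGE_sub fun N => ?_
  have h1 := fc_sub_ordGE c hv N
  have h2 : Polynomial.aeval (fc d u) (PowerSeries.trunc N c) =
      fc ((PowerSeries.trunc N c : PowerSeries k).subst d) u := by
    rw [PowerSeries.subst_coe hs]
    exact Polynomial.aeval_algHom_apply (fcHom hu) d _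
  rw [h2] at h1
  have h3 : OrdGE N (fc (c.subst d - (PowerSeries.trunc N c : PowerSeries k).subst d) u) := by
    refine ordGE_fc hu fun r hr => ?_
    rw [← PowerSeries.subst_sub hs]
    have hdvd : PowerSeries.X ^ N ∣ c - (PowerSeries.trunc N c : PowerSeries k) :=
      PowerSeries.X_pow_dvd_iff.mpr fun j hj => by
        rw [map_sub, Polynomial.coeff_coe, PowerSeries.coeff_trunc, if_pos hj, sub_self]
    obtain ⟨e, he⟩ := hdvd
    obtain ⟨e', he'⟩ := PowerSeries.X_dvd_iff.mpr hd
    rw [he, PowerSeries.subst_mul hs, PowerSeries.subst_pow hs, PowerSeries.subst_X hs]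
    have : d ^ N = PowerSeries.X ^ N * e' ^ N := by rw [he', mul_pow]
    rw [this, mul_assoc, PowerSeries.coeff_X_pow_mul', if_neg (by omega)]
  rw [fc_sub] at h3
  have := h3.sub h1
  rwa [sub_sub_sub_cancel_right] at this

/-- The power series `log (1 + z) / z`. -/
noncomputable def logDiv (k : Type*) [Field k] : PowerSeries k :=
  PowerSeries.mk fun r => (-1) ^ r / ((r : k) + 1)

theorem X_mul_logDiv : PowerSeries.X * logDiv k = PowerSeries.log k := by
  ext r
  cases r with
  | zero => simp
  | succ r =>
    rw [PowerSeries.coeff_succ_X_mul, logDiv, PowerSeries.coeff_mk, PowerSeries.coeff_log,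
      if_neg (Nat.succ_ne_zero r)]
    simp [pow_succ]

theorem log_subst_exp : (PowerSeries.log k).subst (PowerSeries.exp k - 1) = PowerSeries.X := by
  have hs := PowerSeries.HasSubst.exp_sub_one (A := k)
  refine PowerSeries.derivative.ext ?_ ?_
  · rw [PowerSeries.derivative_subst hs, PowerSeries.deriv_log, map_sub,
      PowerSeries.derivative_exp]
    have h1 : (PowerSeries.mk fun n => algebraMap ℚ k ((-1 : ℚ) ^ n)) * (1 + PowerSeries.X) = 1 := by
      ext r
      rw [mul_add, mul_one, map_add]
      cases r with
      | zero => simp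
      | succ r =>
        rw [PowerSeries.coeff_succ_mul_X, PowerSeries.coeff_mk, PowerSeries.coeff_mk,
          PowerSeries.coeff_one, if_neg (Nat.succ_ne_zero r)]
        simp [pow_succ]
    have h2 := congrArg (PowerSeries.subst (PowerSeries.exp k - 1)) h1
    rw [PowerSeries.subst_mul hs, PowerSeries.subst_add hs, PowerSeries.subst_X hs] at h2
    have h3 : PowerSeries.subst (PowerSeries.exp k - 1) (1 : PowerSeries k) = 1 := by
      rw [← PowerSeries.coe_substAlgHom hs, map_one]
    rw [h3] at h2
    simpa using h2
  · rw [PowerSeries.constantCoeff_X]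
    exact PowerSeries.constantCoeff_subst_eq_zero
      (by rw [map_sub, map_one, ← PowerSeries.constantCoeff_eq, PowerSeries.constantCoeff_exp,
            sub_self]) _ PowerSeries.constantCoeff_log

/-- Both sides are `z / (e^z - 1)`. This rewrites the components of `L_μ` as `log M / (M - 1)` with
`M = e^{ad x}`, the form in which Dynkin's formula arises. -/
theorem logDiv_subst_exp : (logDiv k).subst (PowerSeries.exp k - 1) =
    (phiSeries k)⁻¹ * PowerSeries.rescale (-1) (PowerSeries.exp k) := by
  have hs := PowerSeries.HasSubst.exp_sub_one (A := k)
  have h := congrArg (PowerSeries.subst (PowerSeries.exp k - 1)) (X_mul_logDiv (k := k))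
  rw [PowerSeries.subst_mul hs, PowerSeries.subst_X hs, log_subst_exp] at h
  have h0 : PowerSeries.exp k - 1 ≠ 0 := by
    intro h0
    rw [h0, zero_mul] at h
    exact PowerSeries.X_ne_zero h.symm
  refine mul_left_cancel₀ h0 ?_
  rw [h]
  have h1 := X_mul_phiSeries (k := k)
  have h2 := phiSeries_mul_inv (k := k)
  have h3 := exp_mul_rescale (k := k)
  linear_combination (-(PowerSeries.X : PowerSeries k)) * h2 + (phiSeries k)⁻¹ * h1 -
    (phiSeries k)⁻¹ * h3

end FcComp

/-! ### Homomorphisms applied to matrix entries -/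

section EntMap

variable {k : Type*} [Field k] [CharZero k] {σ τ : Type*} [Fintype σ] [DecidableEq σ]
  [Fintype τ] [DecidableEq τ] {a : Type*} [Fintype a] [DecidableEq a]

/-- An algebra homomorphism of power series applied to the entries of a matrix. -/
noncomputable def entMap (a : Type*) [Fintype a] [DecidableEq a]
    (Θ : MvPowerSeries σ k →ₐ[k] MvPowerSeries τ k) :
    MvPowerSeries σ (Matrix a a k) →ₐ[k] MvPowerSeries τ (Matrix a a k) :=
  AlgHom.ofLinearMap
    { toFun := fun F d q p => coeff d (Θ (ent F q p))
      map_add' := fun F G => by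
        refine ent_ext fun q p => ?_
        exact map_add Θ (ent F q p) (ent G q p)
      map_smul' := fun r F => by
        refine ent_ext fun q p => ?_
        exact map_smul Θ r (ent F q p) }
    (by
      refine ent_ext fun q p => ?_
      refine Eq.trans (?_ : _ = Θ (ent 1 q p)) ?_
      · rfl
      · rw [ent_one, ent_one]
        split_ifs <;> simp)
    (fun F G => by
      refine ent_ext fun q p => ?_
      refine Eq.trans (?_ : _ = Θ (ent (F * G) q p)) ?_
      · rfl
      · rw [ent_mul, ent_mul, map_sum]
        simp only [map_mul]
        rfl)

theorem ent_entMap (Θ : MvPowerSeries σ k →ₐ[k] MvPowerSeries τ k)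
    (F : MvPowerSeries σ (Matrix a a k)) (q p : a) : ent (entMap a Θ F) q p = Θ (ent F q p) := rfl

theorem entMap_fc (Θ : MvPowerSeries σ k →ₐ[k] MvPowerSeries τ k)
    (hΘ : ∀ N f, OrdGE N f → OrdGE N (Θ f)) (c : PowerSeries k)
    {u : MvPowerSeries σ (Matrix a a k)} (hu : OrdGE 1 u) :
    entMap a Θ (fc c u) = fc c (entMap a Θ u) := by
  have h0 : ∀ N F, OrdGE N F → OrdGE N (entMap a Θ F) := by
    intro N F hF d hd
    ext q p
    exact hΘ N (ent F q p) (fun e he => congrFun (congrFun (hF e he) q) p) d hd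
  refine eq_of_ordGE_sub fun N => ?_
  have h1 := h0 N _ (fc_sub_ordGE c hu N)
  have h2 := fc_sub_ordGE c (h0 1 _ hu) N
  rw [map_sub, ← Polynomial.aeval_algHom_apply] at h1
  have := h1.sub h2
  rwa [sub_sub_sub_cancel_right] at this

end EntMap

/-! ### The multiplication of the formal group -/

section Delta

variable {k : Type u} [Field k] [CharZero k] {m n : ℕ} (L : InhomBialgebra k m n)

/-- The exponents of the first variables. -/
noncomputable def fstE (d : Fin n ⊕ Fin n →₀ ℕ) : Fin n →₀ ℕ := d.comapDomain Sum.inl Sum.inl_injective.injOn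

/-- The exponents of the second variables. -/
noncomputable def sndE (d : Fin n ⊕ Fin n →₀ ℕ) : Fin n →₀ ℕ := d.comapDomain Sum.inr Sum.inr_injective.injOn

theorem fstE_apply (d : Fin n ⊕ Fin n →₀ ℕ) (i : Fin n) : fstE d i = d (Sum.inl i) := rfl

theorem sndE_apply (d : Fin n ⊕ Fin n →₀ ℕ) (i : Fin n) : sndE d i = d (Sum.inr i) := rfl

theorem degree_fst_add_snd (d : Fin n ⊕ Fin n →₀ ℕ) :
    (fstE d).degree + (sndE d).degree = d.degree := by
  rw [Finsupp.degree_eq_sum, Finsupp.degree_eq_sum, Finsupp.degree_eq_sum, Fintype.sum_sum_type]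
  rfl

theorem single_le_iff' {ι : Type*} (s : ι) (d : ι →₀ ℕ) : Finsupp.single s 1 ≤ d ↔ 1 ≤ d s := by
  classical
  refine ⟨fun h => by simpa using h s, fun h t => ?_⟩
  by_cases hst : s = t
  · subst hst; simpa using h
  · rw [Finsupp.single_eq_of_ne (Ne.symm hst)]; exact Nat.zero_le _

theorem fstE_sub_inl (d : Fin n ⊕ Fin n →₀ ℕ) (μ : Fin n) :
    fstE (d - Finsupp.single (Sum.inl μ) 1) = fstE d - Finsupp.single μ 1 := by
  ext i
  simp [fstE_apply, Finsupp.single_apply]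

theorem sndE_sub_inl (d : Fin n ⊕ Fin n →₀ ℕ) (μ : Fin n) :
    sndE (d - Finsupp.single (Sum.inl μ) 1) = sndE d := by
  ext i
  simp [sndE_apply]

theorem fstE_sub_inr (d : Fin n ⊕ Fin n →₀ ℕ) (μ : Fin n) :
    fstE (d - Finsupp.single (Sum.inr μ) 1) = fstE d := by
  ext i
  simp [fstE_apply]

theorem sndE_sub_inr (d : Fin n ⊕ Fin n →₀ ℕ) (μ : Fin n) :
    sndE (d - Finsupp.single (Sum.inr μ) 1) = sndE d - Finsupp.single μ 1 := by
  ext i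
  simp [sndE_apply, Finsupp.single_apply]

/-- The pullback of a function along the multiplication of the formal group. -/
noncomputable def dlt : MvPowerSeries (Fin n) k →ₗ[k] MvPowerSeries (Fin n ⊕ Fin n) k where
  toFun f := fun d => coeff (sndE d) (sl L (fstE d) f)
  map_add' f g := by
    ext d
    exact (congrArg (coeff (sndE d)) (map_add (sl L (fstE d)) f g)).trans (map_add _ _ _)
  map_smul' r f := by
    ext d
    exact (congrArg (coeff (sndE d)) (map_smul (sl L (fstE d)) r f)).trans (map_smul _ _ _)

theorem coeff_dlt (f : MvPowerSeries (Fin n) k) (d : Fin n ⊕ Fin n →₀ ℕ) :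
    coeff d (dlt L f) = coeff (sndE d) (sl L (fstE d) f) := rfl

theorem OrdGE.dlt {N : ℕ} {f : MvPowerSeries (Fin n) k} (hf : OrdGE N f) :
    OrdGE N (dlt L f) := by
  intro d hd
  have h := degree_fst_add_snd d
  rw [coeff_dlt]
  exact OrdGE.sl L (N := N - (fstE d).degree) _ (hf.mono (by omega)) _ (by omega)

/-- The degree splits into the degrees in the two sets of variables. In the first, the recursion for
`σ_a(L)` produces `L_μ`; in the second, `E = ∑ X_μ R_μ`, and `R_μ` commutes with `σ_a(L)`. -/
theorem euler_dlt (f : MvPowerSeries (Fin n) k) :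
    euler (dlt L f) = ∑ μ, X (Sum.inl μ) * dlt L (lf L μ f) +
      ∑ μ, X (Sum.inr μ) * dlt L (rf L μ f) := by
  ext d
  rw [coeff_euler, coeff_dlt, ← degree_fst_add_snd, add_smul, map_add, ← map_nsmul, sl_rec,
    ← coeff_euler, ← sum_X_mul_rf L (sl L (fstE d) f), map_sum, map_sum, map_sum, map_sum]
  congr 1
  · refine Finset.sum_congr rfl fun μ _ => ?_
    rw [coeff_X_mul', coeff_dlt, fstE_sub_inl, sndE_sub_inl]
    simp only [single_le_iff', fstE_apply]
    split_ifs
    · rfl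
    · exact map_zero _
  · refine Finset.sum_congr rfl fun μ _ => ?_
    rw [coeff_X_mul', coeff_X_mul', coeff_dlt, fstE_sub_inr, sndE_sub_inr, sl_rf]
    simp only [single_le_iff', sndE_apply]

theorem coeff_zero_dlt (f : MvPowerSeries (Fin n) k) : coeff 0 (dlt L f) = coeff 0 f := by
  have h1 : fstE (0 : Fin n ⊕ Fin n →₀ ℕ) = 0 := by ext i; rfl
  have h2 : sndE (0 : Fin n ⊕ Fin n →₀ ℕ) = 0 := by ext i; rfl
  rw [coeff_dlt, h1, h2, sl_zero]

/-- The `L_μ` and `R_μ` are derivations, so `E` of the defect of the pair `(f, g)` is a combination,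
with coefficients of order one, of defects of other pairs; the uniqueness principle is applied to
all pairs at once. -/
theorem dlt_mul (f g : MvPowerSeries (Fin n) k) : dlt L (f * g) = dlt L f * dlt L g := by
  rw [← sub_eq_zero]
  have := isAddTorsionFree_of_algebra k k
  refine family_eq_zero (fun s : MvPowerSeries (Fin n) k × MvPowerSeries (Fin n) k =>
    dlt L (s.1 * s.2) - dlt L s.1 * dlt L s.2) 0 1 ?_ (fun N hN => by omega) ?_ (f, g)
  · rintro ⟨f, g⟩
    refine OrdGE.one_of_coeff_eq ?_
    rw [coeff_zero_dlt]
    simp only [coeff_zero_eq_constantCoeff_apply, map_mul]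
    simp only [← coeff_zero_eq_constantCoeff_apply, coeff_zero_dlt]
  · rintro N hN ⟨f, g⟩
    have : euler (dlt L (f * g) - dlt L f * dlt L g) =
        ∑ μ, X (Sum.inl μ) * ((dlt L (lf L μ f * g) - dlt L (lf L μ f) * dlt L g) +
          (dlt L (f * lf L μ g) - dlt L f * dlt L (lf L μ g))) +
        ∑ μ, X (Sum.inr μ) * ((dlt L (rf L μ f * g) - dlt L (rf L μ f) * dlt L g) +
          (dlt L (f * rf L μ g) - dlt L f * dlt L (rf L μ g))) := by
      rw [map_sub, euler_mul, euler_dlt, euler_dlt, euler_dlt]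
      simp only [add_mul, mul_add, Finset.sum_mul, Finset.mul_sum]
      have e : ∀ (F G H K P Q : Fin n → MvPowerSeries (Fin n ⊕ Fin n) k),
        (∑ μ, F μ + ∑ μ, G μ) - (∑ μ, H μ + ∑ μ, K μ + (∑ μ, P μ + ∑ μ, Q μ)) =
          ∑ μ, (F μ - H μ - P μ) + ∑ μ, (G μ - K μ - Q μ) := by
        intro F G H K P Q
        simp only [Finset.sum_sub_distrib]
        ring
      rw [e]
      congr 1 <;> refine Finset.sum_congr rfl fun μ _ => ?_ <;>
        rw [Derivation.leibniz, smul_eq_mul, smul_eq_mul, map_add]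
      · rw [mul_comm g]; ring
      · rw [mul_comm g]; ring
    change OrdGE (N + 1) (euler (dlt L (f * g) - dlt L f * dlt L g) +
      (0 : ℤ) • (dlt L (f * g) - dlt L f * dlt L g))
    rw [zero_smul, add_zero, this]
    refine OrdGE.add (OrdGE.sum fun μ _ => ?_) (OrdGE.sum fun μ _ => ?_) <;> rw [add_comm] <;>
      refine (ordGE_X _).mul (OrdGE.add (hN (_, _)) (hN (_, _)))

theorem dlt_one : dlt L 1 = 1 := by
  rw [← sub_eq_zero]
  have := isAddTorsionFree_of_algebra k k
  refine family_eq_zero (fun _ : Unit => dlt L 1 - 1) 0 1 (fun _ => ?_) (fun N hN => by omega)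
    (fun N _ _ => ?_) ()
  · refine OrdGE.one_of_coeff_eq ?_
    rw [coeff_zero_dlt, coeff_zero_one, coeff_zero_one]
  · rw [zero_smul, add_zero, map_sub, euler_one, euler_dlt]
    simp only [Derivation.map_one_eq_zero, map_zero, mul_zero, Finset.sum_const_zero, add_zero,
      sub_zero]
    exact ordGE_zero _

/-- `dlt` as an algebra homomorphism. -/
noncomputable def dltHom : MvPowerSeries (Fin n) k →ₐ[k] MvPowerSeries (Fin n ⊕ Fin n) k :=
  AlgHom.ofLinearMap (dlt L) (dlt_one L) (dlt_mul L)

theorem dltHom_apply (f : MvPowerSeries (Fin n) k) : dltHom L f = dlt L f := rfl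

/-- The adjoint action of the first generic point. -/
noncomputable def adX : Fin n ⊕ Fin n → Matrix (Fin n) (Fin n) k := Sum.elim (adL (pc L)) 0

/-- The adjoint action of the second generic point. -/
noncomputable def adY : Fin n ⊕ Fin n → Matrix (Fin n) (Fin n) k := Sum.elim 0 (adL (pc L))

theorem lf_gen_neg (μ : Fin n) (q p : Fin n) :
    lf L μ (ent (gen k fun μ => -adL (pc L) μ) q p) =
      -∑ r, L.γ μ p r • ent (gen k fun μ => -adL (pc L) μ) q r := by
  simp only [← kap_inl_inl]
  rw [lf, fld_kap (pc_factorLie L), Fintype.sum_sum_type]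
  simp [pc]

theorem rf_gen_neg (μ : Fin n) (q p : Fin n) :
    rf L μ (ent (gen k fun μ => -adL (pc L) μ) q p) =
      -∑ r, L.γ μ r q • ent (gen k fun μ => -adL (pc L) μ) r p := by
  simp only [← kap_inl_inl]
  rw [rf, vf_kap (pc_factorLie L), om_rfld, br_apply, Finset.sum_eq_single (Sum.inl μ)]
  · rw [Fintype.sum_sum_type]
    simp [pc, kap_inl_inr (pc_factorLie L)]
  · intro b _ hb; simp [hb]
  · simp

theorem ent_linForm_adX (q p : Fin n) :
    ent (linForm (adX L)) q p = ∑ μ, L.γ μ p q • X (Sum.inl μ) := by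
  rw [ent_linForm, Fintype.sum_sum_type]
  simp [adX, adL, pc]

theorem ent_linForm_adY (q p : Fin n) :
    ent (linForm (adY L)) q p = ∑ μ, L.γ μ p q • X (Sum.inr μ) := by
  rw [ent_linForm, Fintype.sum_sum_type]
  simp [adY, adL, pc]

/-- The identity `Ad((gh)⁻¹) = Ad(h⁻¹) Ad(g⁻¹)`: with `x'` and `x''` the two generic points, both
sides solve `E D = -D (ad x') - (ad x'') D` and are 1 at the origin. -/
theorem entMap_gen_neg : entMap (Fin n) (dltHom L) (gen k fun μ => -adL (pc L) μ) =
    gen k (fun μ => -adY L μ) * gen k (fun μ => -adX L μ) := by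
  rw [← sub_eq_zero]
  have := isAddTorsionFree_of_algebra k (Matrix (Fin n) (Fin n) k)
  set K := gen k fun μ => -adL (pc L) μ with hK
  set D := entMap (Fin n) (dltHom L) K with hD
  set G := gen k (fun μ => -adY L μ) * gen k (fun μ => -adX L μ) with hG
  have e1 : euler D = -(D * linForm (adX L)) - linForm (adY L) * D := by
    refine ent_ext fun q p => ?_
    have h1 : euler (ent D q p) = -(∑ r, ent D q r * ent (linForm (adX L)) r p) -
        ∑ r, ent (linForm (adY L)) q r * ent D r p := by
      rw [hD]
      simp only [ent_entMap]
      rw [dltHom_apply, euler_dlt, hK]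
      simp only [lf_gen_neg, rf_gen_neg, map_neg, mul_neg, Finset.sum_neg_distrib]
      rw [sub_eq_add_neg]
      congr 2
      · rw [← hK]
        simp only [map_sum, map_smul, Finset.mul_sum, ent_linForm_adX]
        rw [Finset.sum_comm]
        refine Finset.sum_congr rfl fun r _ => Finset.sum_congr rfl fun μ _ => ?_
        rw [mul_smul_comm, mul_smul_comm, mul_comm]; rfl
      · rw [← hK]
        simp only [map_sum, map_smul, Finset.mul_sum, Finset.sum_mul, ent_linForm_adY]
        rw [Finset.sum_comm]
        refine Finset.sum_congr rfl fun r _ => Finset.sum_congr rfl fun μ _ => ?_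
        rw [mul_smul_comm, smul_mul_assoc]; rfl
    rw [ent_euler, h1, ent_sub, ent_mul, ← ent_mul D]
    rfl
  have e2 : euler G = -(G * linForm (adX L)) - linForm (adY L) * G := by
    rw [hG, euler_mul, euler_gen, euler_gen', linForm_neg, linForm_neg]
    noncomm_ring
  refine family_eq_zero (fun _ : Unit => D - G) 0 1 (fun _ => ?_) (fun N hN => by omega)
    (fun N hN _ => ?_) ()
  · refine OrdGE.one_of_coeff_eq ?_
    have h1 : coeff 0 G = 1 := by
      rw [hG, coeff_zero_eq_constantCoeff_apply, map_mul, ← coeff_zero_eq_constantCoeff_apply,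
        ← coeff_zero_eq_constantCoeff_apply, coeff_gen, coeff_gen, sig_zero, sig_zero, one_mul]
    ext q p
    rw [h1]
    change coeff 0 (ent D q p) = _
    rw [hD, ent_entMap, dltHom_apply, coeff_zero_dlt, coeff_ent, hK, coeff_gen, sig_zero]
  · have : euler (D - G) = -((D - G) * linForm (adX L)) - linForm (adY L) * (D - G) := by
      rw [map_sub, e1, e2]
      noncomm_ring
    rw [zero_smul, add_zero, this]
    refine OrdGE.sub (OrdGE.neg ((hN ()).mul (ordGE_linForm _))) ?_
    rw [add_comm]
    exact (ordGE_linForm _).mul (hN ())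

theorem entMap_gen : entMap (Fin n) (dltHom L) (gen k (adL (pc L))) =
    gen k (adX L) * gen k (adY L) := by
  have h1 := congrArg (entMap (Fin n) (dltHom L)) (gen_mul_gen_neg (k := k) (adL (pc L)))
  rw [map_mul, map_one, entMap_gen_neg] at h1
  have h2 : (gen k (fun μ => -adY L μ) * gen k (fun μ => -adX L μ)) *
      (gen k (adX L) * gen k (adY L)) = 1 := by
    have a1 : gen k (fun μ => -adX L μ) * gen k (adX L) = 1 := by
      rw [gen_neg, gen, ← fc_mul _ _ (ordGE_linForm _), mul_comm, exp_mul_rescale, fc_one]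
    have a2 : gen k (fun μ => -adY L μ) * gen k (adY L) = 1 := by
      rw [gen_neg, gen, ← fc_mul _ _ (ordGE_linForm _), mul_comm, exp_mul_rescale, fc_one]
    rw [mul_assoc, ← mul_assoc (gen k (fun μ => -adX L μ)), a1, one_mul, a2]
  exact left_inv_eq_right_inv h1 h2

/-- The Euler field applied to the Campbell-Hausdorff product, in closed form. -/
theorem euler_dlt_X (μ : Fin n) : euler (dlt L (X μ)) =
    ∑ ν, ent (fc (logDiv k) (gen k (adX L) * gen k (adY L) - 1)) μ ν * X (Sum.inl ν) +
    ∑ ν, ent (fc (logDiv k) (gen k (adX L) * gen k (adY L) - 1) *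
      (gen k (adX L) * gen k (adY L))) μ ν * X (Sum.inr ν) := by
  have hl : OrdGE 1 (linForm (adL (pc L))) := ordGE_linForm _
  have hD : OrdGE 1 (entMap (Fin n) (dltHom L) (linForm (adL (pc L)))) := by
    intro d hd
    ext q p
    exact OrdGE.dlt L (f := ent (linForm (adL (pc L))) q p)
      (fun e he => congrFun (congrFun (hl e he) q) p) d hd
  have hfc : ∀ c : PowerSeries k, entMap (Fin n) (dltHom L) (fc c (linForm (adL (pc L)))) =
      fc c (entMap (Fin n) (dltHom L) (linForm (adL (pc L)))) := fun c =>
    entMap_fc (dltHom L) (fun N f hf => OrdGE.dlt L hf) c hl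
  -- The pulled-back adjoint matrix is a logarithm of `M = e^{ad x'} e^{ad x''}`, so the components
  -- of `L_ν` and `R_ν` become `log M / (M - 1)` and `M log M / (M - 1)`.
  have hM : gen k (adX L) * gen k (adY L) =
      fc (PowerSeries.exp k) (entMap (Fin n) (dltHom L) (linForm (adL (pc L)))) := by
    rw [← entMap_gen, gen, hfc]
  have hlog : fc (logDiv k) (gen k (adX L) * gen k (adY L) - 1) =
      fc ((phiSeries k)⁻¹ * PowerSeries.rescale (-1) (PowerSeries.exp k))
        (entMap (Fin n) (dltHom L) (linForm (adL (pc L)))) := by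
    rw [← logDiv_subst_exp, fc_subst hD _ _ (by rw [map_sub, PowerSeries.constantCoeff_exp,
      map_one, sub_self]), fc_sub, fc_one, hM]
  have hphi : fc (logDiv k) (gen k (adX L) * gen k (adY L) - 1) *
      (gen k (adX L) * gen k (adY L)) =
      fc (phiSeries k)⁻¹ (entMap (Fin n) (dltHom L) (linForm (adL (pc L)))) := by
    rw [hlog, hM, ← fc_mul _ _ hD, mul_assoc, mul_comm _ (PowerSeries.exp k), exp_mul_rescale,
      mul_one]
  rw [euler_dlt, hphi, hlog, ← hfc, ← hfc]
  simp only [ent_entMap, dltHom_apply, lf_X, rf_X, mul_comm]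

end Delta

/-! ### Sums over words in two letters -/

section Words

variable {M : Type*} [AddCommMonoid M]

/-- The sum over all words of length `r`. -/
def sumWords : ℕ → (List Bool → M) → M
  | 0, F => F []
  | r + 1, F => sumWords r (fun w => F (false :: w)) + sumWords r (fun w => F (true :: w))

theorem sumWords_eq (r : ℕ) (F : List Bool → M) :
    ∑ w : Fin r → Bool, F (List.ofFn w) = sumWords r F := by
  induction r generalizing F with
  | zero => simp [sumWords]
  | succ r ih =>
    rw [sumWords, ← ih, ← ih, ← (Fin.consEquiv fun _ : Fin (r + 1) => Bool).sum_comp,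
      Fintype.sum_prod_type, Fintype.sum_bool, add_comm]
    simp [Fin.consEquiv, List.ofFn_succ]

theorem sumWords_add (r : ℕ) (F G : List Bool → M) :
    sumWords r (fun w => F w + G w) = sumWords r F + sumWords r G := by
  induction r generalizing F G with
  | zero => rfl
  | succ r ih => rw [sumWords, ih, ih, sumWords, sumWords]; abel

theorem sumWords_congr (r : ℕ) {F G : List Bool → M} (h : ∀ w, w.length = r → F w = G w) :
    sumWords r F = sumWords r G := by
  induction r generalizing F G with
  | zero => exact h [] rfl
  | succ r ih =>
    rw [sumWords, sumWords, ih fun w hw => h (false :: w) (by simp [hw]),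
      ih fun w hw => h (true :: w) (by simp [hw])]

theorem sumWords_map {N : Type*} [AddCommMonoid N] (f : M →+ N) (r : ℕ) (F : List Bool → M) :
    f (sumWords r F) = sumWords r fun w => f (F w) := by
  induction r generalizing F with
  | zero => rfl
  | succ r ih => rw [sumWords, map_add, ih, ih, sumWords]

theorem sumWords_zero (r : ℕ) : sumWords r (fun _ => (0 : M)) = 0 := by
  induction r with
  | zero => rfl
  | succ r ih => rw [sumWords, ih, add_zero]

theorem sumWords_split (r : ℕ) (F : List Bool → List Bool → M) :
    sumWords r (fun w => ∑ j ∈ Finset.range (w.length + 1), F (w.take j) (w.drop j)) =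
      ∑ j ∈ Finset.range (r + 1), sumWords j fun u => sumWords (r - j) fun v => F u v := by
  induction r generalizing F with
  | zero => simp [sumWords]
  | succ r ih =>
    rw [sumWords, Finset.sum_range_succ']
    have h : ∀ b, sumWords r (fun w => ∑ j ∈ Finset.range ((b :: w).length + 1),
        F ((b :: w).take j) ((b :: w).drop j)) = (∑ j ∈ Finset.range (r + 1),
          sumWords j fun u => sumWords (r - j) fun v => F (b :: u) v) +
          sumWords r fun w => F [] (b :: w) := by
      intro b
      rw [← ih fun u v => F (b :: u) v, ← sumWords_add]
      refine sumWords_congr r fun w _ => ?_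
      rw [List.length_cons, Finset.sum_range_succ']
      simp
    rw [h, h]
    have h2 : ∀ j, sumWords (j + 1) (fun u => sumWords (r + 1 - (j + 1)) fun v => F u v) =
        (sumWords j fun u => sumWords (r - j) fun v => F (false :: u) v) +
        (sumWords j fun u => sumWords (r - j) fun v => F (true :: u) v) := by
      intro j
      rw [sumWords, Nat.add_sub_add_right]
    simp only [h2, Finset.sum_add_distrib]
    have h3 : sumWords 0 (fun u => sumWords (r + 1 - 0) fun v => F u v) =
      (sumWords r fun w => F [] (false :: w)) + sumWords r fun w => F [] (true :: w) := rfl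
    rw [h3]
    abel

theorem sumWords_true (r : ℕ) (F : List Bool → M) :
    sumWords r (fun w => if w = List.replicate r true then F w else 0) =
      F (List.replicate r true) := by
  induction r generalizing F with
  | zero => simp [sumWords]
  | succ r ih =>
    rw [sumWords, sumWords_congr r (G := fun _ => 0), sumWords_zero, zero_add,
      sumWords_congr r (G := fun w => if w = List.replicate r true then F (true :: w) else 0)]
    · exact ih fun w => F (true :: w)
    · intro w _
      simp [List.replicate_succ]
    · intro w _
      simp [List.replicate_succ]

/-- The condition selects the sorted words `x^p y^{r-p}`. After a first letter `x` the rest is again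
sorted; after a first letter `y` all letters are `y`. -/
theorem sumWords_sorted (r : ℕ) (F : List Bool → M) :
    sumWords r (fun w => if w = List.replicate (w.count false) false ++
      List.replicate (w.count true) true then F w else 0) =
      ∑ p ∈ Finset.range (r + 1), F (List.replicate p false ++ List.replicate (r - p) true) := by
  induction r generalizing F with
  | zero => simp [sumWords]
  | succ r ih =>
    rw [sumWords, Finset.sum_range_succ']
    congr 1
    · rw [sumWords_congr r (G := fun w => if w = List.replicate (w.count false) false ++
        List.replicate (w.count true) true then F (false :: w) else 0), ih fun w => F (false :: w)]
      · refine Finset.sum_congr rfl fun p _ => ?_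
        rw [List.replicate_succ, Nat.add_sub_add_right, List.cons_append]
      · intro w _
        simp [List.replicate_succ]
    · rw [sumWords_congr r (G := fun w => if w = List.replicate r true then F (true :: w) else 0),
        sumWords_true r fun w => F (true :: w)]
      · simp [List.replicate_succ]
      · intro w hw
        have : (true :: w = List.replicate ((true :: w).count false) false ++
            List.replicate ((true :: w).count true) true) ↔ w = List.replicate r true := by
          constructor
          · intro h
            have h0 : w.count false = 0 := by
              by_contra h0
              obtain ⟨c, hc⟩ := Nat.exists_eq_succ_of_ne_zero h0
              have : (true :: w).count false = c + 1 := by simpa using hc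
              rw [this, List.replicate_succ] at h
              simp at h
            rw [List.eq_replicate_iff]
            refine ⟨hw, fun b hb => ?_⟩
            cases b with
            | true => rfl
            | false => exact absurd hb (List.count_eq_zero.mp h0)
          · intro h
            subst h
            simp [List.count_replicate, List.replicate_succ]
        simp only [this]

end Words

/-! ### Dynkin's form of the Campbell–Hausdorff series -/

section Dynkin

variable {k : Type u} [Field k] [CharZero k] {m n : ℕ} (L : InhomBialgebra k m n)

/-- A series is homogeneous of degree `r`. -/
def IsHom {σ R : Type*} [Ring R] (r : ℕ) (f : MvPowerSeries σ R) : Prop :=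
  ∀ d : σ →₀ ℕ, d.degree ≠ r → coeff d f = 0

theorem IsHom.mul {σ R : Type*} [Ring R] {r s : ℕ} {f g : MvPowerSeries σ R} (hf : IsHom r f)
    (hg : IsHom s g) : IsHom (r + s) (f * g) := by
  classical
  intro d hd
  rw [coeff_mul]
  refine Finset.sum_eq_zero fun p hp => ?_
  rw [Finset.HasAntidiagonal.mem_antidiagonal] at hp
  by_cases h1 : p.1.degree = r
  · rw [hg p.2 (fun h2 => hd (by rw [← hp, map_add, h1, h2])), mul_zero]
  · rw [hf p.1 h1, zero_mul]

theorem IsHom.add {σ R : Type*} [Ring R] {r : ℕ} {f g : MvPowerSeries σ R} (hf : IsHom r f)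
    (hg : IsHom r g) : IsHom r (f + g) := fun d hd => by rw [map_add, hf d hd, hg d hd, add_zero]

theorem IsHom.one {σ R : Type*} [Ring R] : IsHom 0 (1 : MvPowerSeries σ R) := by
  classical
  intro d hd
  rw [coeff_one, if_neg]
  rintro rfl
  exact hd (by simp)

theorem IsHom.smul {σ R : Type*} [Ring R] {S : Type*} [CommRing S] [Algebra S R] {r : ℕ}
    {f : MvPowerSeries σ R} (c : S) (hf : IsHom r f) : IsHom r (c • f) := fun d hd => by
  have : coeff d (c • f) = c • coeff d f := rfl
  rw [this, hf d hd, smul_zero]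

theorem IsHom.sumWords {σ R : Type*} [Ring R] {r s : ℕ} {F : List Bool → MvPowerSeries σ R}
    (h : ∀ w, w.length = r → IsHom s (F w)) : IsHom s (sumWords r F) := by
  induction r generalizing F with
  | zero => exact h [] rfl
  | succ r ih =>
    exact (ih fun w hw => h _ (by simp [hw])).add (ih fun w hw => h _ (by simp [hw]))

theorem IsHom.pow {σ R : Type*} [Ring R] {f : MvPowerSeries σ R} (hf : IsHom 1 f) (r : ℕ) :
    IsHom r (f ^ r) := by
  induction r with
  | zero => exact IsHom.one
  | succ r ih => rw [pow_succ]; exact ih.mul hf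

theorem isHom_linForm {σ R : Type*} [Fintype σ] [DecidableEq σ] [Ring R] (T : σ → R) :
    IsHom 1 (linForm T) := by
  intro d hd
  rw [linForm, map_sum]
  refine Finset.sum_eq_zero fun μ _ => ?_
  rw [coeff_monomial, if_neg]
  rintro rfl
  exact hd (Finsupp.degree_single _ _)

/-- The series with the given homogeneous parts. -/
noncomputable def tot {σ R : Type*} [Ring R] (s : ℕ → MvPowerSeries σ R) : MvPowerSeries σ R :=
  fun d => coeff d (s d.degree)

theorem coeff_tot {σ R : Type*} [Ring R] (s : ℕ → MvPowerSeries σ R) (d : σ →₀ ℕ) :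
    coeff d (tot s) = coeff d (s d.degree) := rfl

theorem tot_mul {σ R : Type*} [Ring R] {s t : ℕ → MvPowerSeries σ R} (hs : ∀ r, IsHom r (s r)) :
    tot (fun r => ∑ j ∈ Finset.range (r + 1), s j * t (r - j)) = tot s * tot t := by
  classical
  ext d
  rw [coeff_tot, map_sum, coeff_mul]
  simp only [coeff_mul]
  rw [Finset.sum_comm]
  refine Finset.sum_congr rfl fun p hp => ?_
  rw [Finset.HasAntidiagonal.mem_antidiagonal] at hp
  have hdeg : p.1.degree + p.2.degree = d.degree := by rw [← hp, map_add]
  rw [Finset.sum_eq_single p.1.degree, coeff_tot, coeff_tot]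
  · congr 3
    omega
  · intro j _ hj
    rw [hs j p.1 hj.symm, zero_mul]
  · intro h
    rw [Finset.mem_range] at h
    omega

theorem tot_add {σ R : Type*} [Ring R] (s t : ℕ → MvPowerSeries σ R) :
    tot (fun r => s r + t r) = tot s + tot t := by
  ext d
  rw [coeff_tot, map_add, map_add]; rfl

theorem tot_gen {σ R : Type*} [Fintype σ] [DecidableEq σ] [Ring R] [Algebra k R] (T : σ → R) :
    tot (fun r => ((r ! : ℕ) : k)⁻¹ • linForm T ^ r) = gen k T := by
  ext d
  rw [coeff_tot, gen, coeff_fc_linForm, coeff_exp']; rfl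

/-- The matrix series of a letter. -/
noncomputable def letterM (b : Bool) : MvPowerSeries (Fin n ⊕ Fin n) (Matrix (Fin n) (Fin n) k) :=
  if b then linForm (adY L) else linForm (adX L)

/-- The vector of a letter, as a matrix with equal columns. -/
noncomputable def letterV (k : Type u) [Field k] {n : ℕ} (b : Bool) :
    MvPowerSeries (Fin n ⊕ Fin n) (Matrix (Fin n) (Fin n) k) :=
  linForm (Sum.elim (fun μ => if b then 0 else Matrix.of fun q _ => if q = μ then 1 else 0)
    (fun μ => if b then Matrix.of fun q _ => if q = μ then 1 else 0 else 0))

theorem isHom_letterM (b : Bool) : IsHom 1 (letterM L b) := by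
  cases b <;> exact isHom_linForm _

/-- The operator of a word. -/
noncomputable def wordM : List Bool → MvPowerSeries (Fin n ⊕ Fin n) (Matrix (Fin n) (Fin n) k)
  | [] => 1
  | b :: w => letterM L b * wordM w

/-- The nested bracket of a word, as a matrix with equal columns. -/
noncomputable def wordV : List Bool → MvPowerSeries (Fin n ⊕ Fin n) (Matrix (Fin n) (Fin n) k)
  | [] => 0
  | [b] => letterV k b
  | b :: c :: w => letterM L b * wordV (c :: w)

theorem isHom_wordM (w : List Bool) : IsHom w.length (wordM L w) := by
  induction w with
  | nil => exact IsHom.one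
  | cons b w ih =>
    rw [wordM, List.length_cons, add_comm]
    exact (isHom_letterM L b).mul ih

/-- A prefix acts on a nested bracket through the product of the adjoint operators of its letters.
The empty suffix must be excluded, because its nested bracket is 0. -/
theorem wordV_append (u v : List Bool) (hv : v ≠ []) : wordV L (u ++ v) = wordM L u * wordV L v := by
  induction u with
  | nil => rw [List.nil_append, wordM, one_mul]
  | cons b u ih =>
    obtain ⟨c, w, hw⟩ := List.exists_cons_of_ne_nil (l := u ++ v) (by simp [hv])
    rw [List.cons_append, hw, wordV, ← hw, ih, wordM, mul_assoc]

theorem wordM_append (u v : List Bool) : wordM L (u ++ v) = wordM L u * wordM L v := by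
  induction u with
  | nil => rw [List.nil_append, wordM, one_mul]
  | cons b u ih => rw [List.cons_append, wordM, ih, wordM, mul_assoc]

theorem wordM_replicate (b : Bool) (r : ℕ) :
    wordM L (List.replicate r b) = letterM L b ^ r := by
  induction r with
  | zero => rfl
  | succ r ih => rw [List.replicate_succ, wordM, ih, pow_succ']

theorem letterM_mul_letterV (b : Bool) : letterM L b * letterV k b = 0 := by
  have h : ∀ (Z : Fin n → MvPowerSeries (Fin n ⊕ Fin n) k) (q : Fin n),
      ∑ r, (∑ μ, L.γ μ r q • Z μ) * Z r = 0 := by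
    intro Z q
    have := isAddTorsionFree_of_algebra k (MvPowerSeries (Fin n ⊕ Fin n) k)
    refine self_eq_neg.mp ?_
    simp only [Finset.sum_mul]
    conv_rhs => rw [Finset.sum_comm, ← Finset.sum_neg_distrib]
    refine Finset.sum_congr rfl fun r _ => ?_
    rw [← Finset.sum_neg_distrib]
    refine Finset.sum_congr rfl fun μ _ => ?_
    rw [L.γ_skew, neg_smul, neg_mul, smul_mul_assoc, smul_mul_assoc, mul_comm]
  refine ent_ext fun q p => ?_
  have h0 : ent (0 : MvPowerSeries (Fin n ⊕ Fin n) (Matrix (Fin n) (Fin n) k)) q p = 0 := rfl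
  rw [h0, ent_mul]
  cases b with
  | false =>
    refine Eq.trans ?_ (h (fun μ => X (Sum.inl μ)) q)
    refine Finset.sum_congr rfl fun r _ => ?_
    have h1 : ent (letterM L false) q r = _ := ent_linForm_adX L q r
    rw [h1, letterV, ent_linForm, Fintype.sum_sum_type]
    simp [Matrix.of_apply, ite_smul]
  | true =>
    refine Eq.trans ?_ (h (fun μ => X (Sum.inr μ)) q)
    refine Finset.sum_congr rfl fun r _ => ?_
    have h1 : ent (letterM L true) q r = _ := ent_linForm_adY L q r
    rw [h1, letterV, ent_linForm, Fintype.sum_sum_type]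
    simp [Matrix.of_apply, ite_smul]

theorem coe_nestedBracket (w : List Bool) (μ p : Fin n) :
    ((nestedBracket (R := MvPolynomial (Fin n ⊕ Fin n) k) L.γ
      (fun ν => MvPolynomial.X (Sum.inl ν)) (fun ν => MvPolynomial.X (Sum.inr ν)) w μ :
        MvPolynomial (Fin n ⊕ Fin n) k) : MvPowerSeries (Fin n ⊕ Fin n) k) =
      ent (wordV L w) μ p := by
  induction w generalizing μ with
  | nil =>
    rw [nestedBracket]
    exact MvPolynomial.coe_zero
  | cons b w ih =>
    cases w with
    | nil =>
      rw [nestedBracket, wordV, letterV, ent_linForm, Fintype.sum_sum_type]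
      cases b <;> simp [Matrix.of_apply, ite_smul]
    | cons c w =>
      rw [nestedBracket, wordV, ent_mul, scBracket]
      have e : ∀ (r : k) (f : MvPolynomial (Fin n ⊕ Fin n) k),
          ((r • f : MvPolynomial (Fin n ⊕ Fin n) k) : MvPowerSeries (Fin n ⊕ Fin n) k) =
            r • (f : MvPowerSeries (Fin n ⊕ Fin n) k) := fun r f => by ext d; simp
      simp only [← MvPolynomial.coeToMvPowerSeries.ringHom_apply, map_sum]
      simp only [MvPolynomial.coeToMvPowerSeries.ringHom_apply, e, MvPolynomial.coe_mul, ih]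
      rw [Finset.sum_comm]
      refine Finset.sum_congr rfl fun r _ => ?_
      cases b with
      | false =>
        have h1 : ent (letterM L false) μ r = _ := ent_linForm_adX L μ r
        rw [h1, Finset.sum_mul]
        exact Finset.sum_congr rfl fun ν _ => by simp
      | true =>
        have h1 : ent (letterM L true) μ r = _ := ent_linForm_adY L μ r
        rw [h1, Finset.sum_mul]
        exact Finset.sum_congr rfl fun ν _ => by simp

theorem sumWords_expExp {R : Type*} [AddCommGroup R] [Module k R] (r : ℕ) (F : List Bool → R) :
    sumWords (r + 1) (fun w => ((expExpCoeff w : ℚ) : k) • F w) =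
      ∑ p ∈ Finset.range (r + 2), ((p ! : k)⁻¹ * ((r + 1 - p)! : k)⁻¹) •
        F (List.replicate p false ++ List.replicate (r + 1 - p) true) := by
  rw [sumWords_congr (r + 1) (G := fun w => if w = List.replicate (w.count false) false ++
      List.replicate (w.count true) true then
        (((w.count false)! : k)⁻¹ * ((w.count true)! : k)⁻¹) • F w else 0), sumWords_sorted]
  · refine Finset.sum_congr rfl fun p _ => ?_
    simp [List.count_append, List.count_replicate]
  · intro w hw
    have hne : w ≠ [] := by rintro rfl; simp at hw
    unfold expExpCoeff
    by_cases h : w = List.replicate (w.count false) false ++ List.replicate (w.count true) true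
    · rw [if_pos ⟨hne, h⟩, if_pos h]
      push_cast
      rw [mul_inv]
    · rw [if_neg (fun h' => h h'.2), if_neg h, Rat.cast_zero, zero_smul]

theorem expExpCoeff_nil : expExpCoeff [] = 0 := by
  rw [expExpCoeff, if_neg]
  exact fun h => h.1 rfl

theorem expExpPowCoeff_succ_nil (q : ℕ) : expExpPowCoeff (q + 1) [] = 0 := by
  rw [expExpPowCoeff]
  simp [expExpCoeff_nil]

/-- The homogeneous parts of `e^X e^Y - 1`. -/
noncomputable def expU (r : ℕ) : MvPowerSeries (Fin n ⊕ Fin n) (Matrix (Fin n) (Fin n) k) :=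
  sumWords r fun w => ((expExpCoeff w : ℚ) : k) • wordM L w

/-- The homogeneous parts of the nested brackets of the terms of `(e^X e^Y - 1) ^ q`. -/
noncomputable def expV (q r : ℕ) : MvPowerSeries (Fin n ⊕ Fin n) (Matrix (Fin n) (Fin n) k) :=
  sumWords r fun w => ((expExpPowCoeff q w : ℚ) : k) • wordV L w

theorem isHom_expU (r : ℕ) : IsHom r (expU L r) :=
  IsHom.sumWords fun w hw => (hw ▸ isHom_wordM L w).smul _

/-- In `(e^x e^y - 1)^{q+2}` the words are cut after their first factor: the prefix becomes an
operator and the suffix stays a vector. -/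
theorem expV_succ (q r : ℕ) : expV L (q + 2) r =
    ∑ j ∈ Finset.range (r + 1), expU L j * expV L (q + 1) (r - j) := by
  have h : ∀ j, expU L j * expV L (q + 1) (r - j) = sumWords j fun u => sumWords (r - j) fun v =>
      (((expExpCoeff u : ℚ) : k) • wordM L u) *
        (((expExpPowCoeff (q + 1) v : ℚ) : k) • wordV L v) := by
    intro j
    rw [expU, ← AddMonoidHom.mulRight_apply, sumWords_map]
    refine sumWords_congr j fun u _ => ?_
    rw [AddMonoidHom.mulRight_apply, expV]
    exact sumWords_map (AddMonoidHom.mulLeft (((expExpCoeff u : ℚ) : k) • wordM L u)) _ _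
  simp only [h]
  rw [← sumWords_split, expV]
  refine sumWords_congr r fun w _ => ?_
  rw [expExpPowCoeff, Rat.cast_sum, Finset.sum_smul]
  refine Finset.sum_congr rfl fun j _ => ?_
  -- For the empty suffix `wordV_append` is not available, but then the coefficient from the
  -- remaining power is zero.
  by_cases hv : w.drop j = []
  · rw [hv, expExpPowCoeff_succ_nil, mul_zero, Rat.cast_zero, zero_smul, zero_smul, mul_zero]
  · conv_lhs => rw [← List.take_append_drop j w, wordV_append L _ _ hv,
      List.take_append_drop j w]
    rw [smul_mul_smul_comm, Rat.cast_mul]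

theorem expV_one (r : ℕ) :
    expV L 1 r = sumWords r fun w => ((expExpCoeff w : ℚ) : k) • wordV L w := by
  refine sumWords_congr r fun w _ => ?_
  rw [expExpPowCoeff, Finset.sum_eq_single w.length]
  · simp [expExpPowCoeff]
  · intro j hj hne
    rw [Finset.mem_range] at hj
    rw [expExpPowCoeff, if_neg, mul_zero]
    rw [List.drop_eq_nil_iff]
    omega
  · simp

theorem tot_expU : tot (expU L) = gen k (adX L) * gen k (adY L) - 1 := by
  rw [eq_sub_iff_add_eq]
  have h1 : (1 : MvPowerSeries (Fin n ⊕ Fin n) (Matrix (Fin n) (Fin n) k)) =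
      tot fun r => if r = 0 then 1 else 0 := by
    ext1 d
    rw [coeff_tot]
    split_ifs with h
    · rfl
    · rw [map_zero]; exact IsHom.one d h
  rw [h1, ← tot_add, ← tot_gen, ← tot_gen, ← tot_mul]
  · congr 1
    funext r
    cases r with
    | zero => simp [expU, sumWords, expExpCoeff_nil]
    | succ r =>
      rw [expU, sumWords_expExp, if_neg (Nat.succ_ne_zero r), add_zero]
      refine Finset.sum_congr rfl fun p _ => ?_
      rw [wordM_append, wordM_replicate, wordM_replicate, smul_mul_smul_comm]
      rfl
  · exact fun r => ((isHom_linForm _).pow r).smul _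

theorem wordV_sorted (p s : ℕ) :
    wordV L (List.replicate p false ++ List.replicate (s + 1) true) =
      if s = 0 then linForm (adX L) ^ p * letterV k true else 0 := by
  rw [wordV_append L _ _ (by simp), wordM_replicate]
  cases s with
  | zero => rfl
  | succ s =>
    rw [if_neg (Nat.succ_ne_zero s), List.replicate_add (s + 1) 1,
      wordV_append L _ _ (by simp), wordM_replicate, pow_succ, mul_assoc (letterM L true ^ s)]
    have : letterM L true * wordV L (List.replicate 1 true) = 0 := letterM_mul_letterV L true
    rw [this, mul_zero, mul_zero]

theorem wordV_false (p : ℕ) : wordV L (List.replicate (p + 1) false) =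
    if p = 0 then letterV k false else 0 := by
  cases p with
  | zero => rfl
  | succ p =>
    rw [if_neg (Nat.succ_ne_zero p), List.replicate_add (p + 1) 1,
      wordV_append L _ _ (by simp), wordM_replicate, pow_succ, mul_assoc]
    have : letterM L false * wordV L (List.replicate 1 false) = 0 := letterM_mul_letterV L false
    rw [this, mul_zero]

/-- Since `[y, y] = [x, x] = 0`, the only words `x^p y^s` of `e^x e^y - 1` with a nonzero nested
bracket are those with `s = 1` and the word `x`; they sum to `e^{ad x} y + x`. -/
theorem tot_expV_one :
    tot (expV L 1) = gen k (adX L) * letterV k true + letterV k false := by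
  have h : ∀ b, letterV k b = tot (σ := Fin n ⊕ Fin n) (R := Matrix (Fin n) (Fin n) k)
      fun r => if r = 1 then letterV k b else 0 := by
    intro b
    ext1 d
    rw [coeff_tot]
    split_ifs with h
    · rfl
    · rw [map_zero]
      exact isHom_linForm _ d h
  have e := h true
  have e' := h false
  generalize hT : (tot fun r => if r = 1 then letterV k true else 0 :
    MvPowerSeries (Fin n ⊕ Fin n) (Matrix (Fin n) (Fin n) k)) = T at e
  generalize hF : (tot fun r => if r = 1 then letterV k false else 0 :
    MvPowerSeries (Fin n ⊕ Fin n) (Matrix (Fin n) (Fin n) k)) = F at e'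
  rw [e, e', ← hT, ← hF, ← tot_gen, ← tot_mul, ← tot_add]
  · congr 1
    funext r
    rw [expV_one]
    cases r with
    | zero => simp [sumWords, expExpCoeff_nil]
    | succ r =>
      rw [sumWords_expExp, Finset.sum_range_succ, Finset.sum_range_succ _ (r + 1)]
      congr 1
      · rw [Nat.sub_self, if_neg zero_ne_one, mul_zero, add_zero]
        refine Finset.sum_congr rfl fun p hp => ?_
        rw [Finset.mem_range] at hp
        obtain ⟨s, hs⟩ : ∃ s, r + 1 - p = s + 1 := ⟨r - p, by omega⟩
        rw [hs, wordV_sorted]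
        by_cases h0 : s = 0
        · subst h0
          simp
        · rw [if_neg h0, if_neg (by omega), smul_zero, mul_zero]
      · rw [Nat.sub_self, List.replicate_zero, List.append_nil, wordV_false]
        by_cases h0 : r = 0
        · subst h0
          simp
        · rw [if_neg h0, if_neg (by omega), smul_zero]
  · exact fun r => ((isHom_linForm _).pow r).smul _

theorem tot_expV (q : ℕ) : tot (expV L (q + 1)) = tot (expU L) ^ q * tot (expV L 1) := by
  induction q with
  | zero => rw [pow_zero, one_mul]
  | succ q ih =>
    rw [pow_succ', mul_assoc, ← ih, ← tot_mul (isHom_expU L)]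
    exact congrArg tot (funext fun r => expV_succ L q r)

theorem ordGE_tot {σ R : Type*} [Ring R] {s : ℕ → MvPowerSeries σ R} (h : s 0 = 0) :
    OrdGE 1 (tot s) := by
  intro d hd
  rw [coeff_tot, Nat.lt_one_iff.mp hd, h, map_zero]

/-- The Euler operator cancels the factor `1/r` of Dynkin's formula. In `∑ (-1)^q/(q+1) (e^x e^y -
1)^{q+1}` the last factor yields the vector and the other `q` factors become powers of `M - 1`,
which leaves `log M / (M - 1)` applied to that vector. The column `p` is arbitrary because vectors
are stored as matrices with equal columns. -/
theorem coeff_euler_chSeries (μ p : Fin n) (d : Fin n ⊕ Fin n →₀ ℕ) :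
    coeff d (euler (chSeries L.γ μ)) =
      coeff d (ent (fc (logDiv k) (tot (expU L)) * tot (expV L 1)) μ p) := by
  have hU : OrdGE 1 (tot (expU L)) := ordGE_tot (by simp [expU, sumWords, expExpCoeff_nil])
  have hV : OrdGE 1 (tot (expV L 1)) := ordGE_tot (by
    rw [expV_one]; simp [sumWords, expExpCoeff_nil])
  set r := d.degree with hr
  have e1 : coeff d (fc (logDiv k) (tot (expU L)) * tot (expV L 1)) =
      ∑ q ∈ Finset.range r, PowerSeries.coeff q (logDiv k) • coeff d (expV L (q + 1) r) := by
    have h1 := (fc_sub_ordGE (logDiv k) hU r).mul hV d (by omega)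
    rw [sub_mul, map_sub, sub_eq_zero] at h1
    rw [h1, show PowerSeries.trunc r (logDiv k) = ∑ q ∈ Finset.Ico 0 r,
      Polynomial.monomial q (PowerSeries.coeff q (logDiv k)) from rfl, map_sum, Finset.sum_mul,
      map_sum, ← Finset.range_eq_Ico]
    refine Finset.sum_congr rfl fun q _ => ?_
    rw [Polynomial.aeval_monomial, mul_assoc, ← tot_expV, ← Algebra.smul_def, coeff_smul',
      coeff_tot]
  have e2 : coeff d (euler (chSeries L.γ μ)) = ∑ w : Fin r → Bool,
      ((logCoeff (List.ofFn w) : ℚ) : k) * coeff d (ent (wordV L (List.ofFn w)) μ p) := by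
    rw [coeff_euler]
    change r • ∑ w : Fin r → Bool, _ = _
    rw [Finset.smul_sum]
    refine Finset.sum_congr rfl fun w _ => ?_
    rw [← coe_nestedBracket, MvPolynomial.coeff_coe, nsmul_eq_mul, ← mul_assoc]
    congr 1
    rcases Nat.eq_zero_or_pos r with h0 | h0
    · have : logCoeff (List.ofFn w) = 0 := by
        have hz : ∀ w : List Bool, w.length = 0 → logCoeff w = 0 := fun w hw => by
          rw [logCoeff, hw]; simp
        exact hz _ (by rw [List.length_ofFn, h0])
      rw [this]; simp
    · have : (r : k) ≠ 0 := Nat.cast_ne_zero.mpr h0.ne'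
      rw [Rat.cast_div, Rat.cast_natCast]
      exact mul_div_cancel₀ _ this
  rw [e2, coeff_ent, e1, sumWords_eq r fun w => ((logCoeff w : ℚ) : k) * coeff d (ent (wordV L w) μ p)]
  have e3 : ∀ q, (coeff d (expV L q r)) μ p =
      sumWords r fun w => ((expExpPowCoeff q w : ℚ) : k) * coeff d (ent (wordV L w) μ p) := by
    intro q
    let f : MvPowerSeries (Fin n ⊕ Fin n) (Matrix (Fin n) (Fin n) k) →+ k :=
      { toFun := fun F => coeff d F μ p
        map_zero' := rfl
        map_add' := fun _ _ => rfl }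
    exact sumWords_map f r _
  rw [Matrix.sum_apply]
  simp only [Matrix.smul_apply, e3, smul_eq_mul]
  have e4 : ∀ q, PowerSeries.coeff q (logDiv k) * (sumWords r fun w =>
      ((expExpPowCoeff (q + 1) w : ℚ) : k) * coeff d (ent (wordV L w) μ p)) =
      sumWords r fun w => PowerSeries.coeff q (logDiv k) *
      (((expExpPowCoeff (q + 1) w : ℚ) : k) * coeff d (ent (wordV L w) μ p)) := fun q =>
    sumWords_map (AddMonoidHom.mulLeft (PowerSeries.coeff q (logDiv k))) r _
  simp only [e4]
  have e5 : ∀ (s : Finset ℕ) (G : ℕ → List Bool → k), ∑ q ∈ s, sumWords r (G q) =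
      sumWords r fun w => ∑ q ∈ s, G q w := by
    intro s G
    induction s using Finset.induction_on with
    | empty => simp [sumWords_zero]
    | insert q s hq ih =>
      simp only [Finset.sum_insert hq, sumWords_add, ih]
  rw [e5]
  refine sumWords_congr r fun w hw => ?_
  rw [logCoeff, hw, show Finset.Icc 1 r = Finset.Ico (0 + 1) (r + 1) from by
    ext q; simp only [Finset.mem_Icc, Finset.mem_Ico]; omega, ← Finset.sum_Ico_add',
    ← Finset.range_eq_Ico, Rat.cast_sum, Finset.sum_mul]
  refine Finset.sum_congr rfl fun q _ => ?_
  rw [logDiv, PowerSeries.coeff_mk, ← mul_assoc]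
  congr 1
  push_cast
  rw [pow_add (-1 : k) q 2, show ((-1 : k)) ^ 2 = 1 by ring, mul_one]

theorem fc_mul_of_mul_eq_zero {σ R : Type*} [Ring R] [Algebra k R] (c : PowerSeries k)
    {u v : MvPowerSeries σ R} (hu : OrdGE 1 u) (h : u * v = 0) :
    fc c u * v = PowerSeries.constantCoeff c • v := by
  have hdvd : PowerSeries.X ∣ c - PowerSeries.C (PowerSeries.constantCoeff c) :=
    PowerSeries.X_dvd_iff.mpr (by simp)
  obtain ⟨e, he⟩ := hdvd
  have hC : fcHom (k := k) hu (PowerSeries.C (PowerSeries.constantCoeff c)) =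
      algebraMap k _ (PowerSeries.constantCoeff c) := AlgHom.commutes _ _
  rw [sub_eq_iff_eq_add, mul_comm] at he
  conv_lhs => rw [he, fc_add, fc_mul _ _ hu, fc_X hu, ← fcHom_apply hu (PowerSeries.C _), hC, add_mul,
    mul_assoc, h, mul_zero, zero_add, ← Algebra.smul_def]

/-- The pullback of the coordinates along the multiplication of the formal group is the
Campbell-Hausdorff series. -/
theorem chSeries_eq (μ : Fin n) : chSeries L.γ μ = dlt L (X μ) := by
  -- The identity `e^{ad y} y = y` supplies the factor by which the two closed forms differ.
  have hY : gen k (adY L) * letterV k true = letterV k true := by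
    rw [gen, fc_mul_of_mul_eq_zero _ (ordGE_linForm _) (letterM_mul_letterV L true),
      PowerSeries.constantCoeff_exp, one_smul]
  have hE : euler (dlt L (X μ)) =
      ent (fc (logDiv k) (tot (expU L)) * tot (expV L 1)) μ μ := by
    rw [euler_dlt_X, tot_expV_one, tot_expU, mul_add, ent_add, add_comm]
    have h1 : ∀ q, ent (letterV k false) q μ = X (Sum.inl q) := by
      intro q
      rw [letterV, ent_linForm, Fintype.sum_sum_type]
      simp [Matrix.of_apply, ite_smul]
    have h2 : ∀ q, ent (letterV k true) q μ = X (Sum.inr q) := by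
      intro q
      rw [letterV, ent_linForm, Fintype.sum_sum_type]
      simp [Matrix.of_apply, ite_smul]
    congr 1
    · conv_rhs => rw [← hY, ← mul_assoc, ← mul_assoc, mul_assoc (fc _ _), ent_mul]
      simp only [h2]
    · rw [ent_mul]
      simp only [h1]
  ext d
  -- The Euler operator does not see the constant term. In degree zero the coefficient in `chSeries`
  -- is a quotient by zero, hence 0, as it should be.
  rcases Nat.eq_zero_or_pos d.degree with h0 | h0
  · have hd : d = 0 := (Finsupp.degree_eq_zero_iff d).mp h0
    subst hd
    rw [coeff_zero_dlt, coeff_zero_X]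
    change ∑ w : Fin (0 : Fin n ⊕ Fin n →₀ ℕ).degree → Bool, _ = _
    refine Finset.sum_eq_zero fun w _ => ?_
    have hz : ((((0 : Fin n ⊕ Fin n →₀ ℕ).degree : ℕ) : ℚ)) = 0 := by rw [h0, Nat.cast_zero]
    exact (congrArg (fun q : ℚ => (q : k) * _) (by rw [hz, div_zero])).trans
      (by rw [Rat.cast_zero, zero_mul])
  · have := isAddTorsionFree_of_algebra k k
    refine nsmul_right_injective (M := k) (n := d.degree) (by omega) ?_
    change d.degree • coeff d (chSeries L.γ μ) = d.degree • coeff d (dlt L (X μ))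
    rw [← coeff_euler, ← coeff_euler, coeff_euler_chSeries L μ μ, hE]

end Dynkin

/-! ### Power series at commuting nilpotent elements -/

section EvalNil

variable {k : Type*} [Field k] {ι : Type*} [Fintype ι] [DecidableEq ι] {R : Type*} [Ring R]
  [Algebra k R]

/-- The evaluation of power series at commuting nilpotent elements with monomials `t`. -/
noncomputable def evalNil (t : (ι →₀ ℕ) → R) (K : ℕ) : MvPowerSeries ι k →ₗ[k] R where
  toFun F := ∑ d ∈ degLT ι K, coeff d F • t d
  map_add' F G := by simp only [map_add, add_smul, Finset.sum_add_distrib]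
  map_smul' r F := by
    simp only [coeff_smul, mul_smul, Finset.smul_sum, RingHom.id_apply]

theorem evalNil_apply (t : (ι →₀ ℕ) → R) (K : ℕ) (F : MvPowerSeries ι k) :
    evalNil t K F = ∑ d ∈ degLT ι K, coeff d F • t d := rfl

variable {t : (ι →₀ ℕ) → R} {K : ℕ}

theorem evalNil_eq_sum (hK : ∀ d, K ≤ d.degree → t d = 0) (S : Finset (ι →₀ ℕ))
    (hS : ∀ d, t d ≠ 0 → d ∈ S) (F : MvPowerSeries ι k) :
    evalNil t K F = ∑ d ∈ S, coeff d F • t d := by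
  rw [evalNil_apply, ← finsum_eq_sum_of_support_subset, ← finsum_eq_sum_of_support_subset]
  · intro d hd
    exact hS d fun h => hd (by change _ • t d = 0; rw [h, smul_zero])
  · intro d hd
    refine mem_degLT.mpr (lt_of_not_ge fun h => hd ?_)
    change _ • t d = 0
    rw [hK d h, smul_zero]

theorem evalNil_eq_zero {F : MvPowerSeries ι k} (hF : OrdGE K F) : evalNil t K F = 0 :=
  Finset.sum_eq_zero fun d hd => by rw [hF d (mem_degLT.mp hd), zero_smul]

theorem evalNil_one (hK : ∀ d, K ≤ d.degree → t d = 0) (h1 : t 0 = 1) :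
    evalNil t K (1 : MvPowerSeries ι k) = 1 := by
  -- For `K = 0` there are no exponents below the bound; adding the exponent 0 covers this case,
  -- where `1 = t 0 = 0`.
  rw [evalNil_eq_sum hK (insert 0 (degLT ι K)), Finset.sum_eq_single 0]
  · rw [coeff_zero_one, one_smul, h1]
  · intro d _ hd
    rw [coeff_one, if_neg hd, zero_smul]
  · simp
  · exact fun d hd => Finset.mem_insert_of_mem
      (mem_degLT.mpr (lt_of_not_ge fun h => hd (hK d h)))

theorem evalNil_mul (hK : ∀ d, K ≤ d.degree → t d = 0) (hm : ∀ a b, t (a + b) = t a * t b)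
    (F G : MvPowerSeries ι k) : evalNil t K (F * G) = evalNil t K F * evalNil t K G := by
  rw [evalNil_apply, evalNil_apply, evalNil_apply, Finset.sum_mul_sum, ← Finset.sum_product']
  rw [← Finset.sum_filter_of_ne (s := degLT ι K ×ˢ degLT ι K)
    (p := fun p : (ι →₀ ℕ) × (ι →₀ ℕ) => p.1 + p.2 ∈ degLT ι K)]
  · rw [← Finset.sum_fiberwise_of_maps_to (s := Finset.filter _ _) (t := degLT ι K)
      (g := fun p : (ι →₀ ℕ) × (ι →₀ ℕ) => p.1 + p.2) (fun p hp => (Finset.mem_filter.mp hp).2)]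
    refine Finset.sum_congr rfl fun d hd => ?_
    rw [coeff_mul, Finset.sum_smul]
    refine Finset.sum_congr ?_ fun p hp => ?_
    · ext p
      simp only [Finset.HasAntidiagonal.mem_antidiagonal, Finset.mem_filter, Finset.mem_product,
        mem_degLT]
      rw [mem_degLT] at hd
      constructor
      · rintro rfl
        rw [map_add] at hd ⊢
        exact ⟨⟨⟨by omega, by omega⟩, hd⟩, rfl⟩
      · exact fun h => h.2
    · rw [Finset.mem_filter] at hp
      rw [← hp.2, hm, smul_mul_smul_comm]
  · intro p _ hp
    refine mem_degLT.mpr (lt_of_not_ge fun h => hp ?_)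
    rw [smul_mul_smul_comm, ← hm, hK _ h, smul_zero]

end EvalNil

/-! ### Spanning by series times symmetrized monomials -/

section Span

variable {k : Type*} [Field k] [CharZero k] {m : ℕ} {O : Type*} [CommRing O] [Algebra k O]
  {R : Type*} [Ring R] [Algebra k R]

/-- The span of the products of the elements `h i`. -/
def wordSpan (k : Type*) [Field k] [Algebra k R] (h : Fin m → R) : Submodule k R :=
  Submodule.span k (Set.range fun l : List (Fin m) => (l.map h).prod)

theorem word_mem_wordSpan (h : Fin m → R) (l : List (Fin m)) : (l.map h).prod ∈ wordSpan k h :=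
  Submodule.subset_span ⟨l, rfl⟩

theorem sig_mem_wordSpan (h : Fin m → R) (d : Fin m →₀ ℕ) : sig k h d ∈ wordSpan k h := by
  rw [sig_eq_words]
  refine Submodule.smul_mem _ _ (Submodule.sum_mem _ fun w _ => ?_)
  have := word_mem_wordSpan (k := k) h (List.ofFn w)
  rw [List.map_ofFn] at this
  exact this

theorem gen_mul_mem_wordSpan (h : Fin m → R) (i : Fin m) {x : R} (hx : x ∈ wordSpan k h) :
    h i * x ∈ wordSpan k h := by
  refine Submodule.span_induction ?_ ?_ ?_ ?_ hx
  · rintro _ ⟨l, rfl⟩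
    exact word_mem_wordSpan h (i :: l)
  · rw [mul_zero]; exact Submodule.zero_mem _
  · intro x y _ _ hx hy
    rw [mul_add]; exact Submodule.add_mem _ hx hy
  · intro a x _ hx
    rw [mul_smul_comm]; exact Submodule.smul_mem _ _ hx

def wordSpanLT (k : Type*) [Field k] [Algebra k R] (h : Fin m → R) (r : ℕ) : Submodule k R :=
  Submodule.span k {x | ∃ l : List (Fin m), l.length < r ∧ (l.map h).prod = x}

/-- Commutators of generators are linear in the generators, so exchanging two neighbours changes a
word by a combination of shorter words. -/
theorem word_perm {h : Fin m → R} {c : Fin m → Fin m → Fin m → k}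
    (hc : ∀ i j, h i * h j - h j * h i = ∑ l, c i j l • h l) {l l' : List (Fin m)}
    (hp : l.Perm l') : (l.map h).prod - (l'.map h).prod ∈ wordSpanLT k h l.length := by
  induction hp with
  | nil => rw [sub_self]; exact Submodule.zero_mem _
  | @cons i l l' _ ih =>
    rw [List.map_cons, List.map_cons, List.prod_cons, List.prod_cons, ← mul_sub]
    refine Submodule.span_induction (p := fun x _ => h i * x ∈ wordSpanLT k h (i :: l).length)
      ?_ ?_ ?_ ?_ ih
    · rintro _ ⟨w, hw, rfl⟩
      exact Submodule.subset_span ⟨i :: w, by simpa using hw, rfl⟩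
    · rw [mul_zero]; exact Submodule.zero_mem _
    · intro x y _ _ hx hy
      rw [mul_add]; exact Submodule.add_mem _ hx hy
    · intro a x _ hx
      rw [mul_smul_comm]; exact Submodule.smul_mem _ _ hx
  | swap i j l =>
    have : ((j :: i :: l).map h).prod - ((i :: j :: l).map h).prod =
        ∑ q, c j i q • ((q :: l).map h).prod := by
      simp only [List.map_cons, List.prod_cons]
      rw [← mul_assoc, ← mul_assoc, ← sub_mul, hc, Finset.sum_mul]
      simp only [smul_mul_assoc]
    rw [this]
    exact Submodule.sum_mem _ fun q _ => Submodule.smul_mem _ _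
      (Submodule.subset_span ⟨q :: l, by simp, rfl⟩)
  | @trans a b e h1 _ ih1 ih2 =>
    rw [← sub_add_sub_cancel _ (b.map h).prod]
    rw [← h1.length_eq] at ih2
    exact Submodule.add_mem _ ih1 ih2

theorem sum_single_apply (l : List (Fin m)) (i : Fin m) :
    ((l.map fun j => Finsupp.single j 1).sum : Fin m →₀ ℕ) i = l.count i := by
  induction l with
  | nil => rfl
  | cons j l ih =>
    rw [List.map_cons, List.sum_cons, Finsupp.add_apply, ih, List.count_cons, add_comm,
      Finsupp.single_apply]
    simp only [beq_iff_eq]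

theorem sum_ofFn_single {r : ℕ} (w : Fin r → Fin m) :
    ∑ j, Finsupp.single (w j) 1 =
      (((List.ofFn w).map fun j => Finsupp.single j 1).sum : Fin m →₀ ℕ) := by
  rw [List.map_ofFn, List.sum_ofFn]
  rfl

/-- For `T = 1` over `ℚ` the divided symmetrized monomial is `1 / ∏ (d i)!`, which is not zero, so
the sum over words that defines it is not empty. -/
theorem wordsOfContent_nonempty (d : Fin m →₀ ℕ) : (wordsOfContent d).card ≠ 0 := by
  have h1 := sig_eq_words (k := ℚ) (fun _ : Fin m => (1 : ℚ)) d
  rw [sig_comm] at h1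
  intro h
  have h2 : (Finset.univ.filter fun w : Fin d.degree → Fin m =>
    ∑ j, Finsupp.single (w j) 1 = d) = ∅ := Finset.card_eq_zero.mp h
  rw [h2, Finset.sum_empty, smul_zero] at h1
  simp [Finset.prod_eq_zero_iff, Nat.factorial_ne_zero] at h1

/-- Modulo shorter words all rearrangements of a word coincide, so the word is a nonzero multiple of
the symmetrized monomial of its content, up to terms covered by induction on the length. -/
theorem word_mem_span_sig {h : Fin m → R} {c : Fin m → Fin m → Fin m → k}
    (hc : ∀ i j, h i * h j - h j * h i = ∑ l, c i j l • h l) (l : List (Fin m)) :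
    (l.map h).prod ∈ Submodule.span k (Set.range (sig k h)) := by
  induction hr : l.length using Nat.strong_induction_on generalizing l with
  | _ r ih =>
    have hle : wordSpanLT k h r ≤ Submodule.span k (Set.range (sig k h)) := by
      refine Submodule.span_le.mpr ?_
      rintro _ ⟨l', hl', rfl⟩
      exact ih _ hl' l' rfl
    set d : Fin m →₀ ℕ := (l.map fun j => Finsupp.single j 1).sum with hd
    have h1 : ((wordsOfContent d).card : k) • (l.map h).prod -
        ((d.degree ! : ℕ) : k) • sig k h d ∈ wordSpanLT k h r := by
      rw [sig_eq_words, smul_inv_smul₀ (Nat.cast_ne_zero.mpr (Nat.factorial_ne_zero _)),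
        Nat.cast_smul_eq_nsmul, ← Finset.sum_const]
      change _ - ∑ w ∈ wordsOfContent d, _ ∈ _
      rw [← Finset.sum_sub_distrib]
      refine Submodule.sum_mem _ fun w hw => ?_
      have hp : l.Perm (List.ofFn w) := by
        rw [List.perm_iff_count]
        intro i
        rw [← sum_single_apply, ← sum_single_apply, ← sum_ofFn_single, ← hd,
          (Finset.mem_filter.mp hw).2]
      have := word_perm hc hp
      rw [List.map_ofFn, hr] at this
      exact this
    have h2 := Submodule.add_mem _ (hle h1) (Submodule.smul_mem _ ((d.degree ! : ℕ) : k)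
      (Submodule.subset_span (Set.mem_range_self d)))
    rw [sub_add_cancel] at h2
    exact (Submodule.smul_mem_iff _
      (Nat.cast_ne_zero.mpr (wordsOfContent_nonempty d))).mp h2

theorem wordSpan_eq_span_sig {h : Fin m → R} {c : Fin m → Fin m → Fin m → k}
    (hc : ∀ i j, h i * h j - h j * h i = ∑ l, c i j l • h l) :
    wordSpan k h = Submodule.span k (Set.range (sig k h)) := by
  refine le_antisymm (Submodule.span_le.mpr ?_) (Submodule.span_le.mpr ?_)
  · rintro _ ⟨l, rfl⟩
    exact word_mem_span_sig hc l
  · rintro _ ⟨d, rfl⟩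
    exact sig_mem_wordSpan h d

/-- The commutation relations between a commutative algebra `O` and generators `h i`. -/
structure Rels (𝒜 : Fin m → O → O) (c : Fin m → Fin m → Fin m → k) (s : O →ₐ[k] R)
    (h : Fin m → R) : Prop where
  ser : ∀ i f, h i * s f - s f * h i = s (𝒜 i f)
  gens : ∀ i j, h i * h j - h j * h i = ∑ l, c i j l • h l

/-- The span of the products `s f * σ_d(h)`. -/
def monoSpan (s : O →ₐ[k] R) (h : Fin m → R) : Submodule k R :=
  Submodule.span k (Set.range fun p : O × (Fin m →₀ ℕ) => s p.1 * sig k h p.2)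

variable {𝒜 : Fin m → O → O} {c : Fin m → Fin m → Fin m → k} {s : O →ₐ[k] R} {h : Fin m → R}

theorem mul_mem_monoSpan_of_span_sig (f : O) {x : R}
    (hx : x ∈ Submodule.span k (Set.range (sig k h))) : s f * x ∈ monoSpan s h := by
  refine Submodule.span_induction ?_ ?_ ?_ ?_ hx
  · rintro _ ⟨d, rfl⟩
    exact Submodule.subset_span ⟨(f, d), rfl⟩
  · rw [mul_zero]; exact Submodule.zero_mem _
  · intro x y _ _ hx hy
    rw [mul_add]; exact Submodule.add_mem _ hx hy
  · intro a x _ hx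
    rw [mul_smul_comm]; exact Submodule.smul_mem _ _ hx

theorem Rels.ser_mul_word_mem (hr : Rels 𝒜 c s h) (f : O) {x : R} (hx : x ∈ wordSpan k h) :
    s f * x ∈ monoSpan s h :=
  mul_mem_monoSpan_of_span_sig f (wordSpan_eq_span_sig hr.gens ▸ hx)

theorem ser_mul_mem_monoSpan (f : O) {x : R} (hx : x ∈ monoSpan s h) :
    s f * x ∈ monoSpan s h := by
  refine Submodule.span_induction ?_ ?_ ?_ ?_ hx
  · rintro _ ⟨⟨g, d⟩, rfl⟩
    refine Submodule.subset_span ⟨(f * g, d), ?_⟩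
    change s (f * g) * _ = s f * (s g * _)
    rw [map_mul, mul_assoc]
  · rw [mul_zero]; exact Submodule.zero_mem _
  · intro x y _ _ hx hy
    rw [mul_add]; exact Submodule.add_mem _ hx hy
  · intro a x _ hx
    rw [mul_smul_comm]; exact Submodule.smul_mem _ _ hx

theorem Rels.gen_mul_mem (hr : Rels 𝒜 c s h) (i : Fin m) {x : R} (hx : x ∈ monoSpan s h) :
    h i * x ∈ monoSpan s h := by
  refine Submodule.span_induction ?_ ?_ ?_ ?_ hx
  · rintro _ ⟨⟨g, d⟩, rfl⟩
    have e : h i * (s g * sig k h d) = s g * (h i * sig k h d) + s (𝒜 i g) * sig k h d := by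
      rw [← hr.ser i g]; noncomm_ring
    change h i * (s g * sig k h d) ∈ _
    rw [e]
    exact Submodule.add_mem _
      (hr.ser_mul_word_mem _ (gen_mul_mem_wordSpan h i (sig_mem_wordSpan h d)))
      (Submodule.subset_span ⟨(𝒜 i g, d), rfl⟩)
  · rw [mul_zero]; exact Submodule.zero_mem _
  · intro x y _ _ hx hy
    rw [mul_add]; exact Submodule.add_mem _ hx hy
  · intro a x _ hx
    rw [mul_smul_comm]; exact Submodule.smul_mem _ _ hx

theorem Rels.word_mul_mem (hr : Rels 𝒜 c s h) {x y : R} (hx : x ∈ wordSpan k h)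
    (hy : y ∈ monoSpan s h) : x * y ∈ monoSpan s h := by
  refine Submodule.span_induction ?_ ?_ ?_ ?_ hx
  · rintro _ ⟨l, rfl⟩
    change (l.map h).prod * y ∈ _
    induction l with
    | nil => simpa using hy
    | cons i l ih =>
      rw [List.map_cons, List.prod_cons, mul_assoc]
      exact hr.gen_mul_mem i ih
  · rw [zero_mul]; exact Submodule.zero_mem _
  · intro x z _ _ hx hz
    rw [add_mul]; exact Submodule.add_mem _ hx hz
  · intro a x _ hx
    rw [smul_mul_assoc]; exact Submodule.smul_mem _ _ hx

/-- Generators move to the right past series at the cost of a series, and words are combinations of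
symmetrized monomials. No linear independence enters, so the statement can be used in a product of
two algebras. -/
theorem Rels.mul_mem (hr : Rels 𝒜 c s h) {x y : R} (hx : x ∈ monoSpan s h)
    (hy : y ∈ monoSpan s h) : x * y ∈ monoSpan s h := by
  refine Submodule.span_induction ?_ ?_ ?_ ?_ hx
  · rintro _ ⟨⟨g, d⟩, rfl⟩
    change s g * sig k h d * y ∈ _
    rw [mul_assoc]
    exact ser_mul_mem_monoSpan g (hr.word_mul_mem (sig_mem_wordSpan h d) hy)
  · rw [zero_mul]; exact Submodule.zero_mem _
  · intro x z _ _ hx hz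
    rw [add_mul]; exact Submodule.add_mem _ hx hz
  · intro a x _ hx
    rw [smul_mul_assoc]; exact Submodule.smul_mem _ _ hx

end Span

section SymMonomial

variable {k : Type u} [Field k] [CharZero k] {m : ℕ}

/-- The number of words of content `d` is `|d|! / ∏ (d i)!`, as the case of all generators equal to
1 shows. -/
theorem symMonomial_eq {U : Type u} [Ring U] [Algebra k U] (h : Fin m → U) (d : Fin m →₀ ℕ) :
    symMonomial k h d = (∏ i, ((d i)! : k)) • sig k h d := by
  have h1 := sig_eq_words (k := k) (fun _ : Fin m => (1 : k)) d
  rw [sig_comm] at h1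
  simp only [one_pow, Finset.prod_const_one, List.ofFn_const, List.prod_replicate] at h1
  have h2 : (∏ i, ((d i)! : k)) ≠ 0 :=
    Finset.prod_ne_zero_iff.mpr fun i _ => Nat.cast_ne_zero.mpr (Nat.factorial_ne_zero _)
  have h3 : ((wordsOfContent d).card : k) ≠ 0 :=
    Nat.cast_ne_zero.mpr (wordsOfContent_nonempty d)
  have h4 : ((d.degree ! : ℕ) : k) ≠ 0 := Nat.cast_ne_zero.mpr (Nat.factorial_ne_zero _)
  rw [Finset.sum_const, nsmul_eq_mul, mul_one, smul_eq_mul, smul_eq_mul, mul_one] at h1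
  change _ = _ * ((wordsOfContent d).card : k) at h1
  rw [symMonomial, sig_eq_words, smul_smul]
  change _ • ∑ w ∈ wordsOfContent d, _ = _ • ∑ w ∈ wordsOfContent d, _
  congr 1
  field_simp at h1 ⊢
  rw [← h1]

end SymMonomial

/-! ### Coordinates with respect to the basis of symmetrized monomials -/

section PBW

variable {k : Type u} [Field k] [CharZero k] {m n : ℕ} {U : Type u} [Ring U] [Algebra k U]

/-- The sum of the products of the power series `c d` with `x d`. -/
noncomputable def combMap (s : MvPowerSeries (Fin n) k →ₐ[k] U) (x : (Fin m →₀ ℕ) → U) :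
    ((Fin m →₀ ℕ) →₀ MvPowerSeries (Fin n) k) →ₗ[k] U :=
  Finsupp.lsum k fun d => (LinearMap.mulRight k (x d)) ∘ₗ s.toLinearMap

theorem combMap_apply (s : MvPowerSeries (Fin n) k →ₐ[k] U) (x : (Fin m →₀ ℕ) → U)
    (c : (Fin m →₀ ℕ) →₀ MvPowerSeries (Fin n) k) :
    combMap s x c = c.sum fun d f => s f * x d := rfl

theorem combMap_single (s : MvPowerSeries (Fin n) k →ₐ[k] U) (x : (Fin m →₀ ℕ) → U)
    (d : Fin m →₀ ℕ) (f : MvPowerSeries (Fin n) k) :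
    combMap s x (Finsupp.single d f) = s f * x d := by
  rw [combMap_apply, Finsupp.sum_single_index]
  rw [map_zero, zero_mul]

theorem combMap_smul_bijective {s : MvPowerSeries (Fin n) k →ₐ[k] U} {x : (Fin m →₀ ℕ) → U}
    (r : (Fin m →₀ ℕ) → k) (hr : ∀ d, r d ≠ 0) (h : Function.Bijective (combMap s x)) :
    Function.Bijective (combMap s fun d => r d • x d) := by
  let S : ((Fin m →₀ ℕ) → k) → (((Fin m →₀ ℕ) →₀ MvPowerSeries (Fin n) k) →ₗ[k]
    ((Fin m →₀ ℕ) →₀ MvPowerSeries (Fin n) k)) := fun r =>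
    Finsupp.lsum k fun d => r d • Finsupp.lsingle d
  have hS : ∀ r r' : (Fin m →₀ ℕ) → k, (∀ d, r d * r' d = 1) → S r ∘ₗ S r' = LinearMap.id := by
    intro r r' h
    refine Finsupp.lhom_ext fun d f => ?_
    simp [S, smul_smul, h]
  have e : combMap s (fun d => r d • x d) = combMap s x ∘ₗ S r := by
    refine Finsupp.lhom_ext fun d f => ?_
    rw [combMap_single, LinearMap.comp_apply]
    simp only [S, Finsupp.lsum_single, LinearMap.smul_apply, Finsupp.lsingle_apply, map_smul,
      combMap_single, mul_smul_comm]
  rw [e, LinearMap.coe_comp]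
  exact h.comp (Function.bijective_iff_has_inverse.mpr ⟨S fun d => (r d)⁻¹,
    LinearMap.congr_fun (hS _ _ fun d => inv_mul_cancel₀ (hr d)),
    LinearMap.congr_fun (hS _ _ fun d => mul_inv_cancel₀ (hr d))⟩)

/-- Each element is in exactly one way a sum of products `s f * σ_d(h)`. -/
def IsPBW (s : MvPowerSeries (Fin n) k →ₐ[k] U) (h : Fin m → U) : Prop :=
  Function.Bijective (combMap s (sig k h))

theorem isPBW_iff {s : MvPowerSeries (Fin n) k →ₐ[k] U} {h : Fin m → U} :
    IsPBW s h ↔ Function.Bijective fun c : (Fin m →₀ ℕ) →₀ MvPowerSeries (Fin n) k =>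
      c.sum fun d f => s f * symMonomial k h d := by
  have h2 : ∀ d : Fin m →₀ ℕ, (∏ i, ((d i)! : k)) ≠ 0 := fun d =>
    Finset.prod_ne_zero_iff.mpr fun i _ => Nat.cast_ne_zero.mpr (Nat.factorial_ne_zero _)
  have e : symMonomial k h = fun d => (∏ i, ((d i)! : k)) • sig k h d :=
    funext fun d => symMonomial_eq h d
  change _ ↔ Function.Bijective (combMap s (symMonomial k h))
  rw [e]
  refine ⟨combMap_smul_bijective _ h2, fun H => ?_⟩
  have := combMap_smul_bijective (fun d => (∏ i, ((d i)! : k))⁻¹) (fun d => inv_ne_zero (h2 d)) H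
  simp only [smul_smul, inv_mul_cancel₀ (h2 _), one_smul] at this
  exact this

variable {s : MvPowerSeries (Fin n) k →ₐ[k] U} {h : Fin m → U}

/-- The coordinates of an element. -/
noncomputable def IsPBW.crd (hp : IsPBW s h) : U ≃ₗ[k] ((Fin m →₀ ℕ) →₀ MvPowerSeries (Fin n) k) :=
  (LinearEquiv.ofBijective (combMap s (sig k h)) hp).symm

theorem IsPBW.crd_combMap (hp : IsPBW s h) (c : (Fin m →₀ ℕ) →₀ MvPowerSeries (Fin n) k) :
    hp.crd (combMap s (sig k h) c) = c :=
  LinearEquiv.ofBijective_symm_apply_apply (combMap s (sig k h)) c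

theorem IsPBW.combMap_crd (hp : IsPBW s h) (u : U) : combMap s (sig k h) (hp.crd u) = u :=
  LinearEquiv.apply_ofBijective_symm_apply (combMap s (sig k h)) u

theorem IsPBW.crd_mono (hp : IsPBW s h) (f : MvPowerSeries (Fin n) k) (d : Fin m →₀ ℕ) :
    hp.crd (s f * sig k h d) = Finsupp.single d f := by
  rw [← combMap_single, crd_combMap]

theorem IsPBW.crd_ser (hp : IsPBW s h) (f : MvPowerSeries (Fin n) k) :
    hp.crd (s f) = Finsupp.single 0 f := by
  rw [← hp.crd_mono f 0, sig_zero, mul_one]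

theorem IsPBW.induction (hp : IsPBW s h) {P : U → Prop} (hm : ∀ f d, P (s f * sig k h d))
    (h0 : P 0) (ha : ∀ a b, P a → P b → P (a + b)) (u : U) : P u := by
  rw [← hp.combMap_crd u, combMap_apply]
  exact Finset.sum_induction _ P ha h0 fun d _ => hm _ _

/-- Linear maps are determined by their values on the products. -/
theorem IsPBW.ext (hp : IsPBW s h) {V : Type*} [AddCommGroup V] [Module k V] {F G : U →ₗ[k] V}
    (hFG : ∀ f d, F (s f * sig k h d) = G (s f * sig k h d)) : F = G :=
  LinearMap.ext fun u => hp.induction (P := fun u => F u = G u) hFG (by simp)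
    (fun a b ha hb => by rw [map_add, map_add, ha, hb]) u

theorem IsPBW.crd_ser_mul (hp : IsPBW s h) (g : MvPowerSeries (Fin n) k) (u : U)
    (d : Fin m →₀ ℕ) : hp.crd (s g * u) d = g * hp.crd u d := by
  refine hp.induction (P := fun u => hp.crd (s g * u) d = g * hp.crd u d) ?_ ?_ ?_ u
  · intro f e
    rw [← mul_assoc, ← map_mul, hp.crd_mono, hp.crd_mono, Finsupp.single_apply,
      Finsupp.single_apply]
    split_ifs <;> simp
  · simp
  · intro a b ha hb
    rw [mul_add, map_add, map_add, Finsupp.add_apply, Finsupp.add_apply, ha, hb, mul_add]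

theorem IsPBW.eq_zero (hp : IsPBW s h) {u : U} (hu : ∀ N d, OrdGE N (hp.crd u d)) : u = 0 := by
  rw [← hp.crd.map_eq_zero_iff]
  ext1 d
  exact eq_zero_of_ordGE fun N => hu N d

/-! ### The universal property -/

section Lift

variable {𝒜 : Fin m → MvPowerSeries (Fin n) k → MvPowerSeries (Fin n) k}
  {c : Fin m → Fin m → Fin m → k} {B : Type*} [Ring B] [Algebra k B]
  {t : MvPowerSeries (Fin n) k →ₐ[k] B} {g : Fin m → B}

/-- The linear map with `s f * σ_d(h) ↦ t f * σ_d(g)`. -/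
noncomputable def IsPBW.liftLin (hp : IsPBW s h) (t : MvPowerSeries (Fin n) k →ₐ[k] B)
    (g : Fin m → B) : U →ₗ[k] B :=
  (Finsupp.lsum k fun d => (LinearMap.mulRight k (sig k g d)) ∘ₗ t.toLinearMap) ∘ₗ
    hp.crd.toLinearMap

theorem IsPBW.liftLin_mono (hp : IsPBW s h) (f : MvPowerSeries (Fin n) k) (d : Fin m →₀ ℕ) :
    hp.liftLin t g (s f * sig k h d) = t f * sig k g d := by
  rw [liftLin, LinearMap.comp_apply, LinearEquiv.coe_coe, hp.crd_mono, Finsupp.lsum_single]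
  rfl

/-- The graph of the linear map is the span of the products `s f * σ_d(h)` formed in `U × B` from
the pairs of generators. These pairs satisfy the same relations, so the span is closed under
multiplication, and a linear map whose graph is closed under multiplication is multiplicative. -/
theorem IsPBW.liftLin_mul (hp : IsPBW s h) (hr : Rels 𝒜 c s h) (hg : Rels 𝒜 c t g) (u v : U) :
    hp.liftLin t g (u * v) = hp.liftLin t g u * hp.liftLin t g v := by
  have hP : Rels 𝒜 c (s.prod t) (fun i => (h i, g i)) := by
    constructor
    · intro i f
      exact Prod.ext (hr.ser i f) (hg.ser i f)
    · intro i j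
      refine Prod.ext ?_ ?_
      · simpa [Prod.fst_sum] using hr.gens i j
      · simpa [Prod.snd_sum] using hg.gens i j
  have hmono : ∀ f d, (s.prod t) f * sig k (fun i => (h i, g i)) d =
      (s f * sig k h d, t f * sig k g d) := by
    intro f d
    refine Prod.ext ?_ ?_
    · exact congrArg (s f * ·) (map_sig (AlgHom.fst k U B) _ d)
    · exact congrArg (t f * ·) (map_sig (AlgHom.snd k U B) _ d)
  have hmem : ∀ u, (u, hp.liftLin t g u) ∈ monoSpan (s.prod t) (fun i => (h i, g i)) := by
    intro u
    refine hp.induction (P := fun u => (u, hp.liftLin t g u) ∈ monoSpan _ _) ?_ ?_ ?_ u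
    · intro f d
      rw [hp.liftLin_mono, ← hmono]
      exact Submodule.subset_span ⟨(f, d), rfl⟩
    · rw [map_zero]
      exact Submodule.zero_mem _
    · intro a b ha hb
      rw [map_add]
      exact Submodule.add_mem _ ha hb
  have hconv : ∀ p ∈ monoSpan (s.prod t) (fun i => (h i, g i)), p.2 = hp.liftLin t g p.1 := by
    intro p hp'
    refine Submodule.span_induction (p := fun p _ => p.2 = hp.liftLin t g p.1) ?_ ?_ ?_ ?_ hp'
    · rintro _ ⟨⟨f, d⟩, rfl⟩
      change ((s.prod t) f * sig k (fun i => (h i, g i)) d).2 =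
        hp.liftLin t g ((s.prod t) f * sig k (fun i => (h i, g i)) d).1
      rw [hmono, hp.liftLin_mono]
    · exact (map_zero _).symm
    · intro x y _ _ hx hy
      rw [Prod.snd_add, Prod.fst_add, map_add, hx, hy]
    · intro a x _ hx
      rw [Prod.smul_snd, Prod.smul_fst, map_smul, hx]
  exact (hconv _ (hP.mul_mem (hmem u) (hmem v))).symm

noncomputable def IsPBW.lift (hp : IsPBW s h) (hr : Rels 𝒜 c s h) (hg : Rels 𝒜 c t g) :
    U →ₐ[k] B :=
  AlgHom.ofLinearMap (hp.liftLin t g)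
    (by
      have := hp.liftLin_mono (t := t) (g := g) 1 0
      rwa [map_one, map_one, sig_zero, sig_zero, one_mul, one_mul] at this)
    (hp.liftLin_mul hr hg)

theorem IsPBW.lift_mono (hp : IsPBW s h) (hr : Rels 𝒜 c s h) (hg : Rels 𝒜 c t g)
    (f : MvPowerSeries (Fin n) k) (d : Fin m →₀ ℕ) :
    hp.lift hr hg (s f * sig k h d) = t f * sig k g d := hp.liftLin_mono f d

theorem IsPBW.lift_ser (hp : IsPBW s h) (hr : Rels 𝒜 c s h) (hg : Rels 𝒜 c t g)
    (f : MvPowerSeries (Fin n) k) : hp.lift hr hg (s f) = t f := by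
  have := hp.lift_mono hr hg f 0
  rwa [sig_zero, sig_zero, mul_one, mul_one] at this

theorem IsPBW.lift_gen (hp : IsPBW s h) (hr : Rels 𝒜 c s h) (hg : Rels 𝒜 c t g) (i : Fin m) :
    hp.lift hr hg (h i) = g i := by
  have := hp.lift_mono hr hg 1 (Finsupp.single i 1)
  rwa [sig_single, sig_single, map_one, map_one, one_mul, one_mul] at this

theorem IsPBW.algHom_ext (hp : IsPBW s h) {F G : U →ₐ[k] B} (hs : ∀ f, F (s f) = G (s f))
    (hh : ∀ i, F (h i) = G (h i)) : F = G := by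
  refine AlgHom.toLinearMap_injective (hp.ext fun f d => ?_)
  change F (s f * sig k h d) = G (s f * sig k h d)
  rw [map_mul, map_mul, map_sig, map_sig, hs, funext hh]

/-- A set that is closed under sums and products and contains the generators is everything. -/
theorem IsPBW.mem_of_closed (hp : IsPBW s h) {P : U → Prop} (h0 : P 0)
    (ha : ∀ a b, P a → P b → P (a + b)) (hm : ∀ a b, P a → P b → P (a * b))
    (hs : ∀ f, P (s f)) (hh : ∀ i, P (h i)) (u : U) : P u := by
  have hw : ∀ d, P (sig k h d) := by
    intro d
    refine Submodule.span_induction (p := fun x _ => P x) ?_ h0 (fun a b _ _ => ha a b) ?_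
      (sig_mem_wordSpan (k := k) h d)
    · rintro _ ⟨l, rfl⟩
      change P (l.map h).prod
      induction l with
      | nil => simpa using hs 1
      | cons i l ih =>
        rw [List.map_cons, List.prod_cons]
        exact hm _ _ (hh i) ih
    · intro a x _ hx
      have := hm _ _ (hs (algebraMap k _ a)) hx
      rwa [AlgHom.commutes, ← Algebra.smul_def] at this
  exact hp.induction (fun f d => hm _ _ (hs f) (hw d)) h0 ha u

end Lift

/-! ### The powers of the ideal -/

section Ideal

variable {𝒜 : Fin m → MvPowerSeries (Fin n) k → MvPowerSeries (Fin n) k}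
  (hp : IsPBW s h) (hA : ∀ i f, h i * s f - s f * h i = s (𝒜 i f))
  (hord : ∀ N i f, OrdGE N f → OrdGE N (𝒜 i f))
include hA hord

theorem IsPBW.ordGE_mul_left (N : ℕ) (a : U) : ∀ u, (∀ d, OrdGE N (hp.crd u d)) →
    ∀ d, OrdGE N (hp.crd (a * u) d) := by
  refine hp.mem_of_closed
    (P := fun a => ∀ u, (∀ d, OrdGE N (hp.crd u d)) → ∀ d, OrdGE N (hp.crd (a * u) d))
    ?_ ?_ ?_ ?_ ?_ a
  · intro u _ d
    rw [zero_mul, map_zero]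
    exact ordGE_zero N
  · intro a b ha hb u hu d
    rw [add_mul, map_add]
    exact (ha u hu d).add (hb u hu d)
  · intro a b ha hb u hu d
    rw [mul_assoc]
    exact ha _ (hb u hu) d
  · intro f u hu d
    rw [hp.crd_ser_mul]
    exact (hu d).mul_left f
  · intro i u hu d
    conv => rw [← hp.combMap_crd u, combMap_apply, Finsupp.sum, Finset.mul_sum, map_sum,
      Finsupp.finsetSum_apply]
    refine OrdGE.sum fun e _ => ?_
    have : h i * (s (hp.crd u e) * sig k h e) = s (hp.crd u e) * (h i * sig k h e) +
        s (𝒜 i (hp.crd u e)) * sig k h e := by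
      rw [← hA]; noncomm_ring
    rw [this, map_add, Finsupp.add_apply, hp.crd_ser_mul, hp.crd_ser_mul]
    exact ((hu e).mul_right _).add ((hord N i _ (hu e)).mul_right _)

theorem IsPBW.ordGE_mul (M N : ℕ) {a u : U} (ha : ∀ d, OrdGE M (hp.crd a d))
    (hu : ∀ d, OrdGE N (hp.crd u d)) (d : Fin m →₀ ℕ) : OrdGE (M + N) (hp.crd (a * u) d) := by
  conv => rw [← hp.combMap_crd a, combMap_apply, Finsupp.sum, Finset.sum_mul, map_sum,
      Finsupp.finsetSum_apply]
  refine OrdGE.sum fun e _ => ?_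
  rw [mul_assoc, hp.crd_ser_mul]
  exact (ha e).mul (hp.ordGE_mul_left hA hord N _ u hu d)

/-- The elements with coordinates of order at least `N`. -/
def IsPBW.ordIdeal (N : ℕ) : Ideal U where
  carrier := {u | ∀ d, OrdGE N (hp.crd u d)}
  zero_mem' d := by rw [map_zero]; exact ordGE_zero N
  add_mem' ha hb d := by rw [map_add]; exact (ha d).add (hb d)
  smul_mem' a u hu := hp.ordGE_mul_left hA hord N a u hu

omit hA hord in
theorem ser_mem_pow {I : Ideal U} [I.IsTwoSided] (hX : ∀ μ, s (X μ) ∈ I) (N : ℕ) :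
    ∀ f, OrdGE N f → s f ∈ I ^ N := by
  induction N with
  | zero => intro f _; rw [Submodule.pow_zero, Ideal.one_eq_top]; exact Submodule.mem_top
  | succ N ih =>
    intro f hf
    have h0 : constantCoeff f = 0 := hf 0 (by simp)
    rw [eq_add_sum_quot f, h0, map_zero, zero_add, map_sum]
    refine Submodule.sum_mem _ fun μ _ => ?_
    rw [map_mul, Ideal.IsTwoSided.pow_succ]
    exact Ideal.mul_mem_mul (hX μ) (ih _ (hf.quot μ))

/-- Commutators with the `h i` do not lower the order, so the filtration by the order of the
coordinates is multiplicative and contains the powers of `I`. Conversely, Hadamard's decomposition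
puts a series of order `N` into `I ^ N`. -/
theorem IsPBW.mem_pow_iff {I : Ideal U} [I.IsTwoSided]
    (hI : I = Ideal.span {x | ∃ μ b, x = s (X μ) * b}) (N : ℕ) (u : U) :
    u ∈ I ^ N ↔ ∀ d, OrdGE N (hp.crd u d) := by
  constructor
  · have h1 : I ≤ hp.ordIdeal hA hord 1 := by
      rw [hI, Ideal.span_le]
      rintro _ ⟨μ, b, rfl⟩ d
      rw [hp.crd_ser_mul]
      exact (ordGE_X μ).mul_right _
    have : ∀ N, I ^ N ≤ hp.ordIdeal hA hord N := by
      intro N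
      induction N with
      | zero => exact fun u _ d => OrdGE.zero' _
      | succ N ih =>
        rw [Submodule.pow_succ, Ideal.mul_le]
        intro a ha b hb
        exact hp.ordGE_mul hA hord N 1 (ih ha) (h1 hb)
    exact fun hu => this N hu
  · intro hu
    rw [← hp.combMap_crd u, combMap_apply]
    refine Submodule.sum_mem _ fun d _ => ?_
    refine Ideal.mul_mem_right _ _ (ser_mem_pow (fun μ => ?_) N _ (hu d))
    rw [hI]
    exact Ideal.subset_span ⟨μ, 1, (mul_one _).symm⟩

end Ideal

end PBW

/-! ### Functionals applied to one factor of a tensor product -/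

section Slice

variable {k : Type*} [Field k] {V W V' W' : Type*} [AddCommGroup V] [Module k V]
  [AddCommGroup W] [Module k W] [AddCommGroup V'] [Module k V'] [AddCommGroup W'] [Module k W']

/-- The application of a functional to the second factor. -/
noncomputable def sliceR (V : Type*) [AddCommGroup V] [Module k V] (lam : W →ₗ[k] k) :
    V ⊗[k] W →ₗ[k] V :=
  (TensorProduct.rid k V).toLinearMap ∘ₗ LinearMap.lTensor V lam

/-- The application of a functional to the first factor. -/
noncomputable def sliceL (W : Type*) [AddCommGroup W] [Module k W] (lam : V →ₗ[k] k) :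
    V ⊗[k] W →ₗ[k] W :=
  (TensorProduct.lid k W).toLinearMap ∘ₗ LinearMap.rTensor W lam

@[simp] theorem sliceR_tmul (lam : W →ₗ[k] k) (v : V) (w : W) :
    sliceR V lam (v ⊗ₜ w) = lam w • v := by
  simp [sliceR]

@[simp] theorem sliceL_tmul (lam : V →ₗ[k] k) (v : V) (w : W) :
    sliceL W lam (v ⊗ₜ w) = lam v • w := by
  simp [sliceL]

theorem eq_of_sliceR {t t' : V ⊗[k] W} (h : ∀ lam, sliceR V lam t = sliceR V lam t') :
    t = t' := by
  classical
  let b := Module.Basis.ofVectorSpace k W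
  have e : ∀ t : V ⊗[k] W, ∀ i,
      TensorProduct.equivFinsuppOfBasisRight b t i = sliceR V (b.coord i) t := by
    intro t i
    induction t with
    | zero => simp
    | tmul v w => simp
    | add x y hx hy => rw [map_add, map_add, Finsupp.add_apply, hx, hy]
  refine (TensorProduct.equivFinsuppOfBasisRight b).injective (Finsupp.ext fun i => ?_)
  rw [e, e, h]

end Slice

/-! ### The coproduct on generators, at each level of the completion -/

section Adic

variable {k : Type u} [Field k] [CharZero k] {m n : ℕ} (L : InhomBialgebra k m n)
  {P : AdicAlgebra k} {s : MvPowerSeries (Fin n) k →ₐ[k] P.carrier}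

theorem mk_eq_zero_iff {P : AdicAlgebra k} {N : ℕ} {a : P.carrier} :
    P.mk' N a = 0 ↔ a ∈ P.ideal ^ N := Ideal.Quotient.eq_zero_iff_mem

theorem mk_surjective (P : AdicAlgebra k) (N : ℕ) : Function.Surjective (P.mk' N) :=
  Ideal.Quotient.mk_surjective

theorem mk_ser_eq_zero (hX : ∀ μ, s (X μ) ∈ P.ideal) {N : ℕ} {f : MvPowerSeries (Fin n) k}
    (hf : OrdGE N f) : P.mk' N (s f) = 0 := mk_eq_zero_iff.mpr (ser_mem_pow hX N f hf)

theorem sub_sum_monomial (f : MvPowerSeries (Fin n) k) (K : ℕ) :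
    OrdGE K (f - ∑ a ∈ degLT (Fin n) K, coeff a f • monomial a 1) := by
  intro d hd
  rw [map_sub, map_sum, Finset.sum_eq_single d]
  · rw [coeff_smul, coeff_monomial_same, mul_one, sub_self]
  · intro a _ ha
    rw [coeff_smul, coeff_monomial_ne ha.symm, mul_zero]
  · exact fun h => absurd (mem_degLT.mpr hd) h

/-- A linear map that does not lower the order can be applied to the monomials. -/
theorem mk_map_eq_sum (hX : ∀ μ, s (X μ) ∈ P.ideal) {N K : ℕ} (hK : N ≤ K)
    (T : MvPowerSeries (Fin n) k →ₗ[k] MvPowerSeries (Fin n) k)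
    (hT : ∀ f, OrdGE N f → OrdGE N (T f)) (f : MvPowerSeries (Fin n) k) :
    P.mk' N (s (T f)) = ∑ a ∈ degLT (Fin n) K, coeff a f • P.mk' N (s (T (monomial a 1))) := by
  have h := mk_ser_eq_zero hX (hT _ ((sub_sum_monomial f K).mono hK))
  rw [map_sub, map_sub, map_sub, sub_eq_zero] at h
  rw [h]
  simp only [map_sum, map_smul]

theorem mk_ser_eq_sum (hX : ∀ μ, s (X μ) ∈ P.ideal) {N K : ℕ} (hK : N ≤ K)
    (f : MvPowerSeries (Fin n) k) :
    P.mk' N (s f) = ∑ a ∈ degLT (Fin n) K, coeff a f • P.mk' N (s (monomial a 1)) :=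
  mk_map_eq_sum hX hK LinearMap.id (fun _ h => h) f

/-- The exponent with the parts `a` and `b`. -/
noncomputable def pairE (p : (Fin n →₀ ℕ) × (Fin n →₀ ℕ)) : Fin n ⊕ Fin n →₀ ℕ :=
  Finsupp.equivFunOnFinite.symm (Sum.elim p.1 p.2)

theorem fstE_pairE (p : (Fin n →₀ ℕ) × (Fin n →₀ ℕ)) : fstE (pairE p) = p.1 :=
  Finsupp.ext fun _ => rfl

theorem sndE_pairE (p : (Fin n →₀ ℕ) × (Fin n →₀ ℕ)) : sndE (pairE p) = p.2 :=
  Finsupp.ext fun _ => rfl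

theorem pairE_eq (d : Fin n ⊕ Fin n →₀ ℕ) : pairE (fstE d, sndE d) = d :=
  Finsupp.ext fun i => by cases i <;> rfl

theorem pairE_injective : Function.Injective (pairE (n := n)) := fun p q h =>
  Prod.ext (by rw [← fstE_pairE, h, fstE_pairE]) (by rw [← sndE_pairE p, h, sndE_pairE])

/-- The tensor product of two monomials. -/
noncomputable def tMon (s : MvPowerSeries (Fin n) k →ₐ[k] P.carrier) (N : ℕ)
    (d : Fin n ⊕ Fin n →₀ ℕ) : P.Quo N ⊗[k] P.Quo N :=
  P.mk' N (s (monomial (fstE d) 1)) ⊗ₜ P.mk' N (s (monomial (sndE d) 1))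

theorem tMon_eq_zero (hX : ∀ μ, s (X μ) ∈ P.ideal) {N : ℕ} {d : Fin n ⊕ Fin n →₀ ℕ}
    (hd : N ≤ (fstE d).degree ∨ N ≤ (sndE d).degree) : tMon s N d = 0 := by
  rcases hd with h | h
  · rw [tMon, mk_ser_eq_zero hX ((ordGE_monomial _ 1).mono h), TensorProduct.zero_tmul]
  · rw [tMon, mk_ser_eq_zero hX ((ordGE_monomial _ 1).mono h), TensorProduct.tmul_zero]

theorem tMon_degree (hX : ∀ μ, s (X μ) ∈ P.ideal) (N : ℕ) (d : Fin n ⊕ Fin n →₀ ℕ)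
    (hd : 2 * N ≤ d.degree) : tMon s N d = 0 := by
  rw [← degree_fst_add_snd] at hd
  exact tMon_eq_zero hX (by omega)

theorem tMon_add (N : ℕ) (a b : Fin n ⊕ Fin n →₀ ℕ) :
    tMon s N (a + b) = tMon s N a * tMon s N b := by
  have h1 : fstE (a + b) = fstE a + fstE b := Finsupp.ext fun _ => rfl
  have h2 : sndE (a + b) = sndE a + sndE b := Finsupp.ext fun _ => rfl
  have h3 : ∀ a b : Fin n →₀ ℕ, (monomial (a + b) 1 : MvPowerSeries (Fin n) k) =
      monomial a 1 * monomial b 1 := fun a b => by rw [monomial_mul_monomial, mul_one]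
  rw [tMon, tMon, tMon, h1, h2, h3, h3, Algebra.TensorProduct.tmul_mul_tmul, map_mul, map_mul,
    map_mul, map_mul]

theorem tMon_zero (N : ℕ) : tMon s N 0 = 1 := by
  have h1 : fstE (0 : Fin n ⊕ Fin n →₀ ℕ) = 0 := Finsupp.ext fun _ => rfl
  have h2 : sndE (0 : Fin n ⊕ Fin n →₀ ℕ) = 0 := Finsupp.ext fun _ => rfl
  rw [tMon, h1, h2, monomial_zero_one, map_one, map_one]
  rfl

/-- The coproduct of the power series. -/
noncomputable def dN (hX : ∀ μ, s (X μ) ∈ P.ideal) (N : ℕ) :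
    MvPowerSeries (Fin n) k →ₐ[k] P.Quo N ⊗[k] P.Quo N :=
  (AlgHom.ofLinearMap (evalNil (tMon s N) (2 * N)) (evalNil_one (tMon_degree hX N) (tMon_zero N))
    (evalNil_mul (tMon_degree hX N) (tMon_add N))).comp (dltHom L)

theorem dN_apply (hX : ∀ μ, s (X μ) ∈ P.ideal) (N : ℕ) (f : MvPowerSeries (Fin n) k) :
    dN L hX N f = evalNil (tMon s N) (2 * N) (dlt L f) := rfl

theorem dN_eq_zero (hX : ∀ μ, s (X μ) ∈ P.ideal) {N : ℕ} {f : MvPowerSeries (Fin n) k}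
    (hf : OrdGE (2 * N) f) : dN L hX N f = 0 := evalNil_eq_zero (OrdGE.dlt L hf)

/-- Terms with `|a| ≥ N` vanish at level `N`, so the sum may run up to any `K ≥ N`; this freedom is
needed to compare different levels. -/
theorem dN_eq_sum (hX : ∀ μ, s (X μ) ∈ P.ideal) {N K : ℕ} (hK : N ≤ K)
    (f : MvPowerSeries (Fin n) k) : dN L hX N f = ∑ a ∈ degLT (Fin n) K,
      P.mk' N (s (monomial a 1)) ⊗ₜ P.mk' N (s (sl L a f)) := by
  rw [dN_apply, evalNil_eq_sum (tMon_degree hX N)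
    ((degLT (Fin n) K ×ˢ degLT (Fin n) K).map ⟨pairE, pairE_injective⟩), Finset.sum_map,
    Finset.sum_product]
  · refine Finset.sum_congr rfl fun a _ => ?_
    rw [mk_ser_eq_sum hX hK (sl L a f), TensorProduct.tmul_sum]
    refine Finset.sum_congr rfl fun b _ => ?_
    rw [Function.Embedding.coeFn_mk, coeff_dlt, tMon, fstE_pairE, sndE_pairE,
      TensorProduct.tmul_smul]
  · intro d hd
    rw [Finset.mem_map]
    refine ⟨(fstE d, sndE d), ?_, pairE_eq d⟩
    rw [Finset.mem_product, mem_degLT, mem_degLT]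
    constructor
    · exact lt_of_not_ge fun h => hd (tMon_eq_zero hX (Or.inl (hK.trans h)))
    · exact lt_of_not_ge fun h => hd (tMon_eq_zero hX (Or.inr (hK.trans h)))

/-- The functional on power series that a functional on a quotient induces. -/
noncomputable def serFun (s : MvPowerSeries (Fin n) k →ₐ[k] P.carrier) {N : ℕ}
    (lam : P.Quo N →ₗ[k] k) : MvPowerSeries (Fin n) k →ₗ[k] k :=
  lam ∘ₗ (P.mk' N).toLinearMap ∘ₗ s.toLinearMap

/-- Through `eq_of_sliceR` this reduces identities between coproducts of series to the identities
already proved for `dl`. -/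
theorem sliceR_dN (hX : ∀ μ, s (X μ) ∈ P.ideal) {N : ℕ} (lam : P.Quo N →ₗ[k] k)
    (f : MvPowerSeries (Fin n) k) :
    sliceR (P.Quo N) lam (dN L hX N f) = P.mk' N (s (dl L (serFun s lam) f)) := by
  rw [dN_eq_sum L hX le_rfl, map_sum, mk_ser_eq_sum hX le_rfl]
  exact Finset.sum_congr rfl fun a _ => sliceR_tmul _ _ _

/-- The coproduct of the generators `H i`. -/
noncomputable def hN (s : MvPowerSeries (Fin n) k →ₐ[k] P.carrier) (H : Fin m → P.carrier) (N : ℕ)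
    (i : Fin m) : P.Quo N ⊗[k] P.Quo N :=
  ∑ l, P.mk' N (s (ee L i l)) ⊗ₜ P.mk' N (H l) + P.mk' N (H i) ⊗ₜ 1

variable {H : Fin m → P.carrier}

theorem mk_comm_ser {T : MvPowerSeries (Fin n) k → MvPowerSeries (Fin n) k} {h : P.carrier}
    (hs : ∀ f, h * s f - s f * h = s (T f)) (N : ℕ) (f : MvPowerSeries (Fin n) k) :
    P.mk' N h * P.mk' N (s f) - P.mk' N (s f) * P.mk' N h = P.mk' N (s (T f)) := by
  rw [← hs, map_sub, map_mul, map_mul]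

theorem mk_ser_commute (N : ℕ) (f g : MvPowerSeries (Fin n) k) :
    P.mk' N (s f) * P.mk' N (s g) = P.mk' N (s g) * P.mk' N (s f) := by
  rw [← map_mul, ← map_mul, mul_comm, map_mul, map_mul]

/-- The operators `T` are left arbitrary, because the rigidity argument applies this formula to
commutators that are not yet identified with the `A_i`. -/
theorem hN_comm_dN (hX : ∀ μ, s (X μ) ∈ P.ideal)
    {T : Fin m → MvPowerSeries (Fin n) k → MvPowerSeries (Fin n) k}
    (hr : ∀ i f, H i * s f - s f * H i = s (T i f)) (N : ℕ)
    (i : Fin m) (f : MvPowerSeries (Fin n) k) :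
    hN L s H N i * dN L hX N f - dN L hX N f * hN L s H N i =
      ∑ l, ∑ a ∈ degLT (Fin n) N, P.mk' N (s (ee L i l * monomial a 1)) ⊗ₜ[k]
        P.mk' N (s (T l (sl L a f))) +
      ∑ a ∈ degLT (Fin n) N, P.mk' N (s (T i (monomial a 1))) ⊗ₜ[k] P.mk' N (s (sl L a f)) := by
  rw [dN_eq_sum L hX le_rfl, hN, add_mul, mul_add, add_sub_add_comm]
  congr 1
  · rw [Finset.sum_mul, Finset.mul_sum, ← Finset.sum_sub_distrib]
    refine Finset.sum_congr rfl fun l _ => ?_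
    rw [Finset.sum_mul, Finset.mul_sum, ← Finset.sum_sub_distrib]
    refine Finset.sum_congr rfl fun a _ => ?_
    rw [Algebra.TensorProduct.tmul_mul_tmul, Algebra.TensorProduct.tmul_mul_tmul,
      mk_ser_commute N (monomial a 1), ← TensorProduct.tmul_sub, mk_comm_ser (hr l), map_mul,
      map_mul]
  · rw [Finset.sum_mul, Finset.mul_sum, ← Finset.sum_sub_distrib]
    refine Finset.sum_congr rfl fun a _ => ?_
    rw [Algebra.TensorProduct.tmul_mul_tmul, Algebra.TensorProduct.tmul_mul_tmul, one_mul,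
      mul_one, ← TensorProduct.sub_tmul, mk_comm_ser (hr i)]

/-- After a functional is applied to the second factor this is `dl_af`. -/
theorem hN_ser (hX : ∀ μ, s (X μ) ∈ P.ideal) (hr : Rels (fun i f => af L i f) L.C s H) (N : ℕ)
    (i : Fin m) (f : MvPowerSeries (Fin n) k) :
    hN L s H N i * dN L hX N f - dN L hX N f * hN L s H N i = dN L hX N (af L i f) := by
  have h1 := hN_comm_dN L hX hr.ser N i f
  simp only [map_mul] at h1
  refine eq_of_sliceR fun lam => ?_
  rw [h1, sliceR_dN, dl_af, map_add, map_add, map_add, map_sum, map_sum, map_sum, map_sum]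
  congr 1
  · refine Finset.sum_congr rfl fun l _ => ?_
    rw [map_sum, map_mul, map_mul, mk_ser_eq_sum hX le_rfl (dl L _ f), Finset.mul_sum]
    refine Finset.sum_congr rfl fun a _ => ?_
    rw [sliceR_tmul, mul_smul_comm]
    rfl
  · have := mk_map_eq_sum hX le_rfl ((af L i : Derivation k _ _) : MvPowerSeries (Fin n) k →ₗ[k]
      MvPowerSeries (Fin n) k) (fun f hf => OrdGE.af L hf i) (N := N) (dl L (serFun s lam) f)
    refine Eq.trans ?_ this.symm
    exact Finset.sum_congr rfl fun a _ => sliceR_tmul _ _ _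

/-- With `Δ H_i = E_i + G_i`, the brackets of the `G_i` are those of the `H_i`, and the brackets
involving an `E_i` combine to the required value by `ee_cocycle`. -/
theorem hN_gens (hr : Rels (fun i f => af L i f) L.C s H) (N : ℕ) (i j : Fin m) :
    hN L s H N i * hN L s H N j - hN L s H N j * hN L s H N i =
      ∑ l, L.C i j l • hN L s H N l := by
  have hgen : ∀ i j, P.mk' N (H i) * P.mk' N (H j) - P.mk' N (H j) * P.mk' N (H i) =
      ∑ l, L.C i j l • P.mk' N (H l) := by
    intro i j
    rw [← map_mul, ← map_mul, ← map_sub, hr.gens, map_sum]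
    simp only [map_smul]
  let E : Fin m → P.Quo N ⊗[k] P.Quo N := fun i =>
    ∑ l, P.mk' N (s (ee L i l)) ⊗ₜ P.mk' N (H l)
  let G : Fin m → P.Quo N ⊗[k] P.Quo N := fun i => P.mk' N (H i) ⊗ₜ 1
  have h1 : E i * E j - E j * E i = ∑ q, P.mk' N (s (∑ l, ∑ p, L.C l p q •
      (ee L i l * ee L j p))) ⊗ₜ P.mk' N (H q) := by
    have e1 : E i * E j - E j * E i = ∑ l, ∑ p, (P.mk' N (s (ee L i l)) * P.mk' N (s (ee L j p))) ⊗ₜ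
        (P.mk' N (H l) * P.mk' N (H p) - P.mk' N (H p) * P.mk' N (H l)) := by
      simp only [E]
      rw [Finset.sum_mul_sum, Finset.sum_mul_sum,
        Finset.sum_comm (f := fun a b => P.mk' N (s (ee L j a)) ⊗ₜ[k] P.mk' N (H a) *
          P.mk' N (s (ee L i b)) ⊗ₜ[k] P.mk' N (H b)), ← Finset.sum_sub_distrib]
      refine Finset.sum_congr rfl fun l _ => ?_
      rw [← Finset.sum_sub_distrib]
      refine Finset.sum_congr rfl fun p _ => ?_
      rw [Algebra.TensorProduct.tmul_mul_tmul, Algebra.TensorProduct.tmul_mul_tmul,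
        mk_ser_commute N (ee L j p), TensorProduct.tmul_sub]
    rw [e1]
    simp only [hgen, TensorProduct.tmul_sum, map_sum, TensorProduct.sum_tmul]
    rw [Finset.sum_congr rfl fun l _ => Finset.sum_comm, Finset.sum_comm]
    refine Finset.sum_congr rfl fun q _ => Finset.sum_congr rfl fun l _ =>
      Finset.sum_congr rfl fun p _ => ?_
    rw [TensorProduct.tmul_smul, map_smul, map_smul, map_mul, map_mul, TensorProduct.smul_tmul']
  have h2 : ∀ i j, G i * E j - E j * G i =
      ∑ q, P.mk' N (s (af L i (ee L j q))) ⊗ₜ P.mk' N (H q) := by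
    intro i j
    simp only [E, G]
    rw [Finset.mul_sum, Finset.sum_mul, ← Finset.sum_sub_distrib]
    refine Finset.sum_congr rfl fun q _ => ?_
    rw [Algebra.TensorProduct.tmul_mul_tmul, Algebra.TensorProduct.tmul_mul_tmul, one_mul,
      mul_one, ← TensorProduct.sub_tmul, mk_comm_ser (hr.ser i)]
  have h3 : G i * G j - G j * G i = ∑ l, L.C i j l • G l := by
    simp only [G]
    rw [Algebra.TensorProduct.tmul_mul_tmul, Algebra.TensorProduct.tmul_mul_tmul, one_mul,
      ← TensorProduct.sub_tmul, hgen, TensorProduct.sum_tmul]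
    rfl
  have h4 : ∑ l, L.C i j l • E l = (E i * E j - E j * E i) + (G i * E j - E j * G i) -
      (G j * E i - E i * G j) := by
    rw [h1, h2, h2, ← Finset.sum_add_distrib, ← Finset.sum_sub_distrib]
    simp only [E, Finset.smul_sum]
    rw [Finset.sum_comm]
    refine Finset.sum_congr rfl fun q _ => ?_
    rw [← TensorProduct.add_tmul, ← TensorProduct.sub_tmul, ← map_add, ← map_sub, ← map_add,
      ← map_sub, ← ee_cocycle, map_sum, map_sum, TensorProduct.sum_tmul]
    refine Finset.sum_congr rfl fun l _ => ?_
    rw [map_smul, map_smul, TensorProduct.smul_tmul']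
  change (E i + G i) * (E j + G j) - (E j + G j) * (E i + G i) = ∑ l, L.C i j l • (E l + G l)
  simp only [smul_add, Finset.sum_add_distrib]
  rw [h4, ← h3]
  noncomm_ring

theorem hN_rels (hX : ∀ μ, s (X μ) ∈ P.ideal) (hr : Rels (fun i f => af L i f) L.C s H) (N : ℕ) :
    Rels (fun i f => af L i f) L.C (dN L hX N) (hN L s H N) :=
  ⟨hN_ser L hX hr N, hN_gens L hr N⟩

end Adic

section Adic

variable {k : Type u} [Field k] [CharZero k] {m n : ℕ} (L : InhomBialgebra k m n)
  {P : AdicAlgebra k} {s : MvPowerSeries (Fin n) k →ₐ[k] P.carrier}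
  (hX : ∀ μ, s (X μ) ∈ P.ideal)

theorem prod_X_pow (e : Fin n → ℕ) : ∏ j, (X j ^ e j : MvPowerSeries (Fin n) k) =
    monomial (Finsupp.equivFunOnFinite.symm e) 1 := by
  have h : ∀ S : Finset (Fin n), ∏ j ∈ S, (X j ^ e j : MvPowerSeries (Fin n) k) =
      monomial (∑ j ∈ S, Finsupp.single j (e j)) 1 := by
    intro S
    induction S using Finset.induction_on with
    | empty => simp
    | insert j S hj ih =>
      rw [Finset.prod_insert hj, Finset.sum_insert hj, ih, X_pow_eq, monomial_mul_monomial, mul_one]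
  have h' : ∑ j, Finsupp.single j (e j) = Finsupp.equivFunOnFinite.symm e := by
    ext i
    rw [Finsupp.finsetSum_apply, Finset.sum_eq_single i] <;> simp +contextual
  rw [h, h']

/-- Exponents outside the box give zero at level `N`, so the finite sum used to state the coproduct
axiom agrees with the evaluation of the whole Campbell–Hausdorff series. -/
theorem dN_X_eq_box (N : ℕ) (μ : Fin n) : dN L hX N (X μ) =
    ∑ a : Fin n → Fin N, ∑ b : Fin n → Fin N,
      coeff (Finsupp.equivFunOnFinite.symm (Sum.elim (fun j => (a j : ℕ)) (fun j => (b j : ℕ))))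
        (chSeries L.γ μ) •
      (P.mk' N (s (∏ j, X j ^ (a j : ℕ))) ⊗ₜ[k] P.mk' N (s (∏ j, X j ^ (b j : ℕ)))) := by
  have hinj : Function.Injective fun p : (Fin n → Fin N) × (Fin n → Fin N) =>
      (Finsupp.equivFunOnFinite.symm (Sum.elim (fun j => (p.1 j : ℕ)) (fun j => (p.2 j : ℕ))) :
        Fin n ⊕ Fin n →₀ ℕ) := by
    intro p q h
    have h' := Finsupp.equivFunOnFinite.symm.injective h
    refine Prod.ext (funext fun j => Fin.ext ?_) (funext fun j => Fin.ext ?_)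
    · exact congrFun h' (Sum.inl j)
    · exact congrFun h' (Sum.inr j)
  rw [dN_apply, ← chSeries_eq, evalNil_eq_sum (tMon_degree hX N)
    ((Finset.univ ×ˢ Finset.univ).map ⟨_, hinj⟩), Finset.sum_map, Finset.sum_product]
  · refine Finset.sum_congr rfl fun a _ => Finset.sum_congr rfl fun b _ => ?_
    rw [prod_X_pow, prod_X_pow]
    exact congrArg₂ (fun x y => coeff _ _ • (P.mk' N (s (monomial x 1)) ⊗ₜ[k]
      P.mk' N (s (monomial y 1)))) (Finsupp.ext fun _ => rfl) (Finsupp.ext fun _ => rfl)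
  · intro d hd
    have hlt : ∀ i, d i < N := by
      intro i
      refine lt_of_not_ge fun h => hd (tMon_eq_zero hX ?_)
      cases i with
      | inl j => exact Or.inl (h.trans (Finsupp.le_degree j (fstE d)))
      | inr j => exact Or.inr (h.trans (Finsupp.le_degree j (sndE d)))
    rw [Finset.mem_map]
    refine ⟨(fun j => ⟨d (Sum.inl j), hlt _⟩, fun j => ⟨d (Sum.inr j), hlt _⟩), by simp, ?_⟩
    ext i
    cases i <;> rfl

theorem dN_ee (N : ℕ) (i l : Fin m) : dN L hX N (ee L i l) =
    ∑ p, P.mk' N (s (ee L i p)) ⊗ₜ P.mk' N (s (ee L p l)) := by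
  refine eq_of_sliceR fun lam => ?_
  rw [sliceR_dN, dl_ee, map_sum, map_sum, map_sum]
  refine Finset.sum_congr rfl fun p _ => ?_
  rw [sliceR_tmul, map_smul, map_smul]
  rfl

/-- After `λ` is applied to the third factor both sides become the coproduct of `dl λ f`: on the
left by expanding that series into monomials, on the right because `dl λ` commutes with the
`σ_a(L)`. The bound `2 * N` is needed on the left, since the coproduct at level `N` kills only
series of order `2 * N`. -/
theorem dN_coassoc (N : ℕ) (f : MvPowerSeries (Fin n) k) :
    ∑ a ∈ degLT (Fin n) (2 * N), dN L hX N (monomial a 1) ⊗ₜ[k] P.mk' N (s (sl L a f)) =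
      ∑ a ∈ degLT (Fin n) (2 * N), ∑ b ∈ degLT (Fin n) (2 * N),
        (P.mk' N (s (monomial a 1)) ⊗ₜ[k] P.mk' N (s (monomial b 1))) ⊗ₜ[k]
          P.mk' N (s (sl L b (sl L a f))) := by
  have hN : N ≤ 2 * N := Nat.le_mul_of_pos_left N two_pos
  refine eq_of_sliceR fun lam => ?_
  rw [map_sum, map_sum]
  trans dN L hX N (dl L (serFun s lam) f)
  · have h := dN_eq_zero L hX (sub_sum_monomial (dl L (serFun s lam) f) (2 * N))
    rw [map_sub, sub_eq_zero] at h
    rw [h, map_sum]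
    refine Finset.sum_congr rfl fun a _ => ?_
    rw [sliceR_tmul, map_smul]
    rfl
  · rw [dN_eq_sum L hX hN]
    refine Finset.sum_congr rfl fun a _ => ?_
    rw [sl_dl, mk_ser_eq_sum hX hN (dl L _ _), TensorProduct.tmul_sum, map_sum]
    refine Finset.sum_congr rfl fun b _ => ?_
    rw [sliceR_tmul, TensorProduct.tmul_smul]
    rfl

end Adic

/-- The algebra structure of a quantization, with the standard commutation relations. -/
structure Realization {k : Type u} [Field k] [CharZero k] {m n : ℕ} (L : InhomBialgebra k m n)
    extends AdicAlgebra k where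
  H : Fin m → carrier
  ser : MvPowerSeries (Fin n) k →ₐ[k] carrier
  ideal_eq : ideal = Ideal.span {x | ∃ μ b, x = ser (X μ) * b}
  pbw : IsPBW ser H
  rels : Rels (fun i f => af L i f) L.C ser H

/-! ### Coproduct and counit from the universal property -/

namespace Realization

variable {k : Type u} [Field k] [CharZero k] {m n : ℕ} {L : InhomBialgebra k m n}
  (P : Realization L)

theorem X_mem (μ : Fin n) : P.ser (X μ) ∈ P.ideal := by
  rw [P.ideal_eq]
  exact Ideal.subset_span ⟨μ, 1, (mul_one _).symm⟩

theorem mem_pow_iff (N : ℕ) (u : P.carrier) :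
    u ∈ P.ideal ^ N ↔ ∀ d, OrdGE N (P.pbw.crd u d) :=
  P.pbw.mem_pow_iff P.rels.ser (fun _ i _ hf => OrdGE.af L hf i) P.ideal_eq N u

theorem mem_pow_induction {N : ℕ} {Q : P.carrier → Prop} (h0 : Q 0)
    (ha : ∀ a b, Q a → Q b → Q (a + b))
    (hm : ∀ f, OrdGE N f → ∀ d, Q (P.ser f * sig k P.H d)) {u : P.carrier}
    (hu : u ∈ P.ideal ^ N) : Q u := by
  rw [mem_pow_iff] at hu
  rw [← P.pbw.combMap_crd u, combMap_apply]
  exact Finset.sum_induction _ Q ha h0 fun d _ => hm _ (hu d) d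

/-- The components of the coproduct. -/
noncomputable def cm (N : ℕ) : P.carrier →ₐ[k] P.Quo N ⊗[k] P.Quo N :=
  P.pbw.lift P.rels (hN_rels L P.X_mem P.rels N)

theorem cm_ser (N : ℕ) (f : MvPowerSeries (Fin n) k) : P.cm N (P.ser f) = dN L P.X_mem N f :=
  P.pbw.lift_ser _ _ f

theorem cm_H (N : ℕ) (i : Fin m) : P.cm N (P.H i) = hN L P.ser P.H N i :=
  P.pbw.lift_gen _ _ i

theorem cm_compat (N : ℕ) (a : P.carrier) :
    Algebra.TensorProduct.map (P.proj N.le_succ) (P.proj N.le_succ) (P.cm (N + 1) a) =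
      P.cm N a := by
  refine AlgHom.congr_fun (P.pbw.algHom_ext (F := (Algebra.TensorProduct.map (P.proj N.le_succ)
    (P.proj N.le_succ)).comp (P.cm (N + 1))) (G := P.cm N) ?_ ?_) a
  · intro f
    rw [AlgHom.comp_apply, cm_ser, cm_ser, dN_eq_sum L P.X_mem le_rfl,
      dN_eq_sum L P.X_mem N.le_succ, map_sum]
    rfl
  · intro i
    rw [AlgHom.comp_apply, cm_H, cm_H, hN, hN, map_add, map_sum]
    rfl

theorem cm_cont (N : ℕ) (a : P.carrier) (ha : a ∈ P.ideal ^ (2 * N)) : P.cm N a = 0 := by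
  refine P.mem_pow_induction (Q := fun a => P.cm N a = 0) (map_zero _) ?_ ?_ ha
  · intro a b ha hb
    rw [map_add, ha, hb, add_zero]
  · intro f hf d
    rw [map_mul, cm_ser, dN_eq_zero L P.X_mem hf, zero_mul]

/-- Both sides are homomorphisms, so generators suffice: for series it is associativity of the
group, for `H_i` the multiplicativity of the matrix `e^{α·X}`. -/
theorem cm_coassoc (N : ℕ) (a : P.carrier) :
    Algebra.TensorProduct.assoc k k k _ _ _
      (Algebra.TensorProduct.map
        (Ideal.Quotient.liftₐ (P.ideal ^ (2 * N)) (P.cm N) (P.cm_cont N))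
        (P.proj (Nat.le_mul_of_pos_left N two_pos)) (P.cm (2 * N) a)) =
      Algebra.TensorProduct.map
        (P.proj (Nat.le_mul_of_pos_left N two_pos))
        (Ideal.Quotient.liftₐ (P.ideal ^ (2 * N)) (P.cm N) (P.cm_cont N)) (P.cm (2 * N) a) := by
  set D := Ideal.Quotient.liftₐ (P.ideal ^ (2 * N)) (P.cm N) (P.cm_cont N) with hD
  have hDm : ∀ u, D (P.mk' (2 * N) u) = P.cm N u := fun _ => rfl
  set q := P.proj (Nat.le_mul_of_pos_left N two_pos) with hq
  have hqm : ∀ u, q (P.mk' (2 * N) u) = P.mk' N u := fun _ => rfl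
  refine AlgHom.congr_fun (P.pbw.algHom_ext
    (F := (Algebra.TensorProduct.assoc k k k _ _ _).toAlgHom.comp
      ((Algebra.TensorProduct.map D q).comp (P.cm (2 * N))))
    (G := (Algebra.TensorProduct.map q D).comp (P.cm (2 * N))) ?_ ?_) a
  · intro f
    change Algebra.TensorProduct.assoc k k k _ _ _ (Algebra.TensorProduct.map D q
      (P.cm (2 * N) (P.ser f))) = Algebra.TensorProduct.map q D (P.cm (2 * N) (P.ser f))
    rw [cm_ser, dN_eq_sum L P.X_mem le_rfl, map_sum, map_sum (Algebra.TensorProduct.map q D)]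
    simp only [Algebra.TensorProduct.map_tmul, hDm, hqm, cm_ser]
    rw [dN_coassoc, map_sum]
    refine Finset.sum_congr rfl fun a _ => ?_
    rw [map_sum, dN_eq_sum L P.X_mem (Nat.le_mul_of_pos_left N two_pos), TensorProduct.tmul_sum]
    rfl
  · intro i
    change Algebra.TensorProduct.assoc k k k _ _ _ (Algebra.TensorProduct.map D q
      (P.cm (2 * N) (P.H i))) = Algebra.TensorProduct.map q D (P.cm (2 * N) (P.H i))
    have h1 : ∀ M, P.mk' M 1 = 1 := fun M => map_one _
    rw [cm_H, hN, ← h1, map_add, map_add, map_sum, map_sum,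
      map_add (Algebra.TensorProduct.map q D), map_sum (Algebra.TensorProduct.map q D)]
    simp only [Algebra.TensorProduct.map_tmul, hDm, hqm, cm_ser, cm_H, map_one, dN_ee, hN,
      TensorProduct.tmul_add, TensorProduct.add_tmul, TensorProduct.sum_tmul, map_sum, map_add,
      TensorProduct.tmul_sum, Algebra.TensorProduct.assoc_tmul, Algebra.TensorProduct.one_def,
      Finset.sum_add_distrib]
    rw [Finset.sum_comm, add_assoc]

/-- The constant coefficient as a homomorphism of algebras. -/
noncomputable def ccHom (k : Type u) [Field k] (n : ℕ) : MvPowerSeries (Fin n) k →ₐ[k] k :=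
  { (constantCoeff : MvPowerSeries (Fin n) k →+* k) with commutes' := fun _ => constantCoeff_C _ }

theorem ccHom_apply (f : MvPowerSeries (Fin n) k) : ccHom k n f = constantCoeff f := rfl

/-- The fields `A_i` vanish at the origin, so evaluation there is compatible with any representation
of `𝐇`; the zero representation gives the counit. -/
theorem ccHom_rels {L : InhomBialgebra k m n} {B : Type*} [Ring B] [Algebra k B] {h : Fin m → B}
    (hc : ∀ i j, h i * h j - h j * h i = ∑ l, L.C i j l • h l) :
    Rels (fun i f => af L i f) L.C ((Algebra.ofId k B).comp (ccHom k n)) h := by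
  refine ⟨fun i f => ?_, hc⟩
  rw [AlgHom.comp_apply, AlgHom.comp_apply, ccHom_apply, ccHom_apply, constantCoeff_af, map_zero,
    Algebra.ofId_apply, Algebra.commutes, sub_self]

noncomputable def eps : P.carrier →ₐ[k] k :=
  P.pbw.lift P.rels (ccHom_rels (h := fun _ => 0) (by simp))

theorem eps_ser (f : MvPowerSeries (Fin n) k) : P.eps (P.ser f) = constantCoeff f :=
  P.pbw.lift_ser _ _ f

theorem eps_H (i : Fin m) : P.eps (P.H i) = 0 := P.pbw.lift_gen _ _ i

theorem eps_cont (a : P.carrier) (ha : a ∈ P.ideal) : P.eps a = 0 := by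
  have h := Submodule.pow_one P.ideal
  rw [← h] at ha
  refine P.mem_pow_induction (Q := fun a => P.eps a = 0) (map_zero _) ?_ ?_ ha
  · intro a b ha hb
    rw [map_add, ha, hb, add_zero]
  · intro f hf d
    rw [map_mul, eps_ser, ordGE_one_iff.mp hf, zero_mul]

theorem eps_cm (N : ℕ) (a : P.carrier) :
    Algebra.TensorProduct.lid k _
      (Algebra.TensorProduct.map
        (Ideal.Quotient.liftₐ (P.ideal ^ (N + 1)) P.eps
          fun a ha => P.eps_cont a (Ideal.pow_le_self N.succ_ne_zero ha))
        (AlgHom.id k (P.Quo (N + 1))) (P.cm (N + 1) a)) = P.mk' (N + 1) a := by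
  set e := Ideal.Quotient.liftₐ (P.ideal ^ (N + 1)) P.eps
          fun a ha => P.eps_cont a (Ideal.pow_le_self N.succ_ne_zero ha) with he
  have hem : ∀ u, e (P.mk' (N + 1) u) = P.eps u := fun _ => rfl
  refine AlgHom.congr_fun (P.pbw.algHom_ext (F := (Algebra.TensorProduct.lid k _).toAlgHom.comp
    ((Algebra.TensorProduct.map e (AlgHom.id k (P.Quo (N + 1)))).comp (P.cm (N + 1))))
    (G := P.mk' (N + 1)) ?_ ?_) a
  · intro f
    change Algebra.TensorProduct.lid k _ (Algebra.TensorProduct.map e _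
      (P.cm (N + 1) (P.ser f))) = _
    rw [cm_ser, dN_eq_sum L P.X_mem le_rfl, map_sum, map_sum]
    simp only [Algebra.TensorProduct.map_tmul, hem, eps_ser, AlgHom.id_apply,
      Algebra.TensorProduct.lid_tmul]
    rw [Finset.sum_eq_single 0]
    · rw [monomial_zero_one, map_one, one_smul, sl_zero]
    · intro a _ ha
      rw [← coeff_zero_eq_constantCoeff_apply, coeff_monomial_ne ha.symm, zero_smul]
    · exact fun h => absurd (mem_degLT.mpr (by simp)) h
  · intro i
    change Algebra.TensorProduct.lid k _ (Algebra.TensorProduct.map e _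
      (P.cm (N + 1) (P.H i))) = _
    rw [cm_H, hN, map_add, map_add, map_sum, map_sum]
    simp only [Algebra.TensorProduct.map_tmul, hem, eps_ser, eps_H, AlgHom.id_apply,
      Algebra.TensorProduct.lid_tmul, zero_smul, add_zero]
    simp only [← coeff_zero_eq_constantCoeff_apply, coeff_zero_ee, ite_smul, one_smul, zero_smul]
    simp

theorem cm_eps (N : ℕ) (a : P.carrier) :
    Algebra.TensorProduct.rid k k _
      (Algebra.TensorProduct.map (AlgHom.id k (P.Quo (N + 1)))
        (Ideal.Quotient.liftₐ (P.ideal ^ (N + 1)) P.eps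
          fun a ha => P.eps_cont a (Ideal.pow_le_self N.succ_ne_zero ha))
        (P.cm (N + 1) a)) = P.mk' (N + 1) a := by
  set e := Ideal.Quotient.liftₐ (P.ideal ^ (N + 1)) P.eps
          fun a ha => P.eps_cont a (Ideal.pow_le_self N.succ_ne_zero ha) with he
  have hem : ∀ u, e (P.mk' (N + 1) u) = P.eps u := fun _ => rfl
  refine AlgHom.congr_fun (P.pbw.algHom_ext (F := (Algebra.TensorProduct.rid k k _).toAlgHom.comp
    ((Algebra.TensorProduct.map (AlgHom.id k (P.Quo (N + 1))) e).comp (P.cm (N + 1))))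
    (G := P.mk' (N + 1)) ?_ ?_) a
  · intro f
    change Algebra.TensorProduct.rid k k _ (Algebra.TensorProduct.map _ e
      (P.cm (N + 1) (P.ser f))) = _
    rw [cm_ser, dN_eq_sum L P.X_mem le_rfl, map_sum, map_sum]
    simp only [Algebra.TensorProduct.map_tmul, hem, eps_ser, AlgHom.id_apply,
      Algebra.TensorProduct.rid_tmul]
    rw [mk_ser_eq_sum P.X_mem le_rfl]
    refine Finset.sum_congr rfl fun a _ => ?_
    rw [← coeff_zero_eq_constantCoeff_apply, coeff_eq_sl]
  · intro i
    change Algebra.TensorProduct.rid k k _ (Algebra.TensorProduct.map _ e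
      (P.cm (N + 1) (P.H i))) = _
    rw [cm_H, hN, map_add, map_add, map_sum, map_sum]
    simp only [Algebra.TensorProduct.map_tmul, hem, eps_H, AlgHom.id_apply,
      Algebra.TensorProduct.rid_tmul, zero_smul, Finset.sum_const_zero, zero_add, map_one,
      one_smul]

end Realization

/-! ### Linear parts of the fields at the origin -/

section Coeff

variable {k : Type u} [Field k] [CharZero k] {m n : ℕ} (L : InhomBialgebra k m n)

theorem coeff_single_eq_lf (ν : Fin n) (f : MvPowerSeries (Fin n) k) :
    coeff (Finsupp.single ν 1) f = coeff 0 (lf L ν f) := by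
  rw [← coeff_eq_sl L, sl, sig_single]
  rfl

theorem coeff_zero_lf_X (μ ν : Fin n) : coeff 0 (lf L μ (X ν)) = if μ = ν then 1 else 0 := by
  have h := lf_X_coeff_zero L μ ν 0 (by simp)
  rw [map_sub, sub_eq_zero] at h
  rw [h]
  split_ifs
  · exact coeff_zero_one
  · rfl

/-- Evaluate `[L_ν, A_i] X_μ` at the origin: the terms that begin with some `A_l` vanish there, and
the `L`-terms give the structure constant. -/
theorem coeff_single_af_X (i : Fin m) (μ ν : Fin n) :
    coeff (Finsupp.single ν 1) (af L i (X μ)) = L.A i ν μ := by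
  have h0 : ∀ i f, coeff 0 (af L i f) = 0 := fun i f => constantCoeff_af L i f
  rw [coeff_single_eq_lf L, sub_eq_iff_eq_add.mp (lf_af L ν i (X μ)), map_add, map_add, map_sum,
    map_sum, h0, add_zero]
  simp only [coeff_smul, coeff_zero_lf_X, h0, mul_zero, Finset.sum_const_zero, add_zero]
  simp

end Coeff

/-! ### The antipode -/

namespace Realization

variable {k : Type u} [Field k] [CharZero k] {m n : ℕ} {L : InhomBialgebra k m n}
  (P : Realization L)

/-- The value of the antipode at `H i`. -/
noncomputable def antiH (i : Fin m) : P.carrier := -∑ l, P.ser (minus (ee L i l)) * P.H l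

/-- The inversion of the formal group, as a homomorphism into the opposite algebra. -/
noncomputable def serOp : MvPowerSeries (Fin n) k →ₐ[k] P.carrierᵐᵒᵖ :=
  (P.ser.comp minus).toOpposite fun f g => by
    rw [Commute, SemiconjBy, ← map_mul, mul_comm, map_mul]

theorem antiH_ser (i : Fin m) (f : MvPowerSeries (Fin n) k) :
    P.ser (minus f) * P.antiH i - P.antiH i * P.ser (minus f) = P.ser (minus (af L i f)) := by
  rw [minus_af, map_sum, antiH, mul_neg, neg_mul, sub_neg_eq_add, neg_add_eq_sub, Finset.sum_mul,
    Finset.mul_sum, ← Finset.sum_sub_distrib]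
  refine Finset.sum_congr rfl fun l _ => ?_
  rw [map_mul, ← P.rels.ser, ← mul_assoc (P.ser (minus f)), ← map_mul P.ser (minus f), mul_comm,
    map_mul]
  noncomm_ring

/-- The factors appear in reversed order because the antipode is an antihomomorphism. After series
are moved to the left, the coefficient of each `H_q` is `ee_cocycle` with `i` and `j` exchanged,
transported by inversion through `minus_af`. -/
theorem antiH_antiH (i j : Fin m) : P.antiH j * P.antiH i - P.antiH i * P.antiH j =
    ∑ l, L.C i j l • P.antiH l := by
  have h1 : ∀ i j, P.antiH j * P.antiH i =
      ∑ p, ∑ l, P.ser (minus (ee L j p) * minus (ee L i l)) * (P.H p * P.H l) +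
      ∑ l, P.ser (minus (af L j (ee L i l))) * P.H l := by
    intro i j
    rw [antiH, antiH, neg_mul_neg, Finset.sum_mul_sum]
    have : ∀ l, P.ser (minus (af L j (ee L i l))) * P.H l = ∑ p,
        P.ser (minus (ee L j p)) * (P.H p * P.ser (minus (ee L i l)) -
          P.ser (minus (ee L i l)) * P.H p) * P.H l := by
      intro l
      rw [minus_af, map_sum, Finset.sum_mul]
      refine Finset.sum_congr rfl fun p _ => ?_
      rw [P.rels.ser, map_mul]
    simp only [this]
    rw [Finset.sum_comm (f := fun l p => P.ser (minus (ee L j p)) * (P.H p *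
      P.ser (minus (ee L i l)) - P.ser (minus (ee L i l)) * P.H p) * P.H l),
      ← Finset.sum_add_distrib]
    refine Finset.sum_congr rfl fun p _ => ?_
    rw [← Finset.sum_add_distrib]
    refine Finset.sum_congr rfl fun l _ => ?_
    rw [map_mul]
    noncomm_ring
  have h2 : ∑ p, ∑ l, P.ser (minus (ee L j p) * minus (ee L i l)) * (P.H p * P.H l) -
      ∑ p, ∑ l, P.ser (minus (ee L i p) * minus (ee L j l)) * (P.H p * P.H l) =
      ∑ q, P.ser (minus (∑ p, ∑ l, L.C p l q • (ee L j p * ee L i l))) * P.H q := by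
    rw [Finset.sum_comm (f := fun p l => P.ser (minus (ee L i p) * minus (ee L j l)) *
      (P.H p * P.H l)), ← Finset.sum_sub_distrib]
    simp only [map_sum, Finset.sum_mul]
    rw [Finset.sum_comm]
    refine Finset.sum_congr rfl fun p _ => ?_
    rw [Finset.sum_comm, ← Finset.sum_sub_distrib]
    refine Finset.sum_congr rfl fun l _ => ?_
    rw [mul_comm (minus (ee L i l)), ← mul_sub, P.rels.gens, Finset.mul_sum]
    refine Finset.sum_congr rfl fun q _ => ?_
    rw [map_smul, map_smul, map_mul minus, smul_mul_assoc, mul_smul_comm]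
  have h3 : P.antiH j * P.antiH i - P.antiH i * P.antiH j =
      ∑ q, P.ser (minus (∑ l, L.C j i l • ee L l q)) * P.H q := by
    rw [h1, h1, add_sub_add_comm, h2, ← Finset.sum_sub_distrib, ← Finset.sum_add_distrib]
    refine Finset.sum_congr rfl fun q _ => ?_
    rw [ee_cocycle, map_sub, map_sub, map_add, map_add]
    noncomm_ring
  rw [h3]
  simp only [map_sum, map_smul, Finset.sum_mul, smul_mul_assoc]
  rw [Finset.sum_comm]
  refine Finset.sum_congr rfl fun l _ => ?_
  rw [antiH, smul_neg, ← neg_smul, ← L.C_skew, Finset.smul_sum]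

theorem serOp_rels : Rels (fun i f => af L i f) L.C P.serOp
    (fun i => MulOpposite.op (P.antiH i)) := by
  refine ⟨fun i f => ?_, fun i j => ?_⟩
  · exact congrArg MulOpposite.op (P.antiH_ser i f)
  · refine (congrArg MulOpposite.op (P.antiH_antiH i j)).trans ?_
    exact map_sum (MulOpposite.opLinearEquiv k) _ _

/-- The antipode. -/
noncomputable def anti : P.carrier →ₗ[k] P.carrier :=
  (MulOpposite.opLinearEquiv k).symm.toLinearMap ∘ₗ (P.pbw.lift P.rels P.serOp_rels).toLinearMap

theorem anti_mul (a b : P.carrier) : P.anti (a * b) = P.anti b * P.anti a :=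
  congrArg MulOpposite.unop (map_mul (P.pbw.lift P.rels P.serOp_rels) a b)

theorem anti_one : P.anti 1 = 1 :=
  congrArg MulOpposite.unop (map_one (P.pbw.lift P.rels P.serOp_rels))

theorem anti_ser (f : MvPowerSeries (Fin n) k) : P.anti (P.ser f) = P.ser (minus f) :=
  congrArg MulOpposite.unop (P.pbw.lift_ser P.rels P.serOp_rels f)

theorem anti_H (i : Fin m) : P.anti (P.H i) = -∑ l, P.ser (minus (ee L i l)) * P.H l :=
  congrArg MulOpposite.unop (P.pbw.lift_gen P.rels P.serOp_rels i)

theorem anti_mem (N : ℕ) (a : P.carrier) (ha : a ∈ P.ideal ^ N) : P.anti a ∈ P.ideal ^ N := by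
  refine P.mem_pow_induction (Q := fun a => P.anti a ∈ P.ideal ^ N) ?_ ?_ ?_ ha
  · rw [map_zero]; exact Submodule.zero_mem _
  · intro a b ha hb
    rw [map_add]; exact Submodule.add_mem _ ha hb
  · intro f hf d
    rw [anti_mul, anti_ser]
    exact Ideal.mul_mem_left _ _ (ser_mem_pow P.X_mem N _ hf.minus)

theorem anti_cont (N : ℕ) (a : P.carrier) (ha : a ∈ P.ideal ^ N) :
    ((P.mk' N).toLinearMap ∘ₗ P.anti) a = 0 := mk_eq_zero_iff.mpr (P.anti_mem N a ha)

/-- The antipode of the quotients. -/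
noncomputable def antiN (N : ℕ) : P.Quo N →ₗ[k] P.Quo N :=
  idealLift (P.ideal ^ N) ((P.mk' N).toLinearMap ∘ₗ P.anti) (P.anti_cont N)

theorem antiN_mk (N : ℕ) (a : P.carrier) : P.antiN N (P.mk' N a) = P.mk' N (P.anti a) := rfl

theorem antiN_mul (N : ℕ) (a b : P.Quo N) :
    P.antiN N (a * b) = P.antiN N b * P.antiN N a := by
  obtain ⟨a, rfl⟩ := mk_surjective _ N a
  obtain ⟨b, rfl⟩ := mk_surjective _ N b
  rw [← map_mul, antiN_mk, antiN_mk, antiN_mk, anti_mul, map_mul]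

/-- `x ⊗ y ↦ S(x) y` -/
noncomputable def convL (N : ℕ) : P.Quo N ⊗[k] P.Quo N →ₗ[k] P.Quo N :=
  LinearMap.mul' k (P.Quo N) ∘ₗ TensorProduct.map (P.antiN N) LinearMap.id

/-- `x ⊗ y ↦ x S(y)` -/
noncomputable def convR (N : ℕ) : P.Quo N ⊗[k] P.Quo N →ₗ[k] P.Quo N :=
  LinearMap.mul' k (P.Quo N) ∘ₗ TensorProduct.map LinearMap.id (P.antiN N)

theorem convL_tmul (N : ℕ) (x y : P.Quo N) : P.convL N (x ⊗ₜ y) = P.antiN N x * y := rfl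

theorem convR_tmul (N : ℕ) (x y : P.Quo N) : P.convR N (x ⊗ₜ y) = x * P.antiN N y := rfl

/-- In `S(t₁ x) t₂ y = S(x) (S(t₁) t₂) y` the inner factor is a scalar and can be taken out. So the
antipode axiom passes from factors to products and needs proof on generators only. -/
theorem convL_mul (N : ℕ) {r : k} {t : P.Quo N ⊗[k] P.Quo N}
    (ht : P.convL N t = algebraMap k _ r) (t' : P.Quo N ⊗[k] P.Quo N) :
    P.convL N (t * t') = r • P.convL N t' := by
  induction t' with
  | zero => simp
  | add x y hx hy => rw [mul_add, map_add, map_add, smul_add, hx, hy]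
  | tmul x y =>
    have : P.convL N (t * x ⊗ₜ y) = P.antiN N x * P.convL N t * y := by
      clear ht
      induction t with
      | zero => simp
      | add a b ha hb => rw [add_mul, map_add, map_add, mul_add, add_mul, ha, hb]
      | tmul a b =>
        rw [Algebra.TensorProduct.tmul_mul_tmul, convL_tmul, convL_tmul, antiN_mul]
        noncomm_ring
    rw [this, ht, ← Algebra.commutes, mul_assoc, ← convL_tmul, Algebra.smul_def]

theorem convR_mul (N : ℕ) {r : k} {t' : P.Quo N ⊗[k] P.Quo N}
    (ht : P.convR N t' = algebraMap k _ r) (t : P.Quo N ⊗[k] P.Quo N) :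
    P.convR N (t * t') = r • P.convR N t := by
  induction t with
  | zero => simp
  | add x y hx hy => rw [add_mul, map_add, map_add, smul_add, hx, hy]
  | tmul x y =>
    have : P.convR N (x ⊗ₜ y * t') = x * P.convR N t' * P.antiN N y := by
      clear ht
      induction t' with
      | zero => simp
      | add a b ha hb => rw [mul_add, map_add, map_add, mul_add, add_mul, ha, hb]
      | tmul a b =>
        rw [Algebra.TensorProduct.tmul_mul_tmul, convR_tmul, convR_tmul, antiN_mul]
        noncomm_ring
    rw [this, ht, ← Algebra.commutes, mul_assoc, ← convR_tmul, Algebra.smul_def]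

/-- On series the axiom is `negShift_sum`, and on `H_i` it is the formula that defines the antipode
there. -/
theorem convL_cm (N : ℕ) (a : P.carrier) :
    P.convL N (P.cm N a) = algebraMap k (P.Quo N) (P.eps a) := by
  refine P.pbw.mem_of_closed
    (P := fun a => P.convL N (P.cm N a) = algebraMap k (P.Quo N) (P.eps a)) ?_ ?_ ?_ ?_ ?_ a
  · simp
  · intro a b ha hb
    rw [map_add, map_add, ha, hb, map_add, map_add]
  · intro a b ha hb
    rw [map_mul, P.convL_mul N ha, hb, map_mul, map_mul, Algebra.smul_def]
  · intro f
    rw [cm_ser, dN_eq_sum L P.X_mem le_rfl, map_sum, eps_ser]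
    have h := mk_ser_eq_zero P.X_mem (negShift_sum L N f)
    rw [map_sub, map_sub, sub_eq_zero] at h
    have hC : P.ser (C (constantCoeff f)) = algebraMap k _ (constantCoeff f) :=
      AlgHom.commutes _ _
    rw [hC, AlgHom.commutes] at h
    rw [← h, map_sum, map_sum]
    refine Finset.sum_congr rfl fun a _ => ?_
    rw [convL_tmul, antiN_mk, anti_ser, map_mul, map_mul]
  · intro i
    rw [cm_H, hN, map_add, map_sum, eps_H, map_zero, convL_tmul, antiN_mk, anti_H, mul_one,
      map_neg, map_sum, add_neg_eq_zero]
    refine Finset.sum_congr rfl fun l _ => ?_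
    rw [convL_tmul, antiN_mk, anti_ser, map_mul]

/-- On series the identity is the image of `negShift_sum` under inversion; on `H_i` it says that
`e^{-α·X}` is inverse to `e^{α·X}`. -/
theorem convR_cm (N : ℕ) (a : P.carrier) :
    P.convR N (P.cm N a) = algebraMap k (P.Quo N) (P.eps a) := by
  refine P.pbw.mem_of_closed
    (P := fun a => P.convR N (P.cm N a) = algebraMap k (P.Quo N) (P.eps a)) ?_ ?_ ?_ ?_ ?_ a
  · simp
  · intro a b ha hb
    rw [map_add, map_add, ha, hb, map_add, map_add]
  · intro a b ha hb
    rw [map_mul, P.convR_mul N hb, ha, map_mul, map_mul, Algebra.smul_def, Algebra.commutes]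
  · intro f
    rw [cm_ser, dN_eq_sum L P.X_mem le_rfl, map_sum, eps_ser]
    have h := mk_ser_eq_zero P.X_mem (negShift_sum L N f).minus
    have hCm : minus (C (constantCoeff f) : MvPowerSeries (Fin n) k) = C (constantCoeff f) :=
      AlgHom.commutes minus _
    rw [map_sub, map_sub, map_sub, sub_eq_zero, hCm] at h
    have hC : P.ser (C (constantCoeff f)) = algebraMap k _ (constantCoeff f) :=
      AlgHom.commutes _ _
    rw [hC, AlgHom.commutes] at h
    rw [← h, map_sum, map_sum, map_sum]
    refine Finset.sum_congr rfl fun a _ => ?_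
    rw [convR_tmul, antiN_mk, anti_ser, map_mul, map_mul, map_mul, minus_minus]
  · intro i
    have h1 : P.anti 1 = 1 := P.anti_one
    have h2 : P.mk' N 1 = 1 := map_one _
    rw [cm_H, hN, map_add, map_sum, eps_H, map_zero, ← h2, convR_tmul, antiN_mk, h1, h2, mul_one]
    have h3 : ∑ l, P.convR N (P.mk' N (P.ser (ee L i l)) ⊗ₜ P.mk' N (P.H l)) =
        -∑ q, P.mk' N (P.ser (∑ l, ee L i l * minus (ee L l q))) * P.mk' N (P.H q) := by
      simp only [convR_tmul, antiN_mk, anti_H, map_neg, map_sum, mul_neg, Finset.sum_neg_distrib,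
        Finset.mul_sum, map_mul, Finset.sum_mul]
      rw [Finset.sum_comm]
      simp only [mul_assoc]
    rw [h3]
    simp only [sum_ee_mul_minus]
    rw [Finset.sum_eq_single i]
    · simp
    · intro q _ hq
      rw [if_neg (Ne.symm hq), map_zero, map_zero, zero_mul]
    · simp

/-- The Hopf algebra structure. -/
noncomputable def toHopf : AdicHopf k where
  toAdicAlgebra := P.toAdicAlgebra
  comul := P.cm
  comul_compat := P.cm_compat
  comul_cont := P.cm_cont
  coassoc := P.cm_coassoc
  counit := P.eps
  counit_cont := P.eps_cont
  counit_comul := P.eps_cm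
  comul_counit := P.cm_eps
  antipode := P.anti
  antipode_cont := P.anti_cont
  antipode_left := P.convL_cm
  antipode_right := P.convR_cm

noncomputable def toQuantization : Quantization L where
  toAdicHopf := P.toHopf
  H := P.H
  ser := P.ser
  ideal_eq := P.ideal_eq
  pbw := isPBW_iff.mp P.pbw
  comul_X := fun N μ => (P.cm_ser N (X μ)).trans (dN_X_eq_box L P.X_mem N μ)
  comul_H := P.cm_H
  counit_X := fun μ => (P.eps_ser (X μ)).trans (constantCoeff_X μ)
  counit_H := P.eps_H
  comm_HH := ⟨fun i j l => C (L.C i j l), fun i j => by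
    refine (P.rels.gens i j).trans (Finset.sum_congr rfl fun l _ => ?_)
    rw [Algebra.smul_def]
    exact congrArg (· * P.H l) (AlgHom.commutes P.ser _).symm, fun i j l => constantCoeff_C _⟩
  comm_HX := ⟨fun i μ => af L i (X μ), fun i μ => P.rels.ser i (X μ), fun i μ ν =>
    coeff_single_af_X L i μ ν⟩

end Realization

/-- The span of the products of power series and generators is a subalgebra. -/
def Rels.subalgebra {k : Type*} [Field k] [CharZero k] {m : ℕ} {O : Type*} [CommRing O]
    [Algebra k O] {R : Type*} [Ring R] [Algebra k R] {𝒜 : Fin m → O → O}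
    {c : Fin m → Fin m → Fin m → k} {s : O →ₐ[k] R} {h : Fin m → R} (hr : Rels 𝒜 c s h) :
    Subalgebra k R where
  carrier := {x | x ∈ monoSpan s h}
  mul_mem' := fun ha hb => hr.mul_mem ha hb
  add_mem' := fun ha hb => Submodule.add_mem (monoSpan s h) ha hb
  algebraMap_mem' r := by
    refine Submodule.subset_span ⟨(algebraMap k _ r, 0), ?_⟩
    change s _ * sig k h 0 = _
    rw [sig_zero, mul_one, AlgHom.commutes]

theorem isTwoSided_span {U : Type*} [Ring U] {S : Set U} (hS : ∀ x ∈ S, ∀ b, x * b ∈ S) :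
    (Ideal.span S).IsTwoSided := by
  refine ⟨fun {a} b ha => ?_⟩
  refine Submodule.span_induction ?_ ?_ ?_ ?_ ha
  · exact fun x hx => Ideal.subset_span (hS x hx b)
  · rw [zero_mul]; exact Submodule.zero_mem _
  · intro x y _ _ hx hy
    rw [add_mul]; exact Submodule.add_mem _ hx hy
  · intro c x _ hx
    rw [smul_eq_mul, mul_assoc]
    exact Ideal.mul_mem_left _ _ hx

/-! ### The subalgebra generated by series and generators in a given algebra -/

section Generated

variable {k : Type u} [Field k] [CharZero k] {m n : ℕ} {L : InhomBialgebra k m n}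
  {R : Type u} [Ring R] [Algebra k R] {s : MvPowerSeries (Fin n) k →ₐ[k] R} {h : Fin m → R}
  (hr : Rels (fun i f => af L i f) L.C s h)

theorem Rels.ser_mem (f : MvPowerSeries (Fin n) k) : s f ∈ hr.subalgebra := by
  refine Submodule.subset_span ⟨(f, 0), ?_⟩
  change s _ * sig k h 0 = _
  rw [sig_zero, mul_one]

theorem Rels.gen_mem (i : Fin m) : h i ∈ hr.subalgebra := by
  refine Submodule.subset_span ⟨(1, Finsupp.single i 1), ?_⟩
  change s _ * sig k h _ = _
  rw [sig_single, map_one, one_mul]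

noncomputable def Rels.serAlg : MvPowerSeries (Fin n) k →ₐ[k] hr.subalgebra :=
  s.codRestrict hr.subalgebra hr.ser_mem

noncomputable def Rels.genAlg (i : Fin m) : hr.subalgebra := ⟨h i, hr.gen_mem i⟩

theorem Rels.val_combMap (c : (Fin m →₀ ℕ) →₀ MvPowerSeries (Fin n) k) :
    ((combMap hr.serAlg (sig k hr.genAlg) c : hr.subalgebra) : R) = combMap s (sig k h) c := by
  rw [combMap_apply, combMap_apply, Finsupp.sum, Finsupp.sum, AddSubmonoidClass.coe_finsetSum]
  refine Finset.sum_congr rfl fun d _ => ?_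
  change hr.subalgebra.val (hr.serAlg _ * sig k hr.genAlg d) = _
  rw [map_mul, map_sig]
  rfl

theorem Rels.alg_isPBW (hi : Function.Injective (combMap s (sig k h))) :
    IsPBW hr.serAlg hr.genAlg := by
  constructor
  · intro c c' e
    refine hi ?_
    rw [← hr.val_combMap, ← hr.val_combMap, e]
  · rintro ⟨F, hF⟩
    have : monoSpan s h ≤ LinearMap.range (combMap s (sig k h)) := by
      refine Submodule.span_le.mpr ?_
      rintro _ ⟨⟨f, d⟩, rfl⟩
      exact ⟨Finsupp.single d f, combMap_single _ _ _ _⟩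
    obtain ⟨c, hc⟩ := this hF
    exact ⟨c, Subtype.ext ((hr.val_combMap c).trans hc)⟩

theorem Rels.alg_rels : Rels (fun i f => af L i f) L.C hr.serAlg hr.genAlg := by
  refine ⟨fun i f => Subtype.ext (hr.ser i f), fun i j => Subtype.ext ?_⟩
  refine (hr.gens i j).trans ?_
  rw [AddSubmonoidClass.coe_finsetSum]
  rfl

/-- The realization of the quantization by a faithful representation. -/
noncomputable def Rels.realization (hi : Function.Injective (combMap s (sig k h))) :
    Realization L where
  carrier := hr.subalgebra
  ideal := Ideal.span {x | ∃ μ b, x = hr.serAlg (X μ) * b}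
  twoSided := isTwoSided_span (by
    rintro _ ⟨μ, b, rfl⟩ c
    exact ⟨μ, b * c, mul_assoc _ _ _⟩)
  H := hr.genAlg
  ser := hr.serAlg
  ideal_eq := rfl
  pbw := hr.alg_isPBW hi
  rels := hr.alg_rels

end Generated

/-! ### Existence, by a faithful representation -/

section Construction

variable {k : Type u} [Field k] [CharZero k] {m n : ℕ} (L : InhomBialgebra k m n)

/-- The space on which the quantization acts. -/
abbrev RepSpace (k : Type u) [Field k] (m n : ℕ) : Type u :=
  MvPowerSeries (Fin m) k →ₗ[k] MvPowerSeries (Fin n) k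

/-- The action of power series. -/
noncomputable def serRep (k : Type u) [Field k] (m n : ℕ) :
    MvPowerSeries (Fin n) k →ₐ[k] Module.End k (RepSpace k m n) :=
  Algebra.lsmul k k (RepSpace k m n)

theorem serRep_apply (f : MvPowerSeries (Fin n) k) (ξ : RepSpace k m n)
    (g : MvPowerSeries (Fin m) k) : serRep k m n f ξ g = f * ξ g := rfl

/-- The action of the generators `H i`. -/
noncomputable def genRep (i : Fin m) : Module.End k (RepSpace k m n) where
  toFun ξ := (af L i : MvPowerSeries (Fin n) k →ₗ[k] MvPowerSeries (Fin n) k) ∘ₗ ξ +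
    ξ ∘ₗ (lf L.dual i : MvPowerSeries (Fin m) k →ₗ[k] MvPowerSeries (Fin m) k)
  map_add' ξ ξ' := by rw [LinearMap.comp_add, LinearMap.add_comp]; abel
  map_smul' r ξ := by
    rw [LinearMap.comp_smul, LinearMap.smul_comp, ← smul_add]; rfl

theorem genRep_apply (i : Fin m) (ξ : RepSpace k m n) (g : MvPowerSeries (Fin m) k) :
    genRep L i ξ g = af L i (ξ g) + ξ (lf L.dual i g) := rfl

/-- The `A_i` have the brackets of `𝐇`. The left translations of the dual group have the opposite
brackets, but composition on the right reverses the order, so the second term represents `𝐇` as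
well; the two terms act on different sides and commute. -/
theorem rep_rels : Rels (fun i f => af L i f) L.C (serRep k m n) (genRep L) := by
  refine ⟨fun i f => ?_, fun i j => ?_⟩
  · refine LinearMap.ext fun ξ => LinearMap.ext fun g => ?_
    rw [LinearMap.sub_apply, Module.End.mul_apply, Module.End.mul_apply, LinearMap.sub_apply,
      serRep_apply, serRep_apply, genRep_apply, genRep_apply, serRep_apply, serRep_apply,
      Derivation.leibniz, smul_eq_mul, smul_eq_mul]
    ring
  · refine LinearMap.ext fun ξ => LinearMap.ext fun g => ?_
    have h1 := af_af L i j (ξ g)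
    have h2 := congrArg ξ (lf_lf L.dual i j g)
    rw [map_sub, map_neg, map_sum] at h2
    rw [LinearMap.sub_apply, Module.End.mul_apply, Module.End.mul_apply, LinearMap.sub_apply,
      genRep_apply, genRep_apply, genRep_apply, genRep_apply, genRep_apply, genRep_apply, map_add,
      map_add, LinearMap.sum_apply, LinearMap.sum_apply]
    simp only [LinearMap.smul_apply, genRep_apply, smul_add, Finset.sum_add_distrib]
    rw [← h1]
    simp only [map_smul] at h2
    have h3 : ∑ l, L.C i j l • ξ (lf L.dual l g) =
        -(ξ (lf L.dual i (lf L.dual j g)) - ξ (lf L.dual j (lf L.dual i g))) := by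
      rw [h2, neg_neg]
      rfl
    rw [h3]
    ring

/-- The generators act on functionals by the transposes of the fields. -/
theorem sig_transpose (φ' : MvPowerSeries (Fin m) k →ₗ[k] k) (d : Fin m →₀ ℕ) :
    sig k (fun i => LinearMap.lcomp k k (lf L.dual i : MvPowerSeries (Fin m) k →ₗ[k]
      MvPowerSeries (Fin m) k)) d φ' = φ' ∘ₗ sl L.dual d := by
  have h := sig_unique (k := k) (fun i => (LinearMap.lcomp k k (lf L.dual i :
    MvPowerSeries (Fin m) k →ₗ[k] MvPowerSeries (Fin m) k) :
      Module.End k (MvPowerSeries (Fin m) k →ₗ[k] k)))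
    (fun d => LinearMap.lcomp k k (sl L.dual d)) ?_ ?_ d
  · rw [← h]; rfl
  · refine LinearMap.ext fun f => LinearMap.ext fun g => ?_
    change f (sl L.dual 0 g) = f g
    rw [sl_zero]
  · intro d
    refine LinearMap.ext fun f => LinearMap.ext fun g => ?_
    rw [LinearMap.sum_apply, LinearMap.sum_apply]
    change d.degree • f (sl L.dual d g) = _
    -- Composition on the right reverses products: the letter that acts first on `g` in `sl_rec` is
    -- the first letter in the recursion for the transposed operators.
    rw [← map_nsmul, sl_rec, map_sum]
    refine Finset.sum_congr rfl fun i _ => ?_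
    split_ifs
    · rfl
    · exact map_zero f

/-- A cyclic vector. -/
noncomputable def vac (k : Type u) [Field k] (m n : ℕ) : RepSpace k m n :=
  (Algebra.linearMap k (MvPowerSeries (Fin n) k)) ∘ₗ (coeff 0)

/-- Starting from the cyclic vector only constants occur as values, and these are killed by the
`A_i`. Hence the generators act through transposed left translations alone, and `coeff_eq_sl` turns
`σ_d` into the coefficient of `η^d`. -/
theorem rep_vac (f : MvPowerSeries (Fin n) k) (d : Fin m →₀ ℕ) (g : MvPowerSeries (Fin m) k) :
    (serRep k m n f * sig k (genRep L) d) (vac k m n) g = f * C (coeff d g) := by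
  let Φ : (MvPowerSeries (Fin m) k →ₗ[k] k) →ₗ[k] RepSpace k m n :=
    LinearMap.llcomp k _ _ _ (Algebra.linearMap k (MvPowerSeries (Fin n) k))
  have h := sig_intertwine Φ (fun i => (LinearMap.lcomp k k (lf L.dual i :
    MvPowerSeries (Fin m) k →ₗ[k] MvPowerSeries (Fin m) k) :
      Module.End k (MvPowerSeries (Fin m) k →ₗ[k] k))) (genRep L) ?_ d (coeff 0)
  · rw [sig_transpose] at h
    rw [Module.End.mul_apply, serRep_apply]
    change f * sig k (genRep L) d (Φ (coeff 0)) g = _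
    rw [← h]
    change f * C (coeff 0 (sl L.dual d g)) = _
    rw [coeff_eq_sl]
  · intro i v
    refine LinearMap.ext fun g => ?_
    rw [genRep_apply]
    have : af L i (Φ v g) = 0 := (af L i).map_algebraMap (v g)
    rw [this, zero_add]
    rfl

theorem rep_injective : Function.Injective (combMap (serRep k m n) (sig k (genRep L))) := by
  refine (injective_iff_map_eq_zero _).mpr fun c hc => ?_
  ext1 d
  have h := congrArg (fun F : Module.End k (RepSpace k m n) => F (vac k m n) (monomial d 1)) hc
  rw [combMap_apply, Finsupp.sum] at h
  simp only [LinearMap.sum_apply, rep_vac, LinearMap.zero_apply] at h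
  rw [Finset.sum_eq_single d] at h
  · rwa [coeff_monomial_same, map_one, mul_one] at h
  · intro e _ he
    rw [coeff_monomial_ne he, map_zero, mul_zero]
  · intro hd
    rw [Finsupp.notMem_support_iff.mp hd, zero_mul]

theorem nonempty_quantization : Nonempty (Quantization L) :=
  ⟨((rep_rels L).realization (rep_injective L)).toQuantization⟩

end Construction

/-! ### Reduction of the first tensor factor modulo the ideal -/

section Adic

variable {k : Type u} [Field k] [CharZero k] {m n : ℕ} (L : InhomBialgebra k m n)
  {P : AdicAlgebra k} {s : MvPowerSeries (Fin n) k →ₐ[k] P.carrier}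
  {H : Fin m → P.carrier}

/-- Homomorphisms that kill series of large order are determined by the variables. -/
theorem algHom_eq_of_X {R : Type*} [Ring R] [Algebra k R] {F G : MvPowerSeries (Fin n) k →ₐ[k] R}
    (K : ℕ) (hF : ∀ f, OrdGE K f → F f = 0) (hG : ∀ f, OrdGE K f → G f = 0)
    (h : ∀ μ, F (X μ) = G (X μ)) : F = G := by
  have hm : ∀ a : Fin n →₀ ℕ, F (monomial a 1) = G (monomial a 1) := by
    intro a
    have ha : (monomial a 1 : MvPowerSeries (Fin n) k) =
        ((Finset.univ.toList).map fun j => X j ^ a j).prod := by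
      rw [Finset.prod_map_toList, prod_X_pow, Finsupp.equivFunOnFinite_symm_coe]
    rw [ha, map_list_prod, map_list_prod, List.map_map, List.map_map]
    congr 1
    refine List.map_congr_left fun j _ => ?_
    simp [h]
  ext f
  have h1 := hF _ (sub_sum_monomial f K)
  have h2 := hG _ (sub_sum_monomial f K)
  rw [map_sub, sub_eq_zero, map_sum] at h1 h2
  rw [h1, h2]
  refine Finset.sum_congr rfl fun a _ => ?_
  rw [map_smul, map_smul, hm]

theorem mk_one_ser (hX : ∀ μ, s (X μ) ∈ P.ideal) (f : MvPowerSeries (Fin n) k) :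
    P.mk' 1 (s f) = algebraMap k _ (constantCoeff f) := by
  have h := mk_ser_eq_zero hX (N := 1) (f := f - C (constantCoeff f))
    (ordGE_one_iff.mpr (by simp))
  rw [map_sub, map_sub, sub_eq_zero] at h
  rw [h]
  exact (congrArg (P.mk' 1) (AlgHom.commutes s _)).trans (AlgHom.commutes _ _)

/-- The reduction of the first factor modulo the ideal. -/
noncomputable def red (P : AdicAlgebra k) {N : ℕ} (hN : 1 ≤ N) :
    P.Quo N ⊗[k] P.Quo N →ₐ[k] P.Quo 1 ⊗[k] P.Quo N :=
  Algebra.TensorProduct.map (P.proj hN) (AlgHom.id k _)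

theorem red_tmul {N : ℕ} (hN : 1 ≤ N) (a : P.carrier) (b : P.Quo N) :
    red P hN (P.mk' N a ⊗ₜ b) = P.mk' 1 a ⊗ₜ b := rfl

theorem red_dN (hX : ∀ μ, s (X μ) ∈ P.ideal) {N : ℕ} (hN : 1 ≤ N) (f : MvPowerSeries (Fin n) k) :
    red P hN (dN L hX N f) = 1 ⊗ₜ P.mk' N (s f) := by
  rw [dN_eq_sum L hX le_rfl, map_sum, Finset.sum_eq_single 0]
  · rw [red_tmul, monomial_zero_one, map_one, map_one, sl_zero]
  · intro a _ ha
    rw [red_tmul, mk_one_ser hX, ← coeff_zero_eq_constantCoeff_apply, coeff_monomial_ne ha.symm,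
      map_zero, TensorProduct.zero_tmul]
  · exact fun h => absurd (mem_degLT.mpr (by rw [map_zero]; omega)) h

/-- The matrix `e^{α·X}` is the identity modulo the ideal, so the generators become primitive. -/
theorem red_hN (hX : ∀ μ, s (X μ) ∈ P.ideal) {N : ℕ} (h : 1 ≤ N) (i : Fin m) :
    red P h (hN L s H N i) = 1 ⊗ₜ P.mk' N (H i) + P.mk' 1 (H i) ⊗ₜ 1 := by
  rw [hN, map_add, map_sum, red_tmul]
  congr 1
  rw [Finset.sum_eq_single i]
  · rw [red_tmul, mk_one_ser hX, ← coeff_zero_eq_constantCoeff_apply, coeff_zero_ee, if_pos rfl,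
      map_one]
  · intro l _ hl
    rw [red_tmul, mk_one_ser hX, ← coeff_zero_eq_constantCoeff_apply, coeff_zero_ee,
      if_neg hl.symm, map_zero, TensorProduct.zero_tmul]
  · simp

theorem coeff_single_ee (μ : Fin n) (i l : Fin m) :
    coeff (Finsupp.single μ 1) (ee L i l) = L.α μ i l := by
  rw [coeff_single_eq_lf L, lf_ee, map_sum, Finset.sum_eq_single l]
  · rw [coeff_smul, coeff_zero_ee, if_pos rfl, mul_one]
  · intro p _ hp
    rw [coeff_smul, coeff_zero_ee, if_neg hp, mul_zero]
  · simp

/-- The sum of the values at the monomials of a functional of order one. -/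
theorem sum_monomial_fun {M : Type*} [AddCommGroup M] [Module k M] {K : ℕ} (hK : 2 ≤ K)
    (F : (Fin n →₀ ℕ) → k) (h0 : ∀ a, 2 ≤ a.degree → F a = 0) (v : (Fin n →₀ ℕ) → M) :
    ∑ a ∈ degLT (Fin n) K, F a • v a =
      F 0 • v 0 + ∑ ν, F (Finsupp.single ν 1) • v (Finsupp.single ν 1) := by
  rw [sum_degLT, ← Finset.sum_subset (Finset.range_subset_range.mpr hK)]
  · rw [Finset.sum_range_succ, Finset.sum_range_one]
    congr 1
    · rw [Finset.sum_eq_single 0]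
      · intro a ha h
        exact absurd ((Finsupp.degree_eq_zero_iff a).mp (mem_finsuppAntidiag_degree.mp ha)) h
      · exact fun h => absurd (mem_finsuppAntidiag_degree.mpr (map_zero _)) h
    · have := sum_degree_succ (ι := Fin n) 0 fun μ b =>
        F (b + Finsupp.single μ 1) • v (b + Finsupp.single μ 1)
      have h1 : ∀ a ∈ Finset.univ.finsuppAntidiag (0 + 1), (∑ μ : Fin n,
          if Finsupp.single μ 1 ≤ a then F (a - Finsupp.single μ 1 + Finsupp.single μ 1) •
            v (a - Finsupp.single μ 1 + Finsupp.single μ 1) else 0) = F a • v a := by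
        intro a ha
        have hd : a.degree = 1 := mem_finsuppAntidiag_degree.mp ha
        obtain ⟨ν, hν⟩ := (Finsupp.sum_eq_one_iff a).mp hd
        subst hν
        rw [Finset.sum_eq_single ν]
        · rw [if_pos le_rfl, tsub_self, zero_add]
        · intro μ _ hμ
          rw [if_neg]
          rw [single_le_iff', Finsupp.single_apply, if_neg (Ne.symm hμ)]
          omega
        · simp
      rw [Finset.sum_congr rfl h1] at this
      rw [zero_add] at this
      rw [this]
      refine Finset.sum_congr rfl fun μ _ => ?_
      rw [Finset.sum_eq_single 0]
      · rw [zero_add]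
      · intro a ha h
        exact absurd ((Finsupp.degree_eq_zero_iff a).mp (mem_finsuppAntidiag_degree.mp ha)) h
      · exact fun h => absurd (mem_finsuppAntidiag_degree.mpr (map_zero _)) h
  · intro j _ hj
    refine Finset.sum_eq_zero fun a ha => ?_
    rw [h0 a, zero_smul]
    rw [mem_finsuppAntidiag_degree.mp ha]
    rw [Finset.mem_range] at hj
    omega

end Adic


/-! ### The coproduct determines the commutation relations -/

section Rigid

variable {k : Type u} [Field k] [CharZero k] {m n : ℕ} {L : InhomBialgebra k m n}
  (U : Quantization L)

theorem _root_.Quantization.isPBW : IsPBW U.ser U.H := isPBW_iff.mpr U.pbw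

theorem _root_.Quantization.X_mem (μ : Fin n) : U.ser (X μ) ∈ U.ideal := by
  rw [U.ideal_eq]
  exact Ideal.subset_span ⟨μ, 1, (mul_one _).symm⟩

theorem _root_.Quantization.counit_ser (f : MvPowerSeries (Fin n) k) :
    U.counit (U.ser f) = constantCoeff f := by
  have hC : U.ser (C (constantCoeff f)) = algebraMap k _ (constantCoeff f) :=
    AlgHom.commutes _ _
  conv_lhs => rw [eq_add_sum_quot f, map_add, map_add, hC, AlgHom.commutes, map_sum, map_sum]
  rw [Finset.sum_eq_zero, add_zero]
  · rfl
  · intro μ _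
    rw [map_mul, map_mul, U.counit_X, zero_mul]

theorem _root_.Quantization.comul_ser (N : ℕ) (f : MvPowerSeries (Fin n) k) :
    U.comul N (U.ser f) = dN L U.X_mem N f := by
  refine AlgHom.congr_fun (algHom_eq_of_X (F := (U.comul N).comp U.ser) (2 * N) ?_ ?_ ?_) f
  · exact fun f hf => U.comul_cont N _ (ser_mem_pow U.X_mem _ f hf)
  · exact fun f hf => dN_eq_zero L U.X_mem hf
  · exact fun μ => (U.comul_X N μ).trans (dN_X_eq_box L U.X_mem N μ).symm

theorem _root_.Quantization.comul_gen (N : ℕ) (i : Fin m) :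
    U.comul N (U.H i) = hN L U.ser U.H N i := U.comul_H N i

/-- The commutators of the generators with power series, before they are identified. -/
theorem _root_.Quantization.exists_vf : ∃ a : Fin m → Fin n → MvPowerSeries (Fin n) k,
    (∀ i f, U.H i * U.ser f - U.ser f * U.H i = U.ser (vf (a i) f)) ∧
    (∀ N i f, OrdGE N f → OrdGE N (vf (a i) f)) ∧
    ∀ i μ ν, coeff (Finsupp.single ν 1) (a i μ) = L.A i ν μ := by
  obtain ⟨a, ha, hcoeff⟩ := U.comm_HX
  -- The counit applied to the relation shows that the commutators have no constant term.
  have h0 : ∀ i μ, OrdGE 1 (a i μ) := by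
    intro i μ
    rw [ordGE_one_iff, ← U.counit_ser, ← ha, map_sub, map_mul, map_mul, U.counit_H, zero_mul,
      mul_zero, sub_zero]
  refine ⟨a, fun i f => ?_, ?_, hcoeff⟩
  · let y : MvPowerSeries (Fin n) k → U.carrier := fun f =>
      U.H i * U.ser f - U.ser f * U.H i - U.ser (vf (a i) f)
    have hmul : ∀ μ f, y (X μ * f) = U.ser (X μ) * y f := by
      intro μ f
      simp only [y]
      rw [Derivation.leibniz, smul_eq_mul, smul_eq_mul, vf_X, mul_comm f, map_add, map_mul,
        map_mul, map_mul, ← ha]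
      noncomm_ring
    have hadd : ∀ f g, y (f + g) = y f + y g := by
      intro f g
      simp only [y, map_add]
      noncomm_ring
    have hC : ∀ r : k, y (C r) = 0 := by
      intro r
      have hC : U.ser (C r) = algebraMap k _ r := AlgHom.commutes _ _
      have hD : vf (a i) (C r) = 0 := (vf (a i)).map_algebraMap r
      simp only [y]
      rw [hC, hD, map_zero, ← Algebra.commutes, sub_self, sub_self]
    have hsum : ∀ f, y f = ∑ μ, U.ser (X μ) * y (quot μ f) := by
      intro f
      conv_lhs => rw [eq_add_sum_quot f, hadd, hC, zero_add]
      have : ∀ (S : Finset (Fin n)) (g : Fin n → MvPowerSeries (Fin n) k),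
          y (∑ μ ∈ S, g μ) = ∑ μ ∈ S, y (g μ) := by
        intro S g
        induction S using Finset.induction_on with
        | empty => rw [Finset.sum_empty, Finset.sum_empty, ← map_zero C, hC]
        | insert μ S hμ ih => rw [Finset.sum_insert hμ, Finset.sum_insert hμ, hadd, ih]
      rw [this]
      exact Finset.sum_congr rfl fun μ _ => hmul μ _
    have hord : ∀ N f d, OrdGE N (U.isPBW.crd (y f) d) := by
      intro N
      induction N with
      | zero => exact fun f d => OrdGE.zero' _
      | succ N ih =>
        intro f d
        rw [hsum f, map_sum, Finsupp.finsetSum_apply]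
        refine OrdGE.sum fun μ _ => ?_
        rw [U.isPBW.crd_ser_mul, add_comm]
        exact (ordGE_X μ).mul (ih _ d)
    exact sub_eq_zero.mp (U.isPBW.eq_zero fun N d => hord N f d)
  · intro N i f hf
    cases N with
    | zero => exact OrdGE.zero' _
    | succ N =>
      rw [vf_apply]
      refine OrdGE.sum fun μ _ => ?_
      rw [add_comm]
      exact (h0 i μ).mul (hf.pderiv μ)

theorem _root_.Quantization.mem_pow_iff (N : ℕ) (u : U.carrier) :
    u ∈ U.ideal ^ N ↔ ∀ d, OrdGE N (U.isPBW.crd u d) := by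
  obtain ⟨a, h1, h2, -⟩ := U.exists_vf
  exact U.isPBW.mem_pow_iff (𝒜 := fun i f => vf (a i) f) h1 h2 U.ideal_eq N u

/-- The functional `f(X) σ_d(H) ↦ coeff_e f`, for a fixed exponent `d`. -/
noncomputable def _root_.Quantization.coord (e : Fin n →₀ ℕ) (d : Fin m →₀ ℕ) {N : ℕ}
    (hN : e.degree < N) : U.Quo N →ₗ[k] k :=
  idealLift (U.ideal ^ N) ((coeff e) ∘ₗ (Finsupp.lapply d) ∘ₗ U.isPBW.crd.toLinearMap)
    fun u hu => (U.mem_pow_iff N u).mp hu d e hN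

theorem _root_.Quantization.coord_mk (e : Fin n →₀ ℕ) (d : Fin m →₀ ℕ) {N : ℕ}
    (hN : e.degree < N) (u : U.carrier) :
    U.coord e d hN (U.mk' N u) = coeff e (U.isPBW.crd u d) := rfl

theorem _root_.Quantization.ser_eq {f g : MvPowerSeries (Fin n) k} (K : ℕ)
    (h : ∀ N, K ≤ N → U.mk' N (U.ser f) = U.mk' N (U.ser g)) : f = g := by
  refine eq_of_ordGE_sub fun N => OrdGE.mono (le_max_left N K) ?_
  have h1 := h (max N K) (le_max_right N K)
  rw [← sub_eq_zero, ← map_sub, ← map_sub] at h1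
  have h2 := (U.mem_pow_iff _ _).mp (mk_eq_zero_iff.mp h1) 0
  rwa [U.isPBW.crd_ser, Finsupp.single_eq_same] at h2

/-- Reduce the first factor of `Δ [H_i, H_j]` modulo the ideal and take its coordinate along `H_q`.
The generators are primitive there and the mixed terms cancel, so the commutator contributes only
the constant `C i j q`; the right side of the relation contributes the whole series. Hence that
series is constant. -/
theorem _root_.Quantization.gens_comm (i j : Fin m) :
    U.H i * U.H j - U.H j * U.H i = ∑ l, L.C i j l • U.H l := by
  obtain ⟨c, hc, h0⟩ := U.comm_HH
  have hcst : ∀ q, c i j q = C (L.C i j q) := by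
    intro q
    refine U.ser_eq 1 fun N hN => ?_
    have h1 := congrArg (fun t => sliceL (U.Quo N) (U.coord 0 (Finsupp.single q 1)
      (N := 1) (by simp)) (red U.toAdicAlgebra hN (U.comul N t))) (hc i j)
    simp only [map_sub, map_mul, map_sum, U.comul_ser, U.comul_gen, red_dN, red_hN L U.X_mem]
      at h1
    have e1 : ∀ i j : Fin m, ((1 : U.Quo 1) ⊗ₜ[k] U.mk' N (U.H i) + U.mk' 1 (U.H i) ⊗ₜ 1) *
        (1 ⊗ₜ U.mk' N (U.H j) + U.mk' 1 (U.H j) ⊗ₜ 1) =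
        1 ⊗ₜ (U.mk' N (U.H i) * U.mk' N (U.H j)) + U.mk' 1 (U.H j) ⊗ₜ U.mk' N (U.H i) +
        U.mk' 1 (U.H i) ⊗ₜ U.mk' N (U.H j) + U.mk' 1 (U.H i * U.H j) ⊗ₜ 1 := by
      intro i j
      simp only [mul_add, add_mul, Algebra.TensorProduct.tmul_mul_tmul, one_mul, mul_one, map_mul]
      abel
    have hone : (1 : U.Quo 1) = U.mk' 1 1 := (map_one _).symm
    have e2 : U.coord 0 (Finsupp.single q 1) (N := 1) (by simp) 1 = 0 := by
      have : (1 : U.carrier) = U.ser 1 := (map_one _).symm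
      rw [hone, U.coord_mk, this, U.isPBW.crd_ser, Finsupp.single_apply, if_neg]
      · rfl
      · exact fun h => by simpa using congrArg Finsupp.degree h
    have e3 : ∀ f p, U.coord 0 (Finsupp.single q 1) (N := 1) (by simp)
        (U.mk' 1 (U.ser f * U.H p)) = if p = q then constantCoeff f else 0 := by
      intro f p
      rw [U.coord_mk, ← sig_single (k := k) U.H p, U.isPBW.crd_mono, Finsupp.single_apply]
      simp only [Finsupp.single_left_inj one_ne_zero]
      split_ifs <;> rfl
    have e4 : ∀ p, U.coord 0 (Finsupp.single q 1) (N := 1) (by simp)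
        (U.mk' 1 (U.H p)) = if p = q then 1 else 0 := by
      intro p
      have := e3 1 p
      rwa [map_one, one_mul, map_one] at this
    have e5 : U.coord 0 (Finsupp.single q 1) (N := 1) (by simp) (U.mk' 1 (U.H i * U.H j)) -
        U.coord 0 (Finsupp.single q 1) (N := 1) (by simp) (U.mk' 1 (U.H j * U.H i)) =
        L.C i j q := by
      rw [← map_sub, ← map_sub, hc, map_sum, map_sum]
      simp only [e3, h0]
      simp
    rw [e1, e1] at h1
    simp only [map_add, sliceL_tmul, e2, e4, mul_add, Algebra.TensorProduct.tmul_mul_tmul, one_mul,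
      mul_one, zero_smul, zero_add, ite_smul, one_smul, Finset.sum_ite_eq', Finset.mem_univ, if_true] at h1
    rw [← h1, show U.ser (C (L.C i j q)) = algebraMap k _ (L.C i j q) from AlgHom.commutes _ _,
      AlgHom.commutes, Algebra.algebraMap_eq_smul_one, ← e5, sub_smul]
    abel
  rw [hc]
  refine Finset.sum_congr rfl fun l _ => ?_
  rw [hcst, Algebra.smul_def]
  exact congrArg (· * U.H l) (AlgHom.commutes U.ser _)

theorem _root_.Quantization.slice_dN (μ : Fin n) {N : ℕ} (hN : 2 ≤ N)
    (f : MvPowerSeries (Fin n) k) :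
    sliceL (U.Quo N) (U.coord (Finsupp.single μ 1) 0 (N := N) (by rw [Finsupp.degree_single]; omega))
      (dN L U.X_mem N f) = U.mk' N (U.ser (lf L μ f)) := by
  rw [dN_eq_sum L U.X_mem le_rfl, map_sum, Finset.sum_eq_single (Finsupp.single μ 1)]
  · rw [sliceL_tmul, U.coord_mk, U.isPBW.crd_ser, Finsupp.single_eq_same, coeff_monomial_same,
      one_smul, sl, sig_single]
    rfl
  · intro a _ ha
    rw [sliceL_tmul, U.coord_mk, U.isPBW.crd_ser, Finsupp.single_eq_same,
      coeff_monomial_ne ha.symm, zero_smul]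
  · exact fun h => absurd (mem_degLT.mpr (by rw [Finsupp.degree_single]; omega)) h

theorem coeff_single_mul_X (f : MvPowerSeries (Fin n) k) (μ ν : Fin n) :
    coeff (Finsupp.single μ 1) (f * X ν) = if ν = μ then coeff 0 f else 0 := by
  rw [mul_comm, coeff_X_mul']
  by_cases h : ν = μ
  · subst h
    rw [if_pos le_rfl, if_pos rfl, tsub_self]
  · rw [if_neg h, if_neg]
    rw [single_le_iff', Finsupp.single_apply, if_neg (Ne.symm h)]
    omega

/-- The coefficient of `X_μ` in the first factor of `Δ [H_i, f]` computes `L_μ` of the commutator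
field. The result is the same system that `lf_af` gives for the `A_i`; both families vanish at the
origin, so they agree by uniqueness along the frame. -/
theorem _root_.Quantization.ser_comm (i : Fin m) (f : MvPowerSeries (Fin n) k) :
    U.H i * U.ser f - U.ser f * U.H i = U.ser (af L i f) := by
  obtain ⟨a, h1, h2, h3⟩ := U.exists_vf
  have hlf : ∀ μ i f, lf L μ (vf (a i) f) =
      (∑ l, L.α μ i l • vf (a l) f + vf (a i) (lf L μ f)) + ∑ ν, L.A i μ ν • lf L ν f := by
    intro μ i f
    refine U.ser_eq 2 fun N hN => ?_
    have e := hN_comm_dN L U.X_mem (T := fun i f => vf (a i) f) h1 N i f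
    rw [← U.comul_ser, ← U.comul_gen, ← map_mul, ← map_mul, ← map_sub, h1, U.comul_ser] at e
    have e' := congrArg (sliceL (U.Quo N) (U.coord (Finsupp.single μ 1) 0 (N := N)
      (by rw [Finsupp.degree_single]; omega))) e
    have hval : ∀ g, U.coord (Finsupp.single μ 1) 0 (N := N) (by rw [Finsupp.degree_single]; omega)
        (U.mk' N (U.ser g)) = coeff (Finsupp.single μ 1) g := by
      intro g
      rw [U.coord_mk, U.isPBW.crd_ser, Finsupp.single_eq_same]
    have hlow : ∀ g, OrdGE 2 g → coeff (Finsupp.single μ 1) g = (0 : k) := fun g hg =>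
      hg _ (by simp)
    rw [U.slice_dN μ hN, map_add, map_sum, map_sum] at e'
    simp only [map_sum, sliceL_tmul, hval] at e'
    rw [e', map_add, map_add, map_add, map_add]
    have hsl : ∀ ν g, sl L (Finsupp.single ν 1) g = lf L ν g := fun ν g => by
      rw [sl, sig_single]; rfl
    congr 1
    · have : ∀ l, ∑ b ∈ degLT (Fin n) N, coeff (Finsupp.single μ 1) (ee L i l * monomial b 1) •
          U.mk' N (U.ser (vf (a l) (sl L b f))) = L.α μ i l • U.mk' N (U.ser (vf (a l) f)) +
            (if i = l then 1 else 0 : k) • U.mk' N (U.ser (vf (a l) (lf L μ f))) := by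
        intro l
        rw [sum_monomial_fun hN (fun b => coeff (Finsupp.single μ 1) (ee L i l * monomial b 1))
          (fun b hb => hlow _ (((ordGE_monomial b 1).mono hb).mul_left _))
          (fun b => U.mk' N (U.ser (vf (a l) (sl L b f))))]
        congr 1
        · rw [monomial_zero_one, mul_one, coeff_single_ee, sl_zero]
        · have : ∀ ν, coeff (Finsupp.single μ 1) (ee L i l * monomial (Finsupp.single ν 1) 1) =
              if ν = μ then coeff 0 (ee L i l) else 0 := fun ν => coeff_single_mul_X _ μ ν
          simp only [this, hsl, ite_smul, zero_smul, Finset.sum_ite_eq', Finset.mem_univ, if_true,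
            coeff_zero_ee]
      rw [Finset.sum_congr rfl fun l _ => this l, Finset.sum_add_distrib]
      simp only [map_sum, map_smul, ite_smul, one_smul, zero_smul, Finset.sum_ite_eq,
        Finset.mem_univ, if_true]
    · rw [sum_monomial_fun hN (fun b => coeff (Finsupp.single μ 1) (vf (a i) (monomial b 1)))
        (fun b hb => hlow _ (h2 2 i _ ((ordGE_monomial b 1).mono hb)))
        (fun b => U.mk' N (U.ser (sl L b f)))]
      have hone : vf (a i) (monomial 0 1) = 0 := (vf (a i)).map_algebraMap 1
      have : ∀ ν, coeff (Finsupp.single μ 1) (vf (a i) (monomial (Finsupp.single ν 1) 1)) =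
          L.A i μ ν := fun ν => by
        change coeff _ (vf (a i) (X ν)) = _
        rw [vf_X, h3]
      simp only [hone, map_zero, zero_smul, zero_add, this, hsl, map_sum, map_smul]
  rw [h1]
  refine congrArg U.ser (sub_eq_zero.mp ?_)
  refine eq_zero_of_fields (fun μ => lf L μ) (sum_X_mul_lf L)
    (fun p : Fin m × MvPowerSeries (Fin n) k => vf (a p.1) p.2 - af L p.1 p.2) ?_ ?_ (i, f)
  · rintro ⟨i, f⟩
    rw [map_sub, constantCoeff_af, sub_zero, ← U.counit_ser, ← h1, map_sub, map_mul, map_mul,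
      U.counit_H, zero_mul, mul_zero, sub_zero]
  · rintro N hN μ ⟨i, f⟩
    have : lf L μ (vf (a i) f - af L i f) = ∑ l, L.α μ i l • (vf (a l) f - af L l f) +
        (vf (a i) (lf L μ f) - af L i (lf L μ f)) := by
      rw [map_sub, hlf, sub_eq_iff_eq_add.mp (lf_af L μ i f)]
      simp only [smul_sub, Finset.sum_sub_distrib]
      abel
    change OrdGE N (lf L μ (vf (a i) f - af L i f))
    rw [this]
    exact (OrdGE.sum fun l _ => (hN (l, f)).smul _).add (hN (i, lf L μ f))

end Rigid

/-! ### Compatibility of levels and uniqueness of the antipode -/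

section Hopf

variable {k : Type u} [Field k] (U : AdicHopf k)

theorem _root_.AdicHopf.comul_proj {N M : ℕ} (h : N ≤ M) (a : U.carrier) :
    Algebra.TensorProduct.map (U.proj h) (U.proj h) (U.comul M a) = U.comul N a := by
  induction M, h using Nat.le_induction with
  | base =>
    have : U.proj le_rfl = AlgHom.id k (U.Quo N) := AlgHom.ext fun x => by
      obtain ⟨x, rfl⟩ := Ideal.Quotient.mk_surjective x
      rfl
    rw [this, Algebra.TensorProduct.map_id]
    rfl
  | succ M h ih =>
    rw [← ih, ← U.comul_compat M a]
    have : U.proj (h.trans M.le_succ) = (U.proj h).comp (U.proj M.le_succ) :=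
      AlgHom.ext fun x => by
        obtain ⟨x, rfl⟩ := Ideal.Quotient.mk_surjective x
        rfl
    rw [this, Algebra.TensorProduct.map_comp]
    rfl

/-- The counit of the quotients. -/
noncomputable def _root_.AdicHopf.epsN (N : ℕ) : U.Quo (N + 1) →ₐ[k] k :=
  Ideal.Quotient.liftₐ (U.ideal ^ (N + 1)) U.counit
    fun a ha => U.counit_cont a (Ideal.pow_le_self N.succ_ne_zero ha)

theorem _root_.AdicHopf.sliceL_comul (N : ℕ) (a : U.carrier) :
    sliceL (U.Quo (N + 1)) (U.epsN N).toLinearMap (U.comul (N + 1) a) = U.mk' (N + 1) a :=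
  U.counit_comul N a

theorem _root_.AdicHopf.sliceR_comul (N : ℕ) (a : U.carrier) :
    sliceR (U.Quo (N + 1)) (U.epsN N).toLinearMap (U.comul (N + 1) a) = U.mk' (N + 1) a :=
  U.comul_counit N a

/-- A right convolution inverse of the identity is the antipode. -/
theorem _root_.AdicHopf.antipode_unique (N : ℕ) (T : U.Quo (N + 1) →ₗ[k] U.Quo (N + 1))
    (hT : ∀ a, LinearMap.mul' k (U.Quo (N + 1)) (TensorProduct.map LinearMap.id T
      (U.comul (N + 1) a)) = algebraMap k (U.Quo (N + 1)) (U.counit a)) (a : U.carrier) :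
    T (U.mk' (N + 1) a) = U.mk' (N + 1) (U.antipode a) := by
  let S : U.Quo (N + 1) →ₗ[k] U.Quo (N + 1) :=
    idealLift (U.ideal ^ (N + 1)) ((U.mk' (N + 1)).toLinearMap ∘ₗ U.antipode) (U.antipode_cont (N + 1))
  have hS : ∀ u, S (U.mk' (N + 1) u) = U.mk' (N + 1) (U.antipode u) := fun u => rfl
  have hq := Nat.le_mul_of_pos_left (N + 1) two_pos
  let D := Ideal.Quotient.liftₐ (U.ideal ^ (2 * (N + 1))) (U.comul (N + 1)) (U.comul_cont (N + 1))
  have hD : ∀ u, D (U.mk' (2 * (N + 1)) u) = U.comul (N + 1) u := fun u => rfl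
  -- The map `x ⊗ y ⊗ z ↦ S(x) y T(z)`, evaluated on the threefold coproduct with both bracketings.
  let m3 : U.Quo (N + 1) ⊗[k] (U.Quo (N + 1) ⊗[k] U.Quo (N + 1)) →ₗ[k] U.Quo (N + 1) :=
    LinearMap.mul' k (U.Quo (N + 1)) ∘ₗ TensorProduct.map S
      (LinearMap.mul' k (U.Quo (N + 1)) ∘ₗ TensorProduct.map LinearMap.id T)
  have hassoc : ∀ (w : U.Quo (N + 1) ⊗[k] U.Quo (N + 1)) (z : U.Quo (N + 1)),
      m3 (Algebra.TensorProduct.assoc k k k _ _ _ (w ⊗ₜ z)) =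
        LinearMap.mul' k (U.Quo (N + 1)) (TensorProduct.map S LinearMap.id w) * T z := by
    intro w z
    induction w with
    | zero => simp
    | tmul x y => exact (mul_assoc _ _ _).symm
    | add x y hx hy =>
      rw [TensorProduct.add_tmul, map_add, map_add, hx, hy, map_add, map_add, add_mul]
  have hl : ∀ t : U.Quo (2 * (N + 1)) ⊗[k] U.Quo (2 * (N + 1)),
      m3 (Algebra.TensorProduct.assoc k k k _ _ _ (Algebra.TensorProduct.map D (U.proj hq) t)) =
        T (sliceL (U.Quo (N + 1)) (U.epsN N).toLinearMap
          (Algebra.TensorProduct.map (U.proj hq) (U.proj hq) t)) := by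
    intro t
    induction t with
    | zero => simp
    | add x y hx hy => simp only [map_add, hx, hy]
    | tmul x y =>
      obtain ⟨x, rfl⟩ := Ideal.Quotient.mk_surjective x
      obtain ⟨y, rfl⟩ := Ideal.Quotient.mk_surjective y
      rw [Algebra.TensorProduct.map_tmul, Algebra.TensorProduct.map_tmul, hassoc, sliceL_tmul,
        map_smul]
      refine (congrArg (· * _) (U.antipode_left (N + 1) x)).trans ?_
      exact (Algebra.smul_def _ _).symm
  have hr : ∀ t : U.Quo (2 * (N + 1)) ⊗[k] U.Quo (2 * (N + 1)),
      m3 (Algebra.TensorProduct.map (U.proj hq) D t) =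
        S (sliceR (U.Quo (N + 1)) (U.epsN N).toLinearMap
          (Algebra.TensorProduct.map (U.proj hq) (U.proj hq) t)) := by
    intro t
    induction t with
    | zero => simp
    | add x y hx hy => simp only [map_add, hx, hy]
    | tmul x y =>
      obtain ⟨x, rfl⟩ := Ideal.Quotient.mk_surjective x
      obtain ⟨y, rfl⟩ := Ideal.Quotient.mk_surjective y
      rw [Algebra.TensorProduct.map_tmul, Algebra.TensorProduct.map_tmul, sliceR_tmul,
        map_smul]
      refine (congrArg (fun z => S (U.mk' (N + 1) x) * z) (hT y)).trans ?_
      rw [← Algebra.commutes]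
      exact (Algebra.smul_def _ _).symm
  have e := congrArg m3 (U.coassoc (N + 1) a)
  have e1 := (hl (U.comul (2 * (N + 1)) a)).symm.trans (e.trans (hr (U.comul (2 * (N + 1)) a)))
  rw [U.comul_proj hq, U.sliceL_comul, U.sliceR_comul, hS] at e1
  exact e1

end Hopf

/-! ### An arbitrary quantization has the standard structure maps -/

section Real

variable {k : Type u} [Field k] [CharZero k] {m n : ℕ} {L : InhomBialgebra k m n}
  (U : Quantization L)

/-- The algebra that underlies a quantization satisfies the standard relations. -/
noncomputable abbrev _root_.Quantization.real : Realization L where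
  toAdicAlgebra := U.toAdicAlgebra
  H := U.H
  ser := U.ser
  ideal_eq := U.ideal_eq
  pbw := U.isPBW
  rels := ⟨U.ser_comm, U.gens_comm⟩

theorem _root_.Quantization.comul_eq (N : ℕ) : U.comul N = U.real.cm N :=
  U.isPBW.algHom_ext (fun f => (U.comul_ser N f).trans (U.real.cm_ser N f).symm)
    fun i => (U.comul_gen N i).trans (U.real.cm_H N i).symm

theorem _root_.Quantization.counit_eq : U.counit = U.real.eps :=
  U.isPBW.algHom_ext (fun f => (U.counit_ser f).trans (U.real.eps_ser f).symm)
    fun i => (U.counit_H i).trans (U.real.eps_H i).symm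

theorem _root_.Quantization.eq_of_mk {a b : U.carrier}
    (h : ∀ N, U.mk' (N + 1) a = U.mk' (N + 1) b) : a = b := by
  refine sub_eq_zero.mp (U.isPBW.eq_zero fun N d => ?_)
  have h1 := h N
  rw [← sub_eq_zero, ← map_sub] at h1
  exact ((U.mem_pow_iff _ _).mp (mk_eq_zero_iff.mp h1) d).mono N.le_succ

theorem _root_.Quantization.antipode_eq (a : U.carrier) : U.antipode a = U.real.anti a := by
  refine U.eq_of_mk fun N => ?_
  refine (U.antipode_unique N (U.real.antiN (N + 1)) (fun a => ?_) a).symm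
  have h := U.real.convR_cm (N + 1) a
  rw [← U.comul_eq, ← U.counit_eq] at h
  exact h

end Real

/-! ### The pairing of quantizations of `𝐋*` and `𝐋` -/

section Pairing

variable {k : Type u} [Field k] [CharZero k] {m n : ℕ} {L : InhomBialgebra k m n}
  (U : Quantization L) (W : Quantization L.dual)

/-- The action of a quantization on `RepSpace`. -/
noncomputable def _root_.Quantization.rep : U.carrier →ₐ[k] Module.End k (RepSpace k m n) :=
  U.isPBW.lift U.real.rels (rep_rels L)

theorem _root_.Quantization.rep_ser (f : MvPowerSeries (Fin n) k) :
    U.rep (U.ser f) = serRep k m n f := U.isPBW.lift_ser _ _ f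

theorem _root_.Quantization.rep_H (i : Fin m) : U.rep (U.H i) = genRep L i :=
  U.isPBW.lift_gen _ _ i

/-- The map `k[[η]] → k[[X]]` that an element of the quantization defines. -/
noncomputable def _root_.Quantization.vec : U.carrier →ₗ[k] RepSpace k m n :=
  LinearMap.applyₗ (vac k m n) ∘ₗ U.rep.toLinearMap

theorem _root_.Quantization.vec_apply (a : U.carrier) : U.vec a = U.rep a (vac k m n) := rfl

theorem _root_.Quantization.vec_mono (f : MvPowerSeries (Fin n) k) (d : Fin m →₀ ℕ)
    (g : MvPowerSeries (Fin m) k) : U.vec (U.ser f * sig k U.H d) g = coeff d g • f := by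
  have h : U.rep (U.ser f * sig k U.H d) = serRep k m n f * sig k (genRep L) d :=
    U.isPBW.lift_mono _ _ f d
  rw [U.vec_apply, h, rep_vac, smul_eq_C_mul, mul_comm]

/-- The pairing of the quantizations of `𝐋*` and of `𝐋`. -/
noncomputable def pairing : W.carrier →ₗ[k] U.carrier →ₗ[k] k :=
  (Finsupp.lsum k fun e => U.vec.flip.compr₂ (coeff e)) ∘ₗ W.isPBW.crd.toLinearMap

theorem pairing_mono_left (g : MvPowerSeries (Fin m) k) (e : Fin n →₀ ℕ) (a : U.carrier) :
    pairing U W (W.ser g * sig k W.H e) a = coeff e (U.vec a g) := by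
  change (Finsupp.lsum k fun e => U.vec.flip.compr₂ (coeff e))
    (W.isPBW.crd (W.ser g * sig k W.H e)) a = _
  rw [W.isPBW.crd_mono, Finsupp.lsum_single]
  rfl

theorem pairing_mono (g : MvPowerSeries (Fin m) k) (e : Fin n →₀ ℕ) (f : MvPowerSeries (Fin n) k)
    (d : Fin m →₀ ℕ) : pairing U W (W.ser g * sig k W.H e) (U.ser f * sig k U.H d) =
      coeff d g * coeff e f := by
  rw [pairing_mono_left, U.vec_mono, coeff_smul]

/-- The double dual `𝐋**` is definitionally `𝐋`, so `U` is also a quantization of the dual of `𝐋*`.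
The symmetry gives every statement about the pairing a mirror image with `U` and `W` exchanged. -/
theorem pairing_flip : (pairing U W).flip = pairing (L := L.dual) W U := by
  refine U.isPBW.ext fun f d => W.isPBW.ext fun g e => ?_
  rw [LinearMap.flip_apply, pairing_mono]
  exact (mul_comm _ _).trans (pairing_mono (L := L.dual) W U f d g e).symm

theorem pairing_comm (w : W.carrier) (a : U.carrier) :
    pairing U W w a = pairing (L := L.dual) W U a w := by
  rw [← pairing_flip, LinearMap.flip_apply]

theorem pairing_mono_right (w : W.carrier) (f : MvPowerSeries (Fin n) k) (d : Fin m →₀ ℕ) :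
    pairing U W w (U.ser f * sig k U.H d) = coeff d (W.vec w f) :=
  (pairing_comm U W _ _).trans (pairing_mono_left (L := L.dual) W U f d w)

theorem pairing_ser (g : MvPowerSeries (Fin m) k) (a : U.carrier) :
    pairing U W (W.ser g) a = coeff 0 (U.vec a g) := by
  rw [← pairing_mono_left U W, sig_zero, mul_one]

theorem pairing_gen (μ : Fin n) (a : U.carrier) :
    pairing U W (W.H μ) a = coeff (Finsupp.single μ 1) (U.vec a 1) := by
  rw [← pairing_mono_left U W, sig_single, map_one, one_mul]

theorem coeff_crd_eq_pairing (w : W.carrier) (e : Fin n →₀ ℕ) (d : Fin m →₀ ℕ) :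
    coeff d (W.isPBW.crd w e) = pairing U W w (U.ser (monomial e 1) * sig k U.H d) := by
  refine LinearMap.congr_fun (f := coeff d ∘ₗ Finsupp.lapply e ∘ₗ W.isPBW.crd.toLinearMap)
    (g := (pairing U W).flip _) (W.isPBW.ext fun g e' => ?_) w
  change coeff d (W.isPBW.crd (W.ser g * sig k W.H e') e) = _
  rw [W.isPBW.crd_mono, LinearMap.flip_apply, pairing_mono]
  by_cases h : e' = e
  · rw [h, Finsupp.single_eq_same, coeff_monomial_same, mul_one]
  · rw [Finsupp.single_eq_of_ne (Ne.symm h), coeff_monomial_ne h, mul_zero, map_zero]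

theorem pairing_injective : Function.Injective (pairing U W) :=
  (injective_iff_map_eq_zero _).mpr fun w hw => W.isPBW.eq_zero fun N e d _ => by
    rw [coeff_crd_eq_pairing U W, hw, LinearMap.zero_apply]

theorem pairing_mono_vanish (g : MvPowerSeries (Fin m) k) {e : Fin n →₀ ℕ} {N : ℕ}
    (he : e.degree < N) (a : U.carrier) (ha : a ∈ U.ideal ^ N) :
    pairing U W (W.ser g * sig k W.H e) a = 0 := by
  refine U.real.mem_pow_induction (Q := fun a => pairing U W (W.ser g * sig k W.H e) a = 0)
    (map_zero _) (fun a b ha hb => ?_) (fun f hf d => ?_) ha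
  · rw [map_add, ha, hb, add_zero]
  · rw [pairing_mono, hf e he, mul_zero]

theorem pairing_vanish (w : W.carrier) : ∃ N, ∀ M, N ≤ M → ∀ a ∈ U.ideal ^ M,
    pairing U W w a = 0 := by
  refine W.isPBW.induction (P := fun w => ∃ N, ∀ M, N ≤ M → ∀ a ∈ U.ideal ^ M,
    pairing U W w a = 0) (fun g e => ?_) ⟨0, fun M _ a _ => ?_⟩ ?_ w
  · exact ⟨e.degree + 1, fun M hM a ha => pairing_mono_vanish U W g (by omega) a ha⟩
  · rw [map_zero, LinearMap.zero_apply]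
  · rintro w w' ⟨N, h⟩ ⟨N', h'⟩
    refine ⟨max N N', fun M hM a ha => ?_⟩
    rw [map_add, LinearMap.add_apply, h M (by omega) a ha, h' M (by omega) a ha, add_zero]

theorem pairing_range : LinearMap.range (pairing U W) = U.contDual := by
  refine le_antisymm ?_ fun F hF => ?_
  · rintro _ ⟨w, rfl⟩
    obtain ⟨N, h⟩ := pairing_vanish U W w
    exact ⟨N, h N le_rfl⟩
  · obtain ⟨N, hN⟩ := hF
    -- The values of `F` on the products `X^e σ_d(H)`, for fixed `e`, are the coefficients of a
    -- power series in the `η`. Finitely many `e` suffice because `F` vanishes on `I ^ N`.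
    refine ⟨∑ e ∈ degLT (Fin n) N, W.ser (fun d => F (U.ser (monomial e 1) * sig k U.H d)) *
      sig k W.H e, U.isPBW.ext fun f d => ?_⟩
    rw [map_sum, LinearMap.sum_apply]
    have h : F (U.ser (f - ∑ a ∈ degLT (Fin n) N, coeff a f • monomial a 1) * sig k U.H d) = 0 :=
      hN _ (Ideal.mul_mem_right _ _ (ser_mem_pow U.X_mem N _ (sub_sum_monomial f N)))
    rw [map_sub, sub_mul, map_sub, sub_eq_zero] at h
    rw [h, map_sum, Finset.sum_mul, map_sum]
    refine Finset.sum_congr rfl fun e _ => ?_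
    refine (pairing_mono U W _ e f d).trans ?_
    rw [map_smul, smul_mul_assoc, map_smul, smul_eq_mul, mul_comm]
    rfl

theorem pairing_one (a : U.carrier) : pairing U W 1 a = U.counit a := by
  have h : pairing U W 1 = U.counit.toLinearMap := by
    refine U.isPBW.ext fun f d => ?_
    rw [pairing_mono_right, W.vec_apply, map_one, Module.End.one_apply]
    change coeff d (C (constantCoeff f)) = U.counit _
    rw [map_mul, U.counit_ser, map_sig]
    simp only [U.counit_H]
    have h0 := sig_smul (0 : k) (fun _ : Fin m => (0 : k)) d
    simp only [smul_eq_mul, mul_zero] at h0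
    rw [coeff_C]
    split_ifs with hd
    · rw [hd, sig_zero, mul_one]
    · rw [h0, zero_pow (by rwa [Ne, Finsupp.degree_eq_zero_iff]), zero_mul, mul_zero]
  exact LinearMap.congr_fun h a

end Pairing

/-! ### Convolution of continuous functionals -/

section Conv

variable {k : Type u} [Field k] (U : AdicHopf k)

/-- The convolution product of two continuous functionals. -/
noncomputable def _root_.AdicHopf.conv (N : ℕ) (F G : U.carrier →ₗ[k] k)
    (hF : ∀ a ∈ U.ideal ^ N, F a = 0) (hG : ∀ a ∈ U.ideal ^ N, G a = 0) : U.carrier →ₗ[k] k :=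
  pairTensor (idealLift _ F hF) (idealLift _ G hG) ∘ₗ (U.comul N).toLinearMap

variable {U} {F G K : U.carrier →ₗ[k] k}

theorem conv_mono {N M : ℕ} (h : N ≤ M) (hF hG hF' hG') :
    U.conv M F G hF' hG' = U.conv N F G hF hG := by
  refine LinearMap.ext fun a => ?_
  change pairTensor _ _ (U.comul M a) = pairTensor _ _ (U.comul N a)
  rw [← U.comul_proj h]
  generalize U.comul M a = t
  induction t with
  | zero => simp only [map_zero]
  | add x y hx hy => simp only [map_add, hx, hy]
  | tmul x y =>
    obtain ⟨x, rfl⟩ := Ideal.Quotient.mk_surjective x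
    obtain ⟨y, rfl⟩ := Ideal.Quotient.mk_surjective y
    rfl

/-- `K` is the convolution product of `F` and `G`. -/
def IsConv (F G K : U.carrier →ₗ[k] k) : Prop :=
  ∀ N (hF : ∀ a ∈ U.ideal ^ N, F a = 0) (hG : ∀ a ∈ U.ideal ^ N, G a = 0) (a : U.carrier),
    K a = U.conv N F G hF hG a

theorem IsConv.of_level (N : ℕ) (hF : ∀ a ∈ U.ideal ^ N, F a = 0) (hG : ∀ a ∈ U.ideal ^ N, G a = 0)
    (h : ∀ a, K a = U.conv N F G hF hG a) : IsConv F G K := fun M hF' hG' a => by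
  rw [h, ← conv_mono (le_max_left N M) hF hG
    (fun a ha => hF a (Ideal.pow_le_pow_right (le_max_left N M) ha))
    (fun a ha => hG a (Ideal.pow_le_pow_right (le_max_left N M) ha)),
    conv_mono (le_max_right N M) hF' hG']

/-- Coassociativity rewritten for functionals. It reduces the product formula for `W` to left
multiplication by generators. -/
theorem IsConv.assoc {F G H FG GH K : U.carrier →ₗ[k] k} (h1 : IsConv F G FG) (h2 : IsConv G H GH)
    (h3 : IsConv F GH K) {N : ℕ}
    (hv : ∀ M, N ≤ M → ∀ a ∈ U.ideal ^ M, F a = 0 ∧ G a = 0 ∧ H a = 0 ∧ FG a = 0 ∧ GH a = 0) :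
    IsConv FG H K := by
  have hN := Nat.le_mul_of_pos_left N two_pos
  refine IsConv.of_level (2 * N) (fun a ha => (hv _ hN a ha).2.2.2.1)
    (fun a ha => (hv _ hN a ha).2.2.1) fun a => ?_
  rw [h3 (2 * N) (fun a ha => (hv _ hN a ha).1) (fun a ha => (hv _ hN a ha).2.2.2.2)]
  have hF := fun a ha => (hv N le_rfl a ha).1
  have hG := fun a ha => (hv N le_rfl a ha).2.1
  have hH := fun a ha => (hv N le_rfl a ha).2.2.1
  let D := Ideal.Quotient.liftₐ (U.ideal ^ (2 * N)) (U.comul N) (U.comul_cont N)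
  let p := pairTensor (idealLift _ F hF) (pairTensor (idealLift _ G hG) (idealLift _ H hH))
  have hl : ∀ (w : U.Quo N ⊗[k] U.Quo N) (z : U.Quo N),
      p (Algebra.TensorProduct.assoc k k k _ _ _ (w ⊗ₜ z)) =
        pairTensor (idealLift _ F hF) (idealLift _ G hG) w * idealLift _ H hH z := by
    intro w z
    induction w with
    | zero => simp
    | tmul x y => exact (mul_assoc _ _ _).symm
    | add x y hx hy => rw [TensorProduct.add_tmul, map_add, map_add, hx, hy, map_add, add_mul]
  have e := congrArg p (U.coassoc N a)
  have el : ∀ t, p (Algebra.TensorProduct.assoc k k k _ _ _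
      (Algebra.TensorProduct.map D (U.proj hN) t)) = pairTensor
        (idealLift _ FG fun a ha => (hv _ hN a ha).2.2.2.1)
        (idealLift _ H fun a ha => (hv _ hN a ha).2.2.1) t := by
    intro t
    induction t with
    | zero => simp
    | add x y hx hy => simp only [map_add, hx, hy]
    | tmul x y =>
      obtain ⟨x, rfl⟩ := Ideal.Quotient.mk_surjective x
      obtain ⟨y, rfl⟩ := Ideal.Quotient.mk_surjective y
      rw [Algebra.TensorProduct.map_tmul, hl]
      exact congrArg (· * H y) (h1 N hF hG x).symm
  have er : ∀ t, p (Algebra.TensorProduct.map (U.proj hN) D t) = pairTensor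
        (idealLift _ F fun a ha => (hv _ hN a ha).1)
        (idealLift _ GH fun a ha => (hv _ hN a ha).2.2.2.2) t := by
    intro t
    induction t with
    | zero => simp
    | add x y hx hy => simp only [map_add, hx, hy]
    | tmul x y =>
      obtain ⟨x, rfl⟩ := Ideal.Quotient.mk_surjective x
      obtain ⟨y, rfl⟩ := Ideal.Quotient.mk_surjective y
      exact congrArg (F x * ·) (h2 N hG hH y).symm
  exact ((el _).symm.trans (e.trans (er _))).symm

end Conv

/-! ### The product of `W` is convolution: series in the `η` -/

section Mul

variable {k : Type u} [Field k] [CharZero k] {m n : ℕ} {L : InhomBialgebra k m n}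
  (U : Quantization L) (W : Quantization L.dual)

theorem _root_.Quantization.vec_mul (a b : U.carrier) : U.vec (a * b) = U.rep a (U.vec b) := by
  rw [U.vec_apply, map_mul, Module.End.mul_apply, ← U.vec_apply]

theorem pairTensor_mk {P : AdicAlgebra k} {M N : ℕ} {F G : P.carrier →ₗ[k] k}
    (hF : ∀ a ∈ P.ideal ^ M, F a = 0) (hG : ∀ a ∈ P.ideal ^ N, G a = 0) (x y : P.carrier) :
    pairTensor (idealLift _ F hF) (idealLift _ G hG) (P.mk' M x ⊗ₜ P.mk' N y) = F x * G y := rfl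

theorem pairTensor_red {P : AdicAlgebra k} {N : ℕ} (h : 1 ≤ N) {F G : P.carrier →ₗ[k] k}
    (h1 : ∀ a ∈ P.ideal ^ 1, F a = 0) (hF : ∀ a ∈ P.ideal ^ N, F a = 0)
    (hG : ∀ a ∈ P.ideal ^ N, G a = 0) (t : P.Quo N ⊗[k] P.Quo N) :
    pairTensor (idealLift _ F hF) (idealLift _ G hG) t =
      pairTensor (idealLift _ F h1) (idealLift _ G hG) (red P h t) := by
  induction t with
  | zero => simp
  | add x y hx hy => simp only [map_add, hx, hy]
  | tmul x y =>
    obtain ⟨x, rfl⟩ := mk_surjective P _ x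
    rfl

/-- Modulo the ideal in the first factor the generators are primitive and series live in the second
factor, so the coproduct of a divided monomial is the binomial expansion `sig_add`. -/
theorem red_comul_mono (N : ℕ) (f : MvPowerSeries (Fin n) k) (d : Fin m →₀ ℕ) :
    red U.toAdicAlgebra (by omega : 1 ≤ N + 1) (U.comul (N + 1) (U.ser f * sig k U.H d)) =
      ∑ p ∈ Finset.HasAntidiagonal.antidiagonal d,
        U.mk' 1 (sig k U.H p.2) ⊗ₜ[k] U.mk' (N + 1) (U.ser f * sig k U.H p.1) := by
  let R : U.carrier →ₐ[k] U.Quo 1 ⊗[k] U.Quo (N + 1) :=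
    (red U.toAdicAlgebra (by omega : 1 ≤ N + 1)).comp (U.comul (N + 1))
  have hH : ∀ i, R (U.H i) = 1 ⊗ₜ U.mk' (N + 1) (U.H i) + U.mk' 1 (U.H i) ⊗ₜ 1 := fun i =>
    (congrArg (red _ _) (U.comul_gen (N + 1) i)).trans (red_hN L U.X_mem _ i)
  have hf : R (U.ser f) = 1 ⊗ₜ U.mk' (N + 1) (U.ser f) :=
    (congrArg (red _ _) (U.comul_ser (N + 1) f)).trans (red_dN L U.X_mem _ f)
  change R (U.ser f * sig k U.H d) = _
  rw [map_mul R, map_sig R, hf]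
  simp only [hH]
  have ha := sig_add (k := k)
    (fun i => (1 : U.Quo 1) ⊗ₜ[k] U.mk' (N + 1) (U.H i))
    (fun i => U.mk' 1 (U.H i) ⊗ₜ[k] (1 : U.Quo (N + 1)))
    (fun i j => by simp [Commute, SemiconjBy, Algebra.TensorProduct.tmul_mul_tmul]) d
  refine (congrArg _ ha).trans ?_
  rw [Finset.mul_sum]
  refine Finset.sum_congr rfl fun p _ => ?_
  have h1 := map_sig (k := k) (Algebra.TensorProduct.includeRight.comp (U.mk' (N + 1)) :
    U.carrier →ₐ[k] U.Quo 1 ⊗[k] U.Quo (N + 1)) U.H p.1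
  have h2 := map_sig (k := k) (Algebra.TensorProduct.includeLeft.comp (U.mk' 1) :
    U.carrier →ₐ[k] U.Quo 1 ⊗[k] U.Quo (N + 1)) U.H p.2
  refine (congrArg (_ * ·) (congrArg₂ (· * ·) h1 h2)).symm.trans ?_
  change _ * ((1 ⊗ₜ[k] _) * (_ ⊗ₜ[k] 1)) = _
  rw [Algebra.TensorProduct.tmul_mul_tmul, Algebra.TensorProduct.tmul_mul_tmul, one_mul, one_mul,
    mul_one, map_mul (U.mk' (N + 1))]
  rfl

/-- A series in the `η` vanishes on the ideal of `U`, so only `red_comul_mono` is needed; its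
binomial expansion is dual to multiplication of power series. -/
theorem isConv_ser (g : MvPowerSeries (Fin m) k) (w : W.carrier) :
    IsConv (U := U.toAdicHopf) (pairing U W (W.ser g)) (pairing U W w)
      (pairing U W (W.ser g * w)) := by
  have hs : ∀ M, 1 ≤ M → ∀ a ∈ U.ideal ^ M, pairing U W (W.ser g) a = 0 := fun M hM a ha => by
    rw [← mul_one (W.ser g), ← sig_zero (k := k) W.H]
    exact pairing_mono_vanish U W g (by rw [map_zero]; omega) a ha
  obtain ⟨N, hN⟩ := pairing_vanish U W w
  refine IsConv.of_level (N + 1) (hs _ (by omega)) (hN _ (by omega))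
    (LinearMap.congr_fun (U.isPBW.ext fun f d => ?_))
  refine Eq.trans ?_ (pairTensor_red (by omega) (hs 1 le_rfl) _ _ _).symm
  rw [AlgHom.toLinearMap_apply, red_comul_mono, map_sum, pairing_mono_right, W.vec_mul, W.rep_ser, serRep_apply, mul_comm, coeff_mul]
  refine Finset.sum_congr rfl fun p _ => ?_
  rw [pairTensor_mk, pairing_mono_right, mul_comm]
  congr 1
  have h3 := pairing_mono U W g 0 1 p.2
  rw [sig_zero, mul_one, map_one, one_mul] at h3
  rw [h3, coeff_zero_one, mul_one]

end Mul

/-! ### Commutation rules for multiplication by `ζ_μ` -/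

section Mul

variable {k : Type u} [Field k] [CharZero k] {m n : ℕ} {L : InhomBialgebra k m n}
  (U : Quantization L) (W : Quantization L.dual)

theorem coeff_single_af (i : Fin m) (μ : Fin n) (f : MvPowerSeries (Fin n) k) :
    coeff (Finsupp.single μ 1) (af L i f) =
      ∑ ν, L.A i μ ν * coeff (Finsupp.single ν 1) f := by
  have h0 : ∀ i f, coeff 0 (af L i f) = 0 := fun i f => constantCoeff_af L i f
  have h := congrArg (coeff 0) (lf_af L μ i f)
  simp only [map_sub, map_add, map_sum, coeff_smul, h0, sub_zero, mul_zero,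
    Finset.sum_const_zero, add_zero] at h
  simp only [coeff_single_eq_lf L, h]

theorem coeff_single_mul (f g : MvPowerSeries (Fin n) k) (μ : Fin n) :
    coeff (Finsupp.single μ 1) (f * g) =
      coeff 0 f * coeff (Finsupp.single μ 1) g + coeff (Finsupp.single μ 1) f * coeff 0 g := by
  -- For the zero bialgebra the left translations are derivations that compute linear coefficients
  -- at the origin, which yields the product rule.
  let L0 : InhomBialgebra k 0 n := ⟨0, 0, 0, 0, by simp, by simp, by simp, by simp, by simp,
    by simp, by simp, by simp⟩
  simp only [coeff_single_eq_lf L0, Derivation.leibniz, map_add, smul_eq_mul,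
    coeff_zero_eq_constantCoeff_apply, map_mul]
  ring

/-- The operator that corresponds to multiplication by `ζ μ`. -/
noncomputable def zetaOp (L : InhomBialgebra k m n) (μ : Fin n) (ξ : RepSpace k m n) :
    RepSpace k m n :=
  (lf L μ : MvPowerSeries (Fin n) k →ₗ[k] MvPowerSeries (Fin n) k) ∘ₗ ξ +
    ξ ∘ₗ (af L.dual μ : MvPowerSeries (Fin m) k →ₗ[k] MvPowerSeries (Fin m) k)

theorem zetaOp_apply (μ : Fin n) (ξ : RepSpace k m n) (g : MvPowerSeries (Fin m) k) :
    zetaOp L μ ξ g = lf L μ (ξ g) + ξ (af L.dual μ g) := rfl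

/-- The operator `zetaOp L μ` is the transpose of the action of `W.H μ`, so `⟨ζ_μ w, a⟩` can be
evaluated on any element of `U` that represents `zetaOp` applied to the vector of `a`. -/
theorem pairing_gen_mul (μ : Fin n) (w : W.carrier) {a l : U.carrier}
    (hl : U.vec l = zetaOp L μ (U.vec a)) :
    pairing U W (W.H μ * w) a = pairing U W w l := by
  refine LinearMap.congr_fun (f := (pairing U W).flip a ∘ₗ LinearMap.mulLeft k (W.H μ))
    (g := (pairing U W).flip l) (W.isPBW.ext fun g e => ?_) w
  rw [LinearMap.flip_apply, pairing_mono_left, hl]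
  refine LinearMap.congr_fun (f := pairing U W (W.H μ * (W.ser g * sig k W.H e)))
    (g := coeff e ∘ₗ ((lf L μ : MvPowerSeries (Fin n) k →ₗ[k] MvPowerSeries (Fin n) k) ∘ₗ
      U.vec.flip g + U.vec.flip (af L.dual μ g))) (U.isPBW.ext fun f d => ?_) a
  rw [pairing_mono_right, W.vec_mul, W.rep_H, genRep_apply, W.vec_mono, W.vec_mono]
  change _ = coeff e (lf L μ (U.vec _ g) + U.vec _ (af L.dual μ g))
  rw [U.vec_mono, U.vec_mono, Derivation.map_smul, Derivation.map_smul, map_add, map_add,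
    coeff_smul, coeff_smul, coeff_smul, coeff_smul, add_comm, mul_comm, mul_comm (coeff e f)]
  rfl

/-- The functional `ε` on the quotients. -/
noncomputable abbrev epsF (N : ℕ) : U.Quo (N + 2) →ₗ[k] k := (U.epsN (N + 1)).toLinearMap

theorem gen_vanish (μ : Fin n) (N : ℕ) (a : U.carrier) (ha : a ∈ U.ideal ^ (N + 2)) :
    pairing U W (W.H μ) a = 0 := by
  have h := pairing_mono_vanish U W 1 (e := Finsupp.single μ 1) (N := N + 2)
    (by rw [Finsupp.degree_single]; omega) a ha
  rwa [map_one, one_mul, sig_single] at h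

/-- The functional `ζ μ` on the quotients. -/
noncomputable abbrev zetaF (μ : Fin n) (N : ℕ) : U.Quo (N + 2) →ₗ[k] k :=
  idealLift _ (pairing U W (W.H μ)) (gen_vanish U W μ N)

theorem zetaF_mk (μ : Fin n) (N : ℕ) (a : U.carrier) :
    zetaF U W μ N (U.mk' (N + 2) a) = coeff (Finsupp.single μ 1) (U.vec a 1) :=
  pairing_gen U W μ a

theorem epsF_mk (N : ℕ) (a : U.carrier) :
    epsF U N (U.mk' (N + 2) a) = coeff 0 (U.vec a 1) := by
  change U.counit a = _
  obtain ⟨W⟩ := nonempty_quantization L.dual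
  rw [← pairing_one U W, ← map_one W.ser, pairing_ser]

theorem sliceL_epsF_mul (N : ℕ) (a : U.carrier) (t : U.Quo (N + 2) ⊗[k] U.Quo (N + 2)) :
    sliceL _ (epsF U N) (U.comul (N + 2) a * t) = U.mk' (N + 2) a * sliceL _ (epsF U N) t := by
  let E : U.Quo (N + 2) ⊗[k] U.Quo (N + 2) →ₐ[k] U.Quo (N + 2) :=
    (Algebra.TensorProduct.lid k _).toAlgHom.comp
      (Algebra.TensorProduct.map (U.epsN (N + 1)) (AlgHom.id k _))
  refine (map_mul E _ _).trans ?_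
  exact congrArg (· * E t) (U.counit_comul (N + 1) a)

/-- The elements `l` and `κ` describe how the operators `ζ μ` commute with `a`. -/
structure ZetaRule (a : U.carrier) (l : Fin n → U.carrier) (κ : Fin n → Fin n → U.carrier) :
    Prop where
  slice : ∀ μ N t, sliceL _ (zetaF U W μ N) (U.comul (N + 2) a * t) =
    U.mk' (N + 2) (l μ) * sliceL _ (epsF U N) t +
      ∑ ν, U.mk' (N + 2) (κ μ ν) * sliceL _ (zetaF U W ν N) t
  op : ∀ μ ξ, zetaOp L μ (U.rep a ξ) = U.rep (l μ) ξ + ∑ ν, U.rep (κ μ ν) (zetaOp L ν ξ)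

/-- The two halves of the rule compose in the same way. This is why it is stated for arbitrary `t`
and `ξ`: in this form it passes to products and needs checking on generators only. -/
theorem ZetaRule.mul {a b : U.carrier} {l l' κ κ'} (h : ZetaRule U W a l κ)
    (h' : ZetaRule U W b l' κ') : ZetaRule U W (a * b) (fun μ => l μ * b + ∑ ν, κ μ ν * l' ν)
      (fun μ ν => ∑ ρ, κ μ ρ * κ' ρ ν) := by
  refine ⟨fun μ N t => ?_, fun μ ξ => ?_⟩
  · rw [map_mul (U.comul (N + 2)), mul_assoc, h.slice, sliceL_epsF_mul]
    simp only [h'.slice, map_add, map_sum, map_mul, add_mul, mul_add, Finset.sum_add_distrib,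
      Finset.sum_mul, Finset.mul_sum, mul_assoc, add_assoc]
    congr 2
    exact Finset.sum_comm
  · rw [map_mul, Module.End.mul_apply, h.op]
    simp only [h'.op, map_add, map_sum, map_mul, LinearMap.add_apply, LinearMap.sum_apply,
      Module.End.mul_apply, Finset.sum_add_distrib, add_assoc]
    congr 2
    exact Finset.sum_comm

theorem ZetaRule.add {a b : U.carrier} {l l' κ κ'} (h : ZetaRule U W a l κ)
    (h' : ZetaRule U W b l' κ') : ZetaRule U W (a + b) (fun μ => l μ + l' μ)
      (fun μ ν => κ μ ν + κ' μ ν) := by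
  refine ⟨fun μ N t => ?_, fun μ ξ => ?_⟩
  · simp only [map_add, add_mul, h.slice, h'.slice, Finset.sum_add_distrib]
    abel
  · have : zetaOp L μ (U.rep (a + b) ξ) = zetaOp L μ (U.rep a ξ) + zetaOp L μ (U.rep b ξ) := by
      rw [map_add]
      refine LinearMap.ext fun g => ?_
      simp only [zetaOp_apply, LinearMap.add_apply, map_add]
      abel
    rw [this, h.op, h'.op]
    simp only [map_add, LinearMap.add_apply,  Finset.sum_add_distrib]
    abel

theorem zetaRule_of_tmul {a : U.carrier} {l : Fin n → U.carrier} {κ : Fin n → Fin n → U.carrier}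
    (h1 : ∀ μ N u y, sliceL _ (zetaF U W μ N) (U.comul (N + 2) a * (U.mk' (N + 2) u ⊗ₜ y)) =
      coeff 0 (U.vec u 1) • (U.mk' (N + 2) (l μ) * y) +
        ∑ ν, coeff (Finsupp.single ν 1) (U.vec u 1) • (U.mk' (N + 2) (κ μ ν) * y))
    (h2 : ∀ μ ξ, zetaOp L μ (U.rep a ξ) = U.rep (l μ) ξ + ∑ ν, U.rep (κ μ ν) (zetaOp L ν ξ)) :
    ZetaRule U W a l κ := by
  refine ⟨fun μ N t => ?_, h2⟩
  induction t with
  | zero => simp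
  | add x y hx hy =>
    simp only [map_add, mul_add, hx, hy, Finset.sum_add_distrib]
    abel
  | tmul x y =>
    obtain ⟨x, rfl⟩ := mk_surjective U.toAdicAlgebra _ x
    simp only [h1, sliceL_tmul, epsF_mk, zetaF_mk, mul_smul_comm]

/-- Since `ζ_μ` reads linear coefficients, only the exponents of degree at most one in `Δ f = ∑ X^a
⊗ σ_a(L) f` contribute. The operator half is the Leibniz rule. -/
theorem zetaRule_ser (f : MvPowerSeries (Fin n) k) : ZetaRule U W (U.ser f)
    (fun μ => U.ser (lf L μ f)) (fun μ ν => if μ = ν then U.ser f else 0) := by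
  refine zetaRule_of_tmul U W (fun μ N u y => ?_) fun μ ξ => LinearMap.ext fun g => ?_
  · rw [U.comul_ser, dN_eq_sum L U.X_mem le_rfl, Finset.sum_mul, map_sum]
    have hu : ∀ a : Fin n →₀ ℕ, sliceL (U.Quo (N + 2)) (zetaF U W μ N)
        (U.mk' (N + 2) (U.ser (monomial a 1)) ⊗ₜ[k] U.mk' (N + 2) (U.ser (sl L a f)) *
          U.mk' (N + 2) u ⊗ₜ[k] y) = coeff (Finsupp.single μ 1) (monomial a 1 * U.vec u 1) •
            (U.mk' (N + 2) (U.ser (sl L a f)) * y) := by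
      intro a
      rw [Algebra.TensorProduct.tmul_mul_tmul, sliceL_tmul, ← map_mul, zetaF_mk, U.vec_mul,
        U.rep_ser, serRep_apply]
    simp only [hu]
    refine (sum_monomial_fun (n := n) (K := N + 2) (by omega) (fun a => coeff (Finsupp.single μ 1)
      (monomial a 1 * U.vec u 1)) (fun a ha => ?_)
      fun a => U.mk' (N + 2) (U.ser (sl L a f)) * y).trans ?_
    · rw [coeff_single_mul, coeff_monomial_ne (by rintro rfl; simp at ha),
        coeff_monomial_ne (by rintro rfl; simp at ha), zero_mul, zero_mul, add_zero]
    · refine (add_comm _ _).trans ?_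
      simp only [coeff_single_mul, sl_zero]
      rw [monomial_zero_one, coeff_zero_one, one_mul, coeff_one, if_neg (by simp), zero_mul,
        add_zero, Finset.sum_eq_single μ, Finset.sum_eq_single μ]
      · rw [coeff_monomial_same, one_mul, coeff_monomial_ne (Ne.symm (by simp)), zero_mul, zero_add, if_pos rfl,
          sl, sig_single]
        rfl
      · intro ν _ hν
        rw [if_neg hν.symm, map_zero, zero_mul, smul_zero]
      · simp
      · intro ν _ hν
        rw [coeff_monomial_ne (Ne.symm (by simp)), coeff_monomial_ne (by
          simpa [Finsupp.single_left_inj] using hν.symm), zero_mul, zero_mul, add_zero, zero_smul]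
      · simp
  · rw [Finset.sum_eq_single μ, if_pos rfl]
    · rw [LinearMap.add_apply, zetaOp_apply, U.rep_ser, U.rep_ser, serRep_apply, serRep_apply,
        serRep_apply, serRep_apply, zetaOp_apply, Derivation.leibniz, smul_eq_mul, smul_eq_mul]
      ring
    · intro ν _ hν
      rw [if_neg hν.symm, map_zero, LinearMap.zero_apply]
    · simp

/-- The operator half rests on the commutators of `L_μ` and `A_i` for `𝐋` and for `𝐋*` together; the
terms of the two that have no counterpart in the rule cancel. -/
theorem zetaRule_H (i : Fin m) : ZetaRule U W (U.H i) (fun μ => ∑ l, L.α μ i l • U.H l)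
    (fun μ ν => (if μ = ν then U.H i else 0) + algebraMap k _ (L.A i μ ν)) := by
  refine zetaRule_of_tmul U W (fun μ N u y => ?_) fun μ ξ => LinearMap.ext fun g => ?_
  · rw [U.comul_gen, hN, add_mul, Finset.sum_mul, map_add, map_sum]
    simp only [Algebra.TensorProduct.tmul_mul_tmul, sliceL_tmul, ← map_mul (U.mk' (N + 2)),
      zetaF_mk, U.vec_mul, U.rep_ser, U.rep_H, serRep_apply, genRep_apply, 
      Derivation.map_one_eq_zero, map_zero, add_zero, coeff_single_mul, coeff_single_ee,
      coeff_single_af, coeff_zero_ee, one_mul]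
    simp only [add_smul, Finset.sum_add_distrib, map_sum, map_smul, map_add, Finset.sum_mul,
      add_mul, smul_add, smul_mul_assoc, Finset.smul_sum, Finset.sum_smul]
    have hm : ∀ r : k, U.mk' (N + 2) (algebraMap k U.carrier r) * y = r • y := fun r => by
      rw [AlgHom.commutes, Algebra.smul_def]
    simp only [ite_mul, one_mul, zero_mul, ite_smul, zero_smul, Finset.sum_ite_eq, Finset.mem_univ,
      if_true, apply_ite (U.mk' (N + 2)), map_zero, smul_ite, smul_zero, hm, smul_smul,
      mul_comm (coeff _ _)]
    abel
  · have h1 := lf_af L μ i (ξ g)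
    have h2 := congrArg ξ (lf_af L.dual i μ g)
    simp only [map_sub, map_add, map_sum, map_smul] at h2
    have h3 : ∑ ν, U.rep ((if μ = ν then U.H i else 0) + algebraMap k _ (L.A i μ ν))
        (zetaOp L ν ξ) g = genRep L i (zetaOp L μ ξ) g + ∑ ν, L.A i μ ν • zetaOp L ν ξ g := by
      simp only [map_add, LinearMap.add_apply, Finset.sum_add_distrib, apply_ite U.rep, map_zero,
        U.rep_H, AlgHom.commutes]
      congr 1
      rw [Finset.sum_eq_single μ, if_pos rfl]
      · intro ν _ hν
        rw [if_neg hν.symm]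
        rfl
      · simp
    rw [LinearMap.add_apply, LinearMap.sum_apply, h3, map_sum, LinearMap.sum_apply,
      LinearMap.sum_apply]
    simp only [map_smul, LinearMap.smul_apply, U.rep_H, zetaOp_apply, genRep_apply, map_add,
      smul_add, Finset.sum_add_distrib]
    have h4 : ∑ l, L.α μ i l • ξ (lf L.dual l g) + ∑ ν, L.A i μ ν • ξ (af L.dual ν g) =
      ξ (lf L.dual i (af L.dual μ g)) - ξ (af L.dual μ (lf L.dual i g)) := h2.symm
    rw [sub_eq_iff_eq_add] at h1
    rw [h1, eq_sub_iff_add_eq] at *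
    linear_combination -h4

end Mul

/-! ### The product of `W` is convolution: the general case -/

section Mul

variable {k : Type u} [Field k] [CharZero k] {m n : ℕ} {L : InhomBialgebra k m n}
  (U : Quantization L) (W : Quantization L.dual)

theorem exists_zetaRule (a : U.carrier) : ∃ l κ, ZetaRule U W a l κ := by
  refine U.isPBW.mem_of_closed (P := fun a => ∃ l κ, ZetaRule U W a l κ) ?_ ?_ ?_
    (fun f => ⟨_, _, zetaRule_ser U W f⟩) (fun i => ⟨_, _, zetaRule_H U W i⟩) a
  · exact ⟨_, _, (congrArg (ZetaRule U W · _ _) (map_zero U.ser)).mp (zetaRule_ser U W 0)⟩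
  · rintro a b ⟨l, κ, h⟩ ⟨l', κ', h'⟩
    exact ⟨_, _, h.add U W h'⟩
  · rintro a b ⟨l, κ, h⟩ ⟨l', κ', h'⟩
    exact ⟨_, _, h.mul U W h'⟩

theorem vec_one_one : U.vec 1 1 = 1 := by
  rw [U.vec_apply, map_one U.rep]
  exact map_one C

theorem zetaOp_vac (μ : Fin n) : zetaOp L μ (vac k m n) = 0 := by
  refine LinearMap.ext fun g => ?_
  have h1 : lf L μ (vac k m n g) = 0 := (lf L μ).map_algebraMap (coeff 0 g)
  have h2 : coeff 0 (af L.dual μ g) = 0 := constantCoeff_af L.dual μ g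
  rw [zetaOp_apply, h1, zero_add]
  change C (coeff 0 (af L.dual μ g)) = 0
  rw [h2, map_zero]

theorem pairTensor_eq_sliceL {V V' : Type u} [AddCommGroup V] [Module k V] [AddCommGroup V']
    [Module k V'] (f : V →ₗ[k] k) (g : V' →ₗ[k] k) (t : V ⊗[k] V') :
    pairTensor f g t = g (sliceL V' f t) := by
  induction t with
  | zero => simp
  | add x y hx hy => simp only [map_add, hx, hy]
  | tmul x y =>
    rw [sliceL_tmul, map_smul]
    rfl

/-- In the rule for `a` take `t = 1` and `ξ` the cyclic vector. Since `ζ_ν` vanishes at 1 and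
`zetaOp` kills the cyclic vector, both halves reduce to the same element `l μ`, which is `(ζ_μ ⊗ id)
Δ a` and also computes `⟨ζ_μ w, a⟩`. -/
theorem isConv_gen (μ : Fin n) (w : W.carrier) :
    IsConv (U := U.toAdicHopf) (pairing U W (W.H μ)) (pairing U W w)
      (pairing U W (W.H μ * w)) := by
  obtain ⟨N, hN⟩ := pairing_vanish U W w
  refine IsConv.of_level (N + 2) (gen_vanish U W μ N) (hN _ (by omega)) fun a => ?_
  obtain ⟨l, κ, h⟩ := exists_zetaRule U W a
  have h1 := h.op μ (vac k m n)
  simp only [zetaOp_vac, map_zero, Finset.sum_const_zero, add_zero] at h1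
  have h2 := h.slice μ N 1
  have h3 : ∀ ν, zetaF U W ν N 1 = 0 := fun ν => by
    rw [← map_one (U.mk' (N + 2)), zetaF_mk, vec_one_one, coeff_one, if_neg (by simp)]
  rw [mul_one] at h2
  simp only [mul_one, Algebra.TensorProduct.one_def, sliceL_tmul, h3, zero_smul, mul_zero,
    Finset.sum_const_zero, add_zero, AlgHom.toLinearMap_apply, map_one, one_smul] at h2
  rw [pairing_gen_mul U W μ w (l := l μ) h1.symm]
  exact ((pairTensor_eq_sliceL (zetaF U W μ N) (idealLift _ _ (hN (N + 2) (by omega)))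
    (U.comul (N + 2) a)).trans (congrArg _ h2)).symm

/-- The elements `w` for which the formula holds against all `w'` are closed under sums and, by
associativity of both products, under products; they contain the generators. -/
theorem isConv_pairing (w w' : W.carrier) :
    IsConv (U := U.toAdicHopf) (pairing U W w) (pairing U W w') (pairing U W (w * w')) := by
  refine W.isPBW.mem_of_closed (P := fun w => ∀ w', IsConv (U := U.toAdicHopf) (pairing U W w)
    (pairing U W w') (pairing U W (w * w'))) ?_ ?_ ?_ (isConv_ser U W) (isConv_gen U W) w w'
  · intro w'
    have := isConv_ser U W 0 w'
    rwa [map_zero] at this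
  · intro a b ha hb w'
    obtain ⟨N1, h1⟩ := pairing_vanish U W a
    obtain ⟨N2, h2⟩ := pairing_vanish U W b
    obtain ⟨N3, h3⟩ := pairing_vanish U W w'
    have ha1 := h1 (N1 + N2 + N3) (by omega)
    have hb1 := h2 (N1 + N2 + N3) (by omega)
    have hw1 := h3 (N1 + N2 + N3) (by omega)
    have hab : ∀ u ∈ U.ideal ^ (N1 + N2 + N3), pairing U W (a + b) u = 0 := fun u hu => by
      rw [map_add, LinearMap.add_apply, ha1 u hu, hb1 u hu, add_zero]
    refine IsConv.of_level (N1 + N2 + N3) hab hw1 fun u => ?_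
    rw [add_mul, map_add, LinearMap.add_apply, ha w' _ ha1 hw1, hb w' _ hb1 hw1]
    have : pairTensor (idealLift _ _ hab) (idealLift _ _ hw1) =
        pairTensor (idealLift _ _ ha1) (idealLift _ _ hw1) +
          pairTensor (idealLift _ _ hb1) (idealLift _ _ hw1) := TensorProduct.ext' fun x y => by
      obtain ⟨x, rfl⟩ := mk_surjective U.toAdicAlgebra _ x
      obtain ⟨y, rfl⟩ := mk_surjective U.toAdicAlgebra _ y
      rw [LinearMap.add_apply, pairTensor_mk, pairTensor_mk, pairTensor_mk, map_add,
        LinearMap.add_apply, add_mul]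
    exact (LinearMap.congr_fun this (U.comul _ u)).symm
  · intro a b ha hb w'
    obtain ⟨N1, h1⟩ := pairing_vanish U W a
    obtain ⟨N2, h2⟩ := pairing_vanish U W b
    obtain ⟨N3, h3⟩ := pairing_vanish U W w'
    obtain ⟨N4, h4⟩ := pairing_vanish U W (a * b)
    obtain ⟨N5, h5⟩ := pairing_vanish U W (b * w')
    have h := ha (b * w')
    rw [← mul_assoc] at h
    exact IsConv.assoc (ha b) (hb w') h (N := N1 + N2 + N3 + N4 + N5) fun M hM u hu =>
      ⟨h1 M (by omega) u hu, h2 M (by omega) u hu, h3 M (by omega) u hu, h4 M (by omega) u hu,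
        h5 M (by omega) u hu⟩

end Mul

/-! ### The antipodes of `U` and `W` on generators -/

section Antipode

variable {k : Type u} [Field k] [CharZero k] {m n : ℕ} {L : InhomBialgebra k m n}
  (U : Quantization L) (W : Quantization L.dual)

theorem _root_.Quantization.antipode_mul (a b : U.carrier) :
    U.antipode (a * b) = U.antipode b * U.antipode a := by
  simp only [U.antipode_eq]
  exact U.real.anti_mul a b

theorem _root_.Quantization.antipode_ser (f : MvPowerSeries (Fin n) k) :
    U.antipode (U.ser f) = U.ser (minus f) := (U.antipode_eq _).trans (U.real.anti_ser f)

theorem _root_.Quantization.antipode_H (i : Fin m) :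
    U.antipode (U.H i) = -∑ l, U.ser (minus (ee L i l)) * U.H l :=
  (U.antipode_eq _).trans (U.real.anti_H i)

theorem _root_.Quantization.antipode_mem {N : ℕ} {a : U.carrier} (ha : a ∈ U.ideal ^ N) :
    U.antipode a ∈ U.ideal ^ N := mk_eq_zero_iff.mp (U.antipode_cont N a ha)

/-- Modulo the ideal the antipode sends `H_i` to `-H_i`, and the reversal of words does not affect
symmetrized monomials. -/
theorem mk_one_antipode_sig (d : Fin m →₀ ℕ) :
    U.mk' 1 (U.antipode (sig k U.H d)) = (-1) ^ d.degree • U.mk' 1 (sig k U.H d) := by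
  let A : U.carrier →ₐ[k] U.carrierᵐᵒᵖ := U.isPBW.lift U.real.rels U.real.serOp_rels
  have hA : ∀ i, AlgHom.op (U.mk' 1) (A (U.H i)) = (-1 : k) • MulOpposite.op (U.mk' 1 (U.H i)) := by
    intro i
    have : A (U.H i) = MulOpposite.op (U.real.antiH i) := U.isPBW.lift_gen _ _ i
    rw [this]
    change MulOpposite.op (U.mk' 1 (-∑ l, U.ser (minus (ee L i l)) * U.H l)) = _
    rw [map_neg, map_sum]
    simp only [map_mul, mk_one_ser U.X_mem, ← coeff_zero_eq_constantCoeff_apply, coeff_minus,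
      coeff_zero_ee]
    simp
  have h := map_sig (k := k) ((AlgHom.op (U.mk' 1)).comp A) U.H d
  simp only [AlgHom.comp_apply, hA] at h
  rw [sig_smul, ← op_sig, ← map_sig] at h
  have h2 := congrArg MulOpposite.unop h
  rw [U.antipode_eq]
  refine h2.trans ?_
  rw [MulOpposite.unop_smul, MulOpposite.unop_op]
  simp [Algebra.smul_def]

theorem pairing_antipode_ser (g : MvPowerSeries (Fin m) k) (a : U.carrier) :
    pairing U W (W.antipode (W.ser g)) a = pairing U W (W.ser g) (U.antipode a) := by
  have hs : ∀ a ∈ U.ideal ^ 1, pairing U W (W.ser g) a = 0 := fun a ha => by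
    rw [← mul_one (W.ser g), ← sig_zero (k := k) W.H]
    exact pairing_mono_vanish U W g (by rw [map_zero]; omega) a ha
  have hm : ∀ (g : MvPowerSeries (Fin m) k) f d, pairing U W (W.ser g) (U.ser f * sig k U.H d) =
      coeff d g * coeff 0 f := fun g f d => by
    rw [← pairing_mono U W, sig_zero, mul_one]
  rw [W.antipode_ser]
  refine LinearMap.congr_fun (g := pairing U W (W.ser g) ∘ₗ U.antipode)
    (U.isPBW.ext fun f d => ?_) a
  rw [hm, coeff_minus, LinearMap.comp_apply, U.antipode_mul, U.antipode_ser]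
  have h1 : U.mk' 1 (U.antipode (sig k U.H d) * U.ser (minus f)) =
      U.mk' 1 (((-1) ^ d.degree * coeff 0 f : k) • sig k U.H d) := by
    rw [map_mul, mk_one_antipode_sig, mk_one_ser U.X_mem, ← coeff_zero_eq_constantCoeff_apply,
      coeff_minus, map_zero, pow_zero, one_mul, ← Algebra.commutes, ← Algebra.smul_def, map_smul,
      mul_comm, mul_smul]
    congr 1
    simp [Algebra.smul_def]
  have h2 : ∀ u, pairing U W (W.ser g) u = idealLift _ _ hs (U.mk' 1 u) := fun _ => rfl
  have h3 := hm g 1 d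
  rw [map_one, one_mul, coeff_zero_one, mul_one] at h3
  rw [h2, h1, ← h2, map_smul, h3, smul_eq_mul]
  ring

theorem pairing_gen_mul_right (μ : Fin n) (a b : U.carrier) : pairing U W (W.H μ) (a * b) =
    ∑ ν, pairing U W (W.ser (ee L.dual μ ν)) a * pairing U W (W.H ν) b +
      pairing U W (W.H μ) a * U.counit b := by
  obtain ⟨N1, h1⟩ := pairing_vanish (L := L.dual) W U a
  obtain ⟨N2, h2⟩ := pairing_vanish (L := L.dual) W U b
  rw [pairing_comm, isConv_pairing (L := L.dual) W U a b (N1 + N2) (h1 _ (by omega))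
    (h2 _ (by omega)), AdicHopf.conv, LinearMap.comp_apply, AlgHom.toLinearMap_apply, W.comul_gen,
    hN, map_add, map_sum]
  simp only [pairing_comm U W, ← pairing_one U W]
  rfl

/-- Apply `ζ_μ` to the antipode axiom of `U`. With the coproduct of `ζ_μ` this gives `⟨ζ_μ, S a⟩ =
-∑ ⟨S(e_μ^ν) ζ_ν, a⟩`, which is the formula for the antipode of `ζ_μ` in `W`. -/
theorem pairing_antipode_gen (μ : Fin n) (a : U.carrier) :
    pairing U W (W.antipode (W.H μ)) a = pairing U W (W.H μ) (U.antipode a) := by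
  have hs : ∀ (g : MvPowerSeries (Fin m) k), ∀ a ∈ U.ideal ^ 2, pairing U W (W.ser g) a = 0 :=
    fun g a ha => by
      rw [← mul_one (W.ser g), ← sig_zero (k := k) W.H]
      exact pairing_mono_vanish U W g (by rw [map_zero]; omega) a ha
  let F : U.carrier →ₗ[k] k := pairing U W (W.H μ) ∘ₗ U.antipode
  have hF : ∀ a ∈ U.ideal ^ 2, F a = 0 := fun a ha => gen_vanish U W μ 0 _ (U.antipode_mem ha)
  have key : ∀ t : U.Quo 2 ⊗[k] U.Quo 2, zetaF U W μ 0 (LinearMap.mul' k (U.Quo 2)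
      (TensorProduct.map (idealLift (U.ideal ^ 2) ((U.mk' 2).toLinearMap ∘ₗ U.antipode)
        (U.antipode_cont 2)) LinearMap.id t)) =
      ∑ ν, pairTensor (idealLift _ _ (hs (minus (ee L.dual μ ν)))) (zetaF U W ν 0) t +
        pairTensor (idealLift _ F hF) (epsF U 0) t := by
    intro t
    induction t with
    | zero => simp
    | add x y hx hy =>
      simp only [map_add, hx, hy, Finset.sum_add_distrib]
      abel
    | tmul x y =>
      obtain ⟨x, rfl⟩ := mk_surjective U.toAdicAlgebra _ x
      obtain ⟨y, rfl⟩ := mk_surjective U.toAdicAlgebra _ y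
      refine (pairing_gen_mul_right U W μ (U.antipode x) y).trans ?_
      simp only [← pairing_antipode_ser, W.antipode_ser]
      rfl
  have h1 : pairTensor (idealLift _ F hF) (epsF U 0) (U.comul 2 a) = F a := by
    have := U.sliceR_comul 1 a
    refine Eq.trans ?_ (congrArg (idealLift _ F hF) this)
    generalize U.comul 2 a = t
    induction t with
    | zero => simp
    | add x y hx hy => simp only [map_add, hx, hy]
    | tmul x y =>
      rw [sliceR_tmul, map_smul, smul_eq_mul, mul_comm]
      rfl
  have h2 := key (U.comul 2 a)
  have h3 : zetaF U W μ 0 (algebraMap k (U.Quo 2) (U.counit a)) = 0 := by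
    rw [Algebra.algebraMap_eq_smul_one, map_smul, ← map_one (U.mk' 2), zetaF_mk, vec_one_one,
      coeff_one, if_neg (by simp), smul_zero]
  have h4 := (congrArg (zetaF U W μ 0) (U.antipode_left 2 a)).trans h3
  rw [h4, h1] at h2
  rw [W.antipode_H, map_neg, map_sum, LinearMap.neg_apply, LinearMap.sum_apply]
  refine (neg_eq_iff_add_eq_zero.mpr ?_)
  refine Eq.trans ?_ h2.symm
  congr 1
  exact Finset.sum_congr rfl fun ν _ => isConv_ser U W _ _ 2 (hs _) (gen_vanish U W ν 0) a

end Antipode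

/-! ### Continuous functionals separate tensors -/

section Separation

variable {k : Type u} [Field k] {P : AdicAlgebra k} {V : Type u} [AddCommGroup V] [Module k V]
  {B : V →ₗ[k] P.carrier →ₗ[k] k}

theorem exists_eq_idealLift (hB : LinearMap.range B = P.contDual) {N : ℕ}
    (lam : P.Quo N →ₗ[k] k) : ∃ v, ∃ hv : ∀ w ∈ P.ideal ^ N, B v w = 0,
      lam = idealLift _ (B v) hv := by
  have h : lam ∘ₗ (P.mk' N).toLinearMap ∈ P.contDual := ⟨N, fun a ha =>
    (congrArg lam (Ideal.Quotient.eq_zero_iff_mem.mpr ha)).trans (map_zero lam)⟩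
  rw [← hB] at h
  obtain ⟨v, hv⟩ := h
  refine ⟨v, fun w hw => ?_, LinearMap.ext fun x => ?_⟩
  · rw [hv]
    exact (congrArg lam (Ideal.Quotient.eq_zero_iff_mem.mpr hw)).trans (map_zero lam)
  · obtain ⟨x, rfl⟩ := Ideal.Quotient.mk_surjective x
    exact (LinearMap.congr_fun hv x).symm

theorem tensor_ext_of_range (hB : LinearMap.range B = P.contDual) {N : ℕ}
    {t t' : P.Quo N ⊗[k] P.Quo N}
    (h : ∀ v v' (hv : ∀ w ∈ P.ideal ^ N, B v w = 0) (hv' : ∀ w ∈ P.ideal ^ N, B v' w = 0),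
      pairTensor (idealLift _ (B v) hv) (idealLift _ (B v') hv') t =
        pairTensor (idealLift _ (B v) hv) (idealLift _ (B v') hv') t') : t = t' := by
  refine eq_of_sliceR fun lam' => ?_
  refine (Module.forall_dual_apply_eq_zero_iff k _).mp (fun lam => ?_) |> sub_eq_zero.mp
  obtain ⟨v, hv, rfl⟩ := exists_eq_idealLift hB lam
  obtain ⟨v', hv', rfl⟩ := exists_eq_idealLift hB lam'
  have e : ∀ s, pairTensor (idealLift _ (B v) hv) (idealLift _ (B v') hv') s =
      idealLift _ (B v) hv (sliceR _ (idealLift _ (B v') hv') s) := fun s => by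
    induction s with
    | zero => simp
    | add x y hx hy => simp only [map_add, hx, hy]
    | tmul x y =>
      rw [sliceR_tmul, map_smul, smul_eq_mul, mul_comm]
      rfl
  rw [map_sub, ← e, ← e, h, sub_self]

end Separation

/-! ### The two antipodes are transposes of each other -/

section Antipode

variable {k : Type u} [Field k] [CharZero k] {m n : ℕ} {L : InhomBialgebra k m n}
  (U : Quantization L) (W : Quantization L.dual)

/-- The map `x ⊗ y ↦ S y ⊗ S x` on the quotients. -/
noncomputable def _root_.Quantization.swapN (N : ℕ) :
    U.Quo N ⊗[k] U.Quo N →ₗ[k] U.Quo N ⊗[k] U.Quo N :=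
  (TensorProduct.comm k _ _).toLinearMap ∘ₗ TensorProduct.map (U.real.antiN N) (U.real.antiN N)

theorem _root_.Quantization.swapN_tmul (N : ℕ) (x y : U.carrier) :
    U.swapN N (U.mk' N x ⊗ₜ U.mk' N y) =
      U.mk' N (U.antipode y) ⊗ₜ U.mk' N (U.antipode x) := by
  rw [U.antipode_eq, U.antipode_eq]
  rfl

theorem _root_.Quantization.swapN_mul (N : ℕ) (t t' : U.Quo N ⊗[k] U.Quo N) :
    U.swapN N (t * t') = U.swapN N t' * U.swapN N t := by
  induction t with
  | zero => simp
  | add x y hx hy => rw [add_mul, map_add, hx, hy, map_add, mul_add]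
  | tmul x y =>
    induction t' with
    | zero => simp
    | add x y hx hy => rw [mul_add, map_add, hx, hy, map_add, add_mul]
    | tmul x' y' =>
      rw [Algebra.TensorProduct.tmul_mul_tmul]
      change U.real.antiN N (y * y') ⊗ₜ[k] U.real.antiN N (x * x') =
        (U.real.antiN N y' ⊗ₜ[k] U.real.antiN N x') * (U.real.antiN N y ⊗ₜ[k] U.real.antiN N x)
      rw [Algebra.TensorProduct.tmul_mul_tmul, U.real.antiN_mul, U.real.antiN_mul]

theorem pairTensor_swapN {N M : ℕ} (hNM : N ≤ M) {F G F' G' : W.carrier →ₗ[k] k}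
    (hF : ∀ w ∈ W.ideal ^ N, F w = 0) (hG : ∀ w ∈ W.ideal ^ N, G w = 0)
    (hF' : ∀ w ∈ W.ideal ^ M, F' w = 0) (hG' : ∀ w ∈ W.ideal ^ M, G' w = 0)
    (S : Submodule k W.carrier) (hFS : ∀ w ∈ S, F (W.antipode w) = F' w)
    (hGS : ∀ w ∈ S, G (W.antipode w) = G' w) {t : W.Quo M ⊗[k] W.Quo M}
    (ht : t ∈ Submodule.span k {t | ∃ x ∈ S, ∃ y ∈ S, t = W.mk' M x ⊗ₜ W.mk' M y}) :
    pairTensor (idealLift _ F hF) (idealLift _ G hG)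
      (W.swapN N (Algebra.TensorProduct.map (W.proj hNM) (W.proj hNM) t)) =
      pairTensor (idealLift _ G' hG') (idealLift _ F' hF') t := by
  induction ht using Submodule.span_induction with
  | zero => simp
  | add x y _ _ hx hy => simp only [map_add, hx, hy]
  | smul r x _ hx => simp only [map_smul, hx]
  | mem t ht =>
    obtain ⟨x, hx, y, hy, rfl⟩ := ht
    rw [pairTensor_mk, ← hFS y hy, ← hGS x hx, mul_comm]
    refine (congrArg _ (W.swapN_tmul N x y)).trans ?_
    exact pairTensor_mk hF hG _ _

/-- The elements on which the two antipodes agree. -/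
noncomputable def agree : Submodule k W.carrier :=
  LinearMap.ker ((pairing U W) ∘ₗ W.antipode - (LinearMap.lcomp k k U.antipode) ∘ₗ pairing U W)

theorem mem_agree {w : W.carrier} : w ∈ agree U W ↔
    ∀ a, pairing U W (W.antipode w) a = pairing U W w (U.antipode a) := by
  rw [agree, LinearMap.mem_ker, LinearMap.sub_apply, sub_eq_zero]
  exact ⟨fun h a => LinearMap.congr_fun h a, fun h => LinearMap.ext h⟩

theorem pairing_mul_eq (a b : U.carrier) {M : ℕ} (w : W.carrier)
    (ha : ∀ w ∈ W.ideal ^ M, (pairing U W).flip a w = 0)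
    (hb : ∀ w ∈ W.ideal ^ M, (pairing U W).flip b w = 0) :
    pairing U W w (a * b) = pairTensor (idealLift _ _ ha) (idealLift _ _ hb) (W.comul M w) := by
  have h := isConv_pairing (L := L.dual) W U a b
  rw [← pairing_flip] at h
  exact h M ha hb w

theorem pairing_flip_vanish (a : U.carrier) : ∃ N, ∀ M, N ≤ M → ∀ w ∈ W.ideal ^ M,
    (pairing U W).flip a w = 0 := by
  rw [pairing_flip]
  exact pairing_vanish (L := L.dual) W U a

/-- Where the two antipodes are transposes, antimultiplicativity in `U` dualizes to
anticomultiplicativity in `W`. -/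
theorem comul_antipode_of_agree {w : W.carrier} (hw : w ∈ agree U W)
    (hc : ∀ M, W.comul M w ∈ Submodule.span k {t | ∃ x ∈ agree U W, ∃ y ∈ agree U W,
      t = W.mk' M x ⊗ₜ W.mk' M y}) (N : ℕ) :
    W.comul N (W.antipode w) = W.swapN N (W.comul N w) := by
  refine tensor_ext_of_range (B := (pairing U W).flip) ?_ fun a a' ha ha' => ?_
  · rw [pairing_flip]
    exact pairing_range (L := L.dual) W U
  · obtain ⟨N1, h1⟩ := pairing_flip_vanish U W (U.antipode a)
    obtain ⟨N2, h2⟩ := pairing_flip_vanish U W (U.antipode a')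
    have hM : N ≤ N + N1 + N2 := by omega
    rw [← pairing_mul_eq, (mem_agree U W).mp hw, U.antipode_mul, ← W.comul_proj hM,
      pairing_mul_eq U W _ _ w (h2 (N + N1 + N2) (by omega)) (h1 _ (by omega))]
    exact (pairTensor_swapN W hM ha ha' (h1 _ (by omega)) (h2 _ (by omega)) _ (fun w hw => (mem_agree U W).mp hw a)
      (fun w hw => (mem_agree U W).mp hw a') (hc _)).symm

/-- A statement about `W` alone, but the generators are handled by pairing with an auxiliary
quantization of `𝐋`; multiplicativity does the rest. -/
theorem comul_antipode (N : ℕ) (w : W.carrier) :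
    W.comul N (W.antipode w) = W.swapN N (W.comul N w) := by
  obtain ⟨U⟩ := nonempty_quantization L
  have hser : ∀ g, W.ser g ∈ agree U W := fun g => (mem_agree U W).mpr (pairing_antipode_ser U W g)
  have hgen : ∀ μ, W.H μ ∈ agree U W := fun μ => (mem_agree U W).mpr (pairing_antipode_gen U W μ)
  refine W.isPBW.mem_of_closed (P := fun w => W.comul N (W.antipode w) =
    W.swapN N (W.comul N w)) (by simp) ?_ ?_ (fun g => ?_) (fun μ => ?_) w
  · intro a b ha hb
    rw [map_add, map_add, ha, hb, map_add, map_add]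
  · intro a b ha hb
    rw [W.antipode_mul, map_mul, ha, hb, map_mul, W.swapN_mul]
  · refine comul_antipode_of_agree U W (hser g) (fun M => ?_) N
    rw [W.comul_ser, dN_eq_sum L.dual W.X_mem le_rfl]
    exact Submodule.sum_mem _ fun a _ => Submodule.subset_span ⟨_, hser _, _, hser _, rfl⟩
  · refine comul_antipode_of_agree U W (hgen μ) (fun M => ?_) N
    rw [W.comul_gen, hN]
    refine Submodule.add_mem _ (Submodule.sum_mem _ fun ν _ =>
      Submodule.subset_span ⟨_, hser _, _, hgen ν, rfl⟩) (Submodule.subset_span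
        ⟨_, hgen μ, W.ser 1, hser 1, ?_⟩)
    rw [map_one, map_one]

/-- The induction is on `a`. Products in `U` are paired through the coproduct of `w`, where
`comul_antipode` applies, and the generators of `U` are the mirror image of those of `W`. -/
theorem pairing_antipode (w : W.carrier) (a : U.carrier) :
    pairing U W (W.antipode w) a = pairing U W w (U.antipode a) := by
  refine U.isPBW.mem_of_closed (P := fun a => ∀ w, pairing U W (W.antipode w) a =
    pairing U W w (U.antipode a)) (fun w => by simp) ?_ ?_ (fun f w => ?_) (fun i w => ?_) a w
  · intro a b ha hb w
    simp only [map_add, ha, hb]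
  · intro a b ha hb w
    obtain ⟨N1, h1⟩ := pairing_flip_vanish U W (U.antipode a)
    obtain ⟨N2, h2⟩ := pairing_flip_vanish U W (U.antipode b)
    obtain ⟨N3, h3⟩ := pairing_flip_vanish U W a
    obtain ⟨N4, h4⟩ := pairing_flip_vanish U W b
    have ht : ∀ M (t : W.Quo M ⊗[k] W.Quo M), t ∈ Submodule.span k {t | ∃ x ∈ (⊤ : Submodule k
        W.carrier), ∃ y ∈ (⊤ : Submodule k W.carrier), t = W.mk' M x ⊗ₜ W.mk' M y} := fun M t => by
      induction t with
      | zero => exact Submodule.zero_mem _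
      | add x y hx hy => exact Submodule.add_mem _ hx hy
      | tmul x y =>
        obtain ⟨x, rfl⟩ := mk_surjective W.toAdicAlgebra _ x
        obtain ⟨y, rfl⟩ := mk_surjective W.toAdicAlgebra _ y
        exact Submodule.subset_span ⟨x, trivial, y, trivial, rfl⟩
    have hM := le_refl (N1 + N2 + N3 + N4)
    rw [U.antipode_mul, pairing_mul_eq U W _ _ w (h2 (N1 + N2 + N3 + N4) (by omega))
      (h1 _ (by omega)), pairing_mul_eq U W _ _ _ (h3 (N1 + N2 + N3 + N4) (by omega))
      (h4 _ (by omega)), comul_antipode, ← W.comul_proj hM w,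
      pairTensor_swapN W hM _ _ (h1 _ (by omega)) (h2 _ (by omega)) ⊤ (fun w _ => ha w)
      (fun w _ => hb w) (ht _ _), W.comul_proj hM]
  · rw [pairing_comm, pairing_comm]
    exact (pairing_antipode_ser (L := L.dual) W U f w).symm
  · rw [pairing_comm, pairing_comm]
    exact (pairing_antipode_gen (L := L.dual) W U i w).symm

theorem isDual_pairing : U.IsDual W (pairing U W) where
  left_injective := pairing_injective U W
  left_range := pairing_range U W
  right_injective := by
    rw [pairing_flip]
    exact pairing_injective (L := L.dual) W U
  right_range := by
    rw [pairing_flip]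
    exact pairing_range (L := L.dual) W U
  mul := fun N w w' hw hw' a => isConv_pairing U W w w' N hw hw' a
  one := pairing_one U W
  comul := fun N a b ha hb w => (pairing_mul_eq U W a b w ha hb).symm
  counit := fun w => ((pairing_comm U W w 1).trans (pairing_one (L := L.dual) W U w)).symm
  antipode := pairing_antipode U W
  zeta := fun μ f d => by
    have h := pairing_mono U W 1 (Finsupp.single μ 1) f d
    rw [map_one, one_mul, sig_single] at h
    rw [symMonomial_eq, mul_smul_comm, map_smul, h, coeff_one]
    split_ifs with hd
    · simp [hd]
    · rw [zero_mul, smul_zero]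
  eta := fun i f d => by
    have h := pairing_mono U W (X i) 0 f d
    rw [sig_zero, mul_one] at h
    rw [symMonomial_eq, mul_smul_comm, map_smul]
    refine (congrArg _ h).trans ?_
    rw [coeff_X]
    split_ifs with hd
    · rw [hd, one_mul, coeff_zero_eq_constantCoeff_apply, Finset.prod_eq_one, one_smul]
      intro j _
      rw [Finsupp.single_apply]
      split_ifs <;> simp
    · rw [zero_mul, smul_zero]

end Antipode

/-! ### The canonical element -/

section Canonical

variable {k : Type u} [Field k] [CharZero k] {m n : ℕ} {L : InhomBialgebra k m n}
  (U : Quantization L) (W : Quantization L.dual)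

/-- Expansion in dual bases. Vanishing on the `N`-th power of the ideal of `W` bounds the degree in
the `H_i`, and reduction modulo `I ^ N` bounds the degree in the `X^μ`. -/
theorem mk_eq_sum_pairing {N : ℕ} (a : U.carrier)
    (ha : ∀ w ∈ W.ideal ^ N, (pairing U W).flip a w = 0) :
    U.mk' N a = ∑ e ∈ degLT (Fin n) N, ∑ d ∈ degLT (Fin m) N,
      pairing U W (W.ser (monomial d 1) * sig k W.H e) a •
        U.mk' N (U.ser (monomial e 1) * sig k U.H d) := by
  have hc : ∀ e d, pairing U W (W.ser (monomial d 1) * sig k W.H e) a =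
      coeff e (U.isPBW.crd a d) := fun e d => by
    rw [pairing_comm]
    exact (coeff_crd_eq_pairing (L := L.dual) W U a d e).symm
  have hs : (U.isPBW.crd a).support ⊆ degLT (Fin m) N := fun d hd => by
    rw [mem_degLT]
    by_contra h
    refine Finsupp.mem_support_iff.mp hd (MvPowerSeries.ext fun e => ?_)
    rw [← hc, ← LinearMap.flip_apply, ha, map_zero]
    exact Ideal.mul_mem_right _ _ (ser_mem_pow W.X_mem N _ fun e he => by
      rw [coeff_monomial_ne]
      rintro rfl
      omega)
  conv_lhs => rw [← U.isPBW.combMap_crd a, combMap_apply,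
    Finsupp.sum_of_support_subset _ hs _ (by simp), map_sum]
  rw [Finset.sum_comm]
  refine Finset.sum_congr rfl fun d _ => ?_
  simp only [map_mul (U.mk' N), ← smul_mul_assoc, hc]
  rw [← Finset.sum_mul, mk_ser_eq_sum U.X_mem le_rfl]

theorem ser_X_mul_monomial (i : Fin n) (d : Fin n →₀ ℕ) :
    U.ser (monomial (d + Finsupp.single i 1) 1) = U.ser (X i) * U.ser (monomial d 1) := by
  rw [← map_mul, X, monomial_mul_monomial, one_mul, add_comm]

theorem zetaX_pow (N j : ℕ) : ((j ! : ℕ) : k)⁻¹ • zetaX W U N ^ j =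
    ∑ e ∈ Finset.univ.finsuppAntidiag j, MulOpposite.op (W.mk' N (sig k W.H e)) ⊗ₜ[k]
      U.mk' N (U.ser (monomial e 1)) := by
  have h := sum_mul_pow (k := k)
    (fun μ => MulOpposite.op (W.mk' N (W.H μ)) ⊗ₜ[k] (1 : U.Quo N))
    (fun μ => (1 : (W.Quo N)ᵐᵒᵖ) ⊗ₜ[k] U.mk' N (U.X μ))
    (fun e => (1 : (W.Quo N)ᵐᵒᵖ) ⊗ₜ[k] U.mk' N (U.ser (monomial e 1)))
    (by rw [monomial_zero_one, map_one, map_one]; rfl)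
    (fun μ e => by
      rw [Algebra.TensorProduct.tmul_mul_tmul, one_mul, ser_X_mul_monomial, map_mul]
      rfl)
    (fun μ ν => by simp [Commute, SemiconjBy, Algebra.TensorProduct.tmul_mul_tmul]) j
  simp only [Algebra.TensorProduct.tmul_mul_tmul, one_mul, mul_one] at h
  refine h.trans (Finset.sum_congr rfl fun e _ => ?_)
  have h1 := map_sig (k := k) (Algebra.TensorProduct.includeLeft.comp (AlgHom.op (W.mk' N)) :
    W.carrierᵐᵒᵖ →ₐ[k] OpTensor W.toAdicAlgebra U.toAdicAlgebra N) (fun μ => MulOpposite.op (W.H μ)) e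
  rw [← op_sig] at h1
  refine (congrArg (· * _) h1).symm.trans ?_
  change (_ ⊗ₜ[k] 1) * _ = _
  rw [Algebra.TensorProduct.tmul_mul_tmul, one_mul, mul_one]
  rfl

theorem etaH_pow (N j : ℕ) : ((j ! : ℕ) : k)⁻¹ • etaH W U N ^ j =
    ∑ d ∈ Finset.univ.finsuppAntidiag j, MulOpposite.op (W.mk' N (W.ser (monomial d 1))) ⊗ₜ[k]
      U.mk' N (sig k U.H d) := by
  have h := sum_mul_pow (k := k)
    (fun i => (1 : (W.Quo N)ᵐᵒᵖ) ⊗ₜ[k] U.mk' N (U.H i))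
    (fun i => MulOpposite.op (W.mk' N (W.X i)) ⊗ₜ[k] (1 : U.Quo N))
    (fun d => MulOpposite.op (W.mk' N (W.ser (monomial d 1))) ⊗ₜ[k] (1 : U.Quo N))
    (by rw [monomial_zero_one, map_one, map_one]; rfl)
    (fun i d => by
      rw [Algebra.TensorProduct.tmul_mul_tmul, one_mul, ← MulOpposite.op_mul, ← map_mul,
        add_comm d, ← one_mul (1 : k), ← monomial_mul_monomial, mul_one, mul_comm, map_mul]
      rfl)
    (fun i j => by simp [Commute, SemiconjBy, Algebra.TensorProduct.tmul_mul_tmul]) j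
  simp only [Algebra.TensorProduct.tmul_mul_tmul, one_mul, mul_one] at h
  refine h.trans (Finset.sum_congr rfl fun d _ => ?_)
  have h1 := map_sig (k := k) (Algebra.TensorProduct.includeRight.comp (U.mk' N) :
    U.carrier →ₐ[k] OpTensor W.toAdicAlgebra U.toAdicAlgebra N) U.H d
  refine (congrArg (· * _) h1).symm.trans ?_
  change (1 ⊗ₜ[k] _) * _ = _
  rw [Algebra.TensorProduct.tmul_mul_tmul, one_mul, mul_one]
  rfl

theorem mk_monomial_eq_zero {N : ℕ} {e : Fin n →₀ ℕ} (he : e ∈ Finset.univ.finsuppAntidiag N) :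
    U.mk' N (U.ser (monomial e 1)) = 0 :=
  mk_ser_eq_zero U.X_mem fun d hd => by
    rw [coeff_monomial_ne]
    rintro rfl
    rw [mem_finsuppAntidiag_degree] at he
    omega

theorem zetaX_pow_eq_zero (N : ℕ) : zetaX W U N ^ N = 0 := by
  have h := zetaX_pow U W N N
  rw [Finset.sum_eq_zero fun e he => by rw [mk_monomial_eq_zero U he, TensorProduct.tmul_zero]] at h
  exact (smul_eq_zero.mp h).resolve_left (inv_ne_zero (Nat.cast_ne_zero.mpr N.factorial_ne_zero))

theorem etaH_pow_eq_zero (N : ℕ) : etaH W U N ^ N = 0 := by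
  have h := etaH_pow U W N N
  rw [Finset.sum_eq_zero fun d hd => by
    rw [mk_monomial_eq_zero (L := L.dual) W hd, MulOpposite.op_zero, TensorProduct.zero_tmul]] at h
  exact (smul_eq_zero.mp h).resolve_left (inv_ne_zero (Nat.cast_ne_zero.mpr N.factorial_ne_zero))

/-- The product of the exponentials is the sum over the dual bases. The opposite multiplication puts
the monomials in `η` to the left of those in `ζ`, as in the basis of `W`. -/
theorem exp_mul_exp (N : ℕ) : expBelow k N (zetaX W U N) * expBelow k N (etaH W U N) =
    ∑ e ∈ degLT (Fin n) N, ∑ d ∈ degLT (Fin m) N,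
      MulOpposite.op (W.mk' N (W.ser (monomial d 1) * sig k W.H e)) ⊗ₜ[k]
        U.mk' N (U.ser (monomial e 1) * sig k U.H d) := by
  simp only [expBelow, zetaX_pow, etaH_pow]
  rw [← sum_degLT, ← sum_degLT, Finset.sum_mul_sum]
  simp only [Algebra.TensorProduct.tmul_mul_tmul, ← MulOpposite.op_mul, ← map_mul]

theorem expBelow_succ {R S : Type u} [Ring R] [Algebra k R] [Ring S] [Algebra k S] (f : R →ₐ[k] S)
    {N : ℕ} {x : R} {y : S} (h : f x = y) (hy : y ^ N = 0) :
    f (expBelow k (N + 1) x) = expBelow k N y := by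
  rw [expBelow, map_sum, Finset.sum_range_succ, map_smul, map_pow, h, hy, smul_zero, add_zero]
  exact Finset.sum_congr rfl fun j _ => by rw [map_smul, map_pow, h]

theorem isCanonicalElement : IsCanonicalElement W.toAdicAlgebra U.toAdicAlgebra (pairing U W)
    (fun N => expBelow k N (zetaX W U N) * expBelow k N (etaH W U N)) where
  compat := fun N => by
    rw [map_mul, expBelow_succ _ (y := zetaX W U N) ?_ (zetaX_pow_eq_zero U W N),
      expBelow_succ _ (y := etaH W U N) ?_ (etaH_pow_eq_zero U W N)]
    · exact map_sum _ _ _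
    · exact map_sum _ _ _
  left := fun N a ha => by
    rw [exp_mul_exp, mk_eq_sum_pairing U W a ha]
    simp only [map_sum]
    exact Finset.sum_congr rfl fun e _ => Finset.sum_congr rfl fun d _ => rfl
  right := fun N w hw => by
    have h := mk_eq_sum_pairing (L := L.dual) W U (N := N) w fun a ha => by
      rw [LinearMap.flip_apply, ← pairing_comm]
      exact hw a ha
    refine Eq.trans ?_ (congrArg (MulOpposite.opLinearEquiv k) h).symm
    rw [exp_mul_exp, Finset.sum_comm]
    simp only [map_sum]
    refine Finset.sum_congr rfl fun d _ => Finset.sum_congr rfl fun e _ => ?_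
    rw [← pairing_comm]
    rfl

end Canonical

/-! ### The isomorphism between two quantizations -/

section Uniqueness

variable {k : Type u} [Field k] [CharZero k] {m n : ℕ} {L : InhomBialgebra k m n}

theorem pow_le_comap_of_X {m' n' : ℕ} {L' : InhomBialgebra k m' n'} (U : Quantization L)
    (U' : Quantization L') (Φ : U.carrier →ₐ[k] U'.carrier) (h : ∀ μ, Φ (U.X μ) ∈ U'.ideal) (N : ℕ) :
    U.ideal ^ N ≤ (U'.ideal ^ N).comap Φ := by
  have h1 : ∀ a ∈ U.ideal, Φ a ∈ U'.ideal := by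
    have : U.ideal ≤ U'.ideal.comap Φ := by
      rw [U.ideal_eq, Ideal.span_le]
      rintro _ ⟨μ, b, rfl⟩
      rw [SetLike.mem_coe, Ideal.mem_comap, map_mul]
      exact Ideal.mul_mem_right _ _ (h μ)
    exact this
  induction N with
  | zero =>
    rw [Submodule.pow_zero, Submodule.pow_zero, Ideal.one_eq_top, Ideal.one_eq_top]
    exact le_top
  | succ N ih =>
    rw [Submodule.pow_succ, Submodule.pow_succ, Ideal.mul_le]
    intro r hr s hs
    rw [Ideal.mem_comap, map_mul]
    exact Ideal.mul_mem_mul (ih hr) (h1 s hs)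

variable (U U' : Quantization L)

/-- The isomorphism of two quantizations that respects the generators. -/
noncomputable def transfer : U.carrier →ₐ[k] U'.carrier :=
  U.isPBW.lift U.real.rels U'.real.rels

theorem transfer_ser (f : MvPowerSeries (Fin n) k) : transfer U U' (U.ser f) = U'.ser f :=
  U.isPBW.lift_ser _ _ f

theorem transfer_H (i : Fin m) : transfer U U' (U.H i) = U'.H i := U.isPBW.lift_gen _ _ i

theorem transfer_transfer (a : U.carrier) : transfer U' U (transfer U U' a) = a :=
  AlgHom.congr_fun (U.isPBW.algHom_ext (F := (transfer U' U).comp (transfer U U'))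
    (G := AlgHom.id k _)
    (fun f => (congrArg _ (transfer_ser U U' f)).trans (transfer_ser U' U f))
    fun i => (congrArg _ (transfer_H U U' i)).trans (transfer_H U' U i)) a

theorem isHopfHom_transfer : IsHopfHom U.toAdicHopf U'.toAdicHopf (transfer U U') where
  map_ideal := pow_le_comap_of_X U U' _ fun μ => by
    rw [Quantization.X, transfer_ser]
    exact U'.X_mem μ
  map_comul := fun N a => by
    have hI := pow_le_comap_of_X U U' (transfer U U') (fun μ => by
      rw [Quantization.X, transfer_ser]
      exact U'.X_mem μ) N
    let q := Ideal.quotientMapₐ (U'.ideal ^ N) (transfer U U') hI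
    have hq : ∀ u, q (U.mk' N u) = U'.mk' N (transfer U U' u) := fun _ => rfl
    refine AlgHom.congr_fun (U.isPBW.algHom_ext
      (F := (Algebra.TensorProduct.map q q).comp (U.comul N))
      (G := (U'.comul N).comp (transfer U U')) (fun f => ?_) fun i => ?_) a
    · rw [AlgHom.comp_apply, AlgHom.comp_apply, transfer_ser, U.comul_ser, U'.comul_ser,
        dN_eq_sum L U.X_mem le_rfl, dN_eq_sum L U'.X_mem le_rfl, map_sum]
      simp only [Algebra.TensorProduct.map_tmul, hq, transfer_ser]
    · rw [AlgHom.comp_apply, AlgHom.comp_apply, transfer_H, U.comul_gen, U'.comul_gen, hN, hN,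
        map_add, map_sum]
      simp only [Algebra.TensorProduct.map_tmul, hq, transfer_ser, transfer_H, map_one]
  map_counit := fun a => AlgHom.congr_fun (U.isPBW.algHom_ext
    (F := U'.counit.comp (transfer U U')) (G := U.counit)
    (fun f => by rw [AlgHom.comp_apply, transfer_ser, U.counit_ser, U'.counit_ser])
    fun i => by rw [AlgHom.comp_apply, transfer_H, U.counit_H, U'.counit_H]) a
  map_antipode := fun a => by
    refine U.isPBW.mem_of_closed (P := fun a => transfer U U' (U.antipode a) =
      U'.antipode (transfer U U' a)) (by simp) ?_ ?_ (fun f => ?_) (fun i => ?_) a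
    · intro a b ha hb
      simp only [map_add, ha, hb]
    · intro a b ha hb
      rw [U.antipode_mul, map_mul, ha, hb, map_mul, U'.antipode_mul]
    · rw [U.antipode_ser, transfer_ser, transfer_ser, U'.antipode_ser]
    · simp only [U.antipode_H, U'.antipode_H, transfer_H, map_neg, map_sum, map_mul, transfer_ser]

theorem existsUnique_iso : ∃! Φ : U.carrier ≃ₐ[k] U'.carrier,
    IsHopfHom U.toAdicHopf U'.toAdicHopf Φ.toAlgHom ∧
    IsHopfHom U'.toAdicHopf U.toAdicHopf Φ.symm.toAlgHom ∧
    (∀ i, Φ (U.H i) = U'.H i) ∧ ∀ f, Φ (U.ser f) = U'.ser f := by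
  refine ⟨AlgEquiv.ofAlgHom (transfer U U') (transfer U' U)
    (AlgHom.ext (transfer_transfer U' U)) (AlgHom.ext (transfer_transfer U U')),
    ⟨isHopfHom_transfer U U', isHopfHom_transfer U' U, transfer_H U U', transfer_ser U U'⟩, ?_⟩
  rintro Ψ ⟨-, -, hH, hf⟩
  refine AlgEquiv.ext fun a => AlgHom.congr_fun (U.isPBW.algHom_ext (F := Ψ.toAlgHom)
    (G := transfer U U') (fun f => ?_) fun i => ?_) a
  · exact (hf f).trans (transfer_ser U U' f).symm
  · exact (hH i).trans (transfer_H U U' i).symm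

end Uniqueness

/-! ### Symmetrized monomials in linear combinations of generators -/

section Sym

variable {k : Type*} [Field k] [CharZero k] {ι κ : Type*} [Fintype ι] [DecidableEq ι] [Fintype κ]
  [DecidableEq κ] {R : Type*} [Ring R] [Algebra k R]

theorem smul_sum_pow (T : ι → R) (t : ι → k) (r : ℕ) : ((r ! : ℕ) : k)⁻¹ • (∑ i, t i • T i) ^ r =
    ∑ a ∈ Finset.univ.finsuppAntidiag r, (∏ i, t i ^ a i) • sig k T a := by
  have h := sum_mul_pow (k := k) T (fun i => algebraMap k R (t i))
    (fun a => algebraMap k R (∏ i, t i ^ a i)) (by simp)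
    (fun i b => by
      rw [← map_mul]
      simp only [Finsupp.add_apply, pow_add, Finset.prod_mul_distrib, Finsupp.single_apply,
        pow_ite, pow_one, pow_zero, Finset.prod_ite_eq, Finset.mem_univ, if_true, mul_comm])
    (fun i j => Algebra.commutes _ _) r
  simpa only [← Algebra.commutes, ← Algebra.smul_def] using h

/-- A functional that vanishes on the symmetrized monomials of degree `r` also vanishes on those in
linear combinations of the generators. -/
theorem sig_linear_eq_zero {φ' : R →ₗ[k] k} {T : κ → R} (p : κ → ι → k) {r : ℕ}
    (hT : ∀ a : κ →₀ ℕ, a.degree = r → φ' (sig k T a) = 0) (d : ι →₀ ℕ) (hd : d.degree = r) :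
    φ' (sig k (fun i => ∑ j, p j i • T j) d) = 0 := by
  -- The generating polynomial of the values in question. At every point it is the functional
  -- applied to a divided power of a combination of the `T j`, hence zero; over the infinite field
  -- `k` all its coefficients vanish.
  let P : MvPolynomial ι k := ∑ a ∈ Finset.univ.finsuppAntidiag r,
    MvPolynomial.monomial a (φ' (sig k (fun i => ∑ j, p j i • T j) a))
  have hP : P = 0 := MvPolynomial.funext fun t => by
    have h1 := congrArg φ' (smul_sum_pow (fun i => ∑ j, p j i • T j) t r)
    have h2 : ∑ i, t i • ∑ j, p j i • T j = ∑ j, (∑ i, t i * p j i) • T j := by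
      simp only [Finset.smul_sum, smul_smul, Finset.sum_smul]
      exact Finset.sum_comm
    rw [h2, smul_sum_pow, map_sum, map_sum, Finset.sum_eq_zero] at h1
    · rw [map_zero, map_sum, h1]
      refine Finset.sum_congr rfl fun a _ => ?_
      rw [MvPolynomial.eval_monomial, map_smul, smul_eq_mul, mul_comm, Finsupp.prod_fintype _ _
        fun i => pow_zero _]
    · intro a ha
      rw [map_smul, hT a (mem_finsuppAntidiag_degree.mp ha), smul_zero]
  have h := congrArg (MvPolynomial.coeff d) hP
  rw [MvPolynomial.coeff_sum, Finset.sum_eq_single d] at h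
  · rwa [MvPolynomial.coeff_monomial, if_pos rfl] at h
  · intro a _ ha
    rw [MvPolynomial.coeff_monomial, if_neg ha]
  · exact fun h => absurd (mem_finsuppAntidiag_degree.mpr hd) h

end Sym

/-! ### Characterization of the functionals `ζ_μ` and `η^i` -/

section Generators

variable {k : Type u} [Field k] [CharZero k] {m n m' n' : ℕ} {L : InhomBialgebra k m n}
  {L' : InhomBialgebra k m' n'} {U : Quantization L} {U' : Quantization L'}
  {W : Quantization L.dual} {W' : Quantization L'.dual}
  {B : W.carrier →ₗ[k] U.carrier →ₗ[k] k} {B' : W'.carrier →ₗ[k] U'.carrier →ₗ[k] k}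

theorem ext_symMonomial {F G : U.carrier →ₗ[k] k}
    (h : ∀ f d, F (U.ser f * symMonomial k U.H d) = G (U.ser f * symMonomial k U.H d)) : F = G :=
  U.isPBW.ext fun f d => by
    have h1 := h f d
    rw [symMonomial_eq, mul_smul_comm, map_smul, map_smul] at h1
    exact smul_right_injective k (Finset.prod_ne_zero_iff.mpr fun i _ =>
      Nat.cast_ne_zero.mpr (Nat.factorial_ne_zero _)) h1

theorem isDual_H (h : U.IsDual W B) (μ : Fin n) : B (W.H μ) = pairing U W (W.H μ) :=
  ext_symMonomial fun f d => (h.zeta μ f d).trans ((isDual_pairing U W).zeta μ f d).symm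

theorem isDual_X (h : U.IsDual W B) (i : Fin m) : B (W.X i) = pairing U W (W.X i) :=
  ext_symMonomial fun f d => (h.eta i f d).trans ((isDual_pairing U W).eta i f d).symm

theorem pairing_gen_H (μ : Fin n) (i : Fin m) : pairing U W (W.H μ) (U.H i) = 0 := by
  have h := pairing_mono U W 1 (Finsupp.single μ 1) 1 (Finsupp.single i 1)
  rw [map_one, one_mul, sig_single, map_one, one_mul, sig_single] at h
  rw [h, coeff_one, if_neg (by simp), zero_mul]

theorem pairing_gen_ser (μ : Fin n) (f : MvPowerSeries (Fin n) k) (d : Fin m →₀ ℕ) :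
    pairing U W (W.H μ) (U.ser f * sig k U.H d) =
      if d = 0 then coeff (Finsupp.single μ 1) f else 0 := by
  have h := pairing_mono U W 1 (Finsupp.single μ 1) f d
  rw [map_one, one_mul, sig_single] at h
  rw [h, coeff_one, ite_mul, one_mul, zero_mul]

theorem pairing_ser_mono (g : MvPowerSeries (Fin m) k) (f : MvPowerSeries (Fin n) k)
    (d : Fin m →₀ ℕ) : pairing U W (W.ser g) (U.ser f * sig k U.H d) = coeff d g * coeff 0 f := by
  rw [← pairing_mono U W, sig_zero, mul_one]

theorem pairing_ser_vanish (g : MvPowerSeries (Fin m) k) {a : U.carrier} (ha : a ∈ U.ideal) :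
    pairing U W (W.ser g) a = 0 := by
  rw [← mul_one (W.ser g), ← sig_zero (k := k) W.H]
  exact pairing_mono_vanish U W g (N := 1) (by rw [map_zero]; omega) a (by rwa [Submodule.pow_one])

/-- A characterization that avoids values on general power series. It is meant for compositions with
a morphism, which is prescribed on the generators but not on series. -/
theorem pairing_gen_unique {F : U.carrier →ₗ[k] k} (c : Fin n → k) (hH : ∀ x i, F (x * U.H i) = 0)
    (h1 : F 1 = 0) (hX : ∀ s g, F (U.X s * U.ser g) = c s * constantCoeff g) :
    F = ∑ s, c s • pairing U W (W.H s) := by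
  refine U.isPBW.ext fun f d => ?_
  simp only [LinearMap.sum_apply, LinearMap.smul_apply, pairing_gen_ser]
  split_ifs with hd
  · have hq : ∀ s, coeff (Finsupp.single s 1) f = constantCoeff (quot s f) := fun s => by
      conv_lhs => rw [eq_add_sum_quot f]
      rw [map_add, map_sum, coeff_C, if_neg (by simp), zero_add, Finset.sum_eq_single s]
      · rw [coeff_single_mul, coeff_zero_X, coeff_index_single_self_X, zero_mul, zero_add, one_mul]
        rfl
      · intro t _ ht
        rw [coeff_single_mul, coeff_zero_X, coeff_index_single_X, if_neg ht.symm, zero_mul,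
          zero_mul, add_zero]
      · simp
    have hC : U.ser (C (constantCoeff f)) = constantCoeff f • 1 :=
      (AlgHom.commutes U.ser _).trans (Algebra.algebraMap_eq_smul_one _)
    rw [hd, sig_zero, mul_one]
    conv_lhs => rw [eq_add_sum_quot f, map_add, map_sum, map_add, map_sum, hC, map_smul, h1,
      smul_zero, zero_add]
    refine Finset.sum_congr rfl fun s _ => ?_
    rw [map_mul, hq]
    exact hX s _
  · have h := congrArg (fun z => F (U.ser f * z)) (sig_rec' (k := k) U.H d)
    simp only [mul_smul_comm, map_nsmul, Finset.mul_sum, map_sum, mul_ite, mul_zero, apply_ite F,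
      map_zero, ← mul_assoc, hH, ite_self, Finset.sum_const_zero] at h
    rw [(smul_eq_zero.mp h).resolve_left (by rwa [Finsupp.degree_eq_zero_iff])]
    simp

end Generators

/-! ### Transposes of morphisms -/

section Transpose

variable {k : Type u} [Field k] [CharZero k] {m n m' n' : ℕ} {L : InhomBialgebra k m n}
  {L' : InhomBialgebra k m' n'} {U : Quantization L} {U' : Quantization L'}
  {W : Quantization L.dual} {W' : Quantization L'.dual}
  {B : W.carrier →ₗ[k] U.carrier →ₗ[k] k} {B' : W'.carrier →ₗ[k] U'.carrier →ₗ[k] k}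
  {p : Matrix (Fin m') (Fin m) k} {q : Matrix (Fin n') (Fin n) k}
  {Φ : U.carrier →ₐ[k] U'.carrier}

theorem pairing_gen_comp (hΦ : U.IsMorphism U' p q Φ) (μ : Fin n') :
    pairing U' W' (W'.H μ) ∘ₗ Φ.toLinearMap = ∑ ν, q μ ν • pairing U W (W.H ν) := by
  refine pairing_gen_unique _ (fun x i => ?_) ?_ fun s g => ?_
  · rw [LinearMap.comp_apply, AlgHom.toLinearMap_apply, map_mul, hΦ.map_H, pairing_gen_mul_right,
      map_sum]
    simp only [map_sum, map_smul, pairing_gen_H, U'.counit_H, smul_zero, Finset.sum_const_zero,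
      mul_zero, add_zero]
  · have h := pairing_gen_ser (U := U') (W := W') μ 1 0
    rw [map_one, one_mul, sig_zero, if_pos rfl, coeff_one, if_neg (by simp)] at h
    rw [LinearMap.comp_apply, AlgHom.toLinearMap_apply, map_one, h]
  · have hX : ∀ ν, pairing U' W' (W'.H μ) (U'.X ν) = if μ = ν then 1 else 0 := fun ν => by
      have h := pairing_gen_ser (U := U') (W := W') μ (X ν) 0
      rw [sig_zero, mul_one, if_pos rfl, coeff_index_single_X] at h
      exact h
    rw [LinearMap.comp_apply, AlgHom.toLinearMap_apply, map_mul, pairing_gen_mul_right,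
      hΦ.map_counit, U.counit_ser, hΦ.map_X, Finset.sum_eq_zero, zero_add]
    · simp [hX]
    · intro ν _
      rw [pairing_ser_vanish _ (Ideal.sum_mem _ fun ρ _ => ?_), zero_mul]
      rw [Algebra.smul_def]
      exact Ideal.mul_mem_left _ _ (U'.X_mem ρ)

/-- The functional `η^j` vanishes on the ideal, so only the constant term of a series matters, times
the image of `σ_d(H)`. This image is a symmetrized monomial in combinations of the new generators,
on which `η^j` is zero unless the degree is one. -/
theorem pairing_X_comp (hΦ : U.IsMorphism U' p q Φ) (j : Fin m') :
    pairing U' W' (W'.X j) ∘ₗ Φ.toLinearMap = ∑ i, p j i • pairing U W (W.X i) := by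
  have hX : ∀ i f d, pairing U W (W.X i) (U.ser f * sig k U.H d) =
      (if d = Finsupp.single i 1 then 1 else 0) * coeff 0 f := fun i f d => by
    rw [← coeff_X, ← pairing_ser_mono]
    rfl
  have hX' : ∀ d, pairing U' W' (W'.X j) (sig k U'.H d) =
      if d = Finsupp.single j 1 then 1 else 0 := fun d => by
    have h := pairing_ser_mono (U := U') (W := W') (X j) 1 d
    rw [map_one, one_mul, coeff_zero_one, mul_one, coeff_X] at h
    exact h
  refine U.isPBW.ext fun f d => ?_
  have hf : U.ser f - algebraMap k _ (coeff 0 f) ∈ U.ideal := by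
    have h := ser_mem_pow U.X_mem 1 (f - C (coeff 0 f)) (ordGE_one_iff.mpr (by simp))
    rw [Submodule.pow_one, map_sub] at h
    exact (AlgHom.commutes U.ser (coeff 0 f)) ▸ h
  have h1 : pairing U' W' (W'.X j) (Φ ((U.ser f - algebraMap k _ (coeff 0 f)) * sig k U.H d)) = 0 := by
    rw [← Submodule.pow_one U.ideal] at hf
    have h2 := hΦ.map_ideal 1 (Ideal.mul_mem_right (sig k U.H d) _ hf)
    rw [Submodule.pow_one] at h2
    exact pairing_ser_vanish _ h2
  rw [sub_mul, map_sub, map_sub, sub_eq_zero, ← Algebra.smul_def, map_smul, map_smul, map_sig] at h1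
  simp only [hΦ.map_H] at h1
  refine h1.trans ?_
  simp only [LinearMap.sum_apply, LinearMap.smul_apply, hX]
  by_cases hd : d.degree = 1
  · obtain ⟨i, rfl⟩ := (Finsupp.sum_eq_one_iff d).mp hd
    rw [sig_single, map_sum, Finset.sum_eq_single i]
    · have hj : ∀ l, pairing U' W' (W'.X j) (U'.H l) = if l = j then 1 else 0 := fun l => by
        simpa only [sig_single, Finsupp.single_left_inj (one_ne_zero (α := ℕ))] using
          hX' (Finsupp.single l 1)
      simp [hj, mul_comm]
    · intro l _ hl
      rw [if_neg (by simpa [Finsupp.single_left_inj] using hl.symm), zero_mul, smul_zero]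
    · simp
  · rw [sig_linear_eq_zero (fun j i => p j i) (fun a ha => ?_) d rfl, smul_zero,
      Finset.sum_eq_zero fun i _ => ?_]
    · rw [if_neg, zero_mul, smul_zero]
      rintro rfl
      exact hd (Finsupp.degree_single _ _)
    · rw [hX', if_neg]
      rintro rfl
      exact hd (ha ▸ Finsupp.degree_single _ _)

/-- Continuity of `Φ` makes composition with it preserve continuous functionals, which are the
ranges of the pairings; this defines the transpose. Its properties follow from those of `Φ` by
injectivity of the pairing and separation of tensors, and continuity from its values on the
generators. -/
theorem existsUnique_transpose (h : U.IsDual W B) (h' : U'.IsDual W' B')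
    (hΦ : U.IsMorphism U' p q Φ) : ∃! Ψ : W'.carrier →ₐ[k] W.carrier,
      W'.IsMorphism W q.transpose p.transpose Ψ ∧ ∀ w a, B (Ψ w) a = B' w (Φ a) := by
  have hr : ∀ w, LinearMap.lcomp k k Φ.toLinearMap (B' w) ∈ LinearMap.range B := fun w => by
    have hw : B' w ∈ U'.contDual := h'.left_range ▸ LinearMap.mem_range_self B' w
    obtain ⟨N, hN⟩ := hw
    rw [h.left_range]
    exact ⟨N, fun a ha => hN _ (hΦ.map_ideal N ha)⟩
  let ψ : W'.carrier →ₗ[k] W.carrier := (LinearEquiv.ofInjective B h.left_injective).symm.toLinearMap ∘ₗ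
    (LinearMap.lcomp k k Φ.toLinearMap ∘ₗ B').codRestrict _ hr
  have hψ : ∀ w a, B (ψ w) a = B' w (Φ a) := fun w a =>
    LinearMap.congr_fun (LinearEquiv.ofInjective_symm_apply (h := h.left_injective) B
      (⟨_, hr w⟩ : LinearMap.range B)) a
  have hv : ∀ w, ∃ N, ∀ M, N ≤ M → ∀ a ∈ U'.ideal ^ M, B' w a = 0 := fun w => by
    have hw : B' w ∈ U'.contDual := h'.left_range ▸ LinearMap.mem_range_self B' w
    obtain ⟨N, hN⟩ := hw
    exact ⟨N, fun M hM a ha => hN a (Ideal.pow_le_pow_right hM ha)⟩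
  have h1 : ψ 1 = 1 := h.left_injective (LinearMap.ext fun a => by
    rw [hψ, h'.one, h.one, hΦ.map_counit])
  have hmul : ∀ w w', ψ (w * w') = ψ w * ψ w' := fun w w' => by
    refine h.left_injective (LinearMap.ext fun a => ?_)
    obtain ⟨N1, h1⟩ := hv w
    obtain ⟨N2, h2⟩ := hv w'
    have e1 := h1 (N1 + N2) (by omega)
    have e2 := h2 (N1 + N2) (by omega)
    rw [hψ, h'.mul (N1 + N2) w w' e1 e2, ← hΦ.map_comul,
      h.mul (N1 + N2) (ψ w) (ψ w') (fun a ha => (hψ w a).trans (e1 _ (hΦ.map_ideal _ ha)))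
        (fun a ha => (hψ w' a).trans (e2 _ (hΦ.map_ideal _ ha)))]
    generalize U.comul (N1 + N2) a = t
    induction t with
    | zero => simp only [map_zero]
    | add x y hx hy => simp only [map_add, hx, hy]
    | tmul x y =>
      obtain ⟨x, rfl⟩ := mk_surjective U.toAdicAlgebra _ x
      obtain ⟨y, rfl⟩ := mk_surjective U.toAdicAlgebra _ y
      exact congrArg₂ (· * ·) (hψ w x).symm (hψ w' y).symm
  let Ψ : W'.carrier →ₐ[k] W.carrier := AlgHom.ofLinearMap ψ h1 hmul
  have hH : ∀ μ, Ψ (W'.H μ) = ∑ ν, q.transpose ν μ • W.H ν := fun μ => by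
    refine h.left_injective (LinearMap.ext fun a => ?_)
    rw [map_sum]
    simp only [map_smul, isDual_H h]
    refine (hψ _ a).trans ?_
    rw [isDual_H h']
    exact LinearMap.congr_fun (pairing_gen_comp hΦ μ) a
  have hX : ∀ j, Ψ (W'.X j) = ∑ i, p.transpose i j • W.X i := fun j => by
    refine h.left_injective (LinearMap.ext fun a => ?_)
    rw [map_sum]
    simp only [map_smul, isDual_X h]
    refine (hψ _ a).trans ?_
    rw [isDual_X h']
    exact LinearMap.congr_fun (pairing_X_comp hΦ j) a
  have hI : ∀ N, W'.ideal ^ N ≤ (W.ideal ^ N).comap Ψ := pow_le_comap_of_X W' W Ψ fun j => by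
    rw [hX]
    refine Ideal.sum_mem _ fun i _ => ?_
    rw [Algebra.smul_def]
    exact Ideal.mul_mem_left _ _ (W.X_mem i)
  refine ⟨Ψ, ⟨⟨⟨hI, fun N w => ?_, fun w => ?_, fun w => ?_⟩, hH, hX⟩, hψ⟩, fun Ψ' hΨ' => ?_⟩
  · refine tensor_ext_of_range h.right_range fun a b ha hb => ?_
    have ha' : ∀ w ∈ W'.ideal ^ N, B'.flip (Φ a) w = 0 := fun w hw =>
      (hψ w a).symm.trans (ha _ (hI N hw))
    have hb' : ∀ w ∈ W'.ideal ^ N, B'.flip (Φ b) w = 0 := fun w hw =>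
      (hψ w b).symm.trans (hb _ (hI N hw))
    refine Eq.trans ?_ ((h.comul N a b ha hb (Ψ w)).trans ((hψ w (a * b)).trans ((congrArg (B' w)
      (map_mul Φ a b)).trans (h'.comul N (Φ a) (Φ b) ha' hb' w).symm))).symm
    generalize W'.comul N w = t
    induction t with
    | zero => simp only [map_zero]
    | add x y hx hy => simp only [map_add, hx, hy]
    | tmul x y =>
      obtain ⟨x, rfl⟩ := mk_surjective W'.toAdicAlgebra _ x
      obtain ⟨y, rfl⟩ := mk_surjective W'.toAdicAlgebra _ y
      exact congrArg₂ (· * ·) (hψ x a) (hψ y b)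
  · rw [h.counit, h'.counit]
    exact (hψ w 1).trans (by rw [map_one])
  · refine h.left_injective (LinearMap.ext fun a => ?_)
    rw [h.antipode]
    refine (hψ _ a).trans ?_
    rw [h'.antipode, ← hΦ.map_antipode]
    exact (hψ _ _).symm
  · exact AlgHom.ext fun w => h.left_injective (LinearMap.ext fun a =>
      (hΨ'.2 w a).trans (hψ w a).symm)

end Transpose

end LieQuant

theorem mainTheorem3 {k : Type u} [Field k] [CharZero k] :
    (∀ (m n : ℕ) (L : InhomBialgebra k m n),
      Nonempty (Quantization L) ∧
      ∀ U : Quantization L,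
        ∃ (W : Quantization L.dual) (B : W.carrier →ₗ[k] U.carrier →ₗ[k] k),
          U.IsDual W B ∧
          (∀ W' : Quantization L.dual, ∃! Φ : W.carrier ≃ₐ[k] W'.carrier,
            IsHopfHom W.toAdicHopf W'.toAdicHopf Φ.toAlgHom ∧
            IsHopfHom W'.toAdicHopf W.toAdicHopf Φ.symm.toAlgHom ∧
            (∀ μ, Φ (W.H μ) = W'.H μ) ∧ ∀ g, Φ (W.ser g) = W'.ser g) ∧
          (∀ N, zetaX W U N ^ N = 0 ∧ etaH W U N ^ N = 0) ∧
          IsCanonicalElement W.toAdicAlgebra U.toAdicAlgebra B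
            (fun N => expBelow k N (zetaX W U N) * expBelow k N (etaH W U N))) ∧
    (∀ (m n m' n' : ℕ) (L : InhomBialgebra k m n) (L' : InhomBialgebra k m' n')
      (U : Quantization L) (U' : Quantization L')
      (W : Quantization L.dual) (W' : Quantization L'.dual)
      (B : W.carrier →ₗ[k] U.carrier →ₗ[k] k) (B' : W'.carrier →ₗ[k] U'.carrier →ₗ[k] k),
      U.IsDual W B → U'.IsDual W' B' →
      ∀ (p : Matrix (Fin m') (Fin m) k) (q : Matrix (Fin n') (Fin n) k)
        (Φ : U.carrier →ₐ[k] U'.carrier), U.IsMorphism U' p q Φ →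
        ∃! Ψ : W'.carrier →ₐ[k] W.carrier,
          W'.IsMorphism W q.transpose p.transpose Ψ ∧
          ∀ w a, B (Ψ w) a = B' w (Φ a)) := by
  refine ⟨fun m n L => ⟨LieQuant.nonempty_quantization L, fun U => ?_⟩,
    fun m n m' n' L L' U U' W W' B B' h h' p q Φ hΦ => LieQuant.existsUnique_transpose h h' hΦ⟩
  -- Any quantization of `𝐋*` can serve as the dual of `U`; the pairing identifies it with the space
  -- of continuous functionals.
  obtain ⟨W⟩ := LieQuant.nonempty_quantization L.dual
  exact ⟨W, LieQuant.pairing U W, LieQuant.isDual_pairing U W, LieQuant.existsUnique_iso W,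
    fun N => ⟨LieQuant.zetaX_pow_eq_zero U W N, LieQuant.etaH_pow_eq_zero U W N⟩,
    LieQuant.isCanonicalElement U W⟩
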